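/- **Setting.** Manifolds with corners are smooth, Hausdorff and paracompact. Let $M\subset\mathbb{R}^n$ be open and let $\Sigma\subset M$ be a (possibly empty) smooth normal crossings variety: a finite union of closed smooth hypersurfaces of $M$ (the components) such that near each $p\in M$ there are smooth coordinates centered at $p$ in which the components through $p$ are distinct coordinate hyperplanes. A *piecewise smooth vector field* $X\in\mathfrak{X}^\infty(M,\Sigma)$ is a smooth vector field on $M\setminus\Sigma$ such that each point of $M$ has a neighbourhood $V$ for which the restriction of $X$ to every connected component of $V\setminus\Sigma$ extends to a smooth vector field on $V$. A *mollifier* is a smooth compactly supported $m\ge 0$ on $\mathbb{R}^n$ with $\int m=1$; put $m_\varepsilon(x)=\varepsilon^{-n}m(x/\varepsilon)$. The *regularization* $X^{\mathrm{reg}}$ is the vector field on $M\times\mathbb{R}_{\ge0}$, with zero $\varepsilon$-component, equal to $m_\varepsilon * X$ for $\varepsilon>0$ and to $X$ for $\varepsilon=0$; it is considered on the open neighbourhood $O_m=\{(x,\varepsilon): x-\varepsilon t\in M \text{ for all } t\in\operatorname{supp} m\}$ of $M\times\{0\}$, and off $\Sigma\times\{0\}$. A *fibered piecewise smooth regularized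 space* $(N,M,\Sigma,\pi)$ consists of an $(n+1)$-dimensional manifold with corners $N$, a closed (not necessarily connected) boundary hypersurface $M\subset\partial N$, a smooth normal crossings variety $\Sigma\subset M$ (near each point of $M$ there are coordinates $(x,\varepsilon)$ of $N$ with $M=\{\varepsilon=0\}$, $\varepsilon\ge0$, in which the components of $\Sigma$ through the point are $\{\varepsilon=x_i=0\}$ for distinct coordinates $x_i$ that are not boundary coordinates), and a smooth $\pi:N\to\mathbb{R}_{\ge0}$ with $\pi^{-1}(0)=\partial N$ that is a submersion off $\partial N$. A *piecewise 1-foliation* on an open $O\subset N$ is a saturated family of local generators $(U_i,X_i)$, where the $U_i$ form an open covering of $O$; each $X_i$ is a smooth vector field on $U_i\setminus\Sigma$, tangent to the fibers of $\pi$ (i.e. $d\pi(X_i)=0$), whose restriction to $M$ extends smoothly, locally and from each local connected component of $M\setminus\Sigma$, across $\Sigma$; and $X_i=\phi_{ij}X_j$ on $(U_i\cap U_j)\setminus\Sigma$ with $\phi_{ij}$ a strictly positive smooth function on $U_i\cap U_j$. The *blowing-up* of $(N,M,\Sigma,\pi)$ with center $C\subset\Sigma$, a closed submanifold of constant codimension,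 is the fibered regularized space $(\tilde N,\tilde M,\tilde\Sigma,\pi\circ\varphi)$, where $\varphi:\tilde N\to N$ is the real oriented (spherical) blowing-up of $C$ and $\tilde M=\overline{\varphi^{-1}(M\setminus C)}$, $\tilde\Sigma=\overline{\varphi^{-1}(\Sigma\setminus C)}$. A piecewise 1-foliation $\tilde{\mathcal F}$ on $\varphi^{-1}(O)$ is a *blowing-up* of $\mathcal F$ on $O$ if $\varphi:\tilde N\setminus\varphi^{-1}(C)\to N\setminus C$ identifies the local generators of $\tilde{\mathcal F}$ and of $\mathcal F$. **Theorem.** Let $M\subset\mathbb{R}^n$ be open and $\Sigma\subset M$ a smooth normal crossings variety. Let $N=M\times\mathbb{R}_{\ge0}$, with $M$ and $\Sigma$ embedded in $N$ as $M\times\{0\}$ and $\Sigma\times\{0\}$, and $\pi(x,\varepsilon)=\varepsilon$. Then $(N,M,\Sigma,\pi)$ is a fibered piecewise smooth regularized space, and there is a finite sequence of blowings-up $$(N,M,\Sigma,\pi)=(N_0,M_0,\Sigma_0,\pi_0)\xleftarrow{\varphi_1}\cdots\xleftarrow{\varphi_r}(N_r,M_r,\Sigma_r,\pi_r)$$ (depending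 only on $M,\Sigma$), the center of $\varphi_{k}$ being contained in $\Sigma_{k-1}$, such that: 1. $\Sigma_r=\emptyset$; 2. for every $X\in\mathfrak{X}^\infty(M,\Sigma)$ and every mollifier $m$ there are piecewise 1-foliations $\mathcal F_0,\dots,\mathcal F_r$, with $\mathcal F_k$ defined on the preimage of $O_m$ in $N_k$, such that $\mathcal F_0$ is globally generated by $X^{\mathrm{reg}}$ on $O_m$ and $\mathcal F_k$ is a blowing-up of $\mathcal F_{k-1}$ under $\varphi_k$ for $k=1,\dots,r$. Consequently $\mathcal F_r$ is a globally smooth oriented 1-foliation: all its local generators $(U,Y)$ are smooth on all of $U$ and satisfy $d\pi_r(Y)=0$. -/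

import Mathlib

open Set MeasureTheory
open scoped Manifold ContDiff Topology

noncomputable section

/-- `ℝ^d` with its Euclidean norm. -/
abbrev Euc (d : ℕ) : Type := EuclideanSpace ℝ (Fin d)

/-- The model with corners `[0, ∞)^d ⊆ ℝ^d`: the `d`-dimensional manifolds with corners are
the manifolds over this model. -/
abbrev cornerModel (d : ℕ) : ModelWithCorners ℝ (Euc d) (EuclideanQuadrant d) :=
  modelWithCornersEuclideanQuadrant d

/-! ### Piecewise smooth vector fields on an open subset of `ℝ^n`, and mollifiers -/

/-- `Sig` is a (possibly empty) smooth normal crossings variety in the open set `M ⊆ ℝ^n`: a finite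
union of relatively closed subsets `H i` (the components) such that near every point `p` of `M`
there are smooth coordinates `x`, centered at `p`, in which the components through `p` are
pairwise distinct coordinate hyperplanes and no other component occurs. -/
def IsNormalCrossings {n : ℕ} (M Sig : Set (Euc n)) : Prop :=
  ∃ (c : ℕ) (H : Fin c → Set (Euc n)),
    Sig = (⋃ i, H i) ∧ (∀ i, H i ⊆ M ∧ IsOpen (M \ H i)) ∧
    ∀ p ∈ M, ∃ (x : OpenPartialHomeomorph (Euc n) (Euc n)) (σ : {i // p ∈ H i} ↪ Fin n),
      p ∈ x.source ∧ x.source ⊆ M ∧ x p = 0 ∧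
      ContDiffOn ℝ ∞ x x.source ∧ ContDiffOn ℝ ∞ x.symm x.target ∧
      (∀ i, ∀ q ∈ x.source, q ∈ H i.1 ↔ x q (σ i) = 0) ∧
      (∀ i, p ∉ H i → Disjoint (H i) x.source)

/-- `X` is a piecewise smooth vector field on `(M, Sig)`: it is smooth on `M \ Sig`, and locally its
restriction to every connected component of the complement of `Sig` extends smoothly across
`Sig`. The values of `X` on `Sig` and outside `M` are irrelevant. -/
def IsPiecewiseSmoothOn {n : ℕ} (M Sig : Set (Euc n)) (X : Euc n → Euc n) : Prop :=
  ContDiffOn ℝ ∞ X (M \ Sig) ∧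
    ∀ p ∈ M, ∃ V : Set (Euc n), IsOpen V ∧ p ∈ V ∧ V ⊆ M ∧
      ∀ q ∈ V \ Sig, ∃ Y : Euc n → Euc n,
        ContDiffOn ℝ ∞ Y V ∧ EqOn X Y (connectedComponentIn (V \ Sig) q)

structure IsMollifier {n : ℕ} (m : Euc n → ℝ) : Prop where
  smooth : ContDiff ℝ ∞ m
  nonneg : ∀ x, 0 ≤ m x
  integral_eq_one : ∫ x, m x = 1
  hasCompactSupport : HasCompactSupport m

/-- The rescaled mollifier `m_ε(y) = ε^{-n} m(y/ε)`. -/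
def rescaled {n : ℕ} (m : Euc n → ℝ) (ε : ℝ) (y : Euc n) : ℝ :=
  (ε ^ n)⁻¹ * m (ε⁻¹ • y)

/-- The regularization by convolution: `(m_ε * X)(x)` for `ε > 0`, and `X(x)` for `ε = 0`. -/
def regularization {n : ℕ} (m : Euc n → ℝ) (X : Euc n → Euc n) (x : Euc n) (ε : ℝ) : Euc n :=
  if ε = 0 then X x else ∫ y, rescaled m ε y • X (x - y)

/-! ### Fibered regularized spaces -/

/-- The data `(N, M, Σ, π)` on a manifold with corners `N` of dimension `n + 1`. -/
structure FiberedSpace (n : ℕ) where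
  carrier : Type
  [topologicalSpace : TopologicalSpace carrier]
  [chartedSpace : ChartedSpace (EuclideanQuadrant (n + 1)) carrier]
  [isManifold : IsManifold (cornerModel (n + 1)) ∞ carrier]
  /-- the initial manifold `M` -/
  init : Set carrier
  /-- the discontinuity locus `Σ` -/
  disc : Set carrier
  /-- the projection `π` -/
  proj : carrier → ℝ

attribute [instance] FiberedSpace.topologicalSpace FiberedSpace.chartedSpace
  FiberedSpace.isManifold

/-- The quadrant in `ℝ^d` in which the coordinates with index in `B` are nonnegative and the
other coordinates are free. -/
def cornerSet {d : ℕ} (B : Set (Fin d)) : Set (Euc d) := {y | ∀ i ∈ B, 0 ≤ y i}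

/-- `x` is a smooth local coordinate system on the manifold with corners `N`, with values in the
quadrant `cornerSet B`: a diffeomorphism from an open subset of `N` to a relatively open subset
of that quadrant. -/
structure IsCornerChart {d : ℕ} {N : Type} [TopologicalSpace N]
    [ChartedSpace (EuclideanQuadrant d) N] (B : Set (Fin d)) (x : PartialEquiv N (Euc d)) :
    Prop where
  isOpen_source : IsOpen x.source
  isOpen_target : ∃ O : Set (Euc d), IsOpen O ∧ x.target = O ∩ cornerSet B
  smooth : ContMDiffOn (cornerModel d) 𝓘(ℝ, Euc d) ∞ x x.source
  smooth_symm : ContMDiffOn 𝓘(ℝ, Euc d) (cornerModel d) ∞ x.symm x.target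

namespace FiberedSpace

variable {n : ℕ}

/-- `S = (N, M, Σ, π)` is a fibered piecewise smooth regularized space: `N` is paracompact and
Hausdorff; `M` is a closed boundary hypersurface and `Σ ⊆ M` is a smooth normal crossings variety
in `M`; more precisely, near each point of `M` there are coordinates `x` of `N`, one of which,
`x_e ≥ 0`, is a defining function of `M`, while the components of `Σ` through the point are given
inside `M` by the vanishing of distinct free coordinates; `π : N → [0, ∞)` is smooth, its zero fiber
is the boundary of `N`, and it is a submersion off the boundary. -/
structure IsRegularized (S : FiberedSpace n) : Prop where
  t2Space : T2Space S.carrier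
  paracompactSpace : ParacompactSpace S.carrier
  isClosed_init : IsClosed S.init
  disc_subset : S.disc ⊆ S.init
  adapted : ∃ (c : ℕ) (H : Fin c → Set S.carrier),
    S.disc = (⋃ i, H i) ∧ (∀ i, IsClosed (H i)) ∧
    ∀ p ∈ S.init, ∃ (B : Set (Fin (n + 1))) (x : PartialEquiv S.carrier (Euc (n + 1)))
      (e : Fin (n + 1)) (σ : {i // p ∈ H i} ↪ Fin (n + 1)),
      IsCornerChart B x ∧ p ∈ x.source ∧ e ∈ B ∧ (∀ i, σ i ∉ B) ∧
      (∀ q ∈ x.source, q ∈ S.init ↔ x q e = 0) ∧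
      (∀ i, ∀ q ∈ x.source, q ∈ H i.1 ↔ x q e = 0 ∧ x q (σ i) = 0) ∧
      (∀ i, p ∉ H i → Disjoint (H i) x.source)
  proj_smooth : ContMDiff (cornerModel (n + 1)) 𝓘(ℝ, ℝ) ∞ S.proj
  proj_nonneg : ∀ p, 0 ≤ S.proj p
  proj_eq_zero : ∀ p, S.proj p = 0 ↔ p ∈ (cornerModel (n + 1)).boundary S.carrier
  proj_submersion : ∀ p, p ∉ (cornerModel (n + 1)).boundary S.carrier →
    Function.Surjective (mfderiv (cornerModel (n + 1)) 𝓘(ℝ, ℝ) S.proj p)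

/-- A vector field on `N` (only its values on the open set under consideration matter). -/
abbrev VField (S : FiberedSpace n) : Type :=
  ∀ p : S.carrier, TangentSpace (cornerModel (n + 1)) p

def SmoothOn (S : FiberedSpace n) (X : S.VField) (U : Set S.carrier) : Prop :=
  ContMDiffOn (cornerModel (n + 1)) (cornerModel (n + 1)).tangent ∞
    (fun p => (⟨p, X p⟩ : TangentBundle (cornerModel (n + 1)) S.carrier)) U

/-- On the open set `U`, the vector field `X` is piecewise smooth with discontinuity locus `Σ` and
tangent to the fibers of `π`: it is smooth on `U \ Σ`; locally, its restriction to every connected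
component of `M \ Σ` extends smoothly across `Σ`; and `dπ(X) = 0`. The values of `X` on `Σ` and
outside `U` are irrelevant. -/
structure IsPiecewiseVField (S : FiberedSpace n) (U : Set S.carrier) (X : S.VField) : Prop where
  smooth : S.SmoothOn X (U \ S.disc)
  extends_across : ∀ p ∈ U ∩ S.init, ∃ V : Set S.carrier, IsOpen V ∧ p ∈ V ∧ V ⊆ U ∧
    ∀ q ∈ (V ∩ S.init) \ S.disc, ∃ Y : S.VField, S.SmoothOn Y V ∧
      ∀ q' ∈ connectedComponentIn ((V ∩ S.init) \ S.disc) q, X q' = Y q'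
  tangent : ∀ p ∈ U \ S.disc, mfderiv (cornerModel (n + 1)) 𝓘(ℝ, ℝ) S.proj p (X p) = 0

/-- `X = φ Y` on `(U ∩ V) \ Σ` for some strictly positive smooth function `φ` on `U ∩ V`. -/
def Compatible (S : FiberedSpace n) (U : Set S.carrier) (X : S.VField)
    (V : Set S.carrier) (Y : S.VField) : Prop :=
  ∃ φ : S.carrier → ℝ, ContMDiffOn (cornerModel (n + 1)) 𝓘(ℝ, ℝ) ∞ φ (U ∩ V) ∧
    (∀ p ∈ U ∩ V, 0 < φ p) ∧ ∀ p ∈ (U ∩ V) \ S.disc, X p = φ p • Y p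

/-- A piecewise smooth oriented 1-dimensional foliation on the open subset `O` of `(N, M, Σ, π)`,
given by its saturated collection of local generators. -/
structure Foliation (S : FiberedSpace n) (O : Set S.carrier) where
  gens : Set (Set S.carrier × S.VField)
  isOpen : ∀ G ∈ gens, IsOpen G.1
  subset : ∀ G ∈ gens, G.1 ⊆ O
  covers : ∀ p ∈ O, ∃ G ∈ gens, p ∈ G.1
  piecewise : ∀ G ∈ gens, S.IsPiecewiseVField G.1 G.2
  compatible : ∀ G ∈ gens, ∀ G' ∈ gens, S.Compatible G.1 G.2 G'.1 G'.2
  saturated : ∀ (V : Set S.carrier) (Y : S.VField), IsOpen V → V ⊆ O →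
    S.IsPiecewiseVField V Y →
    (∀ G ∈ gens, S.Compatible V Y G.1 G.2 ∧ S.Compatible G.1 G.2 V Y) → (V, Y) ∈ gens

/-! ### Blowing-up -/

/-- The directional blowing-up map in direction `j` with sign `s`, for the coordinate subspace
`{y_i = 0, i ∈ J}`: `y_j = s z_j`, `y_i = z_j z_i` for `i ∈ J \ {j}`, `y_i = z_i` for `i ∉ J`. -/
def directionalMap {d : ℕ} (J : Finset (Fin d)) (j : Fin d) (s : ℤˣ) (z : Euc d) : Euc d :=
  WithLp.toLp 2 fun i =>
    if i = j then ((s : ℤ) : ℝ) * z j else if i ∈ J then z j * z i else z i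

/-- The directions `(j, s)` that are needed over the quadrant `cornerSet B`: both signs for a
free coordinate, only the positive one for a nonnegative coordinate. -/
def IsDirection {d : ℕ} (B : Set (Fin d)) (J : Finset (Fin d)) (j : Fin d) (s : ℤˣ) : Prop :=
  j ∈ J ∧ (j ∈ B → s = 1)

/-- `φ : T → S` is the blowing-up of the fibered regularized space `S` with center `C ⊆ Σ`, where `C`
is a closed submanifold of constant codimension `k` (locally, `k` coordinates vanish on it).
Off the center `φ` is a diffeomorphism; over the domain of a coordinate chart adapted to the
center, the blown-up space is covered by the charts of the directional blowing-up maps, each of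
them defined on the whole preimage in the quadrant `z_j ≥ 0, z_i ≥ 0 (i ∈ B)`. -/
structure IsBlowup (S T : FiberedSpace n) (φ : T.carrier → S.carrier) (C : Set S.carrier) :
    Prop where
  isRegularized : T.IsRegularized
  isClosed_center : IsClosed C
  center_subset : C ⊆ S.disc
  smooth : ContMDiff (cornerModel (n + 1)) (cornerModel (n + 1)) ∞ φ
  diffeo_off_center : ∃ g : S.carrier → T.carrier,
    ContMDiffOn (cornerModel (n + 1)) (cornerModel (n + 1)) ∞ g Cᶜ ∧
    (∀ p ∉ C, φ (g p) = p) ∧ ∀ q, φ q ∉ C → g (φ q) = q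
  local_model : ∃ k : ℕ, ∀ p ∈ C, ∃ (B : Set (Fin (n + 1)))
    (x : PartialEquiv S.carrier (Euc (n + 1))) (J : Finset (Fin (n + 1)))
    (z : Fin (n + 1) → ℤˣ → PartialEquiv T.carrier (Euc (n + 1))),
    IsCornerChart B x ∧ p ∈ x.source ∧ J.card = k ∧
    (∀ q ∈ x.source, q ∈ C ↔ ∀ j ∈ J, x q j = 0) ∧
    (∀ j s, IsDirection B J j s →
      IsCornerChart (insert j B) (z j s) ∧
      (z j s).target = cornerSet (insert j B) ∩ directionalMap J j s ⁻¹' x.target ∧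
      ∀ q ∈ (z j s).source, φ q ∈ x.source ∧ x (φ q) = directionalMap J j s (z j s q)) ∧
    ∀ q, φ q ∈ x.source → ∃ j s, IsDirection B J j s ∧ q ∈ (z j s).source
  init_eq : T.init = closure (φ ⁻¹' (S.init \ C))
  disc_eq : T.disc = closure (φ ⁻¹' (S.disc \ C))
  proj_eq : ∀ q, T.proj q = S.proj (φ q)

/-- Finite sequences of blowings-up `S = N_0 ← N_1 ← ⋯ ← N_r = T`. -/
inductive BlowupSequence (S : FiberedSpace n) : FiberedSpace n → Type 1
  | refl : BlowupSequence S S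
  | step {T T' : FiberedSpace n} (b : BlowupSequence S T) (φ : T'.carrier → T.carrier)
      (C : Set T.carrier) (h : IsBlowup T T' φ C) : BlowupSequence S T'

/-- The preimage of `O ⊆ N_0` under the composed map `N_r → N_0`. -/
def BlowupSequence.preimage {S : FiberedSpace n} (O : Set S.carrier) :
    {T : FiberedSpace n} → BlowupSequence S T → Set T.carrier
  | _, .refl => O
  | _, .step b φ _ _ => φ ⁻¹' b.preimage O

/-- The foliation `F'` is a blowing-up of the foliation `F` under `φ`: off the center and the
exceptional divisor, `φ` induces a bijection of local generators. -/
def IsFoliationBlowup {S T : FiberedSpace n} (φ : T.carrier → S.carrier) (C : Set S.carrier)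
    {O : Set S.carrier} (F : S.Foliation O) (F' : T.Foliation (φ ⁻¹' O)) : Prop :=
  ∀ (U : Set S.carrier) (X : S.VField) (X' : T.VField), IsOpen U → U ⊆ O \ C →
    (∀ q ∈ φ ⁻¹' (U \ S.disc),
      mfderiv (cornerModel (n + 1)) (cornerModel (n + 1)) φ q (X' q) = X (φ q)) →
    ((U, X) ∈ F.gens ↔ (φ ⁻¹' U, X') ∈ F'.gens)

/-- There are foliations `F_0 = F, F_1, …, F_r = F'` along the sequence of blowings-up such that
each `F_k` is a blowing-up of `F_{k-1}`. -/
inductive LiftsTo {S : FiberedSpace n} {O : Set S.carrier} (F : S.Foliation O) :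
    {T : FiberedSpace n} → (b : BlowupSequence S T) → T.Foliation (b.preimage O) → Prop
  | refl : LiftsTo F .refl F
  | step {T T' : FiberedSpace n} (b : BlowupSequence S T) (φ : T'.carrier → T.carrier)
      (C : Set T.carrier) (h : IsBlowup T T' φ C) (G : T.Foliation (b.preimage O))
      (G' : T'.Foliation (φ ⁻¹' b.preimage O)) :
      LiftsTo F b G → IsFoliationBlowup φ C G G' → LiftsTo F (.step b φ C h) G'

end FiberedSpace

/-! ### The product space `M × [0, ∞)` -/

/-- `M × [0, ∞)` -/
abbrev ProductCarrier {n : ℕ} (M : Set (Euc n)) : Type :=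
  {p : Euc n × ℝ // p.1 ∈ M ∧ 0 ≤ p.2}

namespace ProductCarrier

variable {n : ℕ} {M : Set (Euc n)}

/-- The global chart `(x, ε) ↦ (exp x_1, …, exp x_n, ε)` of `M × [0, ∞)`. -/
def chart (M : Set (Euc n)) (p : ProductCarrier M) : EuclideanQuadrant (n + 1) :=
  ⟨WithLp.toLp 2 (Fin.snoc (fun i => Real.exp (p.1.1 i)) p.1.2 : Fin (n + 1) → ℝ), by
    intro i
    refine Fin.lastCases ?_ (fun j => ?_) i
    · simpa using p.2.2
    · simpa using (Real.exp_pos _).le⟩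

/-- The inverse of the chart, `y ↦ (log y_1, …, log y_n, y_{n+1})`. -/
def unchart (y : EuclideanQuadrant (n + 1)) : Euc n × ℝ :=
  (WithLp.toLp 2 fun i => Real.log (y.1 i.castSucc), y.1 (Fin.last n))

theorem unchart_chart (p : ProductCarrier M) : unchart (chart M p) = p.1 := by
  refine Prod.ext ?_ ?_
  · ext i
    simp [unchart, chart]
  · simp [unchart, chart]

theorem continuous_chart : Continuous (chart M) := by
  refine Continuous.subtype_mk ?_ _
  refine (PiLp.continuous_toLp 2 _).comp (continuous_pi fun i => ?_)
  refine Fin.lastCases ?_ (fun j => ?_) i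
  · simp only [Fin.snoc_last]
    exact continuous_snd.comp continuous_subtype_val
  · simp only [Fin.snoc_castSucc]
    exact Real.continuous_exp.comp (by fun_prop)

theorem continuousAt_unchart (y : EuclideanQuadrant (n + 1))
    (hy : ∀ i : Fin n, y.1 i.castSucc ≠ 0) : ContinuousAt unchart y := by
  refine ContinuousAt.prodMk ?_ ?_
  · refine (PiLp.continuous_toLp 2 _).continuousAt.comp (continuousAt_pi.2 fun i => ?_)
    exact ContinuousAt.log (by fun_prop) (hy i)
  · fun_prop

theorem isOpenEmbedding_chart (hM : IsOpen M) : Topology.IsOpenEmbedding (chart M) := by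
  have hne : ∀ p : ProductCarrier M, ∀ i : Fin n, (chart M p).1 i.castSucc ≠ 0 := by
    intro p i
    simp [chart]
  refine ⟨⟨?_, ?_⟩, ?_⟩
  · rw [Topology.isInducing_iff_nhds]
    intro p
    refine le_antisymm (continuous_chart.tendsto p).le_comap ?_
    rw [nhds_subtype_eq_comap, ← Filter.tendsto_iff_comap]
    have h := (continuousAt_unchart _ (hne p)).tendsto
    rw [unchart_chart] at h
    have h2 := h.comp (Filter.tendsto_comap (f := chart M) (x := 𝓝 (chart M p)))
    refine h2.congr fun q => unchart_chart q
  · intro p q h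
    apply Subtype.ext
    rw [← unchart_chart p, ← unchart_chart q, h]
  · have : range (chart M) = {y | (∀ i : Fin n, 0 < y.1 i.castSucc) ∧ (unchart y).1 ∈ M} := by
      ext y
      constructor
      · rintro ⟨p, rfl⟩
        refine ⟨fun i => by simpa [chart] using Real.exp_pos _, ?_⟩
        rw [unchart_chart]
        exact p.2.1
      · rintro ⟨h1, h2⟩
        refine ⟨⟨unchart y, h2, y.2 _⟩, ?_⟩
        apply Subtype.ext
        ext i
        refine Fin.lastCases ?_ (fun j => ?_) i
        · simp [chart, unchart]
        · simp [chart, unchart, Real.exp_log (h1 j)]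
    rw [this, isOpen_iff_mem_nhds]
    rintro y ⟨h1, h2⟩
    have hc := continuous_fst.continuousAt.comp (continuousAt_unchart y fun i => (h1 i).ne')
    have e1 : ∀ᶠ y' in 𝓝 y, ∀ i : Fin n, 0 < y'.1 i.castSucc := by
      rw [Filter.eventually_all]
      intro i
      have hi : Continuous fun y' : EuclideanQuadrant (n + 1) => y'.1 i.castSucc := by fun_prop
      exact (isOpen_lt continuous_const hi).mem_nhds (h1 i)
    exact e1.and (hc.eventually (hM.mem_nhds h2))

/-- The smooth structure of `M × [0, ∞)`, given by the single chart above. -/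
@[reducible] def chartedSpace (hM : IsOpen M) :
    ChartedSpace (EuclideanQuadrant (n + 1)) (ProductCarrier M) where
  atlas := {e | ∃ _ : Nonempty (ProductCarrier M),
    e = (isOpenEmbedding_chart hM).toOpenPartialHomeomorph (chart M)}
  chartAt p := haveI : Nonempty (ProductCarrier M) := ⟨p⟩
    (isOpenEmbedding_chart hM).toOpenPartialHomeomorph (chart M)
  mem_chart_source p := by simp
  chart_mem_atlas p := ⟨⟨p⟩, rfl⟩

theorem isManifold (hM : IsOpen M) :
    @IsManifold ℝ _ _ _ _ _ _ (cornerModel (n + 1)) ∞ (ProductCarrier M) _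
      (chartedSpace hM) := by
  let := chartedSpace hM
  rcases isEmpty_or_nonempty (ProductCarrier M) with h | h
  · refine @IsManifold.mk _ _ _ _ _ _ _ _ _ _ _ _ ⟨?_⟩
    rintro e e' ⟨h', -⟩
    exact (not_isEmpty_iff.2 h' h).elim
  · exact @IsManifold.mk _ _ _ _ _ _ _ _ _ _ _ _ ⟨by
      have := (isOpenEmbedding_chart hM).singleton_hasGroupoid
        (contDiffGroupoid ∞ (cornerModel (n + 1)))
      rintro e e' ⟨-, rfl⟩ ⟨-, rfl⟩
      exact this.compatible rfl rfl⟩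

end ProductCarrier

/-- The fibered regularized space `(N, M, Σ, π)` associated to `(M, Σ)`: `N = M × [0, ∞)`, with `M` and
`Σ` embedded as `M × {0}` and `Σ × {0}`, and `π(x, ε) = ε`. -/
def productSpace {n : ℕ} (M Sig : Set (Euc n)) (hM : IsOpen M) : FiberedSpace n where
  carrier := ProductCarrier M
  topologicalSpace := inferInstance
  chartedSpace := ProductCarrier.chartedSpace hM
  isManifold := ProductCarrier.isManifold hM
  init := {p | p.1.2 = 0}
  disc := {p | p.1.2 = 0 ∧ p.1.1 ∈ Sig}
  proj := fun p => p.1.2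

section

variable {n : ℕ} {M Sig : Set (Euc n)} {hM : IsOpen M}

/-- The coordinates `(x, ε)` of a point of `M × [0, ∞)`. -/
def productCoord (p : (productSpace M Sig hM).carrier) : Euc n × ℝ :=
  Subtype.val (p : ProductCarrier M)

/-- The neighborhood of `M × {0}` in `M × [0, ∞)` consisting of the points `(x, ε)` such that the
convolution integral `(m_ε * X)(x)` only involves values of `X` in `M`. -/
def regDomain (M Sig : Set (Euc n)) (hM : IsOpen M) (m : Euc n → ℝ) :
    Set (productSpace M Sig hM).carrier :=
  {p | ∀ t ∈ tsupport m, (productCoord p).1 - (productCoord p).2 • t ∈ M}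

/-- `Y` is the vector field `X^reg` on `M × [0, ∞)`: off `Σ × {0}`, its components in the coordinates
`(x, ε)` are `((m_ε * X)(x), 0)` for `ε > 0`, and `(X(x), 0)` for `ε = 0`. -/
def IsRegularizedVField (m : Euc n → ℝ) (X : Euc n → Euc n)
    (Y : (productSpace M Sig hM).VField) : Prop :=
  ∀ p ∈ regDomain M Sig hM m \ (productSpace M Sig hM).disc,
    mfderiv (cornerModel (n + 1)) 𝓘(ℝ, Euc n × ℝ) (productCoord (Sig := Sig) (hM := hM)) p (Y p)
      = ((regularization m X (productCoord p).1 (productCoord p).2, 0) : Euc n × ℝ)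

end

end

set_option linter.unusedSectionVars false

open FiberedSpace (directionalMap IsDirection)

noncomputable section

/-! ### Quadrants -/

section Quadrant

variable {d : ℕ}

/-! Why blowing up works. Let y be normal crossings coordinates with inverse η. Substituting x' =
η(y - ετ) in the convolution writes X^reg as a sum of integrals over sign sectors, and the sector of
y - ετ is determined by the signs of y_i/ε - τ_i. So X^reg is a function G(u, y, ε) with u_i =
y_i/ε. It is smooth in all its variables, being a convolution in u of indicator functions with
smooth kernels, and it is locally constant in u_i once |u_i| exceeds a bound for τ. Such a G is
called a profile (`IsProfile`, `FiberedSpace.HasProfile`); `hasProfile_regularization` finds it for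
X^reg.

Profiles are stable under blowing up x_e = x_i = 0 (i ∈ I), where x_e is the coordinate that defines
M. In a directional chart x_k = z_j v_k with v_j = ±1, so the quotients become v_i/v_e. If v_e ≠ 0
at a point, the quotient is smooth there; if v_e = 0 ≠ v_i, it is large and G does not see it; if
both vanish, the point lies on the strict transform of component i and the quotient survives as an
argument. A vector field lifts after multiplication by a function that vanishes to first order on
the exceptional divisor. This is `FiberedSpace.hasProfile_lift`. Off the strict transforms no
quotient is left and the generator is smooth.

Choice of centers. The intersections of the components are blown up, the deepest first: a set I is
admissible if all strictly larger sets have been treated (`ResData.Next`). Then exactly the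
components in I pass through a point of the center, and after the blowing-up they have no common
point (`ResData.Good.blow`). The number of untreated sets decreases, and when none is left Σ is
empty.

Global construction. Instead of gluing charts, the space X is embedded in a normed space E, and its
blowing-up is the closure in X × W of the graph of b_I/‖b_I‖. Here b_I is a W-valued function
vanishing exactly on the center, locally of the form Σ x_k A_k with orthogonal nonvanishing A_k
(`AdaptedChart`). For J ⊆ I the function b_J is replaced by b_J/‖b_I‖, which keeps this form. A
component of Σ need not have a global real equation; on M × [0, ∞) the b_J are assembled from
ℓ²-valued equations obtained by a partition of unity (`exists_definingFunction`), and Hadamard's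
lemma gives their local factorization. -/

theorem convex_cornerSet (B : Set (Fin d)) : Convex ℝ (cornerSet B) := by
  intro x hx y hy a b ha hb _ i hi
  have h1 := hx i hi
  have h2 := hy i hi
  simp only [PiLp.add_apply, PiLp.smul_apply, smul_eq_mul]
  positivity

/-- The points of `ℝ^d` with positive coordinates. -/
def positiveSet (d : ℕ) (B : Set (Fin d)) : Set (Euc d) := {y | ∀ i ∈ B, 0 < y i}

theorem isOpen_positiveSet (B : Set (Fin d)) : IsOpen (positiveSet d B) := by
  have : positiveSet d B = ⋂ i : Fin d, {y : Euc d | i ∈ B → 0 < y i} := by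
    ext y; simp [positiveSet]
  rw [this]
  refine isOpen_iInter_of_finite fun i => ?_
  by_cases h : i ∈ B
  · simp only [h, true_imp_iff]
    exact isOpen_lt continuous_const (by fun_prop)
  · simp [h]

theorem positiveSet_subset (B : Set (Fin d)) : positiveSet d B ⊆ cornerSet B :=
  fun _ hy i hi => (hy i hi).le

/-- The vector with all coordinates equal to one. -/
def onesVec (d : ℕ) : Euc d := WithLp.toLp 2 fun _ => 1

theorem add_onesVec_mem {B : Set (Fin d)} {y : Euc d} (hy : y ∈ cornerSet B) {t : ℝ} (ht : 0 < t) :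
    y + t • onesVec d ∈ positiveSet d B := by
  intro i hi
  have := hy i hi
  simp only [onesVec, PiLp.add_apply, PiLp.smul_apply, smul_eq_mul, mul_one]
  positivity

/-- Uniqueness of derivatives within quadrants makes the tangent maps of local parametrizations
meaningful at boundary points. -/
theorem uniqueDiffOn_cornerSet (B : Set (Fin d)) : UniqueDiffOn ℝ (cornerSet B) := by
  refine uniqueDiffOn_convex (convex_cornerSet B) ⟨0 + (1 : ℝ) • onesVec d, ?_⟩
  refine mem_interior.2 ⟨_, positiveSet_subset B, isOpen_positiveSet B, ?_⟩
  exact add_onesVec_mem (fun i _ => le_rfl) one_pos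

theorem uniqueDiffOn_inter_cornerSet (B : Set (Fin d)) {O : Set (Euc d)} (hO : IsOpen O) :
    UniqueDiffOn ℝ (O ∩ cornerSet B) := by
  rw [inter_comm]
  exact (uniqueDiffOn_cornerSet B).inter hO

open Classical in
/-- The coordinates of `ℝ^d` outside `B` are replaced by their exponentials. -/
def expOff (B : Set (Fin d)) (y : Euc d) : Euc d :=
  -- The model is the full quadrant, with all coordinates nonnegative; exponentials move the free
  -- coordinates into its interior.
  WithLp.toLp 2 fun i => if i ∈ B then y i else Real.exp (y i)

open Classical in
/-- The coordinates of `ℝ^d` outside `B` are replaced by their logarithms. -/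
def logOff (B : Set (Fin d)) (y : Euc d) : Euc d :=
  WithLp.toLp 2 fun i => if i ∈ B then y i else Real.log (y i)

open Classical in
/-- The map to the quadrant `[0, ∞)^d` which is `expOff B` on `cornerSet B`. -/
def toQuadrant (B : Set (Fin d)) (y : Euc d) : EuclideanQuadrant d :=
  -- The maximum makes the map total and continuous; on `cornerSet B` it has no effect.
  ⟨WithLp.toLp 2 fun i => if i ∈ B then max (y i) 0 else Real.exp (y i), fun i => by
    by_cases h : i ∈ B <;> simp [h, (Real.exp_pos _).le]⟩

theorem toQuadrant_val {B : Set (Fin d)} {y : Euc d} (hy : y ∈ cornerSet B) :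
    (toQuadrant B y).1 = expOff B y := by
  ext i
  by_cases h : i ∈ B
  · simp [toQuadrant, expOff, h, hy i h]
  · simp [toQuadrant, expOff, h]

theorem continuous_toQuadrant (B : Set (Fin d)) : Continuous (toQuadrant B) := by
  refine Continuous.subtype_mk ((PiLp.continuous_toLp 2 _).comp (continuous_pi fun i => ?_)) _
  by_cases h : i ∈ B <;> simp only [h, if_true, if_false] <;> fun_prop

theorem logOff_expOff (B : Set (Fin d)) (y : Euc d) : logOff B (expOff B y) = y := by
  ext i
  by_cases h : i ∈ B <;> simp [logOff, expOff, h]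

theorem expOff_logOff {B : Set (Fin d)} {y : Euc d} (hy : ∀ i ∉ B, 0 < y i) :
    expOff B (logOff B y) = y := by
  ext i
  by_cases h : i ∈ B
  · simp [logOff, expOff, h]
  · simp [logOff, expOff, h, Real.exp_log (hy i h)]

theorem contDiff_expOff (B : Set (Fin d)) : ContDiff ℝ ∞ (expOff B) := by
  rw [contDiff_euclidean]
  intro i
  by_cases h : i ∈ B <;> simp only [expOff, h, if_true, if_false] <;> fun_prop

theorem contDiffOn_logOff (B : Set (Fin d)) :
    ContDiffOn ℝ ∞ (logOff B) (positiveSet d Bᶜ) := by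
  rw [contDiffOn_euclidean]
  intro i
  by_cases h : i ∈ B
  · simp only [logOff, h, if_true]
    fun_prop
  · simp only [logOff, h, if_false]
    exact ContDiffOn.log (by fun_prop) fun y hy => (hy i h).ne'

theorem expOff_mem_positiveSet (B : Set (Fin d)) (y : Euc d) :
    expOff B y ∈ positiveSet d Bᶜ := by
  intro i hi
  have : i ∉ B := hi
  simp [expOff, this, Real.exp_pos]

theorem logOff_mem_cornerSet {B : Set (Fin d)} {y : Euc d} (hy : ∀ i, 0 ≤ y i) :
    logOff B y ∈ cornerSet B := by
  intro i hi
  simp [logOff, hi, hy i]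

theorem logOff_toQuadrant {B : Set (Fin d)} {y : Euc d} (hy : y ∈ cornerSet B) :
    logOff B (toQuadrant B y).1 = y := by
  rw [toQuadrant_val hy, logOff_expOff]

theorem toQuadrant_logOff {B : Set (Fin d)} (y : EuclideanQuadrant d)
    (hy : y.1 ∈ positiveSet d Bᶜ) : toQuadrant B (logOff B y.1) = y := by
  apply Subtype.ext
  rw [toQuadrant_val (logOff_mem_cornerSet y.2), expOff_logOff hy]

end Quadrant

/-! ### Subsets of normed spaces parametrized by quadrants -/

section Param

variable {d : ℕ} {X E : Type} [TopologicalSpace X] [NormedAddCommGroup E] [NormedSpace ℝ E]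

/-- A smooth map `w` from an open subset `O` of `ℝ^d` to `E`, and a smooth map `ξ` in the other
direction, used as a parametrization of a part of a subset of `E` by `O ∩ cornerSet B`. -/
structure Param (d : ℕ) (E : Type) [NormedAddCommGroup E] [NormedSpace ℝ E] where
  B : Set (Fin d)
  O : Set (Euc d)
  U : Set E
  w : Euc d → E
  ξ : E → Euc d
  isOpen_O : IsOpen O
  isOpen_U : IsOpen U
  -- Both maps are smooth on open subsets of normed spaces, so that smoothness on sets with corners
  -- never has to be checked directly.
  smooth_w : ContDiffOn ℝ ∞ w O
  smooth_ξ : ContDiffOn ℝ ∞ ξ U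

namespace Param

/-- The maps `w` and `ξ` identify `O ∩ cornerSet B` with the part in `U` of the space `X`, which is
embedded in `E` by `ι`. -/
structure Fits (P : Param d E) (ι : X → E) : Prop where
  exists_eq : ∀ y ∈ P.O ∩ cornerSet P.B, ∃ p, ι p = P.w y
  w_mem : ∀ y ∈ P.O ∩ cornerSet P.B, P.w y ∈ P.U
  ξ_w : ∀ y ∈ P.O ∩ cornerSet P.B, P.ξ (P.w y) = y
  ξ_mem : ∀ p, ι p ∈ P.U → P.ξ (ι p) ∈ P.O ∩ cornerSet P.B
  w_ξ : ∀ p, ι p ∈ P.U → P.w (P.ξ (ι p)) = ι p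

/-- The point of `X` with given coordinates. -/
def point [Nonempty X] (P : Param d E) (ι : X → E) (y : Euc d) : X :=
  Function.invFun ι (P.w y)

theorem Fits.ι_point [Nonempty X] {P : Param d E} {ι : X → E} (h : P.Fits ι) {y : Euc d}
    (hy : y ∈ P.O ∩ cornerSet P.B) : ι (P.point ι y) = P.w y :=
  Function.invFun_eq (h.exists_eq y hy)

theorem Fits.point_ξ [Nonempty X] {P : Param d E} {ι : X → E} (h : P.Fits ι)
    (hι : Function.Injective ι) {p : X} (hp : ι p ∈ P.U) : P.point ι (P.ξ (ι p)) = p := by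
  apply hι
  rw [h.ι_point (h.ξ_mem p hp), h.w_ξ p hp]

/-- The local coordinate system given by a parametrization. -/
def chart [Nonempty X] (P : Param d E) {ι : X → E} (hι : Function.Injective ι) (h : P.Fits ι) :
    PartialEquiv X (Euc d) where
  toFun p := P.ξ (ι p)
  invFun := P.point ι
  source := ι ⁻¹' P.U
  target := P.O ∩ cornerSet P.B
  map_source' p hp := h.ξ_mem p hp
  map_target' y hy := by
    change ι (P.point ι y) ∈ P.U
    rw [h.ι_point hy]
    exact h.w_mem y hy
  left_inv' p hp := h.point_ξ hι hp
  right_inv' y hy := by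
    rw [h.ι_point hy, h.ξ_w y hy]

theorem continuousOn_point [Nonempty X] (P : Param d E) {ι : X → E}
    (hι : Topology.IsEmbedding ι) (h : P.Fits ι) :
    ContinuousOn (P.point ι) (P.O ∩ cornerSet P.B) := by
  rw [hι.continuousOn_iff]
  exact (P.smooth_w.continuousOn.mono inter_subset_left).congr fun y hy => h.ι_point hy

theorem continuousOn_coord (P : Param d E) {ι : X → E} (hι : Continuous ι) :
    ContinuousOn (fun p => P.ξ (ι p)) (ι ⁻¹' P.U) :=
  P.smooth_ξ.continuousOn.comp hι.continuousOn fun _ h => h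

/-- Restriction of a parametrization to an open subset of `ℝ^d`. -/
def restrict (P : Param d E) (V : Set (Euc d)) (hV : IsOpen V) : Param d E where
  B := P.B
  O := P.O ∩ V
  U := P.U ∩ P.ξ ⁻¹' V
  w := P.w
  ξ := P.ξ
  isOpen_O := P.isOpen_O.inter hV
  isOpen_U := P.smooth_ξ.continuousOn.isOpen_inter_preimage P.isOpen_U hV
  smooth_w := P.smooth_w.mono inter_subset_left
  smooth_ξ := P.smooth_ξ.mono inter_subset_left

theorem Fits.restrict {P : Param d E} {ι : X → E} (h : P.Fits ι) {V : Set (Euc d)}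
    (hV : IsOpen V) : (P.restrict V hV).Fits ι where
  exists_eq y hy := h.exists_eq y ⟨hy.1.1, hy.2⟩
  w_mem y hy := ⟨h.w_mem y ⟨hy.1.1, hy.2⟩, by
    change P.ξ (P.w y) ∈ V
    rw [h.ξ_w y ⟨hy.1.1, hy.2⟩]; exact hy.1.2⟩
  ξ_w y hy := h.ξ_w y ⟨hy.1.1, hy.2⟩
  ξ_mem p hp := ⟨⟨(h.ξ_mem p hp.1).1, hp.2⟩, (h.ξ_mem p hp.1).2⟩
  w_ξ p hp := h.w_ξ p hp.1

/-- The chart with values in `[0, ∞)^d` given by a parametrization. -/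
def quadrantChart [Nonempty X] (P : Param d E) {ι : X → E} (hι : Topology.IsEmbedding ι)
    (h : P.Fits ι) : OpenPartialHomeomorph X (EuclideanQuadrant d) where
  toFun p := toQuadrant P.B (P.ξ (ι p))
  invFun y := P.point ι (logOff P.B y.1)
  source := ι ⁻¹' P.U
  target := {y | y.1 ∈ positiveSet d P.Bᶜ ∩ logOff P.B ⁻¹' P.O}
  map_source' p hp := by
    have h2 := h.ξ_mem p hp
    refine ⟨?_, ?_⟩
    · rw [toQuadrant_val h2.2]
      exact expOff_mem_positiveSet _ _
    · change logOff P.B _ ∈ P.O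
      rw [logOff_toQuadrant h2.2]
      exact h2.1
  map_target' y hy := by
    change ι (P.point ι _) ∈ P.U
    rw [h.ι_point ⟨hy.2, logOff_mem_cornerSet y.2⟩]
    exact h.w_mem _ ⟨hy.2, logOff_mem_cornerSet y.2⟩
  left_inv' p hp := by
    rw [logOff_toQuadrant (h.ξ_mem p hp).2]
    exact h.point_ξ hι.injective hp
  right_inv' y hy := by
    rw [h.ι_point ⟨hy.2, logOff_mem_cornerSet y.2⟩, h.ξ_w _ ⟨hy.2, logOff_mem_cornerSet y.2⟩,
      toQuadrant_logOff y hy.1]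
  open_source := P.isOpen_U.preimage hι.continuous
  open_target := ((contDiffOn_logOff P.B).continuousOn.isOpen_inter_preimage
    (isOpen_positiveSet _) P.isOpen_O).preimage continuous_subtype_val
  continuousOn_toFun :=
    (continuous_toQuadrant P.B).comp_continuousOn (P.continuousOn_coord hι.continuous)
  continuousOn_invFun := by
    refine (P.continuousOn_point hι h).comp ?_ fun y hy => ⟨hy.2, logOff_mem_cornerSet y.2⟩
    exact (contDiffOn_logOff P.B).continuousOn.comp continuous_subtype_val.continuousOn
      fun y hy => hy.1

end Param

end Param

/-! ### Manifolds with corners whose charts are parametrizations -/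

section ParamCharts

variable {d : ℕ} {X E : Type} [TopologicalSpace X] [NormedAddCommGroup E] [NormedSpace ℝ E]

/-- The charts of the manifold with corners `X` are given by parametrizations which fit an embedding
`ι : X → E`. -/
def HasParamCharts [ChartedSpace (EuclideanQuadrant d) X] (ι : X → E) : Prop :=
  ∀ q : X, ∃ P : Param d E, P.Fits ι ∧ ι q ∈ P.U ∧
    (chartAt (EuclideanQuadrant d) q).source = ι ⁻¹' P.U ∧
    ∀ p, ι p ∈ P.U → chartAt (EuclideanQuadrant d) q p = toQuadrant P.B (P.ξ (ι p))

namespace Param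

/-- The manifold with corners given by parametrizations of neighborhoods of all points. -/
@[reducible] def chartedSpace (P : X → Param d E) {ι : X → E} (hι : Topology.IsEmbedding ι)
    (hP : ∀ q, (P q).Fits ι) (hq : ∀ q, ι q ∈ (P q).U) :
    ChartedSpace (EuclideanQuadrant d) X where
  atlas := {e | ∃ q, haveI : Nonempty X := ⟨q⟩; e = (P q).quadrantChart hι (hP q)}
  chartAt q := haveI : Nonempty X := ⟨q⟩; (P q).quadrantChart hι (hP q)
  mem_chart_source q := hq q
  chart_mem_atlas q := ⟨q, rfl⟩

variable {P : X → Param d E} {ι : X → E} (hι : Topology.IsEmbedding ι)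
    (hP : ∀ q, (P q).Fits ι) (hq : ∀ q, ι q ∈ (P q).U)

theorem hasParamCharts :
    @HasParamCharts d X E _ _ _ (chartedSpace P hι hP hq) ι := by
  intro q
  exact ⟨P q, hP q, hq q, rfl, fun p _ => rfl⟩

/-- A change of charts is a composite of `logOff`, `w`, `ξ` and `expOff`, each of which is smooth on
an open set. -/
theorem isManifold : @IsManifold ℝ _ _ _ _ _ _ (cornerModel d) ∞ X _
      (chartedSpace P hι hP hq) := by
  let := chartedSpace P hι hP hq
  refine isManifold_of_contDiffOn _ _ _ ?_
  rintro e e' ⟨q, rfl⟩ ⟨q', rfl⟩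
  have : Nonempty X := ⟨q⟩
  have key : ContDiffOn ℝ ∞ (fun y : Euc d => expOff (P q').B ((P q').ξ ((P q).w (logOff (P q).B y))))
      ({y | y ∈ positiveSet d (P q).Bᶜ ∧ logOff (P q).B y ∈ (P q).O ∧
        (P q).w (logOff (P q).B y) ∈ (P q').U}) := by
    refine (contDiff_expOff _).comp_contDiffOn ?_
    refine (P q').smooth_ξ.comp ?_ fun y hy => hy.2.2
    refine (P q).smooth_w.comp ?_ fun y hy => hy.2.1
    exact (contDiffOn_logOff _).mono fun y hy => hy.1
  have hι' : ∀ a : EuclideanQuadrant d, a.1 ∈ positiveSet d (P q).Bᶜ →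
      logOff (P q).B a.1 ∈ (P q).O →
      ι ((P q).point ι (logOff (P q).B a.1)) = (P q).w (logOff (P q).B a.1) := fun a _ h2 =>
    (hP q).ι_point ⟨h2, logOff_mem_cornerSet a.2⟩
  refine (key.mono ?_).congr ?_
  · rintro _ ⟨hy, a, rfl⟩
    rw [mem_preimage, ModelWithCorners.left_inv] at hy
    obtain ⟨⟨h1, h2⟩, h3⟩ := hy
    refine ⟨h1, h2, ?_⟩
    change (P q).w (logOff (P q).B a.1) ∈ (P q').U
    rw [← hι' a h1 h2]
    exact h3
  · rintro _ ⟨hy, a, rfl⟩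
    rw [mem_preimage, ModelWithCorners.left_inv] at hy
    obtain ⟨⟨h1, h2⟩, h3⟩ := hy
    have h3' : ι ((P q).point ι (logOff (P q).B a.1)) ∈ (P q').U := h3
    simp only [Function.comp_apply, ModelWithCorners.left_inv]
    change (toQuadrant (P q').B ((P q').ξ (ι ((P q).point ι (logOff (P q).B a.1))))).1 = _
    rw [toQuadrant_val ((hP q').ξ_mem _ h3').2, hι' a h1 h2]
    rfl

end Param

variable [ChartedSpace (EuclideanQuadrant d) X] {ι : X → E}

/-- In a chart, `ι` becomes `w` after `logOff`, which is smooth on a full neighbourhood of the point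
in question. -/
theorem HasParamCharts.contMDiff (hX : HasParamCharts (d := d) ι) (hι : Topology.IsEmbedding ι) :
    ContMDiff (cornerModel d) 𝓘(ℝ, E) ∞ ι := by
  intro q
  obtain ⟨P, hP, hq, hs, hc⟩ := hX q
  have : Nonempty X := ⟨q⟩
  rw [contMDiffAt_iff]
  refine ⟨hι.continuous.continuousAt, ?_⟩
  have hval : extChartAt (cornerModel d) q q = expOff P.B (P.ξ (ι q)) := by
    change (chartAt (EuclideanQuadrant d) q q).1 = _
    rw [hc q hq, toQuadrant_val (hP.ξ_mem q hq).2]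
  have h1 : ContDiffWithinAt ℝ ∞ (fun y => P.w (logOff P.B y)) (range (cornerModel d))
      (extChartAt (cornerModel d) q q) := by
    rw [hval]
    refine ContDiffAt.contDiffWithinAt ?_
    refine ContDiffAt.comp _ ?_ ((contDiffOn_logOff P.B).contDiffAt
      ((isOpen_positiveSet _).mem_nhds (expOff_mem_positiveSet _ _)))
    rw [logOff_expOff]
    exact P.smooth_w.contDiffAt (P.isOpen_O.mem_nhds (hP.ξ_mem q hq).1)
  have h2 : ∀ y ∈ (extChartAt (cornerModel d) q).target,
      ι ((extChartAt (cornerModel d) q).symm y) = P.w (logOff P.B y) := by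
    intro y hy
    set p := (extChartAt (cornerModel d) q).symm y
    have hp : p ∈ (chartAt (EuclideanQuadrant d) q).source := by
      have := (extChartAt (cornerModel d) q).map_target hy
      rwa [extChartAt_source] at this
    rw [hs] at hp
    have e1 : (chartAt (EuclideanQuadrant d) q p).1 = y :=
      (extChartAt (cornerModel d) q).right_inv hy
    rw [hc p hp] at e1
    rw [← e1, logOff_toQuadrant (hP.ξ_mem p hp).2, hP.w_ξ p hp]
  refine h1.congr_of_eventuallyEq ?_ ?_
  · filter_upwards [extChartAt_target_mem_nhdsWithin (I := cornerModel d) q] with y hy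
    exact h2 y hy
  · exact h2 _ (mem_extChartAt_target q)

/-- A map to `X` is smooth if its composition with the embedding is smooth. -/
theorem HasParamCharts.contMDiffWithinAt_of_comp (hX : HasParamCharts (d := d) ι)
    (hι : Topology.IsEmbedding ι) {E' H' Y : Type} [NormedAddCommGroup E'] [NormedSpace ℝ E']
    [TopologicalSpace H'] {J : ModelWithCorners ℝ E' H'} [TopologicalSpace Y] [ChartedSpace H' Y]
    {g : Y → X} {s : Set Y} {y : Y} (hg : ContMDiffWithinAt J 𝓘(ℝ, E) ∞ (fun z => ι (g z)) s y) :
    ContMDiffWithinAt J (cornerModel d) ∞ g s y := by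
  have hcont : ContinuousWithinAt g s y := by
    rw [hι.continuousWithinAt_iff]
    exact hg.continuousWithinAt
  rw [contMDiffWithinAt_iff_target]
  refine ⟨hcont, ?_⟩
  obtain ⟨P, hP, hq, hs, hc⟩ := hX (g y)
  have h1 : ContMDiffWithinAt J 𝓘(ℝ, Euc d) ∞ (fun z => expOff P.B (P.ξ (ι (g z)))) s y := by
    have h2 : ContDiffAt ℝ ∞ (fun e => expOff P.B (P.ξ e)) (ι (g y)) :=
      (contDiff_expOff P.B).contDiffAt.comp _ (P.smooth_ξ.contDiffAt (P.isOpen_U.mem_nhds hq))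
    exact ContMDiffAt.comp_contMDiffWithinAt (g := fun e => expOff P.B (P.ξ e)) y h2.contMDiffAt hg
  have h3 : ∀ p, ι p ∈ P.U → extChartAt (cornerModel d) (g y) p = expOff P.B (P.ξ (ι p)) := by
    intro p hp
    change (chartAt (EuclideanQuadrant d) (g y) p).1 = _
    rw [hc p hp, toQuadrant_val (hP.ξ_mem p hp).2]
  refine h1.congr_of_eventuallyEq ?_ (h3 _ hq)
  have : ∀ᶠ z in 𝓝[s] y, ι (g z) ∈ P.U :=
    hg.continuousWithinAt.eventually (P.isOpen_U.mem_nhds hq)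
  filter_upwards [this] with z hz using h3 _ hz

/-- Any parametrization that fits `ι` is an admissible coordinate system, whether or not it was
selected for the atlas. -/
theorem HasParamCharts.isCornerChart [Nonempty X] (hX : HasParamCharts (d := d) ι)
    (hι : Topology.IsEmbedding ι) {P : Param d E} (hP : P.Fits ι) :
    IsCornerChart P.B (P.chart hι.injective hP) where
  isOpen_source := P.isOpen_U.preimage hι.continuous
  isOpen_target := ⟨P.O, P.isOpen_O, rfl⟩
  smooth := P.smooth_ξ.contMDiffOn.comp (hX.contMDiff hι).contMDiffOn fun _ h => h
  smooth_symm := by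
    intro y hy
    refine hX.contMDiffWithinAt_of_comp hι ?_
    refine ContMDiffWithinAt.congr (f := P.w) ?_ ?_ ?_
    · exact ((P.smooth_w y hy.1).mono inter_subset_left).contMDiffWithinAt
    · intro z hz; exact hP.ι_point hz
    · exact hP.ι_point hy

/-- Exponentials are positive, so a coordinate of the chart can vanish only at an index in `B`. -/
theorem Param.Fits.mem_boundary_iff {P : Param d E} (hP : P.Fits ι) {q : X} (hq : ι q ∈ P.U)
    (hc : chartAt (EuclideanQuadrant d) q q = toQuadrant P.B (P.ξ (ι q))) :
    q ∈ (cornerModel d).boundary X ↔ ∃ i ∈ P.B, P.ξ (ι q) i = 0 := by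
  have hval : extChartAt (cornerModel d) q q = expOff P.B (P.ξ (ι q)) := by
    change (chartAt (EuclideanQuadrant d) q q).1 = _
    rw [hc, toQuadrant_val (hP.ξ_mem q hq).2]
  have hi : q ∉ (cornerModel d).boundary X ↔ ∀ i, 0 < expOff P.B (P.ξ (ι q)) i := by
    rw [← mem_compl_iff, ModelWithCorners.compl_boundary]
    change (cornerModel d).IsInteriorPoint q ↔ _
    have hr : range (cornerModel d) = {y : Euc d | ∀ i, 0 ≤ y i} := range_euclideanQuadrant d
    rw [ModelWithCorners.IsInteriorPoint, hval, hr, interior_euclideanQuadrant]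
    rfl
  rw [← not_iff_not, hi]
  push Not
  constructor
  · intro h i hi h0
    have := h i
    simp [expOff, hi, h0] at this
  · intro h i
    by_cases hb : i ∈ P.B
    · have h2 := (hP.ξ_mem q hq).2 i hb
      have h3 := h i hb
      simpa [expOff, hb] using lt_of_le_of_ne h2 (Ne.symm h3)
    · simpa [expOff, hb] using Real.exp_pos _

end ParamCharts

/-! ### Derivatives of the embedding, and vector fields in coordinates -/

section ParamDerivatives

variable {d : ℕ} {X E : Type} [TopologicalSpace X] [NormedAddCommGroup E] [NormedSpace ℝ E]

variable [ChartedSpace (EuclideanQuadrant d) X] {ι : X → E}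

theorem HasParamCharts.contMDiffOn_point [Nonempty X] (hX : HasParamCharts (d := d) ι)
    (hι : Topology.IsEmbedding ι) {P : Param d E} (hP : P.Fits ι) :
    ContMDiffOn 𝓘(ℝ, Euc d) (cornerModel d) ∞ (P.point ι) (P.O ∩ cornerSet P.B) :=
  (hX.isCornerChart hι hP).smooth_symm

/-- The chain rule for `ι ∘ point = w`, combined with uniqueness of derivatives within the corner
set. -/
theorem HasParamCharts.mfderiv_ι_point [Nonempty X] (hX : HasParamCharts (d := d) ι)
    (hι : Topology.IsEmbedding ι) {P : Param d E} (hP : P.Fits ι) {y : Euc d}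
    (hy : y ∈ P.O ∩ cornerSet P.B) (h : Euc d) :
    mfderiv (cornerModel d) 𝓘(ℝ, E) ι (P.point ι y)
      (mfderivWithin 𝓘(ℝ, Euc d) (cornerModel d) (P.point ι) (P.O ∩ cornerSet P.B) y h) =
      fderiv ℝ P.w y h := by
  have h1 := ((hX.contMDiffOn_point hι hP) y hy).mdifferentiableWithinAt (by simp)
  have h2 := (hX.contMDiff hι).mdifferentiable (by simp) (P.point ι y)
  have h3 := h2.hasMFDerivAt.comp_hasMFDerivWithinAt y h1.hasMFDerivWithinAt
  have hw : DifferentiableAt ℝ P.w y :=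
    (P.smooth_w.contDiffAt (P.isOpen_O.mem_nhds hy.1)).differentiableAt (by simp)
  have h4 : HasMFDerivWithinAt 𝓘(ℝ, Euc d) 𝓘(ℝ, E) (ι ∘ P.point ι) (P.O ∩ cornerSet P.B) y
      (fderiv ℝ P.w y) :=
    (hw.hasFDerivAt.hasFDerivWithinAt.congr (fun z hz => hP.ι_point hz)
      (hP.ι_point hy)).hasMFDerivWithinAt
  have h5 := ((uniqueDiffOn_inter_cornerSet P.B P.isOpen_O).uniqueMDiffOn y hy).eq h3 h4
  exact congrArg (fun L : Euc d →L[ℝ] E => L h) h5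

/-- Serves to construct tangent vectors of `X` with prescribed coordinate components, also at
boundary points. -/
theorem HasParamCharts.exists_mfderiv_eq (hX : HasParamCharts (d := d) ι)
    (hι : Topology.IsEmbedding ι) {P : Param d E} (hP : P.Fits ι) {p : X} (hp : ι p ∈ P.U)
    (h : Euc d) : ∃ v : TangentSpace (cornerModel d) p,
      mfderiv (cornerModel d) 𝓘(ℝ, E) ι p v = fderiv ℝ P.w (P.ξ (ι p)) h := by
  have : Nonempty X := ⟨p⟩
  have key : ∃ v : TangentSpace (cornerModel d) (P.point ι (P.ξ (ι p))),
      mfderiv (cornerModel d) 𝓘(ℝ, E) ι (P.point ι (P.ξ (ι p))) v =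
        fderiv ℝ P.w (P.ξ (ι p)) h :=
    ⟨_, hX.mfderiv_ι_point hι hP (hP.ξ_mem p hp) h⟩
  rwa [hP.point_ξ hι.injective hp] at key

/-- Locally `point ∘ ξ` is a left inverse of `ι`. Consequently vector fields on `X` may be compared
through their components in `E`. -/
theorem HasParamCharts.mfderiv_injective (hX : HasParamCharts (d := d) ι)
    (hι : Topology.IsEmbedding ι) (p : X) :
    Function.Injective (mfderiv (cornerModel d) 𝓘(ℝ, E) ι p) := by
  have : Nonempty X := ⟨p⟩
  obtain ⟨P, hP, hp, -⟩ := hX p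
  have hy := hP.ξ_mem p hp
  have h1 := ((hX.contMDiffOn_point hι hP) _ hy).mdifferentiableWithinAt (by simp)
  have h2 := ((hX.contMDiff hι).mdifferentiable (by simp) p).hasMFDerivAt
  have hξ : DifferentiableAt ℝ P.ξ (ι p) :=
    (P.smooth_ξ.contDiffAt (P.isOpen_U.mem_nhds hp)).differentiableAt (by simp)
  have h3 := (HasMFDerivAt.comp p hξ.hasFDerivAt.hasMFDerivAt h2).hasMFDerivWithinAt
    (s := ι ⁻¹' P.U)
  have h4 := HasMFDerivWithinAt.comp p (u := P.O ∩ cornerSet P.B) h1.hasMFDerivWithinAt h3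
    (fun q hq => hP.ξ_mem q hq)
  have hn : ι ⁻¹' P.U ∈ 𝓝 p := (P.isOpen_U.preimage hι.continuous).mem_nhds hp
  have h5 := (h4.hasMFDerivAt hn).congr_of_eventuallyEq (f₁ := id) (by
    filter_upwards [hn] with q hq
    exact (hP.point_ξ hι.injective hq).symm)
  intro v v' hv
  have h6 := hasMFDerivAt_unique h5 (hasMFDerivAt_id p)
  let D : Euc d →L[ℝ] Euc d := mfderivWithin 𝓘(ℝ, Euc d) (cornerModel d) (P.point ι)
    (P.O ∩ cornerSet P.B) (P.ξ (ι p))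
  have h7 : ∀ u : Euc d, D (fderiv ℝ P.ξ (ι p) (mfderiv (cornerModel d) 𝓘(ℝ, E) ι p u)) = u :=
    fun u => congrArg (fun L : Euc d →L[ℝ] Euc d => L u) h6
  exact ((h7 v).symm.trans (congrArg (fun u : E => D (fderiv ℝ P.ξ (ι p) u)) hv)).trans (h7 v')

theorem HasParamCharts.tangentBundle_ext (hX : HasParamCharts (d := d) ι)
    (hι : Topology.IsEmbedding ι) {a b : TangentBundle (cornerModel d) X} (h1 : a.1 = b.1)
    (h2 : (mfderiv (cornerModel d) 𝓘(ℝ, E) ι a.1 a.2 : E) =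
      mfderiv (cornerModel d) 𝓘(ℝ, E) ι b.1 b.2) : a = b := by
  obtain ⟨p, v⟩ := a
  obtain ⟨q, v'⟩ := b
  obtain rfl : p = q := h1
  congr 1
  exact hX.mfderiv_injective hι p h2

/-- A vector field on `X` is smooth if its components in a parametrization are smooth functions of
the coordinates. -/
theorem HasParamCharts.contMDiffOn_section [IsManifold (cornerModel d) ∞ X]
    (hX : HasParamCharts (d := d) ι)
    (hι : Topology.IsEmbedding ι) {P : Param d E} (hP : P.Fits ι) {Ω : Set X} {V : Set (Euc d)}
    (hΩ : ∀ p ∈ Ω, ι p ∈ P.U ∧ P.ξ (ι p) ∈ V) {h : Euc d → Euc d} (hh : ContDiffOn ℝ ∞ h V)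
    (Z : ∀ p : X, TangentSpace (cornerModel d) p)
    (hZ : ∀ p ∈ Ω, mfderiv (cornerModel d) 𝓘(ℝ, E) ι p (Z p) =
      fderiv ℝ P.w (P.ξ (ι p)) (h (P.ξ (ι p)))) :
    ContMDiffOn (cornerModel d) (cornerModel d).tangent ∞
      (fun p => (⟨p, Z p⟩ : TangentBundle (cornerModel d) X)) Ω := by
  rcases isEmpty_or_nonempty X with hX' | hX'
  · intro p; exact hX'.elim p
  have : IsManifold (cornerModel d) 1 X := IsManifold.of_le (n := ∞) (by simp)
  have h1 := (hX.contMDiffOn_point hι hP).contMDiffOn_tangentMapWithin (m := ∞) (by simp)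
    (uniqueDiffOn_inter_cornerSet P.B P.isOpen_O).uniqueMDiffOn
  have hcoord : ContMDiffOn (cornerModel d) 𝓘(ℝ, Euc d) ∞ (fun p => P.ξ (ι p)) Ω :=
    P.smooth_ξ.contMDiffOn.comp (hX.contMDiff hι).contMDiffOn fun p hp => (hΩ p hp).1
  have h2 : ContMDiffOn (cornerModel d) 𝓘(ℝ, Euc d).tangent ∞
      (fun p => (⟨P.ξ (ι p), h (P.ξ (ι p))⟩ : TangentBundle 𝓘(ℝ, Euc d) (Euc d))) Ω := by
    have h3 : ContMDiffOn 𝓘(ℝ, Euc d) 𝓘(ℝ, Euc d).tangent ∞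
        (fun y => (⟨y, h y⟩ : TangentBundle 𝓘(ℝ, Euc d) (Euc d))) V := fun y hy =>
      contMDiffWithinAt_vectorSpace_iff_contDiffWithinAt.2 (hh y hy)
    exact h3.comp hcoord fun p hp => (hΩ p hp).2
  -- The section is the tangent map of `point` applied to the smooth section y ↦ (y, h y).
  have h3 := h1.comp h2 fun p hp => hP.ξ_mem p (hΩ p hp).1
  refine h3.congr fun p hp => hX.tangentBundle_ext hι ?_ ?_
  · exact (hP.point_ξ hι.injective (hΩ p hp).1).symm
  · exact (hZ p hp).trans (hX.mfderiv_ι_point hι hP (hP.ξ_mem p (hΩ p hp).1) _).symm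

end ParamDerivatives

/-! ### Resolution data and adapted charts -/

/-- A space `X` embedded in `E` by `ι`, with the initial part `init`, the projection `proj`, the
components `H i` of the discontinuity locus, and, for every set `J` of components which does
not yet belong to `L`, a function `b J` vanishing exactly on the intersection of these
components. -/
structure ResData (c : ℕ) (W X E : Type) where
  ι : X → E
  init : Set X
  proj : X → ℝ
  H : Fin c → Set X
  b : Finset (Fin c) → X → W
  L : Set (Finset (Fin c))

/-- The indices of the coordinates that vanish on the intersection of the components in `J`. -/
def coordSet {c d : ℕ} (e : Fin d) (σ : Fin c → Fin d) (J : Finset (Fin c)) : Finset (Fin d) :=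
  insert e (J.image σ)

section ResData

variable {c d : ℕ} {W X E : Type} [NormedAddCommGroup W] [InnerProductSpace ℝ W]
  [TopologicalSpace X] [NormedAddCommGroup E] [NormedSpace ℝ E]

/-- A parametrization of a neighborhood of `q` such that `init` is `x_e = 0`, the components through
`q` are `x_e = x_{σ i} = 0`, and the functions `b J` are either nonvanishing or linear combinations
of `x_e` and `x_{σ i}` with nonvanishing orthogonal vectors as coefficients. -/
structure AdaptedChart (d : ℕ) (R : ResData c W X E) (q : X) extends Param d E where
  e : Fin d
  σ : Fin c → Fin d
  β : Finset (Fin c) → Euc d → W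
  A : Finset (Fin c) → Fin d → Euc d → W
  ϖ : Euc d → ℝ
  fits : toParam.Fits R.ι
  mem : R.ι q ∈ U
  smooth_ϖ : ContDiffOn ℝ ∞ ϖ O
  proj_eq : ∀ p, R.ι p ∈ U → R.proj p = ϖ (ξ (R.ι p))
  proj_eq_zero : ∀ p, R.ι p ∈ U → (R.proj p = 0 ↔ ∃ i ∈ B, ξ (R.ι p) i = 0)
  -- For `q` outside `init` the index `e` is a dummy, and `init_iff` says that the chart misses
  -- `init`. In the same way `σ i` is a dummy for components that do not pass through `q`.
  e_mem : q ∈ R.init → e ∈ B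
  init_iff : ∀ p, R.ι p ∈ U → (p ∈ R.init ↔ q ∈ R.init ∧ ξ (R.ι p) e = 0)
  σ_not_mem : ∀ i, q ∈ R.H i → σ i ∉ B
  σ_inj : ∀ i i', q ∈ R.H i → q ∈ R.H i' → σ i = σ i' → i = i'
  H_iff : ∀ p, R.ι p ∈ U → ∀ i,
    (p ∈ R.H i ↔ q ∈ R.H i ∧ ξ (R.ι p) e = 0 ∧ ξ (R.ι p) (σ i) = 0)
  smooth_β : ∀ J, ContDiffOn ℝ ∞ (β J) O
  smooth_A : ∀ J k, ContDiffOn ℝ ∞ (A J k) O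
  b_eq : ∀ J ∉ R.L, ∀ p, R.ι p ∈ U → R.b J p = β J (ξ (R.ι p))
  β_eq : ∀ J ∉ R.L, J.Nonempty → (∀ i ∈ J, q ∈ R.H i) → ∀ y ∈ O,
    β J y = ∑ k ∈ coordSet e σ J, y k • A J k y
  -- Orthogonality allows each coordinate to be recovered smoothly from the value of `b J`, by the
  -- functional `coeff`.
  A_orth : ∀ J ∉ R.L, J.Nonempty → (∀ i ∈ J, q ∈ R.H i) → ∀ y ∈ O,
    ∀ k ∈ coordSet e σ J, ∀ l ∈ coordSet e σ J, k ≠ l → inner ℝ (A J k y) (A J l y) = 0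
  A_ne : ∀ J ∉ R.L, J.Nonempty → (∀ i ∈ J, q ∈ R.H i) → ∀ y ∈ O,
    ∀ k ∈ coordSet e σ J, A J k y ≠ 0
  β_ne : ∀ J ∉ R.L, J.Nonempty → (¬ ∀ i ∈ J, q ∈ R.H i) → ∀ y ∈ O, β J y ≠ 0

namespace ResData

/-- The discontinuity locus. -/
def disc (R : ResData c W X E) : Set X := ⋃ i, R.H i

theorem mem_disc {R : ResData c W X E} {p : X} : p ∈ R.disc ↔ ∃ i, p ∈ R.H i := mem_iUnion

/-- The properties that are preserved by the blowings-up. -/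
structure Good (d : ℕ) (R : ResData c W X E) : Prop where
  emb : Topology.IsEmbedding R.ι
  isClosed_init : IsClosed R.init
  isClosed_H : ∀ i, IsClosed (R.H i)
  H_subset : ∀ i, R.H i ⊆ R.init
  proj_nonneg : ∀ p, 0 ≤ R.proj p
  upward : ∀ J ∈ R.L, ∀ J', J ⊆ J' → J' ∈ R.L
  exists_chart : ∀ q, Nonempty (AdaptedChart d R q)
  -- Combined with `upward`: the components of a nonempty set in `L` no longer have a common point.
  comp_not_mem : ∀ q (J : Finset (Fin c)), J.Nonempty → (∀ i, i ∈ J ↔ q ∈ R.H i) → J ∉ R.L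

theorem Good.isClosed_disc {R : ResData c W X E} (hR : R.Good d) : IsClosed R.disc :=
  isClosed_iUnion_of_finite hR.isClosed_H

end ResData

end ResData

/-- The embedding makes the carrier metrizable, hence Hausdorff and paracompact, and adapted charts
supply the coordinates. The two conditions on the boundary depend on the manifold structure and are
left as hypotheses. -/
theorem ResData.Good.isRegularized {c n : ℕ} {W E : Type} [NormedAddCommGroup W]
    [InnerProductSpace ℝ W] [NormedAddCommGroup E] [NormedSpace ℝ E] {S : FiberedSpace n}
    {R : ResData c W S.carrier E} (hR : R.Good (n + 1))
    (hX : HasParamCharts (d := n + 1) R.ι) (hinit : S.init = R.init) (hproj : S.proj = R.proj)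
    (hdisc : S.disc = R.disc)
    (hboundary : ∀ p, S.proj p = 0 ↔ p ∈ (cornerModel (n + 1)).boundary S.carrier)
    (hsub : ∀ p, p ∉ (cornerModel (n + 1)).boundary S.carrier →
      Function.Surjective (mfderiv (cornerModel (n + 1)) 𝓘(ℝ, ℝ) S.proj p)) :
    S.IsRegularized where
  t2Space := hR.emb.t2Space
  paracompactSpace := by
    let := hR.emb.comapMetricSpace
    infer_instance
  isClosed_init := hinit ▸ hR.isClosed_init
  disc_subset := by
    rw [hinit, hdisc]
    exact iUnion_subset hR.H_subset
  adapted := by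
    refine ⟨c, R.H, hdisc, hR.isClosed_H, fun p hp => ?_⟩
    obtain ⟨D⟩ := hR.exists_chart p
    have : Nonempty S.carrier := ⟨p⟩
    rw [hinit] at hp
    refine ⟨D.B, D.toParam.chart hR.emb.injective D.fits, D.e,
      ⟨fun i => D.σ i.1, fun i j hij => Subtype.ext (D.σ_inj _ _ i.2 j.2 hij)⟩,
      hX.isCornerChart hR.emb D.fits, D.mem, D.e_mem hp, fun i => D.σ_not_mem _ i.2, ?_, ?_, ?_⟩
    · intro q hq
      rw [hinit, D.init_iff q hq]
      exact and_iff_right hp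
    · intro i q hq
      rw [D.H_iff q hq]
      exact and_iff_right i.2
    · intro i hi
      rw [disjoint_left]
      intro q hq1 hq2
      exact hi ((D.H_iff q hq2 i).1 hq1).1
  proj_smooth := by
    intro p
    obtain ⟨D⟩ := hR.exists_chart p
    have h1 : ContDiffAt ℝ ∞ (fun e => D.ϖ (D.ξ e)) (R.ι p) :=
      (D.smooth_ϖ.contDiffAt (D.isOpen_O.mem_nhds (D.fits.ξ_mem p D.mem).1)).comp _
        (D.smooth_ξ.contDiffAt (D.isOpen_U.mem_nhds D.mem))
    have h2 := ContMDiffAt.comp (g := fun e => D.ϖ (D.ξ e)) p h1.contMDiffAt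
      (hX.contMDiff hR.emb p)
    refine h2.congr_of_eventuallyEq ?_
    filter_upwards [(D.isOpen_U.preimage hR.emb.continuous).mem_nhds D.mem] with q hq
    rw [hproj]
    exact D.proj_eq q hq
  proj_nonneg := by rw [hproj]; exact hR.proj_nonneg
  proj_eq_zero := hboundary
  proj_submersion := hsub

/-! ### Profiles -/

/-- The quotients `y_{σ i} / y_e`, replaced by large numbers of the right sign if `y_e = 0`. -/
def ratioVec {c d : ℕ} (r : ℝ) (e : Fin d) (σ : Fin c → Fin d) (y : Euc d) : Fin c → ℝ :=
  -- A profile does not distinguish numbers beyond `r` of equal sign, so `r + 1` is an arbitrary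
  -- choice. The sign 0 can occur, for a component through the base point of the chart, only on that
  -- component.
  fun i => if y e = 0 then SignType.sign (y (σ i)) * (r + 1) else y (σ i) / y e

/-- A smooth function `G u y` which depends only on the variables `u i` with `i ∈ I` and is locally
constant in each of them outside `[-r, r]`. -/
structure IsProfile {c d : ℕ} {F : Type} [NormedAddCommGroup F] [NormedSpace ℝ F]
    (I : Set (Fin c)) (r : ℝ) (V : Set (Euc d)) (G : (Fin c → ℝ) → Euc d → F) : Prop where
  pos : 0 < r
  isOpen : IsOpen V
  smooth : ContDiffOn ℝ ∞ (fun p : (Fin c → ℝ) × Euc d => G p.1 p.2) (univ ×ˢ V)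
  eq : ∀ u u' : Fin c → ℝ, ∀ y ∈ V,
    (∀ i ∈ I, u i = u' i ∨ (r < u i ∧ r < u' i) ∨ (u i < -r ∧ u' i < -r)) → G u y = G u' y

section Profile

variable {c d : ℕ} {F : Type} [NormedAddCommGroup F] [NormedSpace ℝ F]
    {I : Set (Fin c)} {r : ℝ} {V : Set (Euc d)} {G : (Fin c → ℝ) → Euc d → F}

theorem IsProfile.contDiffOn (h : IsProfile I r V G) {u : Euc d → Fin c → ℝ} {V' : Set (Euc d)}
    (hu : ContDiffOn ℝ ∞ u V') (hV : V' ⊆ V) : ContDiffOn ℝ ∞ (fun y => G (u y) y) V' :=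
  h.smooth.comp (hu.prodMk contDiffOn_id) fun y hy => ⟨mem_univ _, hV hy⟩

/-- If y_e = 0, the quotients nearby are beyond `r` and have fixed signs, because the relevant y_{σ
i} are nonzero and z_e ≥ 0 in the corner set; there G does not depend on them. If y_e ≠ 0, the
quotients themselves are continuous. -/
theorem IsProfile.continuousWithinAt (h : IsProfile I r V G) {e : Fin d} {σ : Fin c → Fin d}
    {B : Set (Fin d)} (hB : I.Nonempty → e ∈ B) {y : Euc d} (hy : y ∈ V)
    (hne : y e = 0 → ∀ i ∈ I, y (σ i) ≠ 0) :
    ContinuousWithinAt (fun z => G (ratioVec r e σ z) z) (cornerSet B) y := by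
  have hr := h.pos
  have hcont : ∀ u : Euc d → Fin c → ℝ, ContinuousAt u y →
      ContinuousAt (fun z => G (u z) z) y := by
    intro u hu
    have h1 := h.smooth.continuousOn.continuousAt (x := (u y, y))
      ((isOpen_univ.prod h.isOpen).mem_nhds ⟨mem_univ _, hy⟩)
    exact ContinuousAt.comp (f := fun z => (u z, z)) h1 (hu.prodMk continuousAt_id)
  by_cases h0 : y e = 0
  · have hg := (hcont (fun _ => ratioVec r e σ y) continuousAt_const).continuousWithinAt
      (s := cornerSet B)
    refine hg.congr_of_eventuallyEq ?_ rfl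
    have h1 : ∀ᶠ z in 𝓝[cornerSet B] y, z ∈ V :=
      nhdsWithin_le_nhds (h.isOpen.mem_nhds hy)
    -- The condition on the quotient is written with a product, so that it is open and covers z_e =
    -- 0 as well.
    have h2 : ∀ᶠ z in 𝓝[cornerSet B] y, ∀ i, i ∈ I →
        (0 < y (σ i) ∧ r * z e < z (σ i)) ∨ (y (σ i) < 0 ∧ z (σ i) < -(r * z e)) := by
      refine Filter.Eventually.filter_mono nhdsWithin_le_nhds ?_
      rw [Filter.eventually_all]
      intro i
      by_cases hi : i ∈ I
      · have hc1 : Continuous fun z : Euc d => r * z e := by fun_prop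
        have hc2 : Continuous fun z : Euc d => z (σ i) := by fun_prop
        rcases lt_or_gt_of_ne (hne h0 i hi) with h3 | h3
        · have := (isOpen_lt hc2 hc1.neg).mem_nhds (show y (σ i) < -(r * y e) by simpa [h0])
          filter_upwards [this] with z hz _ using Or.inr ⟨h3, hz⟩
        · have := (isOpen_lt hc1 hc2).mem_nhds (show r * y e < y (σ i) by simpa [h0])
          filter_upwards [this] with z hz _ using Or.inl ⟨h3, hz⟩
      · exact Filter.Eventually.of_forall fun z hz => absurd hz hi
    filter_upwards [h1, h2, self_mem_nhdsWithin] with z hz1 hz2 hz3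
    refine h.eq _ _ z hz1 fun i hi => Or.inr ?_
    have hze : 0 ≤ z e := hz3 e (hB ⟨i, hi⟩)
    rcases hz2 i hi with ⟨h3, h4⟩ | ⟨h3, h4⟩
    · left
      refine ⟨?_, by simp [ratioVec, h0, sign_pos h3]⟩
      rcases hze.eq_or_lt with h5 | h5
      · have : 0 < z (σ i) := by rw [← h5] at h4; simpa using h4
        simp [ratioVec, ← h5, sign_pos this]
      · simp only [ratioVec, h5.ne', if_false]
        rwa [lt_div_iff₀ h5]
    · right
      refine ⟨?_, by simp [ratioVec, h0, sign_neg h3]⟩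
      rcases hze.eq_or_lt with h5 | h5
      · have : z (σ i) < 0 := by rw [← h5] at h4; simpa using h4
        simp [ratioVec, ← h5, sign_neg this]
      · simp only [ratioVec, h5.ne', if_false]
        rw [div_lt_iff₀ h5]
        linarith
  · have h1 : ContinuousAt (fun z => G (fun i => z (σ i) / z e) z) y := by
      refine hcont _ (continuousAt_pi.2 fun i => ?_)
      exact ContinuousAt.div (by fun_prop) (by fun_prop) h0
    refine (h1.congr ?_).continuousWithinAt
    have hc2 : Continuous fun z : Euc d => z e := by fun_prop
    filter_upwards [hc2.continuousAt.eventually_ne h0] with z hz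
    congr 1
    ext i
    simp [ratioVec, hz]

end Profile

/-! ### Vector fields given by profiles -/

namespace FiberedSpace

variable {c n : ℕ} {W E : Type} [NormedAddCommGroup W]
    [InnerProductSpace ℝ W] [NormedAddCommGroup E] [NormedSpace ℝ E] {S : FiberedSpace n}

/-- Near `q`, the components of the vector field `Z` are given by a profile in an adapted chart. -/
def HasProfile (S : FiberedSpace n) (R : ResData c W S.carrier E) (Z : S.VField) (q : S.carrier) :
    Prop :=
  ∃ (D : AdaptedChart (n + 1) R q) (V : Set (Euc (n + 1))) (r : ℝ)
    (G : (Fin c → ℝ) → Euc (n + 1) → Euc (n + 1)),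
    IsProfile {i | q ∈ R.H i} r V G ∧ D.ξ (R.ι q) ∈ V ∧
    ∀ p, R.ι p ∈ D.U → D.ξ (R.ι p) ∈ V → p ∉ R.disc →
      mfderiv (cornerModel (n + 1)) 𝓘(ℝ, E) R.ι p (Z p) =
        fderiv ℝ D.w (D.ξ (R.ι p)) (G (ratioVec r D.e D.σ (D.ξ (R.ι p))) (D.ξ (R.ι p)))

end FiberedSpace

namespace FiberedSpace

variable {c n : ℕ} {W E : Type} [NormedAddCommGroup W]
    [InnerProductSpace ℝ W] [NormedAddCommGroup E] [NormedSpace ℝ E] {S : FiberedSpace n}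

theorem SmoothOn.mono {X : S.VField} {U V : Set S.carrier} (h : S.SmoothOn X U) (hV : V ⊆ U) :
    S.SmoothOn X V := ContMDiffOn.mono h hV

/-- A vector field given by profiles is piecewise smooth. -/
theorem isPiecewiseVField_of_hasProfile {R : ResData c W S.carrier E} (hR : R.Good (n + 1))
    (hX : HasParamCharts (d := n + 1) R.ι) (hinit : S.init = R.init)
    (hdisc : S.disc = R.disc) {O : Set S.carrier} (hO : IsOpen O) {Z : S.VField}
    (hZ : ∀ q ∈ O, S.HasProfile R Z q)
    (ht : ∀ p ∈ O \ S.disc, mfderiv (cornerModel (n + 1)) 𝓘(ℝ, ℝ) S.proj p (Z p) = 0) :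
    S.IsPiecewiseVField O Z := by
  refine ⟨?_, ?_, ht⟩
  · rintro q ⟨hqO, hq⟩
    obtain ⟨D, V, r, G, hG, hqV, h⟩ := hZ q hqO
    rw [hdisc] at hq
    have hI : {i | q ∈ R.H i} = ∅ := by
      ext i
      simp only [mem_ofPred_eq, mem_empty_iff_false, iff_false]
      exact fun hi => hq (ResData.mem_disc.2 ⟨i, hi⟩)
    have hopen : IsOpen (R.ι ⁻¹' (D.U ∩ D.ξ ⁻¹' V) \ R.disc) :=
      ((D.smooth_ξ.continuousOn.isOpen_inter_preimage D.isOpen_U hG.isOpen).preimage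
        hR.emb.continuous).sdiff hR.isClosed_disc
    -- No component passes through `q`, so G does not depend on the quotients and 0 may be inserted
    -- for them.
    have h1 := hX.contMDiffOn_section hR.emb D.fits
      (Ω := R.ι ⁻¹' (D.U ∩ D.ξ ⁻¹' V) \ R.disc) (fun p hp => hp.1)
      (hG.contDiffOn (u := fun _ => 0) contDiffOn_const subset_rfl) Z (by
        intro p hp
        rw [h p hp.1.1 hp.1.2 hp.2]
        congr 1
        refine hG.eq _ _ _ hp.1.2 fun i hi => ?_
        rw [hI] at hi
        exact hi.elim)
    exact (h1.contMDiffAt (hopen.mem_nhds ⟨⟨D.mem, hqV⟩, hq⟩)).contMDiffWithinAt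
  · rintro q ⟨hqO, hq⟩
    obtain ⟨D, V, r, G, hG, hqV, h⟩ := hZ q hqO
    have hr := hG.pos
    rw [hinit, hdisc]
    rw [hinit] at hq
    refine ⟨O ∩ R.ι ⁻¹' (D.U ∩ D.ξ ⁻¹' V), hO.inter
      ((D.smooth_ξ.continuousOn.isOpen_inter_preimage D.isOpen_U hG.isOpen).preimage
        hR.emb.continuous), ⟨hqO, D.mem, hqV⟩, inter_subset_left, ?_⟩
    intro q₁ hq₁
    set V' := ((O ∩ R.ι ⁻¹' (D.U ∩ D.ξ ⁻¹' V)) ∩ R.init) \ R.disc with hV'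
    -- On M the coordinate y_e vanishes and each quotient is replaced by ±(r + 1), with a sign that
    -- is constant on a connected component of M \ Σ. Freezing these numbers at `q₁` yields the
    -- smooth extension.
    let u : Fin c → ℝ := ratioVec r D.e D.σ (D.ξ (R.ι q₁))
    have hex : ∀ p : S.carrier, ∃ v : TangentSpace (cornerModel (n + 1)) p, R.ι p ∈ D.U →
        mfderiv (cornerModel (n + 1)) 𝓘(ℝ, E) R.ι p v =
          fderiv ℝ D.w (D.ξ (R.ι p)) (G u (D.ξ (R.ι p))) := by
      intro p
      by_cases hp : R.ι p ∈ D.U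
      · obtain ⟨v, hv⟩ := hX.exists_mfderiv_eq hR.emb D.fits hp (G u (D.ξ (R.ι p)))
        exact ⟨v, fun _ => hv⟩
      · exact ⟨0, fun h => absurd h hp⟩
    choose Y hY using hex
    refine ⟨Y, ?_, ?_⟩
    · exact hX.contMDiffOn_section hR.emb D.fits (fun p hp => hp.2)
        (hG.contDiffOn (u := fun _ => u) contDiffOn_const subset_rfl) Y
        (fun p hp => hY p hp.2.1)
    · intro p hp
      have hpV : p ∈ V' := connectedComponentIn_subset _ _ hp
      have hne : ∀ p ∈ V', D.ξ (R.ι p) D.e = 0 ∧ ∀ i, q ∈ R.H i → D.ξ (R.ι p) (D.σ i) ≠ 0 := by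
        intro p hp
        have h1 := ((D.init_iff p hp.1.1.2.1).1 hp.1.2).2
        refine ⟨h1, fun i hi h2 => hp.2 (ResData.mem_disc.2 ⟨i, ?_⟩)⟩
        exact (D.H_iff p hp.1.1.2.1 i).2 ⟨hi, h1, h2⟩
      apply hX.mfderiv_injective hR.emb
      rw [hY p hpV.1.1.2.1, h p hpV.1.1.2.1 hpV.1.1.2.2 hpV.2]
      congr 1
      refine hG.eq _ _ _ hpV.1.1.2.2 fun i hi => Or.inl ?_
      have hc : ContinuousOn (fun p => D.ξ (R.ι p) (D.σ i))
          (connectedComponentIn V' q₁) := by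
        have := D.continuousOn_coord hR.emb.continuous
        refine ContinuousOn.mono (s := R.ι ⁻¹' D.U) (by fun_prop) ?_
        intro p hp
        exact (connectedComponentIn_subset _ _ hp).1.1.2.1
      have hpc := (isPreconnected_connectedComponentIn (x := q₁) (F := V')).image _ hc
      have h1 : D.ξ (R.ι p) (D.σ i) ∈ (fun p => D.ξ (R.ι p) (D.σ i)) ''
        (connectedComponentIn V' q₁) := ⟨p, hp, rfl⟩
      have h2 : D.ξ (R.ι q₁) (D.σ i) ∈ (fun p => D.ξ (R.ι p) (D.σ i)) ''
        (connectedComponentIn V' q₁) := ⟨q₁, mem_connectedComponentIn hq₁, rfl⟩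
      have h0 : (0 : ℝ) ∉ (fun p => D.ξ (R.ι p) (D.σ i)) '' (connectedComponentIn V' q₁) := by
        rintro ⟨p', hp', h0⟩
        exact (hne p' (connectedComponentIn_subset _ _ hp')).2 i hi h0
      -- A continuous function without zeros on a connected set has constant sign.
      have hsign : SignType.sign (D.ξ (R.ι p) (D.σ i)) = SignType.sign (D.ξ (R.ι q₁) (D.σ i)) := by
        rcases lt_trichotomy (D.ξ (R.ι p) (D.σ i)) 0 with h3 | h3 | h3
        · rcases lt_trichotomy (D.ξ (R.ι q₁) (D.σ i)) 0 with h4 | h4 | h4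
          · rw [sign_neg h3, sign_neg h4]
          · exact absurd (h4 ▸ h2) h0
          · exact absurd (hpc.Icc_subset h1 h2 ⟨h3.le, h4.le⟩) h0
        · exact absurd (h3 ▸ h1) h0
        · rcases lt_trichotomy (D.ξ (R.ι q₁) (D.σ i)) 0 with h4 | h4 | h4
          · exact absurd (hpc.Icc_subset h2 h1 ⟨h4.le, h3.le⟩) h0
          · exact absurd (h4 ▸ h2) h0
          · rw [sign_pos h3, sign_pos h4]
      simp only [u, ratioVec, (hne p hpV).1, (hne q₁ hq₁).1, if_true, hsign]

/-! ### Foliations with a global generator -/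

theorem IsPiecewiseVField.of_smul {O : Set S.carrier} {Z : S.VField} (hZ : S.IsPiecewiseVField O Z)
    {U : Set S.carrier} (hU : IsOpen U) (hUO : U ⊆ O) {X : S.VField} {φ : S.carrier → ℝ}
    (hφ : ContMDiffOn (cornerModel (n + 1)) 𝓘(ℝ, ℝ) ∞ φ U)
    (hX : ∀ p ∈ U \ S.disc, X p = φ p • Z p) : S.IsPiecewiseVField U X := by
  refine ⟨?_, ?_, ?_⟩
  · have h1 : ContMDiffOn (cornerModel (n + 1)) (cornerModel (n + 1)).tangent ∞
        (fun p => (⟨p, φ p • Z p⟩ : TangentBundle (cornerModel (n + 1)) S.carrier))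
        (U \ S.disc) :=
      (hφ.mono sdiff_subset).smul_section (hZ.smooth.mono (sdiff_subset_sdiff_left hUO))
    refine h1.congr fun p hp => ?_
    rw [hX p hp]
  · rintro p ⟨hp, hp'⟩
    obtain ⟨V, hV, hpV, hVO, h⟩ := hZ.extends_across p ⟨hUO hp, hp'⟩
    refine ⟨V ∩ U, hV.inter hU, ⟨hpV, hp⟩, inter_subset_right, fun q hq => ?_⟩
    obtain ⟨Y, hY, hYq⟩ := h q ⟨⟨hq.1.1.1, hq.1.2⟩, hq.2⟩
    refine ⟨fun p => φ p • Y p, ?_, fun q' hq' => ?_⟩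
    · exact (hφ.mono inter_subset_right).smul_section (hY.mono inter_subset_left)
    · have h1 := connectedComponentIn_subset _ _ hq'
      rw [hX q' ⟨h1.1.1.2, h1.2⟩, hYq q' (connectedComponentIn_mono q ?_ hq')]
      exact sdiff_subset_sdiff_left (inter_subset_inter_left _ inter_subset_left)
  · intro p hp
    have h1 := hZ.tangent p ⟨hUO hp.1, hp.2⟩
    rw [hX p hp]
    have h2 := (mfderiv (cornerModel (n + 1)) 𝓘(ℝ, ℝ) S.proj p).map_smul (φ p) (Z p)
    rw [h1, smul_zero] at h2
    exact h2

/-- The foliation generated by a piecewise smooth vector field. -/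
def generatedFoliation {O : Set S.carrier} (hO : IsOpen O) {Z : S.VField}
    (hZ : S.IsPiecewiseVField O Z) : S.Foliation O where
  gens := {G | IsOpen G.1 ∧ G.1 ⊆ O ∧ S.Compatible G.1 G.2 O Z ∧ S.IsPiecewiseVField G.1 G.2}
  isOpen _ hG := hG.1
  subset _ hG := hG.2.1
  covers p hp := ⟨(O, Z), ⟨hO, subset_rfl, ⟨fun _ => 1, contMDiffOn_const, fun _ _ => one_pos,
    fun p _ => (one_smul ℝ _).symm⟩, hZ⟩, hp⟩
  piecewise _ hG := hG.2.2.2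
  compatible := by
    rintro ⟨U, X⟩ ⟨hU, hUO, ⟨φ, h1, h2, h3⟩, -⟩ ⟨V, Y⟩ ⟨hV, hVO, ⟨ψ, h4, h5, h6⟩, -⟩
    refine ⟨fun p => φ p * (ψ p)⁻¹, ?_, ?_, ?_⟩
    · refine ContMDiffOn.mul (h1.mono ?_) ((h4.mono ?_).inv₀ ?_)
      · exact fun p hp => ⟨hp.1, hUO hp.1⟩
      · exact fun p hp => ⟨hp.2, hVO hp.2⟩
      · exact fun p hp => (h5 p ⟨hp.2, hVO hp.2⟩).ne'
    · exact fun p hp => mul_pos (h2 p ⟨hp.1, hUO hp.1⟩) (inv_pos.2 (h5 p ⟨hp.2, hVO hp.2⟩))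
    · rintro p ⟨hp, hpd⟩
      have h7 := h5 p ⟨hp.2, hVO hp.2⟩
      change (U, X).2 p = (φ p * (ψ p)⁻¹) • (V, Y).2 p
      rw [h3 p ⟨⟨hp.1, hUO hp.1⟩, hpd⟩, h6 p ⟨⟨hp.2, hVO hp.2⟩, hpd⟩, smul_smul, mul_assoc,
        inv_mul_cancel₀ h7.ne', mul_one]
  saturated V Y hV hVO hY h := ⟨hV, hVO, (h (O, Z) ⟨hO, subset_rfl, ⟨fun _ => 1, contMDiffOn_const,
    fun _ _ => one_pos, fun p _ => (one_smul ℝ _).symm⟩, hZ⟩).1, hY⟩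

/-- Smooth multiples of `Z` are automatically piecewise smooth, so only the existence of the
positive factor matters. -/
theorem mem_generatedFoliation_iff {O : Set S.carrier} (hO : IsOpen O) {Z : S.VField}
    (hZ : S.IsPiecewiseVField O Z) {U : Set S.carrier} {X : S.VField} (hU : IsOpen U) (hUO : U ⊆ O) :
    (U, X) ∈ (generatedFoliation hO hZ).gens ↔
      ∃ φ : S.carrier → ℝ, ContMDiffOn (cornerModel (n + 1)) 𝓘(ℝ, ℝ) ∞ φ U ∧ (∀ p ∈ U, 0 < φ p) ∧
        ∀ p ∈ U \ S.disc, X p = φ p • Z p := by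
  have hinter : U ∩ O = U := inter_eq_left.2 hUO
  constructor
  · rintro ⟨-, -, ⟨φ, h1, h2, h3⟩, -⟩
    simp only [hinter] at h1 h2 h3
    exact ⟨φ, h1, h2, h3⟩
  · rintro ⟨φ, h1, h2, h3⟩
    refine ⟨hU, hUO, ⟨φ, ?_⟩, hZ.of_smul hU hUO h1 h3⟩
    simp only [hinter]
    exact ⟨h1, h2, h3⟩

theorem mem_generatedFoliation_self {O : Set S.carrier} (hO : IsOpen O) {Z : S.VField}
    (hZ : S.IsPiecewiseVField O Z) : (O, Z) ∈ (generatedFoliation hO hZ).gens :=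
  (mem_generatedFoliation_iff hO hZ hO subset_rfl).2
    ⟨fun _ => 1, contMDiffOn_const, fun _ _ => one_pos, fun _ _ => (one_smul ℝ _).symm⟩

theorem IsBlowup.mem_disc_iff {T : FiberedSpace n} {φ : T.carrier → S.carrier} {C : Set S.carrier}
    (h : IsBlowup S T φ C) (hdisc : IsClosed S.disc) {q : T.carrier} (hq : φ q ∉ C) :
    q ∈ T.disc ↔ φ q ∈ S.disc := by
  rw [h.disc_eq]
  constructor
  · intro hm
    have h1 := h.smooth.continuous.closure_preimage_subset _ hm
    exact hdisc.closure_subset_iff.2 sdiff_subset h1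
  · intro hm
    exact subset_closure ⟨hm, hq⟩

/-- The inverse of φ off the center provides a left inverse of its differential; hence lifts of
vector fields are unique there. -/
theorem IsBlowup.mfderiv_injective {T : FiberedSpace n} {φ : T.carrier → S.carrier}
    {C : Set S.carrier} (h : IsBlowup S T φ C) {q : T.carrier} (hq : φ q ∉ C) :
    Function.Injective (mfderiv (cornerModel (n + 1)) (cornerModel (n + 1)) φ q) := by
  obtain ⟨g, hg, h1, h2⟩ := h.diffeo_off_center
  have hC : Cᶜ ∈ 𝓝 (φ q) := h.isClosed_center.isOpen_compl.mem_nhds hq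
  have hgd := ((hg.contMDiffAt hC).mdifferentiableAt (by simp)).hasMFDerivAt
  have hφd := ((h.smooth q).mdifferentiableAt (by simp)).hasMFDerivAt
  have h3 := (HasMFDerivAt.comp q hgd hφd).congr_of_eventuallyEq (f₁ := id) (by
    filter_upwards [h.smooth.continuous.continuousAt hC] with q' hq'
    exact (h2 q' hq').symm)
  have h4 := hasMFDerivAt_unique h3 (hasMFDerivAt_id q)
  intro v v' hv
  let D : Euc (n + 1) →L[ℝ] Euc (n + 1) :=
    mfderiv (cornerModel (n + 1)) (cornerModel (n + 1)) g (φ q)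
  have h7 : ∀ u : Euc (n + 1),
      D (mfderiv (cornerModel (n + 1)) (cornerModel (n + 1)) φ q u) = u :=
    fun u => congrArg (fun L : Euc (n + 1) →L[ℝ] Euc (n + 1) => L u) h4
  exact ((h7 v).symm.trans (congrArg (fun u : Euc (n + 1) => D u) hv)).trans (h7 v')

/-- The blowing-up of a foliation with a global generator `Z` has as global generator a vector
field which is, off the center, a positive multiple of the lift of `Z`. -/
theorem isFoliationBlowup_generatedFoliation {T : FiberedSpace n} {φ : T.carrier → S.carrier}
    {C : Set S.carrier} (h : IsBlowup S T φ C) (hdisc : IsClosed S.disc) {O : Set S.carrier}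
    (hO : IsOpen O) {Z : S.VField} (hZ : S.IsPiecewiseVField O Z) (hO' : IsOpen (φ ⁻¹' O))
    {Z' : T.VField} (hZ' : T.IsPiecewiseVField (φ ⁻¹' O) Z') {f : T.carrier → ℝ}
    (hf : ContMDiff (cornerModel (n + 1)) 𝓘(ℝ, ℝ) ∞ f) (hpos : ∀ q, φ q ∉ C → 0 < f q)
    (hrel : ∀ q ∈ φ ⁻¹' O \ T.disc, φ q ∉ C →
      mfderiv (cornerModel (n + 1)) (cornerModel (n + 1)) φ q (Z' q) = f q • Z (φ q)) :
    IsFoliationBlowup φ C (generatedFoliation hO hZ) (generatedFoliation hO' hZ') := by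
  intro U X X' hU hUO hXX'
  obtain ⟨g, hg, hg1, hg2⟩ := h.diffeo_off_center
  have hUC : ∀ p ∈ U, p ∉ C := fun p hp => (hUO hp).2
  rw [mem_generatedFoliation_iff hO hZ hU (hUO.trans sdiff_subset),
    mem_generatedFoliation_iff hO' hZ' (hU.preimage h.smooth.continuous)
      (preimage_mono (hUO.trans sdiff_subset))]
  constructor
  · rintro ⟨ψ, h1, h2, h3⟩
    -- From dφ(Z') = f Z and injectivity of dφ: X = ψ Z corresponds to X' = (ψ ∘ φ) f⁻¹ Z'. The
    -- converse direction multiplies by f instead.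
    refine ⟨fun q => ψ (φ q) * (f q)⁻¹, ?_, ?_, ?_⟩
    · refine ContMDiffOn.mul (h1.comp h.smooth.contMDiffOn fun q hq => hq) ?_
      exact hf.contMDiffOn.inv₀ fun q hq => (hpos q (hUC _ hq)).ne'
    · exact fun q hq => mul_pos (h2 _ hq) (inv_pos.2 (hpos q (hUC _ hq)))
    · rintro q ⟨hq, hqd⟩
      have hqC := hUC _ hq
      have hqd' : φ q ∉ S.disc := fun hm => hqd ((h.mem_disc_iff hdisc hqC).2 hm)
      apply h.mfderiv_injective hqC
      rw [hXX' q ⟨hq, hqd'⟩, h3 _ ⟨hq, hqd'⟩]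
      have h4 := (mfderiv (cornerModel (n + 1)) (cornerModel (n + 1)) φ q).map_smul
        (ψ (φ q) * (f q)⁻¹) (Z' q)
      rw [hrel q ⟨(hUO hq).1, hqd⟩ hqC, smul_smul, mul_assoc,
        inv_mul_cancel₀ (hpos q hqC).ne', mul_one] at h4
      exact h4.symm
  · rintro ⟨ψ, h1, h2, h3⟩
    have hgU : ∀ p ∈ U, φ (g p) ∈ U := fun p hp => by rwa [hg1 p (hUC p hp)]
    refine ⟨fun p => ψ (g p) * f (g p), ?_, ?_, ?_⟩
    · exact (h1.mul hf.contMDiffOn).comp (hg.mono hUC) hgU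
    · intro p hp
      refine mul_pos (h2 _ (hgU p hp)) (hpos _ ?_)
      rw [hg1 p (hUC p hp)]
      exact hUC p hp
    · rintro p ⟨hp, hpd⟩
      have hpC := hUC p hp
      obtain ⟨q, rfl⟩ : ∃ q, φ q = p := ⟨g p, hg1 p hpC⟩
      change X (φ q) = (ψ (g (φ q)) * f (g (φ q))) • Z (φ q)
      rw [hg2 q hpC]
      have hqd : q ∉ T.disc := fun hm => hpd ((h.mem_disc_iff hdisc hpC).1 hm)
      rw [← hXX' q ⟨hp, hpd⟩, h3 q ⟨hp, hqd⟩]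
      have h4 := (mfderiv (cornerModel (n + 1)) (cornerModel (n + 1)) φ q).map_smul (ψ q) (Z' q)
      rw [hrel q ⟨(hUO hp).1, hqd⟩ hpC, smul_smul] at h4
      exact h4

end FiberedSpace

/-! ### The blowing-up of resolution data -/

/-- Closed relations pass to the closure. It is applied to the graph of a direction and to the part
of a strict transform off the exceptional divisor. -/
theorem mem_of_mem_closure_of_eventually {Y V : Type} [TopologicalSpace Y] [TopologicalSpace V]
    {G : Set Y} {t : Y} (ht : t ∈ closure G) {F : Y → V} (hF : ContinuousAt F t) {K : Set V}
    (hK : IsClosed K) (h : ∀ᶠ g in 𝓝[G] t, F g ∈ K) : F t ∈ K :=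
  have : (𝓝[G] t).NeBot := mem_closure_iff_nhdsWithin_neBot.1 ht
  hK.mem_of_tendsto (hF.mono_left nhdsWithin_le_nhds) h

section Coefficients

variable {W : Type} [NormedAddCommGroup W] [InnerProductSpace ℝ W]

/-- The coefficient of the orthogonal projection of `x` to the line spanned by `a`. -/
def coeff (a x : W) : ℝ := inner ℝ a x / ‖a‖ ^ 2

theorem coeff_sum {κ : Type} {K : Finset κ} {A : κ → W} (hne : ∀ k ∈ K, A k ≠ 0)
    (horth : ∀ k ∈ K, ∀ l ∈ K, k ≠ l → inner ℝ (A k) (A l) = 0) (v : κ → ℝ) {k : κ} (hk : k ∈ K) :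
    coeff (A k) (∑ l ∈ K, v l • A l) = v k := by
  have h1 : inner ℝ (A k) (∑ l ∈ K, v l • A l) = v k * ‖A k‖ ^ 2 := by
    rw [inner_sum, Finset.sum_eq_single_of_mem k hk]
    · rw [inner_smul_right, real_inner_self_eq_norm_sq]
    · intro l hl hlk
      rw [inner_smul_right, horth k hk l hl hlk.symm, mul_zero]
  have h2 : ‖A k‖ ^ 2 ≠ 0 := by simpa using hne k hk
  rw [coeff, h1, mul_div_cancel_right₀ _ h2]

theorem sum_smul_ne_zero {κ : Type} {K : Finset κ} {A : κ → W} (hne : ∀ k ∈ K, A k ≠ 0)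
    (horth : ∀ k ∈ K, ∀ l ∈ K, k ≠ l → inner ℝ (A k) (A l) = 0) {v : κ → ℝ} {k : κ} (hk : k ∈ K)
    (hv : v k ≠ 0) : ∑ l ∈ K, v l • A l ≠ 0 := by
  intro h
  have := coeff_sum hne horth v hk
  rw [h] at this
  simp [coeff] at this
  exact hv this.symm

theorem coeff_smul (a x : W) (r : ℝ) : coeff a (r • x) = r * coeff a x := by
  rw [coeff, inner_smul_right, mul_div_assoc, coeff]

theorem ContDiffOn.coeff {V : Type} [NormedAddCommGroup V] [NormedSpace ℝ V] {a x : V → W}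
    {s : Set V} (ha : ContDiffOn ℝ ∞ a s) (hx : ContDiffOn ℝ ∞ x s) (hne : ∀ y ∈ s, a y ≠ 0) :
    ContDiffOn ℝ ∞ (fun y => coeff (a y) (x y)) s := by
  refine (ha.inner ℝ hx).div (ha.norm_sq ℝ) fun y hy => ?_
  simpa using hne y hy

theorem ContinuousAt.coeff {V : Type} [TopologicalSpace V] {a x : V → W}
    {y : V} (ha : ContinuousAt a y) (hx : ContinuousAt x y) (hne : a y ≠ 0) :
    ContinuousAt (fun y => coeff (a y) (x y)) y := by
  refine (ha.inner hx).div (ha.norm.pow 2) ?_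
  simpa using hne

theorem norm_inv_smul_self {x : W} (hx : x ≠ 0) : ‖‖x‖⁻¹ • x‖ = 1 := by
  rw [norm_smul, norm_inv, norm_norm, inv_mul_cancel₀ (norm_ne_zero_iff.2 hx)]

end Coefficients

theorem units_cast_mul_self (s : ℤˣ) : (((s : ℤ) : ℝ)) * ((s : ℤ) : ℝ) = 1 := by
  rcases Int.units_eq_one_or s with rfl | rfl <;> simp

section Directional

variable {d : ℕ}

/-- The coordinates of a direction: those of `z`, with the `j`-th replaced by the sign `s`. -/
def directionVec (j : Fin d) (s : ℤˣ) (z : Euc d) (k : Fin d) : ℝ :=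
  if k = j then ((s : ℤ) : ℝ) else z k

/-- Writing the map as z_j v with v_j = s puts the index j on the same footing as the other indices
in K. -/
theorem directionalMap_of_mem {K : Finset (Fin d)} {j : Fin d} {s : ℤˣ}
    {z : Euc d} {k : Fin d} (hk : k ∈ K) :
    directionalMap K j s z k = z j * directionVec j s z k := by
  by_cases h : k = j
  · simp [directionalMap, directionVec, h, mul_comm]
  · simp [directionalMap, directionVec, h, hk]

theorem directionalMap_of_not_mem {K : Finset (Fin d)} {j : Fin d} (hj : j ∈ K) {s : ℤˣ}
    {z : Euc d} {k : Fin d} (hk : k ∉ K) :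
    directionalMap K j s z k = z k := by
  have h : k ≠ j := fun h => hk (h ▸ hj)
  simp [directionalMap, h, hk]

theorem contDiff_directionVec (j : Fin d) (s : ℤˣ) (k : Fin d) :
    ContDiff ℝ ∞ fun z : Euc d => directionVec j s z k := by
  by_cases h : k = j <;> simp only [directionVec, h, if_true, if_false] <;> fun_prop

theorem contDiff_directionalMap (K : Finset (Fin d)) (j : Fin d) (s : ℤˣ) :
    ContDiff ℝ ∞ (directionalMap K j s) := by
  rw [contDiff_euclidean]
  intro i
  by_cases h : i = j
  · simp only [directionalMap, h, if_true]; fun_prop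
  · by_cases h' : i ∈ K <;> simp only [directionalMap, h, h', if_true, if_false] <;> fun_prop

theorem directionalMap_mem_cornerSet {B : Set (Fin d)} {K : Finset (Fin d)} {j : Fin d} {s : ℤˣ}
    (h : IsDirection B K j s) {z : Euc d} (hz : z ∈ cornerSet (insert j B)) :
    directionalMap K j s z ∈ cornerSet B := by
  intro k hk
  have hj := hz j (mem_insert j B)
  have hzk := hz k (mem_insert_of_mem j hk)
  by_cases h1 : k ∈ K
  · rw [directionalMap_of_mem h1]
    refine mul_nonneg hj ?_
    by_cases h2 : k = j
    · subst h2
      simp [directionVec, h.2 hk]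
    · simpa [directionVec, h2] using hzk
  · rwa [directionalMap_of_not_mem h.1 h1]

end Directional

namespace ResData

variable {c d : ℕ} {W X E : Type} [NormedAddCommGroup W] [InnerProductSpace ℝ W]
  [TopologicalSpace X] [NormedAddCommGroup E] [NormedSpace ℝ E]

/-- The intersection of the components in `I`, if `I` can be blown up. -/
def center (R : ResData c W X E) (I : Finset (Fin c)) : Set X := {p | R.b I p = 0}

/-- The graph of the direction of `b I`. -/
def directionGraph (R : ResData c W X E) (I : Finset (Fin c)) : Set (X × W) :=
  {t | R.b I t.1 ≠ 0 ∧ t.2 = ‖R.b I t.1‖⁻¹ • R.b I t.1}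

/-- The space obtained by blowing up the intersection of the components in `I`. -/
abbrev BlowCarrier (R : ResData c W X E) (I : Finset (Fin c)) : Type :=
  {t : X × W // t ∈ closure (R.directionGraph I)}

/-- The blowing-up map. -/
def blowMap (R : ResData c W X E) (I : Finset (Fin c)) (t : R.BlowCarrier I) : X := t.1.1

/-- The blowing-up of the intersection of the components in `I`. -/
def blow (R : ResData c W X E) (I : Finset (Fin c)) : ResData c W (R.BlowCarrier I) (E × W) where
  ι t := (R.ι t.1.1, t.1.2)
  init := closure (R.blowMap I ⁻¹' (R.init \ R.center I))
  proj t := R.proj (R.blowMap I t)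
  H i := closure (R.blowMap I ⁻¹' (R.H i \ R.center I))
  -- The division removes the factor which vanishes on the exceptional divisor. The other nonempty J
  -- outside `L` need no change: exactly the components of I pass through a point of the center, so
  -- `b J` does not vanish there.
  b J := if J.Nonempty ∧ J ⊆ I then extendFrom (R.blowMap I ⁻¹' R.center I)ᶜ
      (fun t => ‖R.b I (R.blowMap I t)‖⁻¹ • R.b J (R.blowMap I t))
    else fun t => R.b J (R.blowMap I t)
  L := insert I R.L

/-- The conditions under which the set `I` of components is the next one to be blown up. -/
structure Next (R : ResData c W X E) (I : Finset (Fin c)) : Prop where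
  nonempty : I.Nonempty
  not_mem : I ∉ R.L
  max : ∀ J, I ⊂ J → J ∈ R.L

variable {R : ResData c W X E} {I : Finset (Fin c)}

theorem continuous_blowMap : Continuous (R.blowMap I) :=
  continuous_fst.comp continuous_subtype_val

theorem Good.continuous_b (hR : R.Good d) {J : Finset (Fin c)} (hJ : J ∉ R.L) :
    Continuous (R.b J) := by
  rw [continuous_iff_continuousAt]
  intro q
  obtain ⟨D⟩ := hR.exists_chart q
  have h1 : ContinuousAt (fun p => D.β J (D.ξ (R.ι p))) q :=
    ContinuousAt.comp (g := D.β J)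
      ((D.smooth_β J).continuousOn.continuousAt (D.isOpen_O.mem_nhds (D.fits.ξ_mem q D.mem).1))
      ((D.continuousOn_coord hR.emb.continuous).continuousAt
        ((D.isOpen_U.preimage hR.emb.continuous).mem_nhds D.mem))
  refine h1.congr ?_
  filter_upwards [(D.isOpen_U.preimage hR.emb.continuous).mem_nhds D.mem] with p hp
  exact (D.b_eq J hJ p hp).symm

theorem Good.isClosed_center (hR : R.Good d) (hI : R.Next I) : IsClosed (R.center I) :=
  isClosed_eq (hR.continuous_b hI.not_mem) continuous_const

end ResData

theorem AdaptedChart.coord_eq_zero {c d : ℕ} {W X E : Type} [NormedAddCommGroup W]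
    [InnerProductSpace ℝ W] [TopologicalSpace X] [NormedAddCommGroup E] [NormedSpace ℝ E]
    {R : ResData c W X E} {q : X} (D : AdaptedChart d R q) {I : Finset (Fin c)}
    (hI : I.Nonempty) {p : X} (hp : R.ι p ∈ D.U)
    (h : ∀ i ∈ I, p ∈ R.H i) : ∀ k ∈ coordSet D.e D.σ I, D.ξ (R.ι p) k = 0 := by
  intro k hk
  rw [coordSet, Finset.mem_insert, Finset.mem_image] at hk
  rcases hk with rfl | ⟨i, hi, rfl⟩
  · obtain ⟨i, hi⟩ := hI
    exact ((D.H_iff p hp i).1 (h i hi)).2.1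
  · exact ((D.H_iff p hp i).1 (h i hi)).2.2

namespace ResData

variable {c d : ℕ} {W X E : Type} [NormedAddCommGroup W] [InnerProductSpace ℝ W]
  [TopologicalSpace X] [NormedAddCommGroup E] [NormedSpace ℝ E]
  {R : ResData c W X E} {I : Finset (Fin c)}

theorem Good.mem_center_iff (hR : R.Good d) (hI : R.Next I) {p : X} :
    p ∈ R.center I ↔ ∀ i ∈ I, p ∈ R.H i := by
  obtain ⟨D⟩ := hR.exists_chart p
  have hO := (D.fits.ξ_mem p D.mem).1
  change R.b I p = 0 ↔ _
  rw [D.b_eq I hI.not_mem p D.mem]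
  constructor
  · intro h
    by_contra h'
    exact D.β_ne I hI.not_mem hI.nonempty h' _ hO h
  · intro h
    rw [D.β_eq I hI.not_mem hI.nonempty h _ hO]
    refine Finset.sum_eq_zero fun k hk => ?_
    rw [D.coord_eq_zero hI.nonempty D.mem h k hk, zero_smul]

/-- A further component through `q` would produce a set strictly larger than I. By maximality this
set is in `L`, which `comp_not_mem` forbids. -/
theorem Good.mem_iff_of_mem_center (hR : R.Good d) (hI : R.Next I) {q : X} (hq : q ∈ R.center I)
    (i : Fin c) : i ∈ I ↔ q ∈ R.H i := by
  classical
  rw [hR.mem_center_iff hI] at hq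
  refine ⟨hq i, fun h => ?_⟩
  by_contra hi
  let J : Finset (Fin c) := Finset.univ.filter fun i => q ∈ R.H i
  have hJ : ∀ i, i ∈ J ↔ q ∈ R.H i := fun i => by simp [J]
  have hIJ : I ⊂ J := by
    refine Finset.ssubset_iff_subset_ne.2 ⟨fun k hk => (hJ k).2 (hq k hk), ?_⟩
    rintro h1
    exact hi (h1 ▸ (hJ i).2 h)
  exact hR.comp_not_mem q J ⟨i, (hJ i).2 h⟩ hJ (hI.max J hIJ)

theorem Good.mem_center_iff_coord (hR : R.Good d) (hI : R.Next I) {q : X} (hq : q ∈ R.center I)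
    (D : AdaptedChart d R q) {p : X} (hp : R.ι p ∈ D.U) :
    p ∈ R.center I ↔ ∀ k ∈ coordSet D.e D.σ I, D.ξ (R.ι p) k = 0 := by
  rw [hR.mem_center_iff hI] at hq ⊢
  refine ⟨D.coord_eq_zero hI.nonempty hp, fun h i hi => (D.H_iff p hp i).2 ⟨hq i hi, ?_, ?_⟩⟩
  · exact h _ (Finset.mem_insert_self _ _)
  · exact h _ (Finset.mem_insert_of_mem (Finset.mem_image_of_mem _ hi))

/-- Off the center the normalized `b I` is continuous, so taking the closure of the graph adds no
points there. -/
theorem Good.direction_eq (hR : R.Good d) (hI : R.Next I) (t : R.BlowCarrier I)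
    (ht : R.blowMap I t ∉ R.center I) :
    t.1.2 = ‖R.b I (R.blowMap I t)‖⁻¹ • R.b I (R.blowMap I t) := by
  have hb := hR.continuous_b hI.not_mem
  have hF : ContinuousAt (fun t : X × W => t.2 - ‖R.b I t.1‖⁻¹ • R.b I t.1) t.1 := by
    refine continuousAt_snd.sub (ContinuousAt.smul (ContinuousAt.inv₀ ?_ ?_) ?_)
    · exact (hb.comp continuous_fst).norm.continuousAt
    · exact norm_ne_zero_iff.2 ht
    · exact (hb.comp continuous_fst).continuousAt
  have h := mem_of_mem_closure_of_eventually t.2 hF (isClosed_singleton (x := (0 : W))) (by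
    filter_upwards [self_mem_nhdsWithin] with g hg
    exact sub_eq_zero.2 hg.2)
  exact sub_eq_zero.1 h

/-- In an adapted chart at a point of the center, the direction is a normalized linear combination
of the coefficient vectors. -/
theorem Good.direction_spec (hR : R.Good d) (hI : R.Next I) {q : X} (hq : q ∈ R.center I)
    (D : AdaptedChart d R q) (t : R.BlowCarrier I) (ht : R.ι (R.blowMap I t) ∈ D.U) :
    ‖t.1.2‖ = 1 ∧
    t.1.2 = ∑ k ∈ coordSet D.e D.σ I,
      coeff (D.A I k (D.ξ (R.ι t.1.1))) t.1.2 • D.A I k (D.ξ (R.ι t.1.1)) ∧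
    ∀ k ∈ coordSet D.e D.σ I,
      (k ∈ D.B → 0 ≤ coeff (D.A I k (D.ξ (R.ι t.1.1))) t.1.2) ∧
      D.ξ (R.ι t.1.1) k = ‖R.b I t.1.1‖ * coeff (D.A I k (D.ξ (R.ι t.1.1))) t.1.2 := by
  have hqI := (hR.mem_center_iff hI).1 hq
  have hb := hR.continuous_b hI.not_mem
  have hmem := D.fits.ξ_mem _ ht
  have hξ : ContinuousAt (fun t : X × W => D.ξ (R.ι t.1)) t.1 :=
    ContinuousAt.comp (f := Prod.fst) (g := fun p => D.ξ (R.ι p))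
      ((D.continuousOn_coord hR.emb.continuous).continuousAt
      ((D.isOpen_U.preimage hR.emb.continuous).mem_nhds ht)) continuousAt_fst
  have hA : ∀ k, ContinuousAt (fun t : X × W => D.A I k (D.ξ (R.ι t.1))) t.1 := fun k =>
    ContinuousAt.comp (f := fun t : X × W => D.ξ (R.ι t.1)) (g := D.A I k)
      ((D.smooth_A I k).continuousOn.continuousAt (D.isOpen_O.mem_nhds hmem.1)) hξ
  have hco : ∀ k ∈ coordSet D.e D.σ I,
      ContinuousAt (fun t : X × W => coeff (D.A I k (D.ξ (R.ι t.1))) t.2) t.1 := fun k hk =>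
    (hA k).coeff continuousAt_snd (D.A_ne I hI.not_mem hI.nonempty hqI _ hmem.1 k hk)
  -- All assertions are closed conditions. They hold on the graph, where the direction is b_I/‖b_I‖
  -- and b_I = Σ x_k A_k, and therefore on its closure.
  have hev : ∀ᶠ g in 𝓝[R.directionGraph I] t.1, R.ι g.1 ∈ D.U ∧ R.b I g.1 ≠ 0 ∧
      g.2 = ‖R.b I g.1‖⁻¹ • R.b I g.1 ∧
      ∀ k ∈ coordSet D.e D.σ I,
        coeff (D.A I k (D.ξ (R.ι g.1))) g.2 = ‖R.b I g.1‖⁻¹ * D.ξ (R.ι g.1) k := by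
    have h1 : ∀ᶠ g in 𝓝[R.directionGraph I] t.1, R.ι g.1 ∈ D.U :=
      Filter.Eventually.filter_mono nhdsWithin_le_nhds
        ((hR.emb.continuous.comp continuous_fst).continuousAt.eventually
          (D.isOpen_U.mem_nhds ht))
    filter_upwards [h1, self_mem_nhdsWithin] with g hg1 hg2
    refine ⟨hg1, hg2.1, hg2.2, fun k hk => ?_⟩
    have hO := (D.fits.ξ_mem _ hg1).1
    rw [hg2.2, coeff_smul, D.b_eq I hI.not_mem _ hg1,
      D.β_eq I hI.not_mem hI.nonempty hqI _ hO,
      coeff_sum (D.A_ne I hI.not_mem hI.nonempty hqI _ hO)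
        (D.A_orth I hI.not_mem hI.nonempty hqI _ hO) _ hk]
  refine ⟨?_, ?_, fun k hk => ⟨fun hkB => ?_, ?_⟩⟩
  · refine mem_of_mem_closure_of_eventually t.2 (F := fun t : X × W => ‖t.2‖)
      continuousAt_snd.norm (isClosed_singleton (x := (1 : ℝ))) ?_
    filter_upwards [hev] with g hg
    rw [mem_singleton_iff, hg.2.2.1]
    exact norm_inv_smul_self hg.2.1
  · have h := mem_of_mem_closure_of_eventually t.2 (F := fun t : X × W => t.2 -
      ∑ k ∈ coordSet D.e D.σ I,
        coeff (D.A I k (D.ξ (R.ι t.1))) t.2 • D.A I k (D.ξ (R.ι t.1))) ?_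
      (isClosed_singleton (x := (0 : W))) ?_
    · exact sub_eq_zero.1 h
    · exact continuousAt_snd.sub (tendsto_finsetSum _ fun k hk => (hco k hk).smul (hA k))
    · filter_upwards [hev] with g hg
      rw [mem_singleton_iff, sub_eq_zero]
      have hO := (D.fits.ξ_mem _ hg.1).1
      conv_lhs => rw [hg.2.2.1, D.b_eq I hI.not_mem _ hg.1,
        D.β_eq I hI.not_mem hI.nonempty hqI _ hO, Finset.smul_sum]
      refine Finset.sum_congr rfl fun k hk => ?_
      rw [hg.2.2.2 k hk, smul_smul, D.b_eq I hI.not_mem _ hg.1,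
        D.β_eq I hI.not_mem hI.nonempty hqI _ hO]
  · refine mem_of_mem_closure_of_eventually t.2 (hco k hk) (isClosed_Ici (a := (0 : ℝ))) ?_
    filter_upwards [hev] with g hg
    have h := mul_nonneg (inv_nonneg.2 (norm_nonneg (R.b I g.1))) ((D.fits.ξ_mem _ hg.1).2 k hkB)
    rw [← hg.2.2.2 k hk] at h
    exact h
  · have h := mem_of_mem_closure_of_eventually t.2 (F := fun t : X × W => D.ξ (R.ι t.1) k -
        ‖R.b I t.1‖ * coeff (D.A I k (D.ξ (R.ι t.1))) t.2) ?_
      (isClosed_singleton (x := (0 : ℝ))) ?_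
    · exact sub_eq_zero.1 h
    · have h1 : ContinuousAt (fun t : X × W => D.ξ (R.ι t.1) k) t.1 := by fun_prop
      exact h1.sub ((hb.comp continuous_fst).norm.continuousAt.mul (hco k hk))
    · filter_upwards [hev] with g hg
      rw [mem_singleton_iff, sub_eq_zero, hg.2.2.2 k hk, ← mul_assoc,
        mul_inv_cancel₀ (norm_ne_zero_iff.2 hg.2.1), one_mul]

end ResData

/-! ### Parametrizations of the blown-up space -/

section BlowCharts

variable {c d : ℕ} {W X E : Type} [NormedAddCommGroup W] [InnerProductSpace ℝ W]
  [TopologicalSpace X] [NormedAddCommGroup E] [NormedSpace ℝ E]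
  {R : ResData c W X E} {I : Finset (Fin c)} {q : X}

namespace AdaptedChart

/-- The parametrization of the blown-up space over an adapted chart at a point which does not
belong to the center. -/
def offParam (D : AdaptedChart d R q) (hI : R.Next I) (hq : ¬ ∀ i ∈ I, q ∈ R.H i) :
    Param d (E × W) where
  B := D.B
  O := D.O
  U := D.U ×ˢ univ
  w y := (D.w y, ‖D.β I y‖⁻¹ • D.β I y)
  ξ t := D.ξ t.1
  isOpen_O := D.isOpen_O
  isOpen_U := D.isOpen_U.prod isOpen_univ
  smooth_w := by
    have h0 := D.β_ne I hI.not_mem hI.nonempty hq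
    exact D.smooth_w.prodMk ((((D.smooth_β I).norm ℝ h0).inv fun y hy =>
      norm_ne_zero_iff.2 (h0 y hy)).smul (D.smooth_β I))
  smooth_ξ := D.smooth_ξ.comp contDiffOn_fst fun _ h => h.1

/-- The linear combination of the coefficient vectors whose direction is the direction given by the
coordinates `z` of a directional blowing-up. -/
def dirVec (D : AdaptedChart d R q) (I : Finset (Fin c)) (j : Fin d) (s : ℤˣ) (z : Euc d) : W :=
  ∑ k ∈ coordSet D.e D.σ I, directionVec j s z k • D.A I k (directionalMap (coordSet D.e D.σ I) j s z)

theorem dirVec_ne_zero (D : AdaptedChart d R q) (hI : R.Next I) (hq : ∀ i ∈ I, q ∈ R.H i)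
    {j : Fin d} (hj : j ∈ coordSet D.e D.σ I) (s : ℤˣ) {z : Euc d}
    (hz : directionalMap (coordSet D.e D.σ I) j s z ∈ D.O) : D.dirVec I j s z ≠ 0 := by
  refine sum_smul_ne_zero (D.A_ne I hI.not_mem hI.nonempty hq _ hz)
    (D.A_orth I hI.not_mem hI.nonempty hq _ hz) hj ?_
  rcases Int.units_eq_one_or s with rfl | rfl <;> simp [directionVec]

theorem smooth_dirVec (D : AdaptedChart d R q) (j : Fin d) (s : ℤˣ) :
    ContDiffOn ℝ ∞ (D.dirVec I j s) (directionalMap (coordSet D.e D.σ I) j s ⁻¹' D.O) := by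
  refine ContDiffOn.sum fun k _ => (contDiff_directionVec j s k).contDiffOn.smul ?_
  exact (D.smooth_A I k).comp (contDiff_directionalMap _ j s).contDiffOn fun _ h => h

theorem smooth_coeff (D : AdaptedChart d R q) (hI : R.Next I) (hq : ∀ i ∈ I, q ∈ R.H i)
    {k : Fin d} (hk : k ∈ coordSet D.e D.σ I) :
    ContDiffOn ℝ ∞ (fun t : E × W => coeff (D.A I k (D.ξ t.1)) t.2)
      ((D.U ∩ D.ξ ⁻¹' D.O) ×ˢ univ) := by
  refine ContDiffOn.coeff ?_ contDiffOn_snd fun t ht =>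
    D.A_ne I hI.not_mem hI.nonempty hq _ ht.1.2 k hk
  refine (D.smooth_A I k).comp (t := D.O) ?_ fun t ht => ht.1.2
  exact D.smooth_ξ.comp contDiffOn_fst fun t ht => ht.1.1

open Classical in
/-- The parametrization of the blown-up space in the direction `(j, s)`. -/
def dirParam (D : AdaptedChart d R q) (hI : R.Next I) (hq : ∀ i ∈ I, q ∈ R.H i) {j : Fin d}
    (hj : j ∈ coordSet D.e D.σ I) (s : ℤˣ) : Param d (E × W) where
  B := insert j D.B
  O := directionalMap (coordSet D.e D.σ I) j s ⁻¹' D.O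
  -- The direction (j, s) covers the points whose j-th coefficient c_j has the sign s. Division by
  -- |c_j| = s c_j normalizes the direction to v_j = s.
  U := ((D.U ∩ D.ξ ⁻¹' D.O) ×ˢ univ) ∩
    (fun t : E × W => ((s : ℤ) : ℝ) * coeff (D.A I j (D.ξ t.1)) t.2) ⁻¹' Ioi 0
  w z := (D.w (directionalMap (coordSet D.e D.σ I) j s z), ‖D.dirVec I j s z‖⁻¹ • D.dirVec I j s z)
  ξ t := WithLp.toLp 2 fun k => if k = j then ((s : ℤ) : ℝ) * D.ξ t.1 j
    else if k ∈ coordSet D.e D.σ I then coeff (D.A I k (D.ξ t.1)) t.2 /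
      (((s : ℤ) : ℝ) * coeff (D.A I j (D.ξ t.1)) t.2)
    else D.ξ t.1 k
  isOpen_O := D.isOpen_O.preimage (contDiff_directionalMap _ j s).continuous
  isOpen_U := by
    refine ContinuousOn.isOpen_inter_preimage ?_ ?_ isOpen_Ioi
    · exact continuousOn_const.mul (D.smooth_coeff hI hq hj).continuousOn
    · exact (D.smooth_ξ.continuousOn.isOpen_inter_preimage D.isOpen_U D.isOpen_O).prod isOpen_univ
  smooth_w := by
    have h0 : ∀ z ∈ directionalMap (coordSet D.e D.σ I) j s ⁻¹' D.O, D.dirVec I j s z ≠ 0 :=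
      fun z hz => D.dirVec_ne_zero hI hq hj s hz
    refine (D.smooth_w.comp (contDiff_directionalMap _ j s).contDiffOn fun _ h => h).prodMk ?_
    exact (((D.smooth_dirVec j s).norm ℝ h0).inv fun y hy =>
      norm_ne_zero_iff.2 (h0 y hy)).smul (D.smooth_dirVec j s)
  smooth_ξ := by
    have hx : ContDiffOn ℝ ∞ (fun t : E × W => D.ξ t.1) ((D.U ∩ D.ξ ⁻¹' D.O) ×ˢ univ) :=
      D.smooth_ξ.comp contDiffOn_fst fun t ht => ht.1.1
    rw [contDiffOn_euclidean] at hx ⊢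
    intro k
    by_cases h1 : k = j
    · simp only [h1, if_true]
      exact (contDiffOn_const.mul (hx j)).mono inter_subset_left
    · by_cases h2 : k ∈ coordSet D.e D.σ I
      · simp only [h1, h2, if_true, if_false]
        refine ((D.smooth_coeff hI hq h2).mono inter_subset_left).div
          ((contDiffOn_const.mul (D.smooth_coeff hI hq hj)).mono inter_subset_left) ?_
        exact fun t ht => ne_of_gt ht.2
      · simp only [h1, h2, if_false]
        exact (hx k).mono inter_subset_left

/-- Off the center the component in `W` is determined by the point of `X`, according to
`direction_eq`. -/
theorem offParam_fits (D : AdaptedChart d R q) (hI : R.Next I) (hq : ¬ ∀ i ∈ I, q ∈ R.H i)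
    (hR : R.Good d) : (D.offParam hI hq).Fits (R.blow I).ι := by
  have hb : ∀ p, R.ι p ∈ D.U → R.b I p ≠ 0 := fun p hp => by
    rw [D.b_eq I hI.not_mem p hp]
    exact D.β_ne I hI.not_mem hI.nonempty hq _ (D.fits.ξ_mem p hp).1
  refine ⟨fun y hy => ?_, fun y hy => ⟨D.fits.w_mem y hy, mem_univ _⟩, fun y hy => D.fits.ξ_w y hy,
    fun t ht => D.fits.ξ_mem _ ht.1, fun t ht => ?_⟩
  · obtain ⟨p, hp⟩ := D.fits.exists_eq y hy
    have hpU : R.ι p ∈ D.U := hp ▸ D.fits.w_mem y hy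
    have hy' : D.ξ (R.ι p) = y := by rw [hp, D.fits.ξ_w y hy]
    refine ⟨⟨(p, ‖R.b I p‖⁻¹ • R.b I p), subset_closure ⟨hb p hpU, rfl⟩⟩, ?_⟩
    refine Prod.ext hp ?_
    change ‖R.b I p‖⁻¹ • R.b I p = ‖D.β I y‖⁻¹ • D.β I y
    rw [D.b_eq I hI.not_mem p hpU, hy']
  · have ht1 : R.ι (R.blowMap I t) ∈ D.U := ht.1
    refine Prod.ext (D.fits.w_ξ _ ht1) ?_
    change ‖D.β I (D.ξ (R.ι (R.blowMap I t)))‖⁻¹ • D.β I (D.ξ (R.ι (R.blowMap I t))) = t.1.2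
    rw [← D.b_eq I hI.not_mem _ ht1]
    exact (hR.direction_eq hI t (hb _ ht1)).symm

/-- The common factor z_j comes out of `b I`. What remains is nonzero, so the normalized direction
has a smooth continuation to z_j = 0. -/
theorem β_directionalMap (D : AdaptedChart d R q) (hI : R.Next I) (hq : ∀ i ∈ I, q ∈ R.H i)
    (j : Fin d) (s : ℤˣ) {z : Euc d} (hz : directionalMap (coordSet D.e D.σ I) j s z ∈ D.O) :
    D.β I (directionalMap (coordSet D.e D.σ I) j s z) = z j • D.dirVec I j s z := by
  rw [D.β_eq I hI.not_mem hI.nonempty hq _ hz, dirVec, Finset.smul_sum]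
  refine Finset.sum_congr rfl fun k hk => ?_
  rw [directionalMap_of_mem hk, smul_smul]

/-- For z_j > 0 the point lies on the graph itself. For z_j = 0 it is the limit of the points
belonging to z + δ e_j as δ > 0 tends to 0. -/
theorem mem_closure_directionGraph [Nonempty X] (D : AdaptedChart d R q) (hI : R.Next I)
    (hq : ∀ i ∈ I, q ∈ R.H i) (hR : R.Good d) {j : Fin d} {s : ℤˣ}
    (hjs : IsDirection D.B (coordSet D.e D.σ I) j s) {z : Euc d}
    (hz : directionalMap (coordSet D.e D.σ I) j s z ∈ D.O) (hzB : z ∈ cornerSet (insert j D.B)) :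
    (D.point R.ι (directionalMap (coordSet D.e D.σ I) j s z),
      ‖D.dirVec I j s z‖⁻¹ • D.dirVec I j s z) ∈ closure (R.directionGraph I) := by
  have hpos : ∀ z, directionalMap (coordSet D.e D.σ I) j s z ∈ D.O →
      z ∈ cornerSet (insert j D.B) → 0 < z j →
      (D.point R.ι (directionalMap (coordSet D.e D.σ I) j s z),
        ‖D.dirVec I j s z‖⁻¹ • D.dirVec I j s z) ∈ R.directionGraph I := by
    intro z hz hzB h0
    have hmem := directionalMap_mem_cornerSet hjs hzB
    have hι := D.fits.ι_point ⟨hz, hmem⟩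
    have hU : R.ι (D.point R.ι (directionalMap (coordSet D.e D.σ I) j s z)) ∈ D.U := by
      rw [hι]; exact D.fits.w_mem _ ⟨hz, hmem⟩
    have hb := D.b_eq I hI.not_mem _ hU
    rw [hι, D.fits.ξ_w _ ⟨hz, hmem⟩, D.β_directionalMap hI hq j s hz] at hb
    refine ⟨?_, ?_⟩
    · change R.b I (D.point R.ι _) ≠ 0
      rw [hb]
      exact smul_ne_zero h0.ne' (D.dirVec_ne_zero hI hq hjs.1 s hz)
    · change _ = ‖R.b I (D.point R.ι _)‖⁻¹ • R.b I (D.point R.ι _)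
      rw [hb, norm_smul, Real.norm_of_nonneg h0.le, smul_smul, mul_inv, mul_comm, ← mul_assoc,
        mul_inv_cancel₀ h0.ne', one_mul]
  let zδ : ℝ → Euc d := fun δ => z + δ • EuclideanSpace.single j (1 : ℝ)
  have hzδc : Continuous zδ := by fun_prop
  have hzδ0 : zδ 0 = z := by simp [zδ]
  have hzδB : ∀ δ > 0, zδ δ ∈ cornerSet (insert j D.B) ∧ 0 < zδ δ j := by
    intro δ hδ
    have hj0 := hzB j (mem_insert _ _)
    refine ⟨fun k hk => ?_, ?_⟩
    · have := hzB k hk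
      by_cases h : k = j
      · subst h; simp [zδ]; positivity
      · simpa [zδ, h] using this
    · simp [zδ]; positivity
  have hOopen : IsOpen (directionalMap (coordSet D.e D.σ I) j s ⁻¹' D.O) :=
    D.isOpen_O.preimage (contDiff_directionalMap _ j s).continuous
  have hev : ∀ᶠ δ in 𝓝[>] (0 : ℝ), directionalMap (coordSet D.e D.σ I) j s (zδ δ) ∈ D.O := by
    refine Filter.Eventually.filter_mono nhdsWithin_le_nhds ?_
    have h0 := hOopen.mem_nhds hz
    rw [← hzδ0] at h0
    exact hzδc.continuousAt.eventually_mem h0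
  have hlim : Filter.Tendsto zδ (𝓝[>] 0)
      (𝓝[directionalMap (coordSet D.e D.σ I) j s ⁻¹' D.O ∩ cornerSet (insert j D.B)] z) := by
    refine tendsto_nhdsWithin_iff.2 ⟨?_, ?_⟩
    · have := hzδc.tendsto 0
      rw [hzδ0] at this
      exact this.mono_left nhdsWithin_le_nhds
    · filter_upwards [hev, self_mem_nhdsWithin] with δ h1 h2 using ⟨h1, (hzδB δ h2).1⟩
  have h1 : ContinuousOn (fun z => D.point R.ι (directionalMap (coordSet D.e D.σ I) j s z))
      (directionalMap (coordSet D.e D.σ I) j s ⁻¹' D.O ∩ cornerSet (insert j D.B)) :=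
    (D.continuousOn_point hR.emb D.fits).comp
      (contDiff_directionalMap _ j s).continuous.continuousOn
      fun z hz => ⟨hz.1, directionalMap_mem_cornerSet hjs hz.2⟩
  have h2 : ContinuousOn (fun z => ‖D.dirVec I j s z‖⁻¹ • D.dirVec I j s z)
      (directionalMap (coordSet D.e D.σ I) j s ⁻¹' D.O ∩ cornerSet (insert j D.B)) :=
    (contDiffOn_snd.comp (D.dirParam hI hq hjs.1 s).smooth_w (mapsTo_univ _ _)).continuousOn.mono
      inter_subset_left
  have h3 := ((h1.prodMk h2) z ⟨hz, hzB⟩).tendsto.comp hlim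
  refine mem_closure_of_tendsto h3 ?_
  filter_upwards [hev, self_mem_nhdsWithin] with δ hδ1 hδ2
  exact hpos _ hδ1 (hzδB δ hδ2).1 (hzδB δ hδ2).2

/-- By `direction_spec`, a point of the closure has coordinates x_k = ‖b_I‖ c_k, where c_k are the
coefficients of its direction. Taking z_j = s x_j and v_k = c_k/(s c_j) recovers the point, because
x_k = z_j v_k for k in K. -/
theorem dirParam_fits (D : AdaptedChart d R q) (hI : R.Next I) (hq : q ∈ R.center I)
    (hR : R.Good d) {j : Fin d} {s : ℤˣ} (hjs : IsDirection D.B (coordSet D.e D.σ I) j s) :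
    (D.dirParam hI ((hR.mem_center_iff hI).1 hq) hjs.1 s).Fits (R.blow I).ι := by
  have hqI := (hR.mem_center_iff hI).1 hq
  have : Nonempty X := ⟨q⟩
  have hs := units_cast_mul_self s
  have hs0 : ((s : ℤ) : ℝ) ≠ 0 := fun h => by simp [h] at hs
  set K := coordSet D.e D.σ I with hK
  have hcz : ∀ z, directionalMap K j s z ∈ D.O → ∀ k ∈ K,
      coeff (D.A I k (directionalMap K j s z)) (‖D.dirVec I j s z‖⁻¹ • D.dirVec I j s z) =
        ‖D.dirVec I j s z‖⁻¹ * directionVec j s z k := by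
    intro z hz k hk
    rw [coeff_smul, dirVec, coeff_sum (D.A_ne I hI.not_mem hI.nonempty hqI _ hz)
        (D.A_orth I hI.not_mem hI.nonempty hqI _ hz) _ hk]
  have key : ∀ t : R.BlowCarrier I,
      (R.blow I).ι t ∈ (D.dirParam hI hqI hjs.1 s).U →
      directionalMap K j s ((D.dirParam hI hqI hjs.1 s).ξ ((R.blow I).ι t)) = D.ξ (R.ι t.1.1) ∧
      (D.dirParam hI hqI hjs.1 s).ξ ((R.blow I).ι t) ∈ cornerSet (insert j D.B) ∧
      ‖D.dirVec I j s ((D.dirParam hI hqI hjs.1 s).ξ ((R.blow I).ι t))‖⁻¹ •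
        D.dirVec I j s ((D.dirParam hI hqI hjs.1 s).ξ ((R.blow I).ι t)) = t.1.2 := by
    intro t ht
    have htU : R.ι (R.blowMap I t) ∈ D.U := ht.1.1.1
    obtain ⟨h1, h2, h3⟩ := hR.direction_spec hI hq D t htU
    have hmem := D.fits.ξ_mem _ htU
    set z := (D.dirParam hI hqI hjs.1 s).ξ ((R.blow I).ι t) with hzdef
    set cf : Fin d → ℝ := fun k => coeff (D.A I k (D.ξ (R.ι t.1.1))) t.1.2 with hcf
    have hc : 0 < ((s : ℤ) : ℝ) * cf j := ht.2
    have hzk : ∀ k, z k = if k = j then ((s : ℤ) : ℝ) * D.ξ (R.ι t.1.1) j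
      else if k ∈ K then cf k / (((s : ℤ) : ℝ) * cf j) else D.ξ (R.ι t.1.1) k := fun k => rfl
    have hv : ∀ k ∈ K, directionVec j s z k = (((s : ℤ) : ℝ) * cf j)⁻¹ * cf k := by
      intro k hk
      by_cases h : k = j
      · rw [directionVec, if_pos h, h, mul_inv, mul_assoc, inv_mul_cancel₀, mul_one]
        · exact eq_inv_of_mul_eq_one_left hs
        · rintro h0
          rw [h0, mul_zero] at hc
          exact hc.false
      · rw [directionVec, if_neg h, hzk, if_neg h, if_pos hk, div_eq_inv_mul]
    have hzj : z j = ((s : ℤ) : ℝ) * (‖R.b I t.1.1‖ * cf j) := by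
      rw [hzk, if_pos rfl, (h3 j hjs.1).2]
    have hdir : directionalMap K j s z = D.ξ (R.ι t.1.1) := by
      ext k
      by_cases hk : k ∈ K
      · rw [directionalMap_of_mem hk, hv k hk, hzj, (h3 k hk).2]
        calc _ = ‖R.b I t.1.1‖ * cf k * ((((s : ℤ) : ℝ) * cf j) * (((s : ℤ) : ℝ) * cf j)⁻¹) := by
              ring
          _ = _ := by rw [mul_inv_cancel₀ hc.ne', mul_one]
      · rw [directionalMap_of_not_mem hjs.1 hk, hzk, if_neg hk, if_neg]
        exact fun h => hk (h ▸ hjs.1)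
    -- `dirVec` is a positive multiple of the unit vector `t.1.2`, so its normalization gives this
    -- vector back.
    have hvec : D.dirVec I j s z = (((s : ℤ) : ℝ) * cf j)⁻¹ • t.1.2 := by
      conv_rhs => rw [h2]
      rw [dirVec, Finset.smul_sum]
      refine Finset.sum_congr rfl fun k hk => ?_
      rw [← hK, hdir, hv k hk, smul_smul]
    refine ⟨hdir, ?_, ?_⟩
    · intro k hk
      rw [hzk]
      by_cases h : k = j
      · rw [if_pos h, (h3 j hjs.1).2, mul_left_comm]
        exact mul_nonneg (norm_nonneg _) hc.le
      · have hkB : k ∈ D.B := (mem_insert_iff.1 hk).resolve_left h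
        rw [if_neg h]
        by_cases hkK : k ∈ K
        · rw [if_pos hkK]
          exact div_nonneg ((h3 k hkK).1 hkB) hc.le
        · rw [if_neg hkK]
          exact hmem.2 k hkB
    · rw [hvec, norm_smul, h1, mul_one, Real.norm_of_nonneg (inv_nonneg.2 hc.le), smul_smul,
        inv_inv, mul_inv_cancel₀ hc.ne', one_smul]
  refine ⟨?_, ?_, ?_, ?_, ?_⟩
  · rintro z ⟨hz, hzB⟩
    refine ⟨⟨_, D.mem_closure_directionGraph hI hqI hR hjs hz hzB⟩, ?_⟩
    exact Prod.ext (D.fits.ι_point ⟨hz, directionalMap_mem_cornerSet hjs hzB⟩) rfl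
  · rintro z ⟨hz, hzB⟩
    have hmem : directionalMap K j s z ∈ D.O ∩ cornerSet D.B :=
      ⟨hz, directionalMap_mem_cornerSet hjs hzB⟩
    refine ⟨⟨⟨D.fits.w_mem _ hmem, ?_⟩, mem_univ _⟩, ?_⟩
    · change D.ξ (D.w (directionalMap K j s z)) ∈ D.O
      rw [D.fits.ξ_w _ hmem]; exact hz
    · change 0 < ((s : ℤ) : ℝ) * coeff (D.A I j (D.ξ (D.w (directionalMap K j s z))))
        (‖D.dirVec I j s z‖⁻¹ • D.dirVec I j s z)
      rw [D.fits.ξ_w _ hmem, hcz z hz j hjs.1, directionVec, if_pos rfl, mul_left_comm, hs, mul_one]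
      exact inv_pos.2 (norm_pos_iff.2 (D.dirVec_ne_zero hI hqI hjs.1 s hz))
  · rintro z ⟨hz, hzB⟩
    have hmem : directionalMap K j s z ∈ D.O ∩ cornerSet D.B :=
      ⟨hz, directionalMap_mem_cornerSet hjs hzB⟩
    have hn : ‖D.dirVec I j s z‖⁻¹ ≠ 0 :=
      inv_ne_zero (norm_ne_zero_iff.2 (D.dirVec_ne_zero hI hqI hjs.1 s hz))
    ext k
    change (if k = j then ((s : ℤ) : ℝ) * D.ξ (D.w (directionalMap K j s z)) j
      else if k ∈ K then coeff (D.A I k (D.ξ (D.w (directionalMap K j s z))))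
        (‖D.dirVec I j s z‖⁻¹ • D.dirVec I j s z) /
        (((s : ℤ) : ℝ) * coeff (D.A I j (D.ξ (D.w (directionalMap K j s z))))
          (‖D.dirVec I j s z‖⁻¹ • D.dirVec I j s z))
      else D.ξ (D.w (directionalMap K j s z)) k) = z k
    rw [D.fits.ξ_w _ hmem]
    by_cases h1 : k = j
    · rw [if_pos h1, directionalMap_of_mem hjs.1, directionVec, if_pos rfl, h1,
        mul_left_comm, hs, mul_one]
    · rw [if_neg h1]
      by_cases h2 : k ∈ K
      · rw [if_pos h2, hcz z hz k h2, hcz z hz j hjs.1, directionVec, directionVec, if_neg h1,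
          if_pos rfl, mul_left_comm, hs, mul_one, mul_div_assoc, mul_comm,
          div_mul_cancel₀ _ hn]
      · rw [if_neg h2, directionalMap_of_not_mem hjs.1 h2]
  · intro t ht
    obtain ⟨h1, h2, -⟩ := key t ht
    refine ⟨?_, h2⟩
    change directionalMap K j s _ ∈ D.O
    rw [h1]
    exact (D.fits.ξ_mem _ ht.1.1.1).1
  · intro t ht
    obtain ⟨h1, -, h3⟩ := key t ht
    refine Prod.ext ?_ h3
    change D.w (directionalMap K j s _) = R.ι t.1.1
    rw [h1]
    exact D.fits.w_ξ _ ht.1.1.1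

end AdaptedChart

end BlowCharts

theorem directionVec_add_smul_single {d : ℕ} {j : Fin d} {s : ℤˣ} (z : Euc d) (δ : ℝ) (k : Fin d) :
    directionVec j s (z + δ • EuclideanSpace.single j (1 : ℝ)) k = directionVec j s z k := by
  by_cases h : k = j <;> simp [directionVec, h]

theorem directionVec_self_ne_zero {d : ℕ} {j : Fin d} {s : ℤˣ} (z : Euc d) : directionVec j s z j ≠ 0 := by
  rcases Int.units_eq_one_or s with rfl | rfl <;> simp [directionVec]

theorem mem_coordSet_left {c d : ℕ} (e : Fin d) (σ : Fin c → Fin d) (J : Finset (Fin c)) :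
    e ∈ coordSet e σ J := Finset.mem_insert_self _ _

theorem mem_coordSet_of_mem {c d : ℕ} (e : Fin d) (σ : Fin c → Fin d) {J : Finset (Fin c)}
    {i : Fin c} (hi : i ∈ J) : σ i ∈ coordSet e σ J :=
  Finset.mem_insert_of_mem (Finset.mem_image_of_mem _ hi)

/-! ### Strict transforms, and extension of the functions `b J` -/

namespace ResData

variable {c d : ℕ} {W X E : Type} [NormedAddCommGroup W] [InnerProductSpace ℝ W]
  [TopologicalSpace X] [NormedAddCommGroup E] [NormedSpace ℝ E]
  {R : ResData c W X E} {I : Finset (Fin c)} {q : X}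

/-- The carrier is the closure of a graph which does not meet the exceptional divisor. -/
theorem dense_compl_exceptional : Dense (R.blowMap I ⁻¹' R.center I)ᶜ := by
  intro t
  rw [closure_subtype]
  refine closure_mono ?_ t.2
  rintro g hg
  exact ⟨⟨g, subset_closure hg⟩, hg.1, rfl⟩

theorem mem_closure_preimage_iff {S : Set X} (hS : IsClosed S)
    {t : R.BlowCarrier I} (ht : R.blowMap I t ∉ R.center I) :
    t ∈ closure (R.blowMap I ⁻¹' (S \ R.center I)) ↔ R.blowMap I t ∈ S := by
  constructor
  · intro h
    exact hS.closure_subset_iff.2 sdiff_subset (continuous_blowMap.closure_preimage_subset _ h)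
  · intro h
    exact subset_closure ⟨h, ht⟩

theorem Good.emb_blow (hR : R.Good d) : Topology.IsEmbedding (R.blow I).ι :=
  (hR.emb.prodMap Topology.IsEmbedding.id).comp Topology.IsEmbedding.subtypeVal

/-- Since the complement of the exceptional divisor is dense, any continuous function that agrees
with the quotient off the divisor computes its extension. -/
theorem blow_b_of_subset {J : Finset (Fin c)} (hJ : J.Nonempty ∧ J ⊆ I) {t : R.BlowCarrier I}
    {F : R.BlowCarrier I → W} (hF : ContinuousAt F t)
    (h : ∀ᶠ t' in 𝓝 t, R.blowMap I t' ∉ R.center I →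
      ‖R.b I (R.blowMap I t')‖⁻¹ • R.b J (R.blowMap I t') = F t') : (R.blow I).b J t = F t := by
  change (if J.Nonempty ∧ J ⊆ I then _ else _ : R.BlowCarrier I → W) t = F t
  rw [if_pos hJ]
  refine extendFrom_eq (dense_compl_exceptional t) ?_
  refine (hF.tendsto.mono_left nhdsWithin_le_nhds).congr' ?_
  filter_upwards [self_mem_nhdsWithin, nhdsWithin_le_nhds h] with t' h1 h2 using (h2 h1).symm

theorem blow_b_of_not_subset {J : Finset (Fin c)} (hJ : ¬ (J.Nonempty ∧ J ⊆ I)) (t : R.BlowCarrier I) :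
    (R.blow I).b J t = R.b J (R.blowMap I t) := by
  change (if J.Nonempty ∧ J ⊆ I then _ else _ : R.BlowCarrier I → W) t = _
  rw [if_neg hJ]

theorem not_mem_of_not_mem_blow {J : Finset (Fin c)} (hJ : J ∉ (R.blow I).L) : J ∉ R.L :=
  fun h => hJ (mem_insert_of_mem I h)

theorem Good.continuous_blowMap_b (hR : R.Good d) (hI : R.Next I) :
    Continuous fun t => R.b I (R.blowMap I t) :=
  (hR.continuous_b hI.not_mem).comp continuous_blowMap

end ResData

/-! ### Adapted charts of the blown-up space -/

namespace AdaptedChart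

variable {c d : ℕ} {W X E : Type} [NormedAddCommGroup W] [InnerProductSpace ℝ W]
  [TopologicalSpace X] [NormedAddCommGroup E] [NormedSpace ℝ E]
  {R : ResData c W X E} {I : Finset (Fin c)} {q : X}

open Classical in
/-- The adapted chart of the blown-up space over an adapted chart at a point which does not belong
to the center. -/
def off (hR : R.Good d) (hI : R.Next I) (t : R.BlowCarrier I)
    (D : AdaptedChart d R (R.blowMap I t)) (ht : ¬ ∀ i ∈ I, R.blowMap I t ∈ R.H i) :
    AdaptedChart d (R.blow I) t :=
  have hoff : ∀ p : R.BlowCarrier I, (R.blow I).ι p ∈ D.U ×ˢ (univ : Set W) →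
      R.blowMap I p ∉ R.center I := by
    intro p hp h
    rw [hR.mem_center_iff hI] at h
    exact ht fun i hi => ((D.H_iff _ hp.1 i).1 (h i hi)).1
  have hβ := D.β_ne I hI.not_mem hI.nonempty ht
  have hn : ContDiffOn ℝ ∞ (fun y => ‖D.β I y‖⁻¹) D.O :=
    ((D.smooth_β I).norm ℝ hβ).inv fun y hy => norm_ne_zero_iff.2 (hβ y hy)
  have hn0 : ∀ y ∈ D.O, ‖D.β I y‖⁻¹ ≠ 0 := fun y hy => inv_ne_zero (norm_ne_zero_iff.2 (hβ y hy))
  have hH : ∀ p : R.BlowCarrier I, (R.blow I).ι p ∈ D.U ×ˢ (univ : Set W) →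
      ∀ i, p ∈ (R.blow I).H i ↔ R.blowMap I p ∈ R.H i := fun p hp i =>
    ResData.mem_closure_preimage_iff (hR.isClosed_H i) (hoff p hp)
  have hinit : ∀ p : R.BlowCarrier I, (R.blow I).ι p ∈ D.U ×ˢ (univ : Set W) →
      (p ∈ (R.blow I).init ↔ R.blowMap I p ∈ R.init) := fun p hp =>
    ResData.mem_closure_preimage_iff hR.isClosed_init (hoff p hp)
  have htU : (R.blow I).ι t ∈ D.U ×ˢ (univ : Set W) := ⟨D.mem, mem_univ _⟩
  have hsub : ∀ J : Finset (Fin c), (∀ i ∈ J, t ∈ (R.blow I).H i) ↔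
      ∀ i ∈ J, R.blowMap I t ∈ R.H i := fun J => by simp only [hH t htU]
  { toParam := D.offParam hI ht
    e := D.e
    σ := D.σ
    -- On this chart ‖β I‖ is smooth and nowhere zero, so that β and A are merely rescaled.
    β := fun J => if J.Nonempty ∧ J ⊆ I then fun y => ‖D.β I y‖⁻¹ • D.β J y else D.β J
    A := fun J k => if J.Nonempty ∧ J ⊆ I then fun y => ‖D.β I y‖⁻¹ • D.A J k y else D.A J k
    ϖ := D.ϖ
    fits := D.offParam_fits hI ht hR
    mem := htU
    smooth_ϖ := D.smooth_ϖ
    proj_eq := fun p hp => D.proj_eq _ hp.1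
    proj_eq_zero := fun p hp => D.proj_eq_zero _ hp.1
    e_mem := fun h => D.e_mem ((hinit t htU).1 h)
    init_iff := fun p hp => by
      rw [hinit p hp, hinit t htU]
      exact D.init_iff _ hp.1
    σ_not_mem := fun i hi => D.σ_not_mem i ((hH t htU i).1 hi)
    σ_inj := fun i i' hi hi' => D.σ_inj i i' ((hH t htU i).1 hi) ((hH t htU i').1 hi')
    H_iff := fun p hp i => by
      rw [hH p hp, hH t htU]
      exact D.H_iff _ hp.1 i
    smooth_β := fun J => by
      by_cases hJ : J.Nonempty ∧ J ⊆ I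
      · simp only [hJ, and_self, if_true]
        exact hn.smul (D.smooth_β J)
      · simp only [hJ, if_false]
        exact D.smooth_β J
    smooth_A := fun J k => by
      by_cases hJ : J.Nonempty ∧ J ⊆ I
      · simp only [hJ, and_self, if_true]
        exact hn.smul (D.smooth_A J k)
      · simp only [hJ, if_false]
        exact D.smooth_A J k
    b_eq := fun J hJL p hp => by
      have hJL' := ResData.not_mem_of_not_mem_blow hJL
      by_cases hJ : J.Nonempty ∧ J ⊆ I
      · simp only [hJ, and_self, if_true]
        change _ = ‖D.β I (D.ξ (R.ι (R.blowMap I p)))‖⁻¹ • D.β J (D.ξ (R.ι (R.blowMap I p)))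
        rw [← D.b_eq J hJL' (R.blowMap I p) hp.1, ← D.b_eq I hI.not_mem (R.blowMap I p) hp.1]
        refine ResData.blow_b_of_subset hJ
          (F := fun p => ‖R.b I (R.blowMap I p)‖⁻¹ • R.b J (R.blowMap I p)) ?_
          (Filter.Eventually.of_forall fun _ _ => rfl)
        refine ContinuousAt.smul (ContinuousAt.inv₀ ?_ ?_) ?_
        · exact (hR.continuous_blowMap_b hI).norm.continuousAt
        · exact norm_ne_zero_iff.2 (hoff p hp)
        · exact ((hR.continuous_b hJL').comp ResData.continuous_blowMap).continuousAt
      · simp only [hJ, if_false]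
        rw [ResData.blow_b_of_not_subset hJ]
        exact D.b_eq J hJL' _ hp.1
    β_eq := fun J hJL hJ0 hJt y hy => by
      have h := D.β_eq J (ResData.not_mem_of_not_mem_blow hJL) hJ0 ((hsub J).1 hJt) y hy
      by_cases hJ : J.Nonempty ∧ J ⊆ I
      · simp only [hJ, and_self, if_true]
        rw [h, Finset.smul_sum]
        exact Finset.sum_congr rfl fun k _ => smul_comm _ _ _
      · simp only [hJ, if_false]
        exact h
    A_orth := fun J hJL hJ0 hJt y hy k hk l hl hkl => by
      have h := D.A_orth J (ResData.not_mem_of_not_mem_blow hJL) hJ0 ((hsub J).1 hJt) y hy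
        k hk l hl hkl
      by_cases hJ : J.Nonempty ∧ J ⊆ I
      · simp only [hJ, and_self, if_true]
        rw [inner_smul_left, inner_smul_right, h, mul_zero, mul_zero]
      · simp only [hJ, if_false]
        exact h
    A_ne := fun J hJL hJ0 hJt y hy k hk => by
      have h := D.A_ne J (ResData.not_mem_of_not_mem_blow hJL) hJ0 ((hsub J).1 hJt) y hy k hk
      by_cases hJ : J.Nonempty ∧ J ⊆ I
      · simp only [hJ, and_self, if_true]
        exact smul_ne_zero (hn0 y hy) h
      · simp only [hJ, if_false]
        exact h
    β_ne := fun J hJL hJ0 hJt y hy => by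
      have h := D.β_ne J (ResData.not_mem_of_not_mem_blow hJL) hJ0 (fun h => hJt ((hsub J).2 h)) y hy
      by_cases hJ : J.Nonempty ∧ J ⊆ I
      · simp only [hJ, and_self, if_true]
        exact smul_ne_zero (hn0 y hy) h
      · simp only [hJ, if_false]
        exact h }

/-! Properties of the parametrizations in the direction `(j, s)`. -/

section Dir

variable (D : AdaptedChart d R q) (hI : R.Next I) (hq : q ∈ R.center I) (hqI : ∀ i ∈ I, q ∈ R.H i)
  (hR : R.Good d)
  {j : Fin d} {s : ℤˣ} (hjs : IsDirection D.B (coordSet D.e D.σ I) j s)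

include hR hq in
theorem directionalMap_coord {p : R.BlowCarrier I}
    (hp : (R.blow I).ι p ∈ (D.dirParam hI hqI hjs.1 s).U) :
    directionalMap (coordSet D.e D.σ I) j s ((D.dirParam hI hqI hjs.1 s).ξ ((R.blow I).ι p)) =
      D.ξ (R.ι (R.blowMap I p)) := by
  have hf := D.dirParam_fits hI hq hR hjs
  have h1 := hf.ξ_mem p hp
  have h2 : D.w (directionalMap (coordSet D.e D.σ I) j s
    ((D.dirParam hI hqI hjs.1 s).ξ ((R.blow I).ι p))) = R.ι (R.blowMap I p) :=
    congrArg Prod.fst (hf.w_ξ p hp)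
  rw [← h2, D.fits.ξ_w _ ⟨h1.1, directionalMap_mem_cornerSet hjs h1.2⟩]

include hR hq in
theorem b_eq_smul_dirVec {p : R.BlowCarrier I}
    (hp : (R.blow I).ι p ∈ (D.dirParam hI hqI hjs.1 s).U) :
    R.b I (R.blowMap I p) = (D.dirParam hI hqI hjs.1 s).ξ ((R.blow I).ι p) j •
      D.dirVec I j s ((D.dirParam hI hqI hjs.1 s).ξ ((R.blow I).ι p)) := by
  have h1 := (D.dirParam_fits hI hq hR hjs).ξ_mem p hp
  rw [D.b_eq I hI.not_mem (R.blowMap I p) hp.1.1.1, ← D.β_directionalMap hI hqI j s h1.1,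
    D.directionalMap_coord hI hq hqI hR hjs hp]

include hR hq in
-- `b I` is z_j times the nonvanishing vector `dirVec`; thus the exceptional divisor is z_j = 0.
theorem mem_center_iff_coord_eq_zero {p : R.BlowCarrier I}
    (hp : (R.blow I).ι p ∈ (D.dirParam hI hqI hjs.1 s).U) :
    R.blowMap I p ∈ R.center I ↔ (D.dirParam hI hqI hjs.1 s).ξ ((R.blow I).ι p) j = 0 := by
  have h1 := (D.dirParam_fits hI hq hR hjs).ξ_mem p hp
  change R.b I _ = 0 ↔ _
  rw [D.b_eq_smul_dirVec hI hq hqI hR hjs hp, smul_eq_zero]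
  exact or_iff_left (D.dirVec_ne_zero hI hqI hjs.1 s h1.1)

include hR hq in
-- Computes strict transforms in coordinates. A point of Q with z_j = 0 is approached within Q by
-- increasing z_j, because Q is invariant under translations along the j-axis; the other inclusion
-- uses that Q is closed.
theorem mem_closure_iff_of_dirParam {S : Set X} {Q : Set (Euc d)} (hQ : IsClosed Q)
    (hinv : ∀ z ∈ Q, ∀ δ : ℝ, z + δ • EuclideanSpace.single j (1 : ℝ) ∈ Q)
    (h : ∀ p : R.BlowCarrier I, (R.blow I).ι p ∈ (D.dirParam hI hqI hjs.1 s).U →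
      R.blowMap I p ∉ R.center I →
      (R.blowMap I p ∈ S ↔ (D.dirParam hI hqI hjs.1 s).ξ ((R.blow I).ι p) ∈ Q))
    {p : R.BlowCarrier I} (hp : (R.blow I).ι p ∈ (D.dirParam hI hqI hjs.1 s).U) :
    p ∈ closure (R.blowMap I ⁻¹' (S \ R.center I)) ↔
      (D.dirParam hI hqI hjs.1 s).ξ ((R.blow I).ι p) ∈ Q := by
  have hf := D.dirParam_fits hI hq hR hjs
  set P := D.dirParam hI hqI hjs.1 s with hP
  have hemb := hR.emb_blow (I := I)
  have hnhds := (P.isOpen_U.preimage hemb.continuous).mem_nhds hp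
  constructor
  · intro hpc
    refine mem_of_mem_closure_of_eventually hpc (F := fun p => P.ξ ((R.blow I).ι p))
      ((P.continuousOn_coord hemb.continuous).continuousAt hnhds) hQ ?_
    filter_upwards [self_mem_nhdsWithin, nhdsWithin_le_nhds hnhds] with g hg1 hg2
    exact (h g hg2 hg1.2).1 hg1.1
  · intro hpQ
    have : Nonempty (R.BlowCarrier I) := ⟨p⟩
    set z := P.ξ ((R.blow I).ι p) with hz
    have hzm := hf.ξ_mem p hp
    let zδ : ℝ → Euc d := fun δ => z + δ • EuclideanSpace.single j (1 : ℝ)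
    have hzδc : Continuous zδ := by fun_prop
    have hzδ0 : zδ 0 = z := by simp [zδ]
    have hzδB : ∀ δ > 0, zδ δ ∈ cornerSet P.B ∧ 0 < zδ δ j := by
      intro δ hδ
      have hj0 := hzm.2 j (mem_insert _ _)
      refine ⟨fun k hk => ?_, ?_⟩
      · have := hzm.2 k hk
        by_cases h : k = j
        · subst h; simp [zδ]; positivity
        · simpa [zδ, h] using this
      · simp [zδ]; positivity
    have hev : ∀ᶠ δ in 𝓝[>] (0 : ℝ), zδ δ ∈ P.O := by
      refine Filter.Eventually.filter_mono nhdsWithin_le_nhds ?_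
      have h0 := P.isOpen_O.mem_nhds hzm.1
      change P.O ∈ 𝓝 z at h0
      rw [← hzδ0] at h0
      exact hzδc.continuousAt.eventually_mem h0
    have hlim : Filter.Tendsto zδ (𝓝[>] 0) (𝓝[P.O ∩ cornerSet P.B] z) := by
      refine tendsto_nhdsWithin_iff.2 ⟨?_, ?_⟩
      · have := hzδc.tendsto 0
        rw [hzδ0] at this
        exact this.mono_left nhdsWithin_le_nhds
      · filter_upwards [hev, self_mem_nhdsWithin] with δ h1 h2 using ⟨h1, (hzδB δ h2).1⟩
    have h3 := ((P.continuousOn_point hemb hf) z hzm).tendsto.comp hlim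
    rw [hz, hf.point_ξ hemb.injective hp] at h3
    refine mem_closure_of_tendsto h3 ?_
    filter_upwards [hev, self_mem_nhdsWithin] with δ hδ1 hδ2
    have hm : zδ δ ∈ P.O ∩ cornerSet P.B := ⟨hδ1, (hzδB δ hδ2).1⟩
    have hU : (R.blow I).ι (P.point (R.blow I).ι (zδ δ)) ∈ P.U := by
      rw [hf.ι_point hm]; exact hf.w_mem _ hm
    have hξ : P.ξ ((R.blow I).ι (P.point (R.blow I).ι (zδ δ))) = zδ δ := by
      rw [hf.ι_point hm, hf.ξ_w _ hm]
    have hC : R.blowMap I (P.point (R.blow I).ι (zδ δ)) ∉ R.center I := by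
      rw [D.mem_center_iff_coord_eq_zero hI hq hqI hR hjs hU, ← hP, hξ]
      exact (hzδB δ hδ2).2.ne'
    refine ⟨(h _ hU hC).2 ?_, hC⟩
    rw [hξ]
    exact hinv z hpQ δ

include hR hq in
-- One has x_e = z_j v_e, and z_j ≠ 0 off the exceptional divisor. If j = e then v_e = ±1, and the
-- strict transform is absent from the chart.
theorem mem_blow_init_iff {p : R.BlowCarrier I}
    (hp : (R.blow I).ι p ∈ (D.dirParam hI hqI hjs.1 s).U) :
    p ∈ (R.blow I).init ↔
      directionVec j s ((D.dirParam hI hqI hjs.1 s).ξ ((R.blow I).ι p)) D.e = 0 := by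
  refine D.mem_closure_iff_of_dirParam hI hq hqI hR hjs (S := R.init)
    (Q := {z | directionVec j s z D.e = 0})
    (isClosed_eq (contDiff_directionVec j s _).continuous continuous_const) ?_ ?_ hp
  · intro z hz δ
    exact (directionVec_add_smul_single z δ D.e).trans hz
  · intro p hp hC
    rw [D.mem_center_iff_coord_eq_zero hI hq hqI hR hjs hp] at hC
    obtain ⟨i, hi⟩ := hI.nonempty
    rw [D.init_iff (R.blowMap I p) hp.1.1.1, ← D.directionalMap_coord hI hq hqI hR hjs hp,
      directionalMap_of_mem (mem_coordSet_left _ _ _), mul_eq_zero, or_iff_right hC]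
    exact and_iff_right (hR.H_subset i (hqI i hi))

include hR hq in
-- The same computation for x_e and x_{σ i}. Components outside I do not pass through `q`, and so
-- they miss the chart altogether.
theorem mem_blow_H_iff {p : R.BlowCarrier I}
    (hp : (R.blow I).ι p ∈ (D.dirParam hI hqI hjs.1 s).U) (i : Fin c) :
    p ∈ (R.blow I).H i ↔ i ∈ I ∧
      directionVec j s ((D.dirParam hI hqI hjs.1 s).ξ ((R.blow I).ι p)) D.e = 0 ∧
      directionVec j s ((D.dirParam hI hqI hjs.1 s).ξ ((R.blow I).ι p)) (D.σ i) = 0 := by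
  refine D.mem_closure_iff_of_dirParam hI hq hqI hR hjs (S := R.H i)
    (Q := {z | i ∈ I ∧ directionVec j s z D.e = 0 ∧ directionVec j s z (D.σ i) = 0}) ?_ ?_ ?_ hp
  · by_cases hi : i ∈ I
    · simp only [hi, true_and]
      exact (isClosed_eq (contDiff_directionVec j s _).continuous continuous_const).inter
        (isClosed_eq (contDiff_directionVec j s _).continuous continuous_const)
    · simp [hi]
  · rintro z ⟨h1, h2, h3⟩ δ
    exact ⟨h1, (directionVec_add_smul_single z δ _).trans h2,
      (directionVec_add_smul_single z δ _).trans h3⟩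
  · intro p hp hC
    rw [D.mem_center_iff_coord_eq_zero hI hq hqI hR hjs hp] at hC
    rw [D.H_iff (R.blowMap I p) hp.1.1.1, ← D.directionalMap_coord hI hq hqI hR hjs hp,
      ← hR.mem_iff_of_mem_center hI hq i]
    refine and_congr_right fun hi => ?_
    rw [directionalMap_of_mem (mem_coordSet_left _ _ _), directionalMap_of_mem
      (mem_coordSet_of_mem _ _ hi), mul_eq_zero, or_iff_right hC,
      mul_eq_zero, or_iff_right hC]

end Dir

end AdaptedChart

theorem coordSet_mono {c d : ℕ} (e : Fin d) (σ : Fin c → Fin d) {J J' : Finset (Fin c)}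
    (h : J ⊆ J') : coordSet e σ J ⊆ coordSet e σ J' :=
  Finset.insert_subset_insert _ (Finset.image_subset_image h)

theorem forall_mem_coordSet {c d : ℕ} {e : Fin d} {σ : Fin c → Fin d} {J : Finset (Fin c)}
    {P : Fin d → Prop} : (∀ k ∈ coordSet e σ J, P k) ↔ P e ∧ ∀ i ∈ J, P (σ i) := by
  simp [coordSet]

theorem eq_of_directionVec_eq_zero {d : ℕ} {j : Fin d} {s : ℤˣ} {z : Euc d} {k : Fin d}
    (h : directionVec j s z k = 0) : k ≠ j ∧ z k = 0 := by
  by_cases hk : k = j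
  · subst hk
    exact absurd h (directionVec_self_ne_zero z)
  · exact ⟨hk, by simpa [directionVec, hk] using h⟩

theorem directionVec_of_ne {d : ℕ} {j : Fin d} {s : ℤˣ} {z : Euc d} {k : Fin d} (h : k ≠ j) :
    directionVec j s z k = z k := if_neg h

/-- The coordinates `z` all of whose directions `v_k` are nonzero if they are nonzero at `z₀`. -/
def directionRegion {d : ℕ} (K : Finset (Fin d)) (j : Fin d) (s : ℤˣ) (z₀ : Euc d) : Set (Euc d) :=
  {z | ∀ k ∈ K, directionVec j s z₀ k ≠ 0 → directionVec j s z k ≠ 0}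

theorem isOpen_directionRegion {d : ℕ} (K : Finset (Fin d)) (j : Fin d) (s : ℤˣ) (z₀ : Euc d) :
    IsOpen (directionRegion K j s z₀) := by
  have : directionRegion K j s z₀ =
      ⋂ k ∈ K, {z | directionVec j s z₀ k ≠ 0 → directionVec j s z k ≠ 0} := by
    ext z; simp [directionRegion]
  rw [this]
  refine isOpen_biInter_finset fun k _ => ?_
  by_cases h : directionVec j s z₀ k = 0
  · simp [h]
  · simp only [ne_eq, h, not_false_eq_true, true_imp_iff]
    exact isOpen_ne_fun (contDiff_directionVec j s k).continuous continuous_const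

namespace AdaptedChart

variable {c d : ℕ} {W X E : Type} [NormedAddCommGroup W] [InnerProductSpace ℝ W]
  [TopologicalSpace X] [NormedAddCommGroup E] [NormedSpace ℝ E]
  {R : ResData c W X E} {I : Finset (Fin c)}

/-- The directions that are defined over an adapted chart at a point of the center. -/
theorem exists_mem_dirParam {q : X} (D : AdaptedChart d R q) (hI : R.Next I)
    (hqI : ∀ i ∈ I, q ∈ R.H i) (hR : R.Good d) (t : R.BlowCarrier I)
    (ht : R.ι (R.blowMap I t) ∈ D.U) :
    ∃ j s, ∃ h : IsDirection D.B (coordSet D.e D.σ I) j s,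
      (R.blow I).ι t ∈ (D.dirParam hI hqI h.1 s).U := by
  obtain ⟨h1, h2, h3⟩ := hR.direction_spec hI ((hR.mem_center_iff hI).2 hqI) D t ht
  obtain ⟨j, hj, hne⟩ : ∃ j ∈ coordSet D.e D.σ I, coeff (D.A I j (D.ξ (R.ι t.1.1))) t.1.2 ≠ 0 := by
    by_contra! h
    rw [Finset.sum_eq_zero fun k hk => by rw [h k hk, zero_smul]] at h2
    rw [h2, norm_zero] at h1
    exact zero_ne_one h1
  have hmem : (R.blow I).ι t ∈ (D.U ∩ D.ξ ⁻¹' D.O) ×ˢ (univ : Set W) :=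
    ⟨⟨ht, (D.fits.ξ_mem _ ht).1⟩, mem_univ _⟩
  rcases lt_or_gt_of_ne hne with h | h
  · refine ⟨j, -1, ⟨hj, fun hB => absurd ((h3 j hj).1 hB) (not_le.2 h)⟩, hmem, ?_⟩
    change 0 < (((-1 : ℤˣ) : ℤ) : ℝ) * coeff (D.A I j (D.ξ (R.ι t.1.1))) t.1.2
    simpa using h
  · refine ⟨j, 1, ⟨hj, fun _ => rfl⟩, hmem, ?_⟩
    change 0 < (((1 : ℤˣ) : ℤ) : ℝ) * coeff (D.A I j (D.ξ (R.ι t.1.1))) t.1.2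
    simpa using h

/-- The linear combination of the coefficient vectors of `J` in the direction given by `z`. -/
def subVec {q : X} (D : AdaptedChart d R q) (I J : Finset (Fin c)) (j : Fin d) (s : ℤˣ)
    (z : Euc d) : W :=
  ∑ k ∈ coordSet D.e D.σ J, directionVec j s z k • D.A J k (directionalMap (coordSet D.e D.σ I) j s z)

theorem smooth_subVec {q : X} (D : AdaptedChart d R q) (J : Finset (Fin c)) (j : Fin d) (s : ℤˣ) :
    ContDiffOn ℝ ∞ (D.subVec I J j s) (directionalMap (coordSet D.e D.σ I) j s ⁻¹' D.O) := by
  refine ContDiffOn.sum fun k _ => (contDiff_directionVec j s k).contDiffOn.smul ?_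
  exact (D.smooth_A J k).comp (contDiff_directionalMap _ j s).contDiffOn fun _ h => h

theorem b_eq_smul_subVec {q : X} (D : AdaptedChart d R q) (hI : R.Next I) (hq : q ∈ R.center I)
    (hqI : ∀ i ∈ I, q ∈ R.H i) (hR : R.Good d) {j : Fin d} {s : ℤˣ}
    (hjs : IsDirection D.B (coordSet D.e D.σ I) j s) {J : Finset (Fin c)} (hJL : J ∉ R.L)
    (hJ : J.Nonempty) (hJI : J ⊆ I) {p : R.BlowCarrier I}
    (hp : (R.blow I).ι p ∈ (D.dirParam hI hqI hjs.1 s).U) :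
    R.b J (R.blowMap I p) = (D.dirParam hI hqI hjs.1 s).ξ ((R.blow I).ι p) j •
      D.subVec I J j s ((D.dirParam hI hqI hjs.1 s).ξ ((R.blow I).ι p)) := by
  have h1 := (D.dirParam_fits hI hq hR hjs).ξ_mem p hp
  rw [D.b_eq J hJL (R.blowMap I p) hp.1.1.1, ← D.directionalMap_coord hI hq hqI hR hjs hp,
    D.β_eq J hJL hJ (fun i hi => hqI i (hJI hi)) _ h1.1, subVec, Finset.smul_sum]
  refine Finset.sum_congr rfl fun k hk => ?_
  rw [directionalMap_of_mem (coordSet_mono _ _ hJI hk), smul_smul]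

open Classical in
/-- The adapted chart of the blown-up space in the direction `(j, s)` over an adapted chart at a
point of the center. -/
def dir (hR : R.Good d) (hI : R.Next I) (t : R.BlowCarrier I)
    (D : AdaptedChart d R (R.blowMap I t)) (hq : R.blowMap I t ∈ R.center I)
    (hqI : ∀ i ∈ I, R.blowMap I t ∈ R.H i)
    {j : Fin d} {s : ℤˣ} (hjs : IsDirection D.B (coordSet D.e D.σ I) j s)
    (ht : (R.blow I).ι t ∈ (D.dirParam hI hqI hjs.1 s).U) :
    AdaptedChart d (R.blow I) t :=
  have heB : D.e ∈ D.B := by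
    obtain ⟨i, hi⟩ := hI.nonempty
    exact D.e_mem (hR.H_subset i (hqI i hi))
  have hf := D.dirParam_fits hI hq hR hjs
  have hv0 : ∀ z : Euc d, directionVec j s z j ≠ 0 := directionVec_self_ne_zero
  have hd0 : ∀ z ∈ directionalMap (coordSet D.e D.σ I) j s ⁻¹' D.O, D.dirVec I j s z ≠ 0 :=
    fun z hz => D.dirVec_ne_zero hI hqI hjs.1 s hz
  have hn : ContDiffOn ℝ ∞ (fun z => ‖D.dirVec I j s z‖⁻¹)
      (directionalMap (coordSet D.e D.σ I) j s ⁻¹' D.O) :=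
    ((D.smooth_dirVec j s).norm ℝ hd0).inv fun y hy => norm_ne_zero_iff.2 (hd0 y hy)
  have hn0 : ∀ z ∈ directionalMap (coordSet D.e D.σ I) j s ⁻¹' D.O, ‖D.dirVec I j s z‖⁻¹ ≠ 0 :=
    fun y hy => inv_ne_zero (norm_ne_zero_iff.2 (hd0 y hy))
  have hiff : ∀ i, R.blowMap I t ∈ R.H i ↔ i ∈ I := fun i => (hR.mem_iff_of_mem_center hI hq i).symm
  have hH := fun i => D.mem_blow_H_iff hI hq hqI hR hjs ht i
  have hinit := D.mem_blow_init_iff hI hq hqI hR hjs ht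
  have hsub : ∀ {J : Finset (Fin c)}, J.Nonempty → (∀ i ∈ J, t ∈ (R.blow I).H i) →
      (J ⊆ I) ∧ ∀ k ∈ coordSet D.e D.σ J,
        directionVec j s ((D.dirParam hI hqI hjs.1 s).ξ ((R.blow I).ι t)) k = 0 := by
    rintro J ⟨i₀, hi₀⟩ h
    refine ⟨fun i hi => ((hH i).1 (h i hi)).1, ?_⟩
    rw [forall_mem_coordSet]
    exact ⟨((hH i₀).1 (h i₀ hi₀)).2.1, fun i hi => ((hH i).1 (h i hi)).2.2⟩
  have hreg : ∀ z ∈ directionRegion (coordSet D.e D.σ I) j s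
      ((D.dirParam hI hqI hjs.1 s).ξ ((R.blow I).ι t)), ∀ k ∈ coordSet D.e D.σ I,
      directionVec j s z k = 0 ↔
        directionVec j s ((D.dirParam hI hqI hjs.1 s).ξ ((R.blow I).ι t)) k = 0 ∧ z k = 0 := by
    intro z hz k hk
    constructor
    · intro h
      exact ⟨by_contra fun h' => hz k hk h' h, (eq_of_directionVec_eq_zero h).2⟩
    · rintro ⟨h1, h2⟩
      rw [directionVec_of_ne (eq_of_directionVec_eq_zero h1).1, h2]
  -- In the restricted region, directions that are nonzero at `t` remain nonzero. This makes the
  -- description of the components through `t`, and the nonvanishing of β, valid on the whole chart.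
  { toParam := (D.dirParam hI hqI hjs.1 s).restrict (directionRegion (coordSet D.e D.σ I) j s
      ((D.dirParam hI hqI hjs.1 s).ξ ((R.blow I).ι t))) (isOpen_directionRegion _ _ _ _)
    e := D.e
    σ := D.σ
    β := fun J => if J.Nonempty ∧ J ⊆ I then fun z => ‖D.dirVec I j s z‖⁻¹ • D.subVec I J j s z
      else fun z => D.β J (directionalMap (coordSet D.e D.σ I) j s z)
    A := fun J k => if J.Nonempty ∧ J ⊆ I then fun z =>
        ‖D.dirVec I j s z‖⁻¹ • D.A J k (directionalMap (coordSet D.e D.σ I) j s z)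
      else fun z => D.A J k (directionalMap (coordSet D.e D.σ I) j s z)
    ϖ := fun z => D.ϖ (directionalMap (coordSet D.e D.σ I) j s z)
    fits := hf.restrict _
    mem := ⟨ht, fun k _ h => h⟩
    smooth_ϖ := D.smooth_ϖ.comp (contDiff_directionalMap _ j s).contDiffOn fun z hz => hz.1
    proj_eq := fun p hp => by
      change R.proj (R.blowMap I p) =
        D.ϖ (directionalMap _ j s ((D.dirParam hI hqI hjs.1 s).ξ ((R.blow I).ι p)))
      rw [D.directionalMap_coord hI hq hqI hR hjs hp.1]
      exact D.proj_eq _ hp.1.1.1.1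
    proj_eq_zero := fun p hp => by
      have h1 := D.proj_eq_zero (R.blowMap I p) hp.1.1.1.1
      rw [← D.directionalMap_coord hI hq hqI hR hjs hp.1] at h1
      refine Iff.trans h1 ?_
      change _ ↔ ∃ i ∈ insert j D.B, (D.dirParam hI hqI hjs.1 s).ξ ((R.blow I).ι p) i = 0
      set z := (D.dirParam hI hqI hjs.1 s).ξ ((R.blow I).ι p)
      constructor
      · rintro ⟨i, hi, h⟩
        by_cases hK : i ∈ coordSet D.e D.σ I
        · rw [directionalMap_of_mem hK, mul_eq_zero] at h
          rcases h with h | h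
          · exact ⟨j, mem_insert _ _, h⟩
          · exact ⟨i, mem_insert_of_mem _ hi, (eq_of_directionVec_eq_zero h).2⟩
        · rw [directionalMap_of_not_mem hjs.1 hK] at h
          exact ⟨i, mem_insert_of_mem _ hi, h⟩
      · rintro ⟨i, hi, h⟩
        by_cases hij : i = j
        -- If z_j = 0 then the old boundary coordinate x_e = z_j v_e vanishes, even when j itself
        -- was a free coordinate.
        · refine ⟨D.e, heB, ?_⟩
          rw [directionalMap_of_mem (mem_coordSet_left _ _ _), ← hij, h, zero_mul]
        · refine ⟨i, (mem_insert_iff.1 hi).resolve_left hij, ?_⟩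
          by_cases hK : i ∈ coordSet D.e D.σ I
          · rw [directionalMap_of_mem hK, directionVec_of_ne hij, h, mul_zero]
          · rw [directionalMap_of_not_mem hjs.1 hK, h]
    e_mem := fun _ => mem_insert_of_mem _ heB
    init_iff := fun p hp => by
      rw [D.mem_blow_init_iff hI hq hqI hR hjs hp.1, hinit]
      exact hreg _ hp.2 _ (mem_coordSet_left _ _ _)
    σ_not_mem := fun i hi => by
      obtain ⟨h1, h2, h3⟩ := (hH i).1 hi
      rintro h
      rcases mem_insert_iff.1 h with h | h
      · exact (eq_of_directionVec_eq_zero h3).1 h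
      · exact D.σ_not_mem i (hqI i h1) h
    σ_inj := fun i i' hi hi' => D.σ_inj i i' (hqI i ((hH i).1 hi).1) (hqI i' ((hH i').1 hi').1)
    H_iff := fun p hp i => by
      rw [D.mem_blow_H_iff hI hq hqI hR hjs hp.1, hH]
      constructor
      · rintro ⟨h1, h2, h3⟩
        rw [hreg _ hp.2 _ (mem_coordSet_left _ _ _)] at h2
        rw [hreg _ hp.2 _ (mem_coordSet_of_mem _ _ h1)] at h3
        exact ⟨⟨h1, h2.1, h3.1⟩, h2.2, h3.2⟩
      · rintro ⟨⟨h1, h2, h3⟩, h4, h5⟩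
        exact ⟨h1, (hreg _ hp.2 _ (mem_coordSet_left _ _ _)).2 ⟨h2, h4⟩,
          (hreg _ hp.2 _ (mem_coordSet_of_mem _ _ h1)).2 ⟨h3, h5⟩⟩
    smooth_β := fun J => by
      by_cases hJ : J.Nonempty ∧ J ⊆ I
      · simp only [hJ, and_self, if_true]
        exact (hn.smul (D.smooth_subVec J j s)).mono fun z hz => hz.1
      · simp only [hJ, if_false]
        exact (D.smooth_β J).comp (contDiff_directionalMap _ j s).contDiffOn fun z hz => hz.1
    smooth_A := fun J k => by
      have h := (D.smooth_A J k).comp (t := D.O) (s := directionalMap (coordSet D.e D.σ I) j s ⁻¹' D.O)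
        (contDiff_directionalMap (coordSet D.e D.σ I) j s).contDiffOn fun z hz => hz
      by_cases hJ : J.Nonempty ∧ J ⊆ I
      · simp only [hJ, and_self, if_true]
        exact (hn.smul h).mono fun z hz => hz.1
      · simp only [hJ, if_false]
        exact h.mono fun z hz => hz.1
    b_eq := fun J hJL p hp => by
      have hJL' := ResData.not_mem_of_not_mem_blow hJL
      by_cases hJ : J.Nonempty ∧ J ⊆ I
      · simp only [hJ, and_self, if_true]
        have hnhds := ((D.dirParam hI hqI hjs.1 s).isOpen_U.preimage
          (hR.emb_blow (I := I)).continuous).mem_nhds hp.1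
        have hm := hf.ξ_mem p hp.1
        refine ResData.blow_b_of_subset hJ (F := fun p =>
          ‖D.dirVec I j s ((D.dirParam hI hqI hjs.1 s).ξ ((R.blow I).ι p))‖⁻¹ •
            D.subVec I J j s ((D.dirParam hI hqI hjs.1 s).ξ ((R.blow I).ι p))) ?_ ?_
        · refine ContinuousAt.comp (g := fun z => ‖D.dirVec I j s z‖⁻¹ • D.subVec I J j s z)
            (f := fun p => (D.dirParam hI hqI hjs.1 s).ξ ((R.blow I).ι p)) ?_ ?_
          · exact (hn.smul (D.smooth_subVec J j s)).continuousOn.continuousAt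
              ((D.dirParam hI hqI hjs.1 s).isOpen_O.mem_nhds hm.1)
          · exact ((D.dirParam hI hqI hjs.1 s).continuousOn_coord
              hR.emb_blow.continuous).continuousAt hnhds
        -- The factor z_j > 0 cancels in the quotient of b_J = z_j `subVec` by ‖b_I‖ = z_j
        -- ‖`dirVec`‖.
        · filter_upwards [hnhds] with p' hp' hC
          rw [D.mem_center_iff_coord_eq_zero hI hq hqI hR hjs hp'] at hC
          have h0 := (hf.ξ_mem p' hp').2 j (mem_insert _ _)
          rw [D.b_eq_smul_subVec hI hq hqI hR hjs hJL' hJ.1 hJ.2 hp',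
            D.b_eq_smul_dirVec hI hq hqI hR hjs hp', norm_smul, Real.norm_of_nonneg h0, smul_smul,
            mul_inv, mul_right_comm, inv_mul_cancel₀ hC, one_mul]
      · simp only [hJ, if_false]
        rw [ResData.blow_b_of_not_subset hJ]
        change _ = D.β J
          (directionalMap _ j s ((D.dirParam hI hqI hjs.1 s).ξ ((R.blow I).ι p)))
        rw [D.directionalMap_coord hI hq hqI hR hjs hp.1]
        exact D.b_eq J hJL' _ hp.1.1.1.1
    β_eq := fun J hJL hJ0 hJt z hz => by
      obtain ⟨h1, h2⟩ := hsub hJ0 hJt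
      have hJ : J.Nonempty ∧ J ⊆ I := ⟨hJ0, h1⟩
      simp only [hJ, and_self, if_true, subVec, Finset.smul_sum]
      refine Finset.sum_congr rfl fun k hk => ?_
      -- An index whose direction vanishes at `t` differs from j, so that v_k is the coordinate z_k
      -- itself.
      rw [directionVec_of_ne (eq_of_directionVec_eq_zero (h2 k hk)).1, smul_comm]
    A_orth := fun J hJL hJ0 hJt z hz k hk l hl hkl => by
      obtain ⟨h1, h2⟩ := hsub hJ0 hJt
      have hJ : J.Nonempty ∧ J ⊆ I := ⟨hJ0, h1⟩
      simp only [hJ, and_self, if_true]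
      rw [inner_smul_left, inner_smul_right, D.A_orth J (ResData.not_mem_of_not_mem_blow hJL) hJ0
        (fun i hi => hqI i (h1 hi)) _ hz.1 k hk l hl hkl, mul_zero, mul_zero]
    A_ne := fun J hJL hJ0 hJt z hz k hk => by
      obtain ⟨h1, h2⟩ := hsub hJ0 hJt
      have hJ : J.Nonempty ∧ J ⊆ I := ⟨hJ0, h1⟩
      simp only [hJ, and_self, if_true]
      exact smul_ne_zero (hn0 z hz.1) (D.A_ne J (ResData.not_mem_of_not_mem_blow hJL) hJ0
        (fun i hi => hqI i (h1 hi)) _ hz.1 k hk)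
    β_ne := fun J hJL hJ0 hJt z hz => by
      have hJL' := ResData.not_mem_of_not_mem_blow hJL
      by_cases hJ : J.Nonempty ∧ J ⊆ I
      · simp only [hJ, and_self, if_true]
        refine smul_ne_zero (hn0 z hz.1) ?_
        have hJq : ∀ i ∈ J, R.blowMap I t ∈ R.H i := fun i hi => hqI i (hJ.2 hi)
        -- As `t` misses one of the components in J, some v_k is nonzero at `t`, and then on the
        -- whole region.
        obtain ⟨k, hk, hne⟩ : ∃ k ∈ coordSet D.e D.σ J,
            directionVec j s ((D.dirParam hI hqI hjs.1 s).ξ ((R.blow I).ι t)) k ≠ 0 := by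
          by_contra! h
          rw [forall_mem_coordSet] at h
          exact hJt fun i hi => (hH i).2 ⟨hJ.2 hi, h.1, h.2 i hi⟩
        exact sum_smul_ne_zero (D.A_ne J hJL' hJ0 hJq _ hz.1) (D.A_orth J hJL' hJ0 hJq _ hz.1) hk
          (hz.2 k (coordSet_mono _ _ hJ.2 hk) hne)
      · simp only [hJ, if_false]
        refine D.β_ne J hJL' hJ0 (fun h => hJ ⟨hJ0, fun i hi => ?_⟩) _ hz.1
        exact (hiff i).1 (h i hi) }

end AdaptedChart

/-! ### Preservation of the invariants under blowing up -/

namespace ResData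

variable {c d : ℕ} {W X E : Type} [NormedAddCommGroup W] [InnerProductSpace ℝ W]
  [TopologicalSpace X] [NormedAddCommGroup E] [NormedSpace ℝ E]
  {R : ResData c W X E} {I : Finset (Fin c)}

/-- The decisive point is `comp_not_mem` for J = I: a common point of the strict transforms over the
center would have v_k = 0 for every coordinate k of the center, but v_j = ±1. -/
theorem Good.blow (hR : R.Good d) (hI : R.Next I) : (R.blow I).Good d where
  emb := hR.emb_blow
  isClosed_init := isClosed_closure
  isClosed_H _ := isClosed_closure
  H_subset i := closure_mono (preimage_mono (sdiff_subset_sdiff_left (hR.H_subset i)))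
  proj_nonneg _ := hR.proj_nonneg _
  upward := by
    rintro J (rfl | hJ) J' h
    · rcases h.eq_or_ssubset with rfl | h
      · exact mem_insert _ _
      · exact mem_insert_of_mem _ (hI.max _ h)
    · exact mem_insert_of_mem _ (hR.upward J hJ J' h)
  exists_chart t := by
    obtain ⟨D⟩ := hR.exists_chart (R.blowMap I t)
    by_cases hq : R.blowMap I t ∈ R.center I
    · have hqI := (hR.mem_center_iff hI).1 hq
      obtain ⟨j, s, hjs, ht⟩ := D.exists_mem_dirParam hI hqI hR t D.mem
      exact ⟨AdaptedChart.dir hR hI t D hq hqI hjs ht⟩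
    · exact ⟨AdaptedChart.off hR hI t D fun h => hq ((hR.mem_center_iff hI).2 h)⟩
  comp_not_mem t J hJ0 hJ := by
    by_cases hq : R.blowMap I t ∈ R.center I
    · have hqI := (hR.mem_center_iff hI).1 hq
      obtain ⟨D⟩ := hR.exists_chart (R.blowMap I t)
      obtain ⟨j, s, hjs, ht⟩ := D.exists_mem_dirParam hI hqI hR t D.mem
      have hH := fun i => D.mem_blow_H_iff hI hq hqI hR hjs ht i
      rintro (rfl | h)
      · have : ∀ k ∈ coordSet D.e D.σ J,
            directionVec j s ((D.dirParam hI hqI hjs.1 s).ξ ((R.blow J).ι t)) k = 0 := by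
          rw [forall_mem_coordSet]
          obtain ⟨i, hi⟩ := hJ0
          exact ⟨((hH i).1 ((hJ i).1 hi)).2.1, fun i hi => ((hH i).1 ((hJ i).1 hi)).2.2⟩
        exact directionVec_self_ne_zero _ (this j hjs.1)
      -- All components through `t` have their index in I, so J ∈ L would imply I ∈ L.
      · exact hI.not_mem (hR.upward J h I fun i hi => ((hH i).1 ((hJ i).1 hi)).1)
    · have hH : ∀ i, t ∈ (R.blow I).H i ↔ R.blowMap I t ∈ R.H i := fun i =>
        mem_closure_preimage_iff (hR.isClosed_H i) hq
      rintro (rfl | h)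
      · exact hq ((hR.mem_center_iff hI).2 fun i hi => (hH i).1 ((hJ i).1 hi))
      · exact hR.comp_not_mem _ J hJ0 (fun i => (hJ i).trans (hH i)) h

end ResData

theorem AdaptedChart.e_not_mem_image {c d : ℕ} {W X E : Type} [NormedAddCommGroup W]
    [InnerProductSpace ℝ W] [TopologicalSpace X] [NormedAddCommGroup E] [NormedSpace ℝ E]
    {R : ResData c W X E} {q : X} (D : AdaptedChart d R q) {I : Finset (Fin c)}
    (he : D.e ∈ D.B) (h : ∀ i ∈ I, q ∈ R.H i) : D.e ∉ I.image D.σ := by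
  rw [Finset.mem_image]
  rintro ⟨i, hi, hie⟩
  exact D.σ_not_mem i (h i hi) (hie ▸ he)

theorem AdaptedChart.card_coordSet {c d : ℕ} {W X E : Type} [NormedAddCommGroup W]
    [InnerProductSpace ℝ W] [TopologicalSpace X] [NormedAddCommGroup E] [NormedSpace ℝ E]
    {R : ResData c W X E} {q : X} (D : AdaptedChart d R q) {I : Finset (Fin c)}
    (he : D.e ∈ D.B) (h : ∀ i ∈ I, q ∈ R.H i) : (coordSet D.e D.σ I).card = I.card + 1 := by
  rw [coordSet, Finset.card_insert_of_notMem (D.e_not_mem_image he h), Finset.card_image_of_injOn]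
  exact fun i hi i' hi' => D.σ_inj i i' (h i hi) (h i' hi')

theorem isDirection_one {d : ℕ} {B : Set (Fin d)} {K : Finset (Fin d)} {j : Fin d} (h : j ∈ K) :
    IsDirection B K j 1 := ⟨h, fun _ => rfl⟩

namespace ResData

variable {c d : ℕ} {W X E : Type} [NormedAddCommGroup W] [InnerProductSpace ℝ W]
  [TopologicalSpace X] [NormedAddCommGroup E] [NormedSpace ℝ E]
  {R : ResData c W X E} {I : Finset (Fin c)}

theorem Good.proj_eq_zero_of_mem_init (hR : R.Good d) {p : X} (hp : p ∈ R.init) : R.proj p = 0 := by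
  obtain ⟨D⟩ := hR.exists_chart p
  exact (D.proj_eq_zero p D.mem).2 ⟨D.e, D.e_mem hp, ((D.init_iff p D.mem).1 hp).2⟩

theorem Good.center_subset_init (hR : R.Good d) (hI : R.Next I) : R.center I ⊆ R.init := by
  intro p hp
  obtain ⟨i, hi⟩ := hI.nonempty
  exact hR.H_subset i ((hR.mem_center_iff hI).1 hp i hi)

/-- At a point of the center the blown-up coordinates vanish, so its coordinates can themselves be
used as z in the direction (e, 1). Nonemptiness is what lets `blowSection` be a total function. -/
theorem Good.nonempty_blowCarrier (hR : R.Good d) (hI : R.Next I) (q : X) :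
    Nonempty (R.BlowCarrier I) := by
  have : Nonempty X := ⟨q⟩
  by_cases hq : q ∈ R.center I
  · have hqI := (hR.mem_center_iff hI).1 hq
    obtain ⟨D⟩ := hR.exists_chart q
    have hz := D.coord_eq_zero hI.nonempty D.mem hqI
    have hm := D.fits.ξ_mem q D.mem
    have he := mem_coordSet_left D.e D.σ I
    have h : directionalMap (coordSet D.e D.σ I) D.e 1 (D.ξ (R.ι q)) = D.ξ (R.ι q) := by
      ext k
      by_cases hk : k ∈ coordSet D.e D.σ I
      · rw [directionalMap_of_mem hk, hz _ he, zero_mul, hz k hk]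
      · rw [directionalMap_of_not_mem he hk]
    refine ⟨⟨_, D.mem_closure_directionGraph hI hqI hR (isDirection_one he) (z := D.ξ (R.ι q))
      (h.symm ▸ hm.1) ?_⟩⟩
    rintro k (rfl | hk)
    · exact (hz _ he).ge
    · exact hm.2 k hk
  · have hq' : R.b I q ≠ 0 := hq
    exact ⟨⟨(q, ‖R.b I q‖⁻¹ • R.b I q), subset_closure ⟨hq', rfl⟩⟩⟩

theorem Good.contMDiff_b [ChartedSpace (EuclideanQuadrant d) X] (hR : R.Good d)
    (hX : HasParamCharts (d := d) R.ι) {J : Finset (Fin c)} (hJ : J ∉ R.L) :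
    ContMDiff (cornerModel d) 𝓘(ℝ, W) ∞ (R.b J) := by
  intro p
  obtain ⟨D⟩ := hR.exists_chart p
  have h1 : ContDiffAt ℝ ∞ (fun e => D.β J (D.ξ e)) (R.ι p) :=
    ((D.smooth_β J).contDiffAt (D.isOpen_O.mem_nhds (D.fits.ξ_mem p D.mem).1)).comp _
      (D.smooth_ξ.contDiffAt (D.isOpen_U.mem_nhds D.mem))
  refine (ContMDiffAt.comp (g := fun e => D.β J (D.ξ e)) p h1.contMDiffAt
    (hX.contMDiff hR.emb p)).congr_of_eventuallyEq ?_
  filter_upwards [(D.isOpen_U.preimage hR.emb.continuous).mem_nhds D.mem] with q hq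
  exact D.b_eq J hJ q hq

open Classical in
/-- The inverse of the blowing-up map off the center. -/
def blowSection (R : ResData c W X E) (I : Finset (Fin c)) [Nonempty (R.BlowCarrier I)] (p : X) :
    R.BlowCarrier I :=
  if h : R.b I p = 0 then Classical.arbitrary _
  else ⟨(p, ‖R.b I p‖⁻¹ • R.b I p), subset_closure ⟨h, rfl⟩⟩

theorem blowSection_val [Nonempty (R.BlowCarrier I)] {p : X} (hp : p ∉ R.center I) :
    (R.blowSection I p).1 = (p, ‖R.b I p‖⁻¹ • R.b I p) := by
  have hp' : ¬ R.b I p = 0 := hp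
  rw [blowSection, dif_neg hp']

theorem Good.blowSection_blowMap [Nonempty (R.BlowCarrier I)] (hR : R.Good d) (hI : R.Next I)
    {t : R.BlowCarrier I} (ht : R.blowMap I t ∉ R.center I) :
    R.blowSection I (R.blowMap I t) = t := by
  apply Subtype.ext
  rw [blowSection_val ht]
  exact Prod.ext rfl (hR.direction_eq hI t ht).symm

end ResData

/-! ### The blowing-up as a fibered space -/

namespace FiberedSpace

variable {c n : ℕ} {W E : Type} [NormedAddCommGroup W] [InnerProductSpace ℝ W]
  [NormedAddCommGroup E] [NormedSpace ℝ E]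

/-- The fibered space `S` is described by the resolution data `R`. -/
structure Realizes (S : FiberedSpace n) (R : ResData c W S.carrier E) : Prop where
  good : R.Good (n + 1)
  charts : HasParamCharts (d := n + 1) R.ι
  init_eq : S.init = R.init
  proj_eq : S.proj = R.proj
  disc_eq : S.disc = R.disc
  isRegularized : S.IsRegularized

section Blow

variable {S : FiberedSpace n} {R : ResData c W S.carrier E} {I : Finset (Fin c)}

/-- The blowing-up of a fibered space described by resolution data. -/
def blowSpace (h : S.Realizes R) (hI : R.Next I) : FiberedSpace n :=
  have hB := h.good.blow hI
  let P : R.BlowCarrier I → Param (n + 1) (E × W) := fun t => (hB.exists_chart t).some.toParam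
  have hP : ∀ t, (P t).Fits (R.blow I).ι := fun t => (hB.exists_chart t).some.fits
  have hm : ∀ t, (R.blow I).ι t ∈ (P t).U := fun t => (hB.exists_chart t).some.mem
  { carrier := R.BlowCarrier I
    topologicalSpace := inferInstance
    chartedSpace := Param.chartedSpace P hB.emb hP hm
    isManifold := Param.isManifold hB.emb hP hm
    init := (R.blow I).init
    disc := (R.blow I).disc
    proj := (R.blow I).proj }

variable (h : S.Realizes R) (hI : R.Next I)

/-- The blowing-up map. -/
def blowSpaceMap : (blowSpace h hI).carrier → S.carrier := R.blowMap I

/-- The resolution data of the blown-up space. -/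
def blowData : ResData c W (blowSpace h hI).carrier (E × W) := R.blow I

theorem blowData_good : (blowData h hI).Good (n + 1) := h.good.blow hI

theorem blowData_charts : HasParamCharts (d := n + 1) (blowData h hI).ι :=
  Param.hasParamCharts (h.good.blow hI).emb
    (fun t => ((h.good.blow hI).exists_chart t).some.fits)
    (fun t => ((h.good.blow hI).exists_chart t).some.mem)

theorem contMDiff_blowSpaceMap :
    ContMDiff (cornerModel (n + 1)) (cornerModel (n + 1)) ∞ (blowSpaceMap h hI) := by
  intro t
  refine (h.charts.contMDiffWithinAt_of_comp h.good.emb (s := univ) ?_).contMDiffAt Filter.univ_mem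
  have h1 := (blowData_charts h hI).contMDiff (blowData_good h hI).emb
  exact ((contDiff_fst (𝕜 := ℝ) (n := ∞) (E := E) (F := W)).contMDiff.comp h1 t).contMDiffWithinAt

/-- The inverse of the blowing-up map off the center. -/
def blowSpaceSection [Nonempty (R.BlowCarrier I)] : S.carrier → (blowSpace h hI).carrier :=
  R.blowSection I

/-- In the ambient space the section is p ↦ (ι p, b_I/‖b_I‖), and the norm is smooth away from 0. -/
theorem contMDiffOn_blowSpaceSection [Nonempty (R.BlowCarrier I)] :
    ContMDiffOn (cornerModel (n + 1)) (cornerModel (n + 1)) ∞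
      (blowSpaceSection h hI) (R.center I)ᶜ := by
  intro p hp
  refine (blowData_charts h hI).contMDiffWithinAt_of_comp (blowData_good h hI).emb ?_
  have hb := h.good.contMDiff_b h.charts hI.not_mem
  have h1 : ContMDiffOn (cornerModel (n + 1)) 𝓘(ℝ, W) ∞
      (fun p => ‖R.b I p‖⁻¹ • R.b I p) (R.center I)ᶜ := by
    intro p hp
    have h2 : ContDiffAt ℝ ∞ (fun w : W => ‖w‖⁻¹ • w) (R.b I p) :=
      ((contDiffAt_norm ℝ hp).inv (norm_ne_zero_iff.2 hp)).smul contDiffAt_id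
    exact (ContMDiffAt.comp (g := fun w : W => ‖w‖⁻¹ • w) p h2.contMDiffAt
      (hb p)).contMDiffWithinAt
  refine ContMDiffWithinAt.congr (f := fun p => (R.ι p, ‖R.b I p‖⁻¹ • R.b I p))
    (((h.charts.contMDiff h.good.emb).contMDiffOn.prodMk_space h1) p hp) ?_ ?_
  · intro y hy
    change (R.ι (R.blowSection I y).1.1, (R.blowSection I y).1.2) = _
    rw [ResData.blowSection_val hy]
  · change (R.ι (R.blowSection I p).1.1, (R.blowSection I p).1.2) = _
    rw [ResData.blowSection_val hp]

theorem blowSpace_mem_boundary_iff (t : (blowSpace h hI).carrier) :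
    (blowSpace h hI).proj t = 0 ↔ t ∈ (cornerModel (n + 1)).boundary (blowSpace h hI).carrier := by
  let D := ((h.good.blow hI).exists_chart t).some
  rw [D.fits.mem_boundary_iff (X := (blowSpace h hI).carrier) D.mem rfl]
  exact D.proj_eq_zero t D.mem

/-- For the submersion property: the center lies over π = 0, and off the center the old projection
is the new one composed with the section, so surjectivity of its derivative passes to the new
projection. -/
theorem blowSpace_realizes : (blowSpace h hI).Realizes (blowData h hI) where
  good := blowData_good h hI
  charts := blowData_charts h hI
  init_eq := rfl
  proj_eq := rfl
  disc_eq := rfl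
  isRegularized := by
    refine (blowData_good h hI).isRegularized (blowData_charts h hI) rfl rfl rfl
      (blowSpace_mem_boundary_iff h hI) fun t ht => ?_
    rw [← blowSpace_mem_boundary_iff] at ht
    have ht' : S.proj (R.blowMap I t) ≠ 0 := by rw [h.proj_eq]; exact ht
    have hC : R.blowMap I t ∉ R.center I := fun hm =>
      ht' (by rw [h.proj_eq]; exact h.good.proj_eq_zero_of_mem_init (h.good.center_subset_init hI hm))
    have : Nonempty (R.BlowCarrier I) := ⟨t⟩
    have hs := h.isRegularized.proj_submersion (R.blowMap I t)
      (fun hb => ht' ((h.isRegularized.proj_eq_zero _).2 hb))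
    have hg := ((contMDiffOn_blowSpaceSection h hI).contMDiffAt
      ((h.good.isClosed_center hI).isOpen_compl.mem_nhds hC)).mdifferentiableAt (by simp)
    have hgt : blowSpaceSection h hI (R.blowMap I t) = t :=
      h.good.blowSection_blowMap hI hC
    have hp : MDifferentiableAt (cornerModel (n + 1)) 𝓘(ℝ, ℝ) (blowSpace h hI).proj
        (blowSpaceSection h hI (R.blowMap I t)) := by
      have h1 : (blowSpace h hI).proj = S.proj ∘ blowSpaceMap h hI := by rw [h.proj_eq]; rfl
      rw [h1]
      exact (h.isRegularized.proj_smooth.comp (contMDiff_blowSpaceMap h hI)).mdifferentiable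
        (by simp) _
    have h2 := (hp.hasMFDerivAt.comp _ hg.hasMFDerivAt).congr_of_eventuallyEq (f₁ := S.proj) (by
      filter_upwards [(h.good.isClosed_center hI).isOpen_compl.mem_nhds hC] with p hp
      change S.proj p = R.proj (R.blowSection I p).1.1
      rw [ResData.blowSection_val hp, h.proj_eq])
    rw [h2.mfderiv] at hs
    rw [← hgt]
    exact Function.Surjective.of_comp hs

theorem isBlowup_blowSpace : IsBlowup S (blowSpace h hI) (blowSpaceMap h hI) (R.center I) where
  isRegularized := (blowSpace_realizes h hI).isRegularized
  isClosed_center := h.good.isClosed_center hI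
  center_subset := by
    rw [h.disc_eq]
    intro p hp
    obtain ⟨i, hi⟩ := hI.nonempty
    exact ResData.mem_disc.2 ⟨i, (h.good.mem_center_iff hI).1 hp i hi⟩
  smooth := contMDiff_blowSpaceMap h hI
  diffeo_off_center := by
    rcases isEmpty_or_nonempty S.carrier with he | ⟨⟨q⟩⟩
    · exact ⟨fun p => he.elim p, fun p => he.elim p, fun p => he.elim p,
        fun q => he.elim (R.blowMap I q)⟩
    · have := h.good.nonempty_blowCarrier hI q
      refine ⟨R.blowSection I, contMDiffOn_blowSpaceSection h hI, fun p hp => ?_, fun t ht => ?_⟩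
      · change (R.blowSection I p).1.1 = p
        rw [ResData.blowSection_val hp]
      · exact h.good.blowSection_blowMap hI ht
  local_model := by
    -- The codimension counts one coordinate for each component in I, and x_e for M.
    refine ⟨I.card + 1, fun p hp => ?_⟩
    obtain ⟨D⟩ := h.good.exists_chart p
    have hpI := (h.good.mem_center_iff hI).1 hp
    have : Nonempty S.carrier := ⟨p⟩
    have hT : Nonempty (blowSpace h hI).carrier := h.good.nonempty_blowCarrier hI p
    have he : D.e ∈ D.B := D.e_mem (h.good.center_subset_init hI hp)
    -- Only admissible directions have a parametrization of interest; the other pairs (j, s) receive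
    -- an arbitrary chart.
    have key : ∀ j s, ∃ z : PartialEquiv (blowSpace h hI).carrier (Euc (n + 1)),
        ∀ hjs : IsDirection D.B (coordSet D.e D.σ I) j s,
          z = (D.dirParam hI hpI hjs.1 s).chart (blowData_good h hI).emb.injective
            (D.dirParam_fits hI hp h.good hjs) := by
      intro j s
      by_cases hjs : IsDirection D.B (coordSet D.e D.σ I) j s
      · exact ⟨(D.dirParam hI hpI hjs.1 s).chart (blowData_good h hI).emb.injective
          (D.dirParam_fits hI hp h.good hjs), fun _ => rfl⟩
      · exact ⟨(D.dirParam hI hpI (mem_coordSet_left D.e D.σ I) 1).chart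
          (blowData_good h hI).emb.injective
          (D.dirParam_fits hI hp h.good (isDirection_one (mem_coordSet_left D.e D.σ I))),
          fun h => absurd h hjs⟩
    choose z hz using key
    refine ⟨D.B, D.chart h.good.emb.injective D.fits, coordSet D.e D.σ I, z,
      h.charts.isCornerChart h.good.emb D.fits, D.mem, D.card_coordSet he hpI,
      fun q hq => h.good.mem_center_iff_coord hI hp D hq, fun j s hjs => ?_, fun t ht => ?_⟩
    · rw [hz j s hjs]
      refine ⟨(blowData_charts h hI).isCornerChart (blowData_good h hI).emb
        (D.dirParam_fits hI hp h.good hjs), ?_, fun t ht => ⟨?_, ?_⟩⟩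
      · ext y
        constructor
        · rintro ⟨h1, h2⟩
          exact ⟨h2, h1, directionalMap_mem_cornerSet hjs h2⟩
        · rintro ⟨h1, h2, -⟩
          exact ⟨h2, h1⟩
      · exact ht.1.1.1
      · exact (D.directionalMap_coord hI hp hpI h.good hjs ht).symm
    · obtain ⟨j, s, hjs, hm⟩ := D.exists_mem_dirParam hI hpI h.good t ht
      refine ⟨j, s, hjs, ?_⟩
      rw [hz j s hjs]
      exact hm
  init_eq := by rw [h.init_eq]; rfl
  disc_eq := by
    rw [h.disc_eq]
    change (⋃ i, closure (R.blowMap I ⁻¹' (R.H i \ R.center I))) =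
      closure (R.blowMap I ⁻¹' ((⋃ i, R.H i) \ R.center I))
    rw [iUnion_sdiff, preimage_iUnion, closure_iUnion_of_finite]
  proj_eq t := by rw [h.proj_eq]; rfl

end Blow

end FiberedSpace

/-! ### Lifting vectors through a directional blowing-up -/

section DirectionalLift

variable {d : ℕ}

/-- The vector `v` at `z` whose image under the directional blowing-up map is `z_j h`. -/
def directionalLift (K : Finset (Fin d)) (j : Fin d) (s : ℤˣ) (z h : Euc d) : Euc d :=
  WithLp.toLp 2 fun k => if k = j then ((s : ℤ) : ℝ) * z j * h j
    else if k ∈ K then h k - z k * (((s : ℤ) : ℝ) * h j) else z j * h k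

theorem contDiff_directionalLift (K : Finset (Fin d)) (j : Fin d) (s : ℤˣ) :
    ContDiff ℝ ∞ fun p : Euc d × Euc d => directionalLift K j s p.1 p.2 := by
  rw [contDiff_euclidean]
  intro k
  by_cases h : k = j
  · simp only [directionalLift, h, if_true]; fun_prop
  · by_cases h' : k ∈ K <;> simp only [directionalLift, h, h', if_true, if_false] <;> fun_prop

/-- Solving dφ(v) = h for k ∈ K \ {j} gives v_k = (h_k - s z_k h_j)/z_j. Multiplication by z_j
removes the only denominator, and the lift becomes polynomial in z and h. -/
theorem fderiv_directionalMap_directionalLift (K : Finset (Fin d)) (j : Fin d) (s : ℤˣ)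
    (z h : Euc d) :
    fderiv ℝ (directionalMap K j s) z (directionalLift K j s z h) = z j • h := by
  have hd := ((contDiff_directionalMap K j s).differentiable (by simp) z).hasFDerivAt
  obtain ⟨π, hπ⟩ : ∃ π : Fin d → Euc d →L[ℝ] ℝ, ∀ k y, π k y = y k :=
    ⟨fun k => EuclideanSpace.proj k, fun _ _ => rfl⟩
  have hp : ∀ (k : Fin d) (y : Euc d), HasFDerivAt (fun z : Euc d => z k) (π k) y := fun k y => by
    rw [← funext (hπ k)]
    exact (π k).hasFDerivAt
  have hs := units_cast_mul_self s
  ext k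
  have h1 : HasFDerivAt (fun z => directionalMap K j s z k)
      ((π k).comp (fderiv ℝ (directionalMap K j s) z)) z :=
    (hp k (directionalMap K j s z)).comp z hd
  by_cases hk : k = j
  · subst hk
    have h2 : HasFDerivAt (fun z => directionalMap K k s z k) (((s : ℤ) : ℝ) • π k) z := by
      simp only [directionalMap, if_true]
      exact (hp k z).const_mul ((s : ℤ) : ℝ)
    have h3 := congrArg (fun L : Euc d →L[ℝ] ℝ => L (directionalLift K k s z h)) (h1.unique h2)
    refine (hπ k _).symm.trans (h3.trans ?_)
    simp only [directionalLift, smul_apply, hπ, if_true,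
      PiLp.smul_apply, smul_eq_mul]
    linear_combination (z k * h k) * hs
  · by_cases hK : k ∈ K
    · have h2 : HasFDerivAt (fun z => directionalMap K j s z k) (z j • π k + z k • π j) z := by
        simp only [directionalMap, hk, hK, if_true, if_false]
        exact (hp j z).mul (hp k z)
      have h3 := congrArg (fun L : Euc d →L[ℝ] ℝ => L (directionalLift K j s z h)) (h1.unique h2)
      refine (hπ k _).symm.trans (h3.trans ?_)
      simp only [directionalLift, add_apply, smul_apply,
        hπ, if_true, hk, hK, if_false, PiLp.smul_apply, smul_eq_mul]
      ring
    · have h2 : HasFDerivAt (fun z => directionalMap K j s z k) (π k) z := by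
        simp only [directionalMap, hk, hK, if_false]
        exact hp k z
      have h3 := congrArg (fun L : Euc d →L[ℝ] ℝ => L (directionalLift K j s z h)) (h1.unique h2)
      refine (hπ k _).symm.trans (h3.trans ?_)
      simp only [directionalLift, hπ, hk, hK, if_false, PiLp.smul_apply, smul_eq_mul]

end DirectionalLift

/-! ### The lifted vector field -/

namespace FiberedSpace

variable {c n : ℕ} {W E : Type} [NormedAddCommGroup W] [InnerProductSpace ℝ W]
  [NormedAddCommGroup E] [NormedSpace ℝ E]
  {S : FiberedSpace n} {R : ResData c W S.carrier E} {I : Finset (Fin c)}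
  (h : S.Realizes R) (hI : R.Next I)

/-- A function vanishing to first order on the exceptional divisor. -/
def blowFactor (t : (blowSpace h hI).carrier) : ℝ := ‖R.b I (blowSpaceMap h hI t)‖

theorem blowFactor_eq {q : S.carrier} (D : AdaptedChart (n + 1) R q) (hq : q ∈ R.center I)
    (hqI : ∀ i ∈ I, q ∈ R.H i) {j : Fin (n + 1)} {s : ℤˣ}
    (hjs : IsDirection D.B (coordSet D.e D.σ I) j s) {t : (blowSpace h hI).carrier}
    (ht : (blowData h hI).ι t ∈ (D.dirParam hI hqI hjs.1 s).U) :
    blowFactor h hI t = (D.dirParam hI hqI hjs.1 s).ξ ((blowData h hI).ι t) j *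
      ‖D.dirVec I j s ((D.dirParam hI hqI hjs.1 s).ξ ((blowData h hI).ι t))‖ := by
  have h1 := ((D.dirParam_fits hI hq h.good hjs).ξ_mem t ht).2 j (mem_insert _ _)
  change ‖R.b I (R.blowMap I t)‖ = _
  rw [D.b_eq_smul_dirVec hI hq hqI h.good hjs ht, norm_smul, Real.norm_of_nonneg h1]
  rfl

/-- The norm is not smooth at 0, but z_j ≥ 0 in a directional chart, so ‖b_I‖ = z_j ‖`dirVec`‖ is
smooth across the exceptional divisor. -/
theorem contMDiff_blowFactor : ContMDiff (cornerModel (n + 1)) 𝓘(ℝ, ℝ) ∞ (blowFactor h hI) := by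
  intro t
  by_cases hq : blowSpaceMap h hI t ∈ R.center I
  · have hqI := (h.good.mem_center_iff hI).1 hq
    obtain ⟨D⟩ := h.good.exists_chart (blowSpaceMap h hI t)
    obtain ⟨j, s, hjs, ht⟩ := D.exists_mem_dirParam hI hqI h.good t D.mem
    have hm := (D.dirParam_fits hI hq h.good hjs).ξ_mem t ht
    have h1 : ContDiffAt ℝ ∞ (fun z : Euc (n + 1) => z j * ‖D.dirVec I j s z‖)
        ((D.dirParam hI hqI hjs.1 s).ξ ((blowData h hI).ι t)) := by
      refine ContDiffAt.mul (by fun_prop) (ContDiffAt.norm ℝ ?_ (D.dirVec_ne_zero hI hqI hjs.1 s hm.1))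
      exact (D.smooth_dirVec j s).contDiffAt
        ((D.dirParam hI hqI hjs.1 s).isOpen_O.mem_nhds hm.1)
    have h2 := h1.comp _ ((D.dirParam hI hqI hjs.1 s).smooth_ξ.contDiffAt
      ((D.dirParam hI hqI hjs.1 s).isOpen_U.mem_nhds ht))
    refine (ContMDiffAt.comp t h2.contMDiffAt
      ((blowData_charts h hI).contMDiff (blowData_good h hI).emb t)).congr_of_eventuallyEq ?_
    filter_upwards [((D.dirParam hI hqI hjs.1 s).isOpen_U.preimage
      (blowData_good h hI).emb.continuous).mem_nhds ht] with t' ht'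
    exact blowFactor_eq h hI D hq hqI hjs ht'
  · have hb := (h.good.contMDiff_b h.charts hI.not_mem).comp (contMDiff_blowSpaceMap h hI) t
    exact ContMDiffAt.comp (g := fun w : W => ‖w‖) t (contDiffAt_norm ℝ hq).contMDiffAt hb

theorem mfderiv_ι_blowSpaceMap (t : (blowSpace h hI).carrier)
    (v : TangentSpace (cornerModel (n + 1)) t) :
    (mfderiv (cornerModel (n + 1)) 𝓘(ℝ, E) R.ι (blowSpaceMap h hI t)
      (mfderiv (cornerModel (n + 1)) (cornerModel (n + 1)) (blowSpaceMap h hI) t v) : E) =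
    (mfderiv (cornerModel (n + 1)) 𝓘(ℝ, E × W) (blowData h hI).ι t v : E × W).1 := by
  have h1 := ((h.charts.contMDiff h.good.emb).mdifferentiable (by simp)
    (blowSpaceMap h hI t)).hasMFDerivAt.comp t
    ((contMDiff_blowSpaceMap h hI).mdifferentiable (by simp) t).hasMFDerivAt
  have h2 := ((ContinuousLinearMap.fst ℝ E W).hasFDerivAt (x := (blowData h hI).ι t)).hasMFDerivAt.comp t
    (((blowData_charts h hI).contMDiff (blowData_good h hI).emb).mdifferentiable (by simp)
      t).hasMFDerivAt
  exact congrArg (fun L : Euc (n + 1) →L[ℝ] E => L v) (hasMFDerivAt_unique h1 h2)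

/-- The lift of `blowFactor • Z` off the exceptional divisor. -/
def preLift (Z : S.VField) : (blowSpace h hI).VField := fun t =>
  -- Off the center dφ is injective, and its inverse yields the lift; the values on the exceptional
  -- divisor are not used.
  Function.invFun (mfderiv (cornerModel (n + 1)) (cornerModel (n + 1)) (blowSpaceMap h hI) t)
    (blowFactor h hI t • Z (blowSpaceMap h hI t))

/-- The components of `preLift` in the ambient space. -/
def ambientLift (Z : S.VField) (t : (blowSpace h hI).carrier) : E × W :=
  mfderiv (cornerModel (n + 1)) 𝓘(ℝ, E × W) (blowData h hI).ι t (preLift h hI Z t)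

open Classical in
/-- The lift of `blowFactor • Z`, extended by continuity to the exceptional divisor. -/
def lift (Z : S.VField) : (blowSpace h hI).VField := fun t =>
  if blowSpaceMap h hI t ∈ R.center I then
    Function.invFun (mfderiv (cornerModel (n + 1)) 𝓘(ℝ, E × W) (blowData h hI).ι t)
      (extendFrom (blowSpaceMap h hI ⁻¹' R.center I)ᶜ (ambientLift h hI Z) t)
  else preLift h hI Z t

variable {Z : S.VField}

/-- The derivatives of `ι` and of the blowing-up map are injective off the center, so it is enough
to exhibit a coordinate vector whose image in `E` is the prescribed one. -/
theorem mfderiv_preLift {P : Param (n + 1) (E × W)} (hP : P.Fits (blowData h hI).ι)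
    {t : (blowSpace h hI).carrier} (ht : (blowData h hI).ι t ∈ P.U)
    (hC : blowSpaceMap h hI t ∉ R.center I) {a : Euc (n + 1)}
    (ha : (fderiv ℝ P.w (P.ξ ((blowData h hI).ι t)) a).1 =
      blowFactor h hI t • (mfderiv (cornerModel (n + 1)) 𝓘(ℝ, E) R.ι (blowSpaceMap h hI t)
        (Z (blowSpaceMap h hI t)) : E)) :
    mfderiv (cornerModel (n + 1)) (cornerModel (n + 1)) (blowSpaceMap h hI) t (preLift h hI Z t) =
      blowFactor h hI t • Z (blowSpaceMap h hI t) ∧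
    ambientLift h hI Z t = fderiv ℝ P.w (P.ξ ((blowData h hI).ι t)) a := by
  obtain ⟨v, hv⟩ := (blowData_charts h hI).exists_mfderiv_eq (blowData_good h hI).emb hP ht a
  have h1 : mfderiv (cornerModel (n + 1)) (cornerModel (n + 1)) (blowSpaceMap h hI) t v =
      blowFactor h hI t • Z (blowSpaceMap h hI t) := by
    apply h.charts.mfderiv_injective h.good.emb
    refine (mfderiv_ι_blowSpaceMap h hI t v).trans ?_
    rw [map_smul, hv]
    exact ha
  have h2 : preLift h hI Z t = v := by
    rw [preLift, ← h1]
    exact Function.leftInverse_invFun ((isBlowup_blowSpace h hI).mfderiv_injective hC) v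
  rw [ambientLift, h2]
  exact ⟨h1, hv⟩

/-- A coordinate formula for the lift that is continuous up to the exceptional divisor persists on
it, because the complement is dense. -/
theorem mfderiv_lift_of_mem {P : Param (n + 1) (E × W)} (hP : P.Fits (blowData h hI).ι)
    {t : (blowSpace h hI).carrier} (ht : (blowData h hI).ι t ∈ P.U)
    (hC : blowSpaceMap h hI t ∈ R.center I) {a : Euc (n + 1) → Euc (n + 1)}
    (ha : ContinuousWithinAt a (cornerSet P.B) (P.ξ ((blowData h hI).ι t)))
    (hev : ∀ᶠ t' in 𝓝 t, blowSpaceMap h hI t' ∉ R.center I →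
      ambientLift h hI Z t' = fderiv ℝ P.w (P.ξ ((blowData h hI).ι t')) (a (P.ξ ((blowData h hI).ι t')))) :
    (mfderiv (cornerModel (n + 1)) 𝓘(ℝ, E × W) (blowData h hI).ι t (lift h hI Z t) : E × W) =
      fderiv ℝ P.w (P.ξ ((blowData h hI).ι t)) (a (P.ξ ((blowData h hI).ι t))) := by
  have hemb := (blowData_good h hI).emb
  obtain ⟨v, hv⟩ := (blowData_charts h hI).exists_mfderiv_eq hemb hP ht
    (a (P.ξ ((blowData h hI).ι t)))
  have hm := hP.ξ_mem t ht
  have hnhds := (P.isOpen_U.preimage hemb.continuous).mem_nhds ht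
  have hc : ContinuousAt (fun t => P.ξ ((blowData h hI).ι t)) t :=
    (P.continuousOn_coord hemb.continuous).continuousAt hnhds
  have hc1 : ContinuousAt (fun t => a (P.ξ ((blowData h hI).ι t))) t := by
    refine Filter.Tendsto.comp ha (tendsto_nhdsWithin_iff.2 ⟨hc, ?_⟩)
    filter_upwards [hnhds] with t' ht' using (hP.ξ_mem t' ht').2
  have hc2 : ContinuousAt (fun t => fderiv ℝ P.w (P.ξ ((blowData h hI).ι t))) t :=
    ContinuousAt.comp (g := fderiv ℝ P.w)
      (((P.smooth_w.fderiv_of_isOpen P.isOpen_O (m := ∞) (by simp)).continuousOn).continuousAt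
        (P.isOpen_O.mem_nhds hm.1)) hc
  have h1 : extendFrom (blowSpaceMap h hI ⁻¹' R.center I)ᶜ (ambientLift h hI Z) t =
      fderiv ℝ P.w (P.ξ ((blowData h hI).ι t)) (a (P.ξ ((blowData h hI).ι t))) := by
    refine extendFrom_eq (ResData.dense_compl_exceptional (R := R) (I := I) t) ?_
    refine ((hc2.clm_apply hc1).tendsto.mono_left nhdsWithin_le_nhds).congr' ?_
    filter_upwards [self_mem_nhdsWithin, nhdsWithin_le_nhds hev] with t' h1 h2 using (h2 h1).symm
  have h2 : lift h hI Z t = v :=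
    (if_pos hC).trans ((congrArg (Function.invFun
      (mfderiv (cornerModel (n + 1)) 𝓘(ℝ, E × W) (blowData h hI).ι t)) (h1.trans hv.symm)).trans
      (Function.leftInverse_invFun ((blowData_charts h hI).mfderiv_injective hemb t) v))
  rw [h2]
  exact hv

theorem mfderiv_lift_of_notMem {t : (blowSpace h hI).carrier}
    (hC : blowSpaceMap h hI t ∉ R.center I) : lift h hI Z t = preLift h hI Z t := if_neg hC

theorem fderiv_fst_eq {G : Type} [NormedAddCommGroup G] [NormedSpace ℝ G] {w' : G → E × W}
    {w : G → E} {z : G} (hw : DifferentiableAt ℝ w' z) (hww : ∀ z, (w' z).1 = w z) (a : G) :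
    (fderiv ℝ w' z a).1 = fderiv ℝ w z a := by
  have h1 : HasFDerivAt w ((ContinuousLinearMap.fst ℝ E W).comp (fderiv ℝ w' z)) z := by
    have := hw.hasFDerivAt.fst
    simpa only [hww] using this
  rw [h1.fderiv]
  rfl

end FiberedSpace

/-! ### Profiles under a directional blowing-up -/

section ProfileLift

variable {c d : ℕ}

/-- The quotients `v_{σ i} / v_e` of the direction given by `z`, if `v_e` is nonzero at `z₀`;
otherwise numbers of the right sign or, if `v_{σ i}` vanishes at `z₀` too, the given numbers `u`. -/
def liftRatio (r : ℝ) (e : Fin d) (σ : Fin c → Fin d) (j : Fin d) (s : ℤˣ) (z₀ z : Euc d)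
    (u : Fin c → ℝ) : Fin c → ℝ := fun i =>
  if directionVec j s z₀ e ≠ 0 then directionVec j s z (σ i) / directionVec j s z e
  else if directionVec j s z₀ (σ i) ≠ 0 then
    SignType.sign (directionVec j s z₀ (σ i)) * (r + 1) else u i

/-- A neighborhood of `z₀` in which the signs of the directions are controlled. -/
def liftRegion (r : ℝ) (e : Fin d) (σ : Fin c → Fin d) (j : Fin d) (s : ℤˣ) (z₀ : Euc d) :
    Set (Euc d) :=
  {z | (directionVec j s z₀ e ≠ 0 → directionVec j s z e ≠ 0) ∧
    ∀ i, directionVec j s z₀ e = 0 → directionVec j s z₀ (σ i) ≠ 0 →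
      r * directionVec j s z e <
        SignType.sign (directionVec j s z₀ (σ i)) * directionVec j s z (σ i)}

theorem isOpen_liftRegion (r : ℝ) (e : Fin d) (σ : Fin c → Fin d) (j : Fin d) (s : ℤˣ)
    (z₀ : Euc d) : IsOpen (liftRegion r e σ j s z₀) := by
  have hc := fun k => (contDiff_directionVec j s k).continuous
  refine IsOpen.and ?_ ?_
  · by_cases h : directionVec j s z₀ e = 0
    · simp [h]
    · simp only [ne_eq, h, not_false_eq_true, true_imp_iff]
      exact isOpen_ne_fun (hc e) continuous_const
  · rw [ofPred_forall]
    refine isOpen_iInter_of_finite fun i => ?_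
    by_cases h : directionVec j s z₀ e = 0
    · by_cases h' : directionVec j s z₀ (σ i) = 0
      · simp [h']
      · simp only [ne_eq, h, h', not_false_eq_true, true_imp_iff]
        exact isOpen_lt (continuous_const.mul (hc e)) (continuous_const.mul (hc _))
    · simp [h]

theorem sign_mul_self_pos {x : ℝ} (h : x ≠ 0) : 0 < (SignType.sign x : ℝ) * x := by
  rcases lt_or_gt_of_ne h with h | h
  · simp [sign_neg h, h]
  · simp [sign_pos h, h]

theorem self_mem_liftRegion (r : ℝ) (e : Fin d) (σ : Fin c → Fin d) (j : Fin d) (s : ℤˣ)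
    (z₀ : Euc d) : z₀ ∈ liftRegion r e σ j s z₀ := by
  refine ⟨id, fun i h1 h2 => ?_⟩
  rw [h1, mul_zero]
  exact sign_mul_self_pos h2

/-- In the directional blowing-up, the quotients of the coordinates agree with `liftRatio`, up to
numbers of the same sign outside `[-r, r]`. -/
theorem ratioVec_directionalMap {r : ℝ} (hr : 0 < r) {e : Fin d} {σ : Fin c → Fin d} {j : Fin d}
    {s : ℤˣ} {z₀ z : Euc d} {K : Finset (Fin d)} (he : e ∈ K) {i : Fin c} (hi : σ i ∈ K)
    (hz : z ∈ liftRegion r e σ j s z₀) (hzj : 0 < z j) (hze : 0 ≤ directionVec j s z e ∨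
      directionVec j s z₀ e ≠ 0) :
    ratioVec r e σ (directionalMap K j s z) i =
        liftRatio r e σ j s z₀ z (ratioVec r e σ z) i ∨
      (r < ratioVec r e σ (directionalMap K j s z) i ∧
        r < liftRatio r e σ j s z₀ z (ratioVec r e σ z) i) ∨
      (ratioVec r e σ (directionalMap K j s z) i < -r ∧
        liftRatio r e σ j s z₀ z (ratioVec r e σ z) i < -r) := by
  have hquot : directionVec j s z e ≠ 0 → ratioVec r e σ (directionalMap K j s z) i =
      directionVec j s z (σ i) / directionVec j s z e := by
    intro h
    rw [ratioVec, directionalMap_of_mem he, directionalMap_of_mem hi,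
      if_neg (mul_ne_zero hzj.ne' h), mul_div_mul_left _ _ hzj.ne']
  have hzero : directionVec j s z e = 0 → ratioVec r e σ (directionalMap K j s z) i =
      SignType.sign (directionVec j s z (σ i)) * (r + 1) := by
    intro h
    rw [ratioVec, directionalMap_of_mem he, directionalMap_of_mem hi, h, mul_zero, if_pos rfl,
      sign_mul, sign_pos hzj, one_mul]
  by_cases h1 : directionVec j s z₀ e = 0
  · by_cases h2 : directionVec j s z₀ (σ i) = 0
    -- Both directions vanish at z₀, so neither index is j. The directions are then coordinates of z
    -- and the quotient keeps its form.
    · left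
      rw [liftRatio, if_neg (not_not.2 h1), if_neg (not_not.2 h2)]
      have h3 := (eq_of_directionVec_eq_zero h1).1
      have h4 := (eq_of_directionVec_eq_zero h2).1
      by_cases h : directionVec j s z e = 0
      · rw [hzero h]
        rw [directionVec_of_ne h3] at h
        rw [ratioVec, if_pos h, directionVec_of_ne h4]
      · rw [hquot h]
        rw [directionVec_of_ne h3] at h
        rw [ratioVec, if_neg h, directionVec_of_ne h4, directionVec_of_ne h3]
    -- Here v_e ≥ 0, and in the region |v_{σ i}| > r v_e with a known sign; both numbers to be
    -- compared lie beyond `r` on the same side.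
    · right
      rw [liftRatio, if_neg (not_not.2 h1), if_pos h2]
      have h5 := hz.2 i h1 h2
      have h6 : 0 ≤ directionVec j s z e := hze.resolve_right (not_not.2 h1)
      have h7 : 0 ≤ r * directionVec j s z e := by positivity
      rcases lt_or_gt_of_ne h2 with h2 | h2
      · right
        simp only [sign_neg h2, SignType.coe_neg_one, neg_mul, one_mul] at h5 ⊢
        refine ⟨?_, by linarith⟩
        rcases h6.eq_or_lt with h | h
        · rw [hzero h.symm, sign_neg (by linarith)]
          simp
        · rw [hquot h.ne', div_lt_iff₀ h]
          linarith
      · left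
        simp only [sign_pos h2, SignType.coe_one, one_mul] at h5 ⊢
        refine ⟨?_, by linarith⟩
        rcases h6.eq_or_lt with h | h
        · rw [hzero h.symm, sign_pos (by linarith)]
          simp
        · rw [hquot h.ne', lt_div_iff₀ h]
          linarith
  · left
    rw [liftRatio, if_pos h1]
    exact hquot (hz.1 h1)

/-- The quotient with index i remains an argument only if v_e and v_{σ i} both vanish at z₀, that
is, on the strict transform of the component. Otherwise `liftRatio` replaces it by a smooth function
of z or by a constant. -/
theorem IsProfile.directionalLift {I I' : Set (Fin c)} {r : ℝ} {V : Set (Euc d)}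
    {G : (Fin c → ℝ) → Euc d → Euc d} (hG : IsProfile I r V G) {e : Fin d} {σ : Fin c → Fin d}
    {K : Finset (Fin d)} {j : Fin d} {s : ℤˣ} {z₀ : Euc d} {V' : Set (Euc d)} (hV' : IsOpen V')
    (hVV' : ∀ z ∈ V', directionalMap K j s z ∈ V) (hreg : V' ⊆ liftRegion r e σ j s z₀)
    {g : Euc d → ℝ} (hg : ContDiffOn ℝ ∞ g V')
    (hI' : ∀ i ∈ I, directionVec j s z₀ e = 0 → directionVec j s z₀ (σ i) = 0 → i ∈ I') :
    IsProfile I' r V' fun u z => g z • _root_.directionalLift K j s z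
      (G (liftRatio r e σ j s z₀ z u) (directionalMap K j s z)) where
  pos := hG.pos
  isOpen := hV'
  smooth := by
    have hdir := (contDiff_directionalMap K j s).comp_contDiffOn
      (contDiffOn_snd (s := univ ×ˢ V') (𝕜 := ℝ) (n := ∞) (E := Fin c → ℝ) (F := Euc d))
    have hvec : ∀ k, ContDiffOn ℝ ∞ (fun p : (Fin c → ℝ) × Euc d => directionVec j s p.2 k)
        (univ ×ˢ V') := fun k => (contDiff_directionVec j s k).comp_contDiffOn contDiffOn_snd
    have hratio : ContDiffOn ℝ ∞ (fun p : (Fin c → ℝ) × Euc d =>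
        liftRatio r e σ j s z₀ p.2 p.1) (univ ×ˢ V') := by
      rw [contDiffOn_pi]
      intro i
      by_cases h1 : directionVec j s z₀ e = 0
      · by_cases h2 : directionVec j s z₀ (σ i) = 0
        · simp only [liftRatio, h1, h2, ne_eq, not_true_eq_false, if_false]
          fun_prop
        · simp only [liftRatio, h1, h2, ne_eq, not_true_eq_false, if_false, not_false_eq_true,
            if_true]
          fun_prop
      · simp only [liftRatio, h1, ne_eq, not_false_eq_true, if_true]
        exact (hvec _).div (hvec e) fun p hp => (hreg hp.2).1 h1
    have h1 := hG.smooth.comp (hratio.prodMk hdir) fun p hp => ⟨mem_univ _, hVV' _ hp.2⟩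
    have h2 := (contDiff_directionalLift K j s).comp_contDiffOn (contDiffOn_snd.prodMk h1)
    exact (hg.comp contDiffOn_snd fun p hp => hp.2).smul h2
  eq u u' z hz huu := by
    have : G (liftRatio r e σ j s z₀ z u) (directionalMap K j s z) =
        G (liftRatio r e σ j s z₀ z u') (directionalMap K j s z) := by
      refine hG.eq _ _ _ (hVV' z hz) fun i hi => ?_
      simp only [liftRatio]
      by_cases h1 : directionVec j s z₀ e = 0
      · by_cases h2 : directionVec j s z₀ (σ i) = 0
        · simp only [h1, h2, ne_eq, not_true_eq_false, if_false]
          exact huu i (hI' i hi h1 h2)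
        · simp [h1, h2]
      · simp [h1]
    simp only [this]

theorem IsProfile.smul {I I' : Set (Fin c)} (hI : I ⊆ I') {r : ℝ} {V V' : Set (Euc d)}
    {G : (Fin c → ℝ) → Euc d → Euc d} (hG : IsProfile I r V G) (hV' : IsOpen V') (hVV' : V' ⊆ V)
    {g : Euc d → ℝ} (hg : ContDiffOn ℝ ∞ g V') : IsProfile I' r V' fun u y => g y • G u y where
  pos := hG.pos
  isOpen := hV'
  smooth := (hg.comp contDiffOn_snd fun p hp => hp.2).smul
    (hG.smooth.mono (prod_mono_right hVV'))
  eq u u' y hy huu := by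
    simp only [hG.eq u u' y (hVV' hy) fun i hi => huu i (hI hi)]

end ProfileLift

/-! ### Stability of profiles under blowing up -/

namespace FiberedSpace

variable {c n : ℕ} {W E : Type} [NormedAddCommGroup W] [InnerProductSpace ℝ W]
  [NormedAddCommGroup E] [NormedSpace ℝ E]
  {S : FiberedSpace n} {R : ResData c W S.carrier E} {I : Finset (Fin c)}
  (h : S.Realizes R) (hI : R.Next I) {Z : S.VField}

theorem mem_blowData_disc_iff {t : (blowSpace h hI).carrier}
    (ht : blowSpaceMap h hI t ∉ R.center I) :
    t ∈ (blowData h hI).disc ↔ blowSpaceMap h hI t ∈ R.disc := by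
  rw [ResData.mem_disc, ResData.mem_disc]
  exact exists_congr fun i => ResData.mem_closure_preimage_iff (h.good.isClosed_H i) ht

/-- Away from the center the coordinates do not change, and the profile is multiplied by the smooth
function ‖β I‖. -/
theorem hasProfile_lift_of_notMem {t : (blowSpace h hI).carrier}
    (hZ : S.HasProfile R Z (blowSpaceMap h hI t)) (ht : blowSpaceMap h hI t ∉ R.center I) :
    (blowSpace h hI).HasProfile (blowData h hI) (lift h hI Z) t ∧
      (t ∉ (blowData h hI).disc →
        mfderiv (cornerModel (n + 1)) (cornerModel (n + 1)) (blowSpaceMap h hI) t (lift h hI Z t) =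
          blowFactor h hI t • Z (blowSpaceMap h hI t)) := by
  obtain ⟨D, V, r, G, hG, hqV, hZD⟩ := hZ
  have htH : ¬ ∀ i ∈ I, blowSpaceMap h hI t ∈ R.H i := fun hm => ht ((h.good.mem_center_iff hI).2 hm)
  have hβ := D.β_ne I hI.not_mem hI.nonempty htH
  let D' : AdaptedChart (n + 1) (blowData h hI) t := AdaptedChart.off h.good hI t D htH
  have hC : ∀ p, (blowData h hI).ι p ∈ D'.U → blowSpaceMap h hI p ∉ R.center I := by
    intro p hp hm
    have h1 : R.b I (blowSpaceMap h hI p) = D.β I (D.ξ (R.ι (blowSpaceMap h hI p))) :=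
      D.b_eq I hI.not_mem _ hp.1
    exact hβ _ (D.fits.ξ_mem _ hp.1).1 (h1.symm.trans hm)
  have key : ∀ p, (blowData h hI).ι p ∈ D'.U → D'.ξ ((blowData h hI).ι p) ∈ V ∩ D.O →
      p ∉ (blowData h hI).disc →
      (fderiv ℝ D'.w (D'.ξ ((blowData h hI).ι p)) (‖D.β I (D'.ξ ((blowData h hI).ι p))‖ •
        G (ratioVec r D'.e D'.σ (D'.ξ ((blowData h hI).ι p))) (D'.ξ ((blowData h hI).ι p)))).1 =
      blowFactor h hI p • (mfderiv (cornerModel (n + 1)) 𝓘(ℝ, E) R.ι (blowSpaceMap h hI p)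
        (Z (blowSpaceMap h hI p)) : E) := by
    intro p hp hV hd
    rw [mem_blowData_disc_iff h hI (hC p hp)] at hd
    refine Eq.trans ?_ (congrArg (fun e : E => blowFactor h hI p • e)
      (hZD (blowSpaceMap h hI p) hp.1 hV.1 hd)).symm
    rw [fderiv_fst_eq (w := D.w)
      ((D'.smooth_w.contDiffAt (D'.isOpen_O.mem_nhds hV.2)).differentiableAt (by simp))
      (fun _ => rfl), map_smul]
    congr 1
    change _ = ‖R.b I (blowSpaceMap h hI p)‖
    have h1 : R.b I (blowSpaceMap h hI p) = D.β I (D.ξ (R.ι (blowSpaceMap h hI p))) :=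
      D.b_eq I hI.not_mem _ hp.1
    rw [h1]
    rfl
  have hmem : D'.ξ ((blowData h hI).ι t) ∈ V ∩ D.O := ⟨hqV, (D.fits.ξ_mem _ D.mem).1⟩
  have hI' : {i | blowSpaceMap h hI t ∈ R.H i} ⊆ {i | t ∈ (blowData h hI).H i} := fun i hi =>
    (ResData.mem_closure_preimage_iff (h.good.isClosed_H i) ht).2 hi
  refine ⟨⟨D', V ∩ D.O, r, _, hG.smul hI' (hG.isOpen.inter D.isOpen_O) inter_subset_left
    (((D.smooth_β I).norm ℝ hβ).mono inter_subset_right), hmem, fun p hp hV hd => ?_⟩, fun hd => ?_⟩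
  · rw [mfderiv_lift_of_notMem h hI (hC p hp)]
    exact (mfderiv_preLift h hI D'.fits hp (hC p hp) (key p hp hV hd)).2
  · rw [mfderiv_lift_of_notMem h hI ht]
    exact (mfderiv_preLift h hI D'.fits D'.mem ht (key t D'.mem hmem hd)).1

/-- The vector field to be lifted is z_j ‖`dirVec`‖ Z, so the new profile is ‖`dirVec`‖ times the
directional lift of the old one, with quotients rewritten by `liftRatio`. The formula is checked off
the exceptional divisor and extended to it by continuity of profiles off Σ. -/
theorem hasProfile_lift_of_mem {t : (blowSpace h hI).carrier}
    (hZ : S.HasProfile R Z (blowSpaceMap h hI t)) (ht : blowSpaceMap h hI t ∈ R.center I) :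
    (blowSpace h hI).HasProfile (blowData h hI) (lift h hI Z) t ∧
      (t ∉ (blowData h hI).disc →
        mfderiv (cornerModel (n + 1)) (cornerModel (n + 1)) (blowSpaceMap h hI) t (lift h hI Z t) =
          blowFactor h hI t • Z (blowSpaceMap h hI t)) := by
  obtain ⟨D, V, r, G, hG, hqV, hZD⟩ := hZ
  have htH := (h.good.mem_center_iff hI).1 ht
  obtain ⟨j, s, hjs, htU⟩ := D.exists_mem_dirParam hI htH h.good t D.mem
  let P : Param (n + 1) (E × W) := D.dirParam hI htH hjs.1 s
  let x : (blowSpace h hI).carrier → Euc (n + 1) := fun p => P.ξ ((blowData h hI).ι p)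
  let D' : AdaptedChart (n + 1) (blowData h hI) t := AdaptedChart.dir h.good hI t D ht htH hjs htU
  let K := coordSet D.e D.σ I
  have heB : D.e ∈ D.B := D.e_mem (h.good.center_subset_init hI ht)
  have hdir : ∀ p, (blowData h hI).ι p ∈ P.U →
      directionalMap K j s (x p) = D.ξ (R.ι (blowSpaceMap h hI p)) := fun p hp =>
    D.directionalMap_coord hI ht htH h.good hjs hp
  let V' : Set (Euc (n + 1)) := (D'.O ∩ directionalMap K j s ⁻¹' V) ∩ liftRegion r D.e D.σ j s (x t)
  have hV'open : IsOpen V' := (D'.isOpen_O.inter (hG.isOpen.preimage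
    (contDiff_directionalMap K j s).continuous)).inter (isOpen_liftRegion _ _ _ _ _ _)
  have hd0 : ∀ z ∈ D'.O, D.dirVec I j s z ≠ 0 := fun z hz => D.dirVec_ne_zero hI htH hjs.1 s hz.1
  have hmem : x t ∈ V' := by
    refine ⟨⟨(D'.fits.ξ_mem t D'.mem).1, ?_⟩, self_mem_liftRegion _ _ _ _ _ _⟩
    change directionalMap K j s (x t) ∈ V
    rw [hdir t htU]
    exact hqV
  have hH : ∀ i ∈ {i | blowSpaceMap h hI t ∈ R.H i}, directionVec j s (x t) D.e = 0 →
      directionVec j s (x t) (D.σ i) = 0 → i ∈ {i | t ∈ (blowData h hI).H i} := by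
    intro i hi h1 h2
    exact (D.mem_blow_H_iff hI ht htH h.good hjs htU i).2
      ⟨(h.good.mem_iff_of_mem_center hI ht i).2 hi, h1, h2⟩
  have hprof : IsProfile {i | t ∈ (blowData h hI).H i} r V' fun u z => ‖D.dirVec I j s z‖ •
      directionalLift K j s z (G (liftRatio r D.e D.σ j s (x t) z u) (directionalMap K j s z)) := by
    refine hG.directionalLift hV'open (fun z hz => hz.1.2) (fun z hz => hz.2) ?_ hH
    exact ((D.smooth_dirVec j s).mono fun z hz => hz.1.1.1).norm ℝ fun z hz => hd0 z hz.1.1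
  set G' : (Fin c → ℝ) → Euc (n + 1) → Euc (n + 1) := fun u z => ‖D.dirVec I j s z‖ •
      directionalLift K j s z (G (liftRatio r D.e D.σ j s (x t) z u) (directionalMap K j s z))
    with hG'
  have hfst : ∀ z ∈ D'.O, ∀ u, (fderiv ℝ P.w z (G' u z)).1 = (z j * ‖D.dirVec I j s z‖) •
      fderiv ℝ D.w (directionalMap K j s z)
        (G (liftRatio r D.e D.σ j s (x t) z u) (directionalMap K j s z)) := by
    intro z hz u
    have hw : DifferentiableAt ℝ D.w (directionalMap K j s z) :=
      (D.smooth_w.contDiffAt (D.isOpen_O.mem_nhds hz.1)).differentiableAt (by simp)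
    have hdd := (contDiff_directionalMap K j s).differentiable (by simp) z
    rw [fderiv_fst_eq (w := fun z => D.w (directionalMap K j s z))
      ((P.smooth_w.contDiffAt (P.isOpen_O.mem_nhds hz.1)).differentiableAt (by simp))
      (fun _ => rfl), HasFDerivAt.fderiv (f := fun z => D.w (directionalMap K j s z))
      (hw.hasFDerivAt.comp z hdd.hasFDerivAt)]
    rw [ContinuousLinearMap.comp_apply, hG', map_smul, fderiv_directionalMap_directionalLift,
      map_smul, map_smul, smul_smul, mul_comm]
  have hoff : ∀ p, (blowData h hI).ι p ∈ D'.U → x p ∈ V' → blowSpaceMap h hI p ∉ R.center I →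
      p ∉ (blowData h hI).disc →
      ambientLift h hI Z p = fderiv ℝ P.w (x p) (G' (ratioVec r D.e D.σ (x p)) (x p)) := by
    intro p hp hV hC hd
    have hpP : (blowData h hI).ι p ∈ P.U := hp.1
    have hxm := (D.dirParam_fits hI ht h.good hjs).ξ_mem p hpP
    have hxj : 0 < x p j := by
      refine lt_of_le_of_ne (hxm.2 j (mem_insert _ _)) fun h0 => hC ?_
      exact (D.mem_center_iff_coord_eq_zero hI ht htH h.good hjs hpP).2 h0.symm
    refine (mfderiv_preLift h hI (D.dirParam_fits hI ht h.good hjs) hpP hC ?_).2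
    rw [mem_blowData_disc_iff h hI hC] at hd
    have h1 := hZD (blowSpaceMap h hI p) hpP.1.1.1 (by
      have := hV.1.2
      rw [mem_preimage, hdir p hpP] at this
      exact this) hd
    refine (hfst (x p) hV.1.1 _).trans ?_
    rw [blowFactor_eq h hI D ht htH hjs hpP]
    refine congrArg _ (Eq.trans ?_ h1.symm)
    have h2 := hdir p hpP
    rw [← h2]
    congr 1
    refine hG.eq _ _ _ hV.1.2 fun i hi => ?_
    have hiI : i ∈ I := (h.good.mem_iff_of_mem_center hI ht i).2 hi
    have hx0 : 0 ≤ directionVec j s (x p) D.e ∨ directionVec j s (x t) D.e ≠ 0 := by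
      left
      have h3 := (D.fits.ξ_mem _ hpP.1.1.1).2 D.e heB
      have h4 : D.ξ (R.ι (blowSpaceMap h hI p)) D.e = x p j * directionVec j s (x p) D.e := by
        rw [← h2, directionalMap_of_mem (mem_coordSet_left _ _ _)]
      have h5 : 0 ≤ x p j * directionVec j s (x p) D.e := h4 ▸ h3
      exact nonneg_of_mul_nonneg_right h5 hxj
    rcases ratioVec_directionalMap hG.pos (mem_coordSet_left D.e D.σ I)
      (mem_coordSet_of_mem D.e D.σ hiI) hV.2 hxj hx0 with h3 | h3 | h3
    · exact Or.inl h3.symm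
    · exact Or.inr (Or.inl h3.symm)
    · exact Or.inr (Or.inr h3.symm)
  have hP' : ∀ p, (blowData h hI).ι p ∈ D'.U → x p ∈ V' → p ∉ (blowData h hI).disc →
      (mfderiv (cornerModel (n + 1)) 𝓘(ℝ, E × W) (blowData h hI).ι p (lift h hI Z p) : E × W) =
        fderiv ℝ P.w (x p) (G' (ratioVec r D.e D.σ (x p)) (x p)) := by
    intro p hp hV hd
    by_cases hC : blowSpaceMap h hI p ∈ R.center I
    · have hx : ContinuousAt x p := (D'.continuousOn_coord
        (blowData_good h hI).emb.continuous).continuousAt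
          ((D'.isOpen_U.preimage (blowData_good h hI).emb.continuous).mem_nhds hp)
      refine mfderiv_lift_of_mem h hI (a := fun z => G' (ratioVec r D.e D.σ z) z)
        (D.dirParam_fits hI ht h.good hjs) hp.1 hC ?_ ?_
      · refine hprof.continuousWithinAt (fun _ => mem_insert_of_mem _ heB) hV fun h0 i hi h1 => ?_
        exact hd (ResData.mem_disc.2 ⟨i, (D'.H_iff p hp i).2 ⟨hi, h0, h1⟩⟩)
      · filter_upwards [(D'.isOpen_U.preimage (blowData_good h hI).emb.continuous).mem_nhds hp,
          hx (hV'open.mem_nhds hV),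
          (blowData_good h hI).isClosed_disc.isOpen_compl.mem_nhds hd] with p' h1 h2 h3 h4
        exact hoff p' h1 h2 h4 h3
    · rw [mfderiv_lift_of_notMem h hI hC]
      exact hoff p hp hV hC hd
  refine ⟨⟨D', V', r, G', hprof, hmem, hP'⟩, fun hd => ?_⟩
  apply h.charts.mfderiv_injective h.good.emb
  refine (mfderiv_ι_blowSpaceMap h hI t _).trans ?_
  -- On the exceptional divisor both sides of the relation vanish, since z_j = 0.
  have h0 : blowFactor h hI t = 0 := norm_eq_zero.2 ht
  have hxj : x t j = 0 := (D.mem_center_iff_coord_eq_zero hI ht htH h.good hjs htU).1 ht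
  rw [hP' t D'.mem hmem hd, hfst _ hmem.1.1, hxj, h0, zero_smul, zero_mul, zero_smul, map_zero]
  rfl

theorem hasProfile_lift {t : (blowSpace h hI).carrier}
    (hZ : S.HasProfile R Z (blowSpaceMap h hI t)) :
    (blowSpace h hI).HasProfile (blowData h hI) (lift h hI Z) t ∧
      (t ∉ (blowData h hI).disc →
        mfderiv (cornerModel (n + 1)) (cornerModel (n + 1)) (blowSpaceMap h hI) t (lift h hI Z t) =
          blowFactor h hI t • Z (blowSpaceMap h hI t)) := by
  by_cases ht : blowSpaceMap h hI t ∈ R.center I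
  · exact hasProfile_lift_of_mem h hI hZ ht
  · exact hasProfile_lift_of_notMem h hI hZ ht

end FiberedSpace

/-! ### The resolution of the discontinuity locus -/

namespace FiberedSpace

variable {c n : ℕ} {W : Type} [NormedAddCommGroup W] [InnerProductSpace ℝ W]

theorem Realizes.isPiecewiseVField {E : Type} [NormedAddCommGroup E] [NormedSpace ℝ E]
    {S : FiberedSpace n} {R : ResData c W S.carrier E} (h : S.Realizes R) {O : Set S.carrier}
    (hO : IsOpen O) {Z : S.VField} (hZ : ∀ q ∈ O, S.HasProfile R Z q)
    (ht : ∀ p ∈ O \ S.disc, mfderiv (cornerModel (n + 1)) 𝓘(ℝ, ℝ) S.proj p (Z p) = 0) :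
    S.IsPiecewiseVField O Z :=
  isPiecewiseVField_of_hasProfile h.good h.charts h.init_eq h.disc_eq hO hZ ht

/-- Along the blowings-up `b`, the foliation `F₀` lifts to a foliation which is generated by a vector
field with profiles. -/
def LiftsToProfile {E : Type} [NormedAddCommGroup E] [NormedSpace ℝ E] {S T : FiberedSpace n}
    (R : ResData c W T.carrier E) (b : BlowupSequence S T) {O : Set S.carrier}
    (F₀ : S.Foliation O) : Prop :=
  ∃ (Z : T.VField) (hO : IsOpen (b.preimage O)) (hZ : T.IsPiecewiseVField (b.preimage O) Z),
    (∀ q ∈ b.preimage O, T.HasProfile R Z q) ∧ LiftsTo F₀ b (generatedFoliation hO hZ)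

/-- The blowing-up map sends the lift to a multiple of `Z`, so the lift is again tangent to the
fibers of the projection; over the center the multiple is zero. -/
theorem LiftsToProfile.step {E : Type} [NormedAddCommGroup E] [NormedSpace ℝ E]
    {S T : FiberedSpace n} {R : ResData c W T.carrier E} {b : BlowupSequence S T}
    {O : Set S.carrier} {F₀ : S.Foliation O} (hF : LiftsToProfile R b F₀) (h : T.Realizes R)
    {I : Finset (Fin c)} (hI : R.Next I) :
    LiftsToProfile (blowData h hI)
      (.step b (blowSpaceMap h hI) (R.center I) (isBlowup_blowSpace h hI)) F₀ := by
  obtain ⟨Z, hO, hZ, hp, hl⟩ := hF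
  have hφ := contMDiff_blowSpaceMap h hI
  have hO' : IsOpen (blowSpaceMap h hI ⁻¹' b.preimage O) := hO.preimage hφ.continuous
  have hlift := fun t (ht : t ∈ blowSpaceMap h hI ⁻¹' b.preimage O) =>
    hasProfile_lift h hI (hp _ ht)
  have hC0 : ∀ t, blowSpaceMap h hI t ∈ R.center I → blowFactor h hI t = 0 := fun t ht =>
    norm_eq_zero.2 ht
  have hZ' : (blowSpace h hI).IsPiecewiseVField (blowSpaceMap h hI ⁻¹' b.preimage O)
      (lift h hI Z) := by
    refine (blowSpace_realizes h hI).isPiecewiseVField hO' (fun t ht => (hlift t ht).1) ?_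
    rintro t ⟨ht, htd⟩
    have h1 := (h.isRegularized.proj_smooth.mdifferentiable (by simp)
      (blowSpaceMap h hI t)).hasMFDerivAt.comp t
      (hφ.mdifferentiable (by simp) t).hasMFDerivAt
    have h2 : (blowSpace h hI).proj = T.proj ∘ blowSpaceMap h hI := by rw [h.proj_eq]; rfl
    rw [h2, h1.mfderiv]
    have h3 := (hlift t ht).2 htd
    change mfderiv (cornerModel (n + 1)) 𝓘(ℝ, ℝ) T.proj (blowSpaceMap h hI t)
      (mfderiv (cornerModel (n + 1)) (cornerModel (n + 1)) (blowSpaceMap h hI) t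
        (lift h hI Z t)) = 0
    rw [h3]
    by_cases hC : blowSpaceMap h hI t ∈ R.center I
    · rw [hC0 t hC, zero_smul, map_zero]
    · rw [map_smul, hZ.tangent _ ⟨ht, ?_⟩, smul_zero]
      rw [h.disc_eq]
      exact fun hm => htd ((mem_blowData_disc_iff h hI hC).2 hm)
  refine ⟨lift h hI Z, hO', hZ', fun t ht => (hlift t ht).1,
    LiftsTo.step b _ _ _ (generatedFoliation hO hZ) _ hl ?_⟩
  refine isFoliationBlowup_generatedFoliation (isBlowup_blowSpace h hI) ?_ hO hZ hO' hZ'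
    (contMDiff_blowFactor h hI) (fun t ht => norm_pos_iff.2 ht)
    fun t ht _ => (hlift t ht.1).2 ht.2
  rw [h.disc_eq]
  exact h.good.isClosed_disc

/-- A remaining set of maximal cardinality has the required property. -/
theorem exists_next {E X : Type} {R : ResData c W X E} (hR : ∃ J : Finset (Fin c), J.Nonempty ∧ J ∉ R.L) :
    ∃ I, R.Next I := by
  classical
  let s : Finset (Finset (Fin c)) := Finset.univ.filter fun J => J.Nonempty ∧ J ∉ R.L
  obtain ⟨J₀, hJ₀⟩ := hR
  obtain ⟨I, hI, hmax⟩ := s.exists_max_image Finset.card ⟨J₀, by simp [s, hJ₀]⟩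
  have hI' : I.Nonempty ∧ I ∉ R.L := by simpa [s] using hI
  refine ⟨I, hI'.1, hI'.2, fun J hJ => ?_⟩
  by_contra hJL
  have h1 := hmax J (by simp [s, hJL, hI'.1.mono hJ.subset])
  exact absurd (Finset.card_lt_card hJ) (not_lt.2 h1)

/-- The set of all components through a point of Σ is nonempty and, by `comp_not_mem`, not in `L`.
-/
theorem Realizes.disc_eq_empty {E : Type} [NormedAddCommGroup E] [NormedSpace ℝ E]
    {S : FiberedSpace n} {R : ResData c W S.carrier E} (h : S.Realizes R)
    (hL : ∀ J : Finset (Fin c), J.Nonempty → J ∈ R.L) : S.disc = ∅ := by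
  classical
  rw [h.disc_eq, eq_empty_iff_forall_notMem]
  intro p hp
  obtain ⟨i, hi⟩ := ResData.mem_disc.1 hp
  let J : Finset (Fin c) := Finset.univ.filter fun i => p ∈ R.H i
  have hJ : ∀ i, i ∈ J ↔ p ∈ R.H i := fun i => by simp [J]
  exact h.good.comp_not_mem p J ⟨i, (hJ i).2 hi⟩ hJ (hL J ⟨i, (hJ i).2 hi⟩)

/-- Induction on the number of untreated sets. The predicate `Q` carries all foliations at once, so
the sequence does not depend on the vector field or the mollifier. The space `E` varies, because
each blowing-up enlarges it to `E × W`. -/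
theorem exists_blowupSequence_of_realizes {S : FiberedSpace n}
    {Q : (O : Set S.carrier) → S.Foliation O → Prop} (k : ℕ) :
    ∀ {E : Type} [NormedAddCommGroup E] [NormedSpace ℝ E] {T : FiberedSpace n}
      {R : ResData c W T.carrier E} (b : BlowupSequence S T), T.Realizes R →
      {J | J.Nonempty ∧ J ∉ R.L}.ncard ≤ k →
      (∀ O F₀, Q O F₀ → LiftsToProfile R b F₀) →
      ∃ (E' : Type) (_ : NormedAddCommGroup E') (_ : NormedSpace ℝ E') (T' : FiberedSpace n)
        (R' : ResData c W T'.carrier E') (b' : BlowupSequence S T'), T'.disc = ∅ ∧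
        ∀ O F₀, Q O F₀ → LiftsToProfile R' b' F₀ := by
  induction k with
  | zero =>
    intro E _ _ T R b h hk hQ
    refine ⟨E, _, _, T, R, b, h.disc_eq_empty fun J hJ => ?_, hQ⟩
    rw [Nat.le_zero, ncard_eq_zero, eq_empty_iff_forall_notMem] at hk
    exact by_contra fun hL => hk J ⟨hJ, hL⟩
  | succ k ih =>
    intro E _ _ T R b h hk hQ
    by_cases hR : ∃ J : Finset (Fin c), J.Nonempty ∧ J ∉ R.L
    · obtain ⟨I, hI⟩ := exists_next hR
      refine ih (.step b (blowSpaceMap h hI) (R.center I) (isBlowup_blowSpace h hI))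
        (blowSpace_realizes h hI) ?_ fun O F₀ hF => (hQ O F₀ hF).step h hI
      have hlt : {J | J.Nonempty ∧ J ∉ (blowData h hI).L}.ncard <
          {J | J.Nonempty ∧ J ∉ R.L}.ncard := by
        refine ncard_lt_ncard ⟨fun J hJ => ⟨hJ.1, fun hL => hJ.2 (mem_insert_of_mem I hL)⟩, ?_⟩
        intro hsub
        exact (hsub ⟨hI.nonempty, hI.not_mem⟩).2 (mem_insert I R.L)
      omega
    · push Not at hR
      exact ⟨E, _, _, T, R, b, h.disc_eq_empty hR, hQ⟩

/-- A fibered space with resolution data admits a sequence of blowings-up which makes all foliations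
generated by vector fields with profiles smooth. -/
theorem Realizes.exists_resolution {E : Type} [NormedAddCommGroup E] [NormedSpace ℝ E]
    {S : FiberedSpace n} {R : ResData c W S.carrier E} (h : S.Realizes R) :
    ∃ (T : FiberedSpace n) (b : BlowupSequence S T), T.disc = ∅ ∧
      ∀ (O : Set S.carrier) (Z : S.VField), IsOpen O → (∀ q ∈ O, S.HasProfile R Z q) →
        (∀ p ∈ O \ S.disc, mfderiv (cornerModel (n + 1)) 𝓘(ℝ, ℝ) S.proj p (Z p) = 0) →
        ∃ (F₀ : S.Foliation O) (F : T.Foliation (b.preimage O)), (O, Z) ∈ F₀.gens ∧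
          LiftsTo F₀ b F ∧ ∀ G ∈ F.gens, T.SmoothOn G.2 G.1 ∧
            ∀ p ∈ G.1, mfderiv (cornerModel (n + 1)) 𝓘(ℝ, ℝ) T.proj p (G.2 p) = 0 := by
  obtain ⟨E', _, _, T, R', b, hT, hb⟩ := exists_blowupSequence_of_realizes (R := R)
    (Q := fun O F₀ => LiftsToProfile R (.refl : BlowupSequence S S) F₀) _ .refl h le_rfl
    fun O F₀ hF => hF
  refine ⟨T, b, hT, fun O Z hO hZ ht => ?_⟩
  have hp := h.isPiecewiseVField hO hZ ht
  obtain ⟨Z', hO', hZ', -, hl⟩ := hb O (generatedFoliation hO hp) ⟨Z, hO, hp, hZ, LiftsTo.refl⟩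
  refine ⟨_, _, mem_generatedFoliation_self hO hp, hl, fun G hG => ?_⟩
  have hG' := (generatedFoliation hO' hZ').piecewise G hG
  have h1 := hG'.smooth
  have h2 := hG'.tangent
  rw [hT, sdiff_empty] at h1 h2
  exact ⟨h1, h2⟩

end FiberedSpace

/-! ### Integrals depending on parameters -/

section Hadamard

/-- If `χ` is supported in `J`, a function which is smooth on `s × J` becomes smooth on all of `s × Y`
after multiplication with `χ`. -/
theorem contDiffOn_cutoff_smul {P Y F : Type} [NormedAddCommGroup P] [NormedSpace ℝ P]
    [NormedAddCommGroup Y] [NormedSpace ℝ Y] [NormedAddCommGroup F] [NormedSpace ℝ F]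
    {s : Set P} (hs : IsOpen s) {J : Set Y} (hJ : IsOpen J) {χ : Y → ℝ} (hχ : ContDiff ℝ ∞ χ)
    (hχJ : tsupport χ ⊆ J) {k : P × Y → F} (hk : ContDiffOn ℝ ∞ k (s ×ˢ J)) :
    ContDiffOn ℝ ∞ (fun q : P × Y => χ q.2 • k q) (s ×ˢ univ) := by
  rintro ⟨p, y⟩ ⟨hp, -⟩
  refine ContDiffAt.contDiffWithinAt ?_
  by_cases hy : y ∈ J
  · exact (hχ.contDiffAt.comp (p, y) contDiffAt_snd).smul
      (hk.contDiffAt ((hs.prod hJ).mem_nhds ⟨hp, hy⟩))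
  · have h1 : ∀ᶠ q : P × Y in 𝓝 (p, y), χ q.2 = 0 := by
      have h2 : ∀ᶠ y' in 𝓝 y, χ y' = 0 := by
        have := notMem_tsupport_iff_eventuallyEq.1 fun h => hy (hχJ h)
        exact this
      exact (continuous_snd.tendsto (p, y)).eventually h2
    refine (contDiffAt_const (c := (0 : F))).congr_of_eventuallyEq ?_
    filter_upwards [h1] with q hq
    rw [hq, zero_smul]

/-- The integral is the value at 0 of the convolution of the indicator function of (0, 1] with t ↦
χ(-t) k(p, -t), and convolutions with smooth kernels depend smoothly on parameters. -/
theorem contDiffOn_integral_unitInterval {P F : Type} [NormedAddCommGroup P] [NormedSpace ℝ P]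
    [NormedAddCommGroup F] [NormedSpace ℝ F] [CompleteSpace F] {s : Set P} (hs : IsOpen s)
    {k : P × ℝ → F} (hk : ContDiffOn ℝ ∞ k (s ×ˢ Ioo (-1) 2)) :
    ContDiffOn ℝ ∞ (fun p => ∫ t in (0 : ℝ)..1, k (p, t)) s := by
  -- Equal to 1 on [0, 1], with support [-1/2, 3/2] inside (-1, 2).
  let χ : ContDiffBump (1 / 2 : ℝ) := ⟨1 / 2, 1, by norm_num, by norm_num⟩
  have hball : tsupport χ ⊆ Ioo (-1) 2 := by
    rw [χ.tsupport_eq]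
    intro t ht
    rw [Metric.mem_closedBall, Real.dist_eq, abs_le] at ht
    have h1 : χ.rOut = 1 := rfl
    rw [h1] at ht
    exact ⟨by linarith [ht.1], by linarith [ht.2]⟩
  let f : ℝ → ℝ := indicator (Ioc 0 1) fun _ => 1
  let g : P → ℝ → F := fun p t => χ (-t) • k (p, -t)
  have hf : LocallyIntegrable f volume :=
    ((integrable_indicator_iff measurableSet_Ioc).2 (integrableOn_const (by simp))).locallyIntegrable
  have hneg : ContDiff ℝ ∞ fun q : P × ℝ => (q.1, -q.2) := contDiff_fst.prodMk contDiff_snd.neg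
  have hg : ContDiffOn ℝ ∞ ↿g (s ×ˢ univ) :=
    (contDiffOn_cutoff_smul hs isOpen_Ioo χ.contDiff hball hk).comp hneg.contDiffOn
      fun q hq => ⟨hq.1, mem_univ _⟩
  have hgs : ∀ p, ∀ t, p ∈ s → t ∉ Icc (-2 : ℝ) 1 → g p t = 0 := by
    intro p t _ ht
    have : -t ∉ tsupport χ := by
      intro h
      have := hball h
      exact ht ⟨by linarith [this.2], by linarith [this.1]⟩
    simp only [g, image_eq_zero_of_notMem_tsupport this, zero_smul]
  have h := contDiffOn_convolution_right_with_param_comp (n := ⊤) (μ := volume)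
    (ContinuousLinearMap.lsmul ℝ ℝ : ℝ →L[ℝ] F →L[ℝ] F) (v := fun _ : P => (0 : ℝ))
    contDiffOn_const hs isCompact_Icc hgs hf hg
  refine h.congr fun p _ => ?_
  rw [convolution_def, intervalIntegral.integral_of_le zero_le_one,
    ← integral_indicator measurableSet_Ioc]
  congr 1
  ext t
  by_cases ht : t ∈ Ioc (0 : ℝ) 1
  · have h1 : χ t = 1 := by
      refine χ.one_of_mem_closedBall ?_
      have h1 : χ.rIn = 1 / 2 := rfl
      rw [Metric.mem_closedBall, Real.dist_eq, abs_le, h1]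
      exact ⟨by linarith [ht.1], by linarith [ht.2]⟩
    simp [f, g, ht, h1]
  · simp [f, ht]

variable {E F : Type} [NormedAddCommGroup E] [NormedSpace ℝ E] [NormedAddCommGroup F]
  [NormedSpace ℝ F]

/-- The difference quotient `(h y - h (y - ε τ)) / ε`, smoothly extended to `ε = 0`. -/
def diffQuot (h : E → F) (a : E × ℝ × E) : F :=
  ∫ t in (0 : ℝ)..1, fderiv ℝ h (a.1 - (t * a.2.1) • a.2.2) a.2.2

/-- The points at which the difference quotients of functions on a ball are defined. -/
def diffQuotDomain (E : Type) [NormedAddCommGroup E] (ρ : ℝ) : Set (E × ℝ × E) :=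
  -- The factor 2 leaves room for t ∈ (-1, 2), an open neighbourhood of the interval of integration.
  {a | ‖a.1‖ + 2 * (|a.2.1| * ‖a.2.2‖) < ρ}

theorem isOpen_diffQuotDomain (ρ : ℝ) : IsOpen (diffQuotDomain E ρ) :=
  isOpen_lt (by fun_prop) continuous_const

theorem sub_smul_mem_ball {ρ : ℝ} {a : E × ℝ × E} (ha : a ∈ diffQuotDomain E ρ) {t : ℝ}
    (ht : |t| ≤ 2) : a.1 - (t * a.2.1) • a.2.2 ∈ Metric.ball (0 : E) ρ := by
  rw [mem_ball_zero_iff]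
  have h1 : ‖(t * a.2.1) • a.2.2‖ ≤ 2 * (|a.2.1| * ‖a.2.2‖) := by
    rw [norm_smul, norm_mul, mul_assoc, Real.norm_eq_abs, Real.norm_eq_abs]
    exact mul_le_mul_of_nonneg_right ht (by positivity)
  exact ((norm_sub_le _ _).trans (by gcongr)).trans_lt ha

theorem contDiffOn_diffQuot [CompleteSpace F] {h : E → F} {ρ : ℝ}
    (hh : ContDiffOn ℝ ∞ h (Metric.ball 0 ρ)) :
    ContDiffOn ℝ ∞ (diffQuot h) (diffQuotDomain E ρ) := by
  refine contDiffOn_integral_unitInterval (P := E × ℝ × E) (isOpen_diffQuotDomain ρ)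
    (k := fun q : (E × ℝ × E) × ℝ => fderiv ℝ h (q.1.1 - (q.2 * q.1.2.1) • q.1.2.2) q.1.2.2) ?_
  have h1 := hh.fderiv_of_isOpen Metric.isOpen_ball (m := ∞) (by simp)
  refine ContDiffOn.clm_apply (h1.comp (by fun_prop) ?_) (by fun_prop)
  rintro ⟨a, t⟩ ⟨ha, ht⟩
  exact sub_smul_mem_ball ha (abs_le.2 ⟨by linarith [ht.1], by linarith [ht.2]⟩)

/-- The fundamental theorem of calculus on the segment from y to y - ετ. -/
theorem smul_diffQuot [CompleteSpace F] {h : E → F} {ρ : ℝ}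
    (hh : ContDiffOn ℝ ∞ h (Metric.ball 0 ρ)) {y τ : E} {ε : ℝ}
    (ha : (y, ε, τ) ∈ diffQuotDomain E ρ) :
    ε • diffQuot h (y, ε, τ) = h y - h (y - ε • τ) := by
  have hder : ∀ t ∈ uIcc (0 : ℝ) 1, HasDerivAt (fun t : ℝ => h (y - (t * ε) • τ))
      (-(ε • fderiv ℝ h (y - (t * ε) • τ) τ)) t := by
    intro t ht
    rw [uIcc_of_le zero_le_one] at ht
    have hm := sub_smul_mem_ball ha (t := t) (abs_le.2 ⟨by linarith [ht.1], by linarith [ht.2]⟩)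
    have h1 := ((hh.contDiffAt (Metric.isOpen_ball.mem_nhds hm)).differentiableAt
      (by simp)).hasFDerivAt
    have h2 : HasDerivAt (fun t : ℝ => y - (t * ε) • τ) (-(ε • τ)) t := by
      have h3 : HasDerivAt (fun t : ℝ => t * ε) ε t := by
        simpa using (hasDerivAt_id t).mul_const ε
      exact (h3.smul_const τ).const_sub y
    have h4 := h1.comp_hasDerivAt t h2
    simp only [map_neg, map_smul] at h4
    exact h4
  have hc : ContinuousOn (fun t : ℝ => -(ε • fderiv ℝ h (y - (t * ε) • τ) τ)) (uIcc 0 1) := by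
    have h1 := (hh.fderiv_of_isOpen Metric.isOpen_ball (m := ∞) (by simp)).continuousOn
    refine ContinuousOn.neg (continuousOn_const.smul (ContinuousOn.clm_apply
      (h1.comp (by fun_prop) fun t ht => ?_) continuousOn_const))
    rw [uIcc_of_le zero_le_one] at ht
    exact sub_smul_mem_ball ha (t := t) (abs_le.2 ⟨by linarith [ht.1], by linarith [ht.2]⟩)
  have h1 := intervalIntegral.integral_eq_sub_of_hasDerivAt hder hc.intervalIntegrable
  rw [intervalIntegral.integral_neg, intervalIntegral.integral_smul] at h1
  simp only [one_mul, zero_mul, zero_smul, sub_zero] at h1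
  rw [diffQuot, ← neg_sub, ← h1, neg_neg]

theorem diffQuot_zero [CompleteSpace F] (h : E → F) (y τ : E) :
    diffQuot h (y, 0, τ) = fderiv ℝ h y τ := by
  simp [diffQuot]

end Hadamard

/-! ### Vector-valued defining functions of hypersurfaces -/

section DefiningFunction

/-- The Hilbert space of square summable functions on `M` and an additional point. -/
abbrev SquareSummable {n : ℕ} (M : Set (Euc n)) : Type := lp (fun _ : Option M => ℝ) 2

/-- Passes from the open submanifold M, where the partition of unity lives, to functions on ℝ^n with
Fréchet derivatives. -/
theorem exists_extension_of_contMDiff {n : ℕ} {M : TopologicalSpace.Opens (Euc n)} {F : Type}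
    [NormedAddCommGroup F] [NormedSpace ℝ F] {f : M → F}
    (hf : ContMDiff 𝓘(ℝ, Euc n) 𝓘(ℝ, F) ∞ f) :
    ∃ g : Euc n → F, (∀ q : M, g q = f q) ∧ ∀ q ∈ M, ContDiffAt ℝ ∞ g q := by
  classical
  let g : Euc n → F := fun q => if h : q ∈ M then f ⟨q, h⟩ else 0
  have hg : ∀ q : M, g q = f q := fun q => by simp [g]
  refine ⟨g, hg, fun q hq => ?_⟩
  have h1 : ContMDiffAt 𝓘(ℝ, Euc n) 𝓘(ℝ, F) ∞ (fun x : M => g x) ⟨q, hq⟩ := by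
    refine (hf ⟨q, hq⟩).congr_of_eventuallyEq (Filter.Eventually.of_forall fun x => ?_)
    exact hg x
  exact (contMDiffAt_subtype_iff.1 h1).contDiffAt

/-- A closed subset of `M` which is locally the regular zero set of a smooth function is globally the
regular zero set of a smooth vector-valued function. -/
theorem exists_definingFunction {n : ℕ} {M H : Set (Euc n)} (hM : IsOpen M)
    (hH : ∀ p ∈ M, ∃ (U : Set (Euc n)) (g : Euc n → ℝ), IsOpen U ∧ p ∈ U ∧ U ⊆ M ∧
      ContDiffOn ℝ ∞ g U ∧ (∀ q ∈ U, g q = 0 ↔ q ∈ H) ∧ ∀ q ∈ U, q ∈ H → fderiv ℝ g q ≠ 0) :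
    ∃ h : Euc n → SquareSummable M, ContDiffOn ℝ ∞ h M ∧ (∀ q ∈ M, h q = 0 ↔ q ∈ H) ∧
      ∀ q ∈ M, q ∈ H → fderiv ℝ h q ≠ 0 := by
  classical
  choose! U g hU hpU hUM hg hgz hgd using hH
  let Mo : TopologicalSpace.Opens (Euc n) := ⟨M, hM⟩
  have : LocallyCompactSpace Mo := hM.locallyCompactSpace
  obtain ⟨ρ, hρ⟩ := SmoothPartitionOfUnity.exists_isSubordinate 𝓘(ℝ, Euc n) (s := (univ : Set Mo))
    isClosed_univ (fun p : M => Subtype.val ⁻¹' U p)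
    (fun p => (hU p p.2).preimage continuous_subtype_val)
    (fun p _ => mem_iUnion.2 ⟨p, hpU p.1 p.2⟩)
  let E : M → SquareSummable M := fun p => lp.single 2 (some p) (1 : ℝ)
  -- Local equations of H agree only up to factors of either sign, so their sum in ℝ could
  -- degenerate. The orthonormal vectors E_p keep them apart: the p-th component of f is ρ_p g_p.
  let f : Mo → SquareSummable M := fun q => ∑ᶠ p : M, ρ p q • g p q • E p
  have hρU : ∀ p : M, ∀ q : Mo, ρ p q ≠ 0 → q.1 ∈ U p := fun p q hq =>
    hρ p (subset_tsupport _ hq)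
  have hf : ContMDiff 𝓘(ℝ, Euc n) 𝓘(ℝ, SquareSummable M) ∞ f := by
    refine ρ.contMDiff_finsum_smul fun p q hq => ?_
    have hqU : q.1 ∈ U p := hρ p hq
    have h1 : ContDiffAt ℝ ∞ (fun q => g p q • E p) q.1 :=
      ((hg p p.2).contDiffAt ((hU p p.2).mem_nhds hqU)).smul contDiffAt_const
    exact (contMDiffAt_subtype_iff (U := Mo) (x := q)).2 h1.contMDiffAt
  have hcomp : ∀ (p : M) (q : Mo), inner ℝ (E p) (f q) = ρ p q * g p q := by
    intro p q
    have hfin : (Function.support fun p : M => ρ p q • g p q • E p).Finite := by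
      refine (ρ.locallyFinite.point_finite q).subset fun p hp => ?_
      exact fun h => hp (by simp [h])
    have h1 := (innerSL ℝ (E p)).toLinearMap.toAddMonoidHom.map_finsum hfin
    refine Eq.trans (b := ρ p q • g p q • inner ℝ (E p) (E p)) (h1.trans ?_) ?_
    · refine Eq.trans (finsum_eq_single _ p fun p' hp' => ?_) ?_
      · change inner ℝ (E p) (ρ p' q • g p' q • E p') = 0
        simp only [E]
        rw [lp.inner_single_left]
        simp [lp.single_apply, Ne.symm hp']
      · change inner ℝ (E p) (ρ p q • g p q • E p) = _
        rw [inner_smul_right, inner_smul_right]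
        rfl
    · simp only [E]
      rw [lp.inner_single_left]
      simp
  obtain ⟨h, hh1, hh2⟩ := exists_extension_of_contMDiff hf
  have hex : ∀ q : Mo, ∃ p : M, ρ p q ≠ 0 := fun q =>
    (ρ.exists_pos_of_mem (mem_univ q)).imp fun _ hp => hp.ne'
  refine ⟨h, fun q hq => (hh2 q hq).contDiffWithinAt, fun q hq => ?_, fun q hq hqH h0 => ?_⟩
  · rw [hh1 ⟨q, hq⟩]
    constructor
    · intro h0
      obtain ⟨p, hp⟩ := hex ⟨q, hq⟩
      have h1 := hcomp p ⟨q, hq⟩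
      rw [h0, inner_zero_right] at h1
      exact (hgz p p.2 q (hρU p _ hp)).1 ((mul_eq_zero.1 h1.symm).resolve_left hp)
    · intro hqH
      refine finsum_eq_zero_of_forall_eq_zero fun p => ?_
      by_cases hp : ρ p ⟨q, hq⟩ = 0
      · rw [hp, zero_smul]
      · have := (hgz p p.2 q (hρU p _ hp)).2 hqH
        change _ • g p q • _ = _
        rw [this, zero_smul, smul_zero]
  · obtain ⟨p, hp⟩ := hex ⟨q, hq⟩
    have hqU := hρU p _ hp
    obtain ⟨r, hr1, hr2⟩ := exists_extension_of_contMDiff (ρ p).contMDiff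
    have d1 : HasFDerivAt r (fderiv ℝ r q) q :=
      ((hr2 q hq).differentiableAt (by simp)).hasFDerivAt
    have d2 : HasFDerivAt (g p) (fderiv ℝ (g p) q) q :=
      (((hg p p.2).contDiffAt ((hU p p.2).mem_nhds hqU)).differentiableAt (by simp)).hasFDerivAt
    have d3 : HasFDerivAt h (fderiv ℝ h q) q :=
      ((hh2 q hq).differentiableAt (by simp)).hasFDerivAt
    -- At a point of H the p-th component of the derivative is ρ_p Dg_p, because g_p = 0 there; it
    -- is nonzero if ρ_p is.
    have d4 := (innerSL ℝ (E p)).hasFDerivAt.comp q d3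
    have d5 := (d1.mul d2).congr_of_eventuallyEq (f₁ := innerSL ℝ (E p) ∘ h) (by
      filter_upwards [hM.mem_nhds hq] with q' hq'
      change inner ℝ (E p) (h q') = r q' * g p q'
      rw [hh1 ⟨q', hq'⟩, hcomp p ⟨q', hq'⟩, hr1 ⟨q', hq'⟩])
    have d6 := d4.unique d5
    rw [h0, (hgz p p.2 q hqU).2 hqH, ContinuousLinearMap.comp_zero, zero_smul, add_zero] at d6
    have d7 : r q ≠ 0 := by rw [hr1 ⟨q, hq⟩]; exact hp
    exact hgd p p.2 q hqU hqH ((smul_eq_zero.1 d6.symm).resolve_left d7)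

end DefiningFunction

/-! ### Normal crossings coordinates -/

section Crossing

/-- Coordinates centered at `p` on a neighborhood of `p` in `M`, with values in a ball, in which the
components `H i` through `p` are coordinate hyperplanes. -/
structure CrossingChart {n c : ℕ} (M : Set (Euc n)) (H : Fin c → Set (Euc n)) (p : Euc n) where
  x : OpenPartialHomeomorph (Euc n) (Euc n)
  σ : {i // p ∈ H i} ↪ Fin n
  ρ : ℝ
  pos : 0 < ρ
  -- A ball is convex, so its intersections with sign sectors are connected.
  target_eq : x.target = Metric.ball 0 ρ
  mem : p ∈ x.source
  map_eq : x p = 0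
  subset : x.source ⊆ M
  smooth : ContDiffOn ℝ ∞ x x.source
  smooth_symm : ContDiffOn ℝ ∞ x.symm (Metric.ball 0 ρ)
  mem_iff : ∀ q ∈ x.source, ∀ i, q ∈ H i ↔ ∃ hi : p ∈ H i, x q (σ ⟨i, hi⟩) = 0

variable {n c : ℕ} {M : Set (Euc n)} {H : Fin c → Set (Euc n)} {p : Euc n}

/-- Restriction of coordinates to the preimage of a ball. -/
theorem CrossingChart.exists_of_ball_subset (x : OpenPartialHomeomorph (Euc n) (Euc n))
    (σ : {i // p ∈ H i} ↪ Fin n) (hp : p ∈ x.source) (hx : x.source ⊆ M) (h0 : x p = 0)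
    (h1 : ContDiffOn ℝ ∞ x x.source) (h2 : ContDiffOn ℝ ∞ x.symm x.target)
    (h3 : ∀ q ∈ x.source, ∀ i, q ∈ H i ↔ ∃ hi : p ∈ H i, x q (σ ⟨i, hi⟩) = 0) {ρ : ℝ}
    (hρ : 0 < ρ) (hb : Metric.ball 0 ρ ⊆ x.target) :
    ∃ D : CrossingChart M H p, D.ρ = ρ ∧ D.x.symm = (x.symm : Euc n → Euc n) ∧ D.σ = σ := by
  let y := (x.symm.restrOpen (Metric.ball 0 ρ) Metric.isOpen_ball).symm
  have hs : y.source = x.source ∩ x ⁻¹' Metric.ball 0 ρ := by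
    ext q
    simp [y, OpenPartialHomeomorph.restrOpen]
  have ht : y.target = Metric.ball 0 ρ := by
    change x.target ∩ Metric.ball 0 ρ = _
    exact inter_eq_right.2 hb
  have hs' : y.source ⊆ x.source := hs ▸ inter_subset_left
  refine ⟨⟨y, σ, ρ, hρ, ht, ?_, h0, hs'.trans hx, h1.mono hs', h2.mono hb,
    fun q hq => h3 q (hs' hq)⟩, rfl, rfl, rfl⟩
  rw [hs]
  refine ⟨hp, ?_⟩
  rw [mem_preimage, h0]
  exact Metric.mem_ball_self hρ

theorem exists_crossingChart
    (h : ∃ (x : OpenPartialHomeomorph (Euc n) (Euc n)) (σ : {i // p ∈ H i} ↪ Fin n),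
      p ∈ x.source ∧ x.source ⊆ M ∧ x p = 0 ∧
      ContDiffOn ℝ ∞ x x.source ∧ ContDiffOn ℝ ∞ x.symm x.target ∧
      (∀ i, ∀ q ∈ x.source, q ∈ H i.1 ↔ x q (σ i) = 0) ∧
      (∀ i, p ∉ H i → Disjoint (H i) x.source)) : Nonempty (CrossingChart M H p) := by
  obtain ⟨x, σ, hp, hx, h0, h1, h2, h3, h4⟩ := h
  obtain ⟨ρ, hρ, hb⟩ := Metric.isOpen_iff.1 x.open_target 0 (h0 ▸ x.map_source hp)
  refine (CrossingChart.exists_of_ball_subset x σ hp hx h0 h1 h2 (fun q hq i => ?_) hρ hb).nonempty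
  by_cases hi : p ∈ H i
  · rw [h3 ⟨i, hi⟩ q hq]
    exact ⟨fun h => ⟨hi, h⟩, fun ⟨_, h⟩ => h⟩
  · exact ⟨fun h => (disjoint_left.1 (h4 i hi) h hq).elim, fun ⟨h, _⟩ => (hi h).elim⟩

namespace CrossingChart

theorem exists_shrink (D : CrossingChart M H p) {ρ : ℝ} (hρ : 0 < ρ) (hle : ρ ≤ D.ρ) :
    ∃ D' : CrossingChart M H p, D'.ρ = ρ ∧ D'.x.symm = (D.x.symm : Euc n → Euc n) ∧ D'.σ = D.σ :=
  exists_of_ball_subset D.x D.σ D.mem D.subset D.map_eq D.smooth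
    (D.target_eq ▸ D.smooth_symm) D.mem_iff hρ (D.target_eq ▸ Metric.ball_subset_ball hle)

theorem symm_mem (D : CrossingChart M H p) {y : Euc n} (hy : y ∈ Metric.ball 0 D.ρ) :
    D.x.symm y ∈ D.x.source := D.x.map_target (D.target_eq ▸ hy)

theorem right_inv (D : CrossingChart M H p) {y : Euc n} (hy : y ∈ Metric.ball 0 D.ρ) :
    D.x (D.x.symm y) = y := D.x.right_inv (D.target_eq ▸ hy)

theorem map_mem (D : CrossingChart M H p) {q : Euc n} (hq : q ∈ D.x.source) :
    D.x q ∈ Metric.ball 0 D.ρ := D.target_eq ▸ D.x.map_source hq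

theorem symm_zero (D : CrossingChart M H p) : D.x.symm 0 = p := by
  rw [← D.map_eq, D.x.left_inv D.mem]

theorem symm_mem_iff (D : CrossingChart M H p) {y : Euc n} (hy : y ∈ Metric.ball 0 D.ρ)
    (i : Fin c) : D.x.symm y ∈ H i ↔ ∃ hi : p ∈ H i, y (D.σ ⟨i, hi⟩) = 0 := by
  rw [D.mem_iff _ (D.symm_mem hy), D.right_inv hy]

theorem hasFDerivAt (D : CrossingChart M H p) {q : Euc n} (hq : q ∈ D.x.source) :
    HasFDerivAt D.x (fderiv ℝ D.x q) q :=
  ((D.smooth.contDiffAt (D.x.open_source.mem_nhds hq)).differentiableAt (by simp)).hasFDerivAt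

theorem hasFDerivAt_symm (D : CrossingChart M H p) {y : Euc n} (hy : y ∈ Metric.ball 0 D.ρ) :
    HasFDerivAt D.x.symm (fderiv ℝ D.x.symm y) y :=
  ((D.smooth_symm.contDiffAt (Metric.isOpen_ball.mem_nhds hy)).differentiableAt
    (by simp)).hasFDerivAt

theorem fderiv_comp_symm (D : CrossingChart M H p) {y : Euc n} (hy : y ∈ Metric.ball 0 D.ρ) :
    (fderiv ℝ D.x (D.x.symm y)).comp (fderiv ℝ D.x.symm y) = ContinuousLinearMap.id ℝ (Euc n) := by
  have h1 := (D.hasFDerivAt (D.symm_mem hy)).comp y (D.hasFDerivAt_symm hy)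
  refine h1.unique ((hasFDerivAt_id y).congr_of_eventuallyEq ?_)
  filter_upwards [Metric.isOpen_ball.mem_nhds hy] with z hz using D.right_inv hz

theorem fderiv_symm_comp (D : CrossingChart M H p) {y : Euc n} (hy : y ∈ Metric.ball 0 D.ρ) :
    (fderiv ℝ D.x.symm y).comp (fderiv ℝ D.x (D.x.symm y)) = ContinuousLinearMap.id ℝ (Euc n) := by
  have h2 := D.hasFDerivAt_symm hy
  have h3 : D.x (D.x.symm y) = y := D.right_inv hy
  have h1 := HasFDerivAt.comp (g := D.x.symm) (g' := fderiv ℝ D.x.symm y) (D.x.symm y)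
    (by rw [h3]; exact h2) (D.hasFDerivAt (D.symm_mem hy))
  refine h1.unique ((hasFDerivAt_id _).congr_of_eventuallyEq ?_)
  filter_upwards [D.x.open_source.mem_nhds (D.symm_mem hy)] with z hz using D.x.left_inv hz

theorem fderiv_coord_ne_zero (D : CrossingChart M H p) {q : Euc n} (hq : q ∈ D.x.source)
    (l : Fin n) : fderiv ℝ (fun q' => D.x q' l) q ≠ 0 := by
  have h1 : HasFDerivAt (fun q' => D.x q' l)
      ((EuclideanSpace.proj l : Euc n →L[ℝ] ℝ).comp (fderiv ℝ D.x q)) q :=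
    (EuclideanSpace.proj l : Euc n →L[ℝ] ℝ).hasFDerivAt.comp q (D.hasFDerivAt hq)
  rw [h1.fderiv]
  intro h0
  have h2 := D.fderiv_comp_symm (D.map_mem hq)
  rw [D.x.left_inv hq] at h2
  have h3 := congrArg (fun L : Euc n →L[ℝ] Euc n => L (EuclideanSpace.single l 1) l) h2
  have h4 := congrArg (fun L : Euc n →L[ℝ] ℝ =>
    L (fderiv ℝ D.x.symm (D.x q) (EuclideanSpace.single l 1))) h0
  have h5 : fderiv ℝ D.x q (fderiv ℝ D.x.symm (D.x q) (EuclideanSpace.single l 1)) l = 0 := h4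
  have h6 : fderiv ℝ D.x q (fderiv ℝ D.x.symm (D.x q) (EuclideanSpace.single l 1)) l = 1 := by
    simpa using h3
  rw [h5] at h6
  exact zero_ne_one h6

end CrossingChart

/-- The components of a normal crossings variety have smooth regular vector-valued defining
functions. -/
theorem exists_definingFunctions (hM : IsOpen M) (hH : ∀ i, IsOpen (M \ H i))
    (hD : ∀ p ∈ M, Nonempty (CrossingChart M H p)) :
    ∃ h : Fin c → Euc n → SquareSummable M, ∀ i, ContDiffOn ℝ ∞ (h i) M ∧
      (∀ q ∈ M, h i q = 0 ↔ q ∈ H i) ∧ ∀ q ∈ M, q ∈ H i → fderiv ℝ (h i) q ≠ 0 := by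
  have : ∀ i, ∃ h : Euc n → SquareSummable M, ContDiffOn ℝ ∞ h M ∧
      (∀ q ∈ M, h q = 0 ↔ q ∈ H i) ∧ ∀ q ∈ M, q ∈ H i → fderiv ℝ h q ≠ 0 := by
    intro i
    refine exists_definingFunction hM fun p hp => ?_
    by_cases hi : p ∈ H i
    · obtain ⟨D⟩ := hD p hp
      refine ⟨D.x.source, fun q => D.x q (D.σ ⟨i, hi⟩), D.x.open_source, D.mem, D.subset,
        ?_, fun q hq => ?_, fun q hq _ => D.fderiv_coord_ne_zero hq _⟩
      · exact (contDiffOn_euclidean.1 D.smooth) _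
      · rw [D.mem_iff q hq]
        exact ⟨fun h => ⟨hi, h⟩, fun ⟨_, h⟩ => h⟩
    · refine ⟨M \ H i, fun _ => 1, hH i, ⟨hp, hi⟩, sdiff_subset, contDiffOn_const, fun q hq => ?_,
        fun q hq hqH => (hq.2 hqH).elim⟩
      simp [hq.2]
  choose h hh using this
  exact ⟨h, hh⟩

/-- In normal crossings coordinates, a regular defining function of the hyperplane `y_l = 0` is the
product of `y_l` with a nonvanishing function. -/
theorem CrossingChart.diffQuot_ne_zero (D : CrossingChart M H p) {F : Type} [NormedAddCommGroup F]
    [NormedSpace ℝ F] [CompleteSpace F] {h : Euc n → F} (hM : IsOpen M) (hh : ContDiffOn ℝ ∞ h M)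
    {i : Fin c} (hi : p ∈ H i) (hz : ∀ q ∈ M, q ∈ H i → h q = 0) (hd : fderiv ℝ h p ≠ 0) :
    diffQuot (h ∘ D.x.symm) (0, 0, EuclideanSpace.single (D.σ ⟨i, hi⟩) 1) ≠ 0 := by
  have hpM : p ∈ M := D.subset D.mem
  have h0 : (0 : Euc n) ∈ Metric.ball (0 : Euc n) D.ρ := Metric.mem_ball_self D.pos
  rw [diffQuot_zero]
  have h1 : HasFDerivAt (h ∘ D.x.symm) ((fderiv ℝ h p).comp (fderiv ℝ D.x.symm 0)) 0 := by
    refine HasFDerivAt.comp 0 ?_ (D.hasFDerivAt_symm h0)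
    rw [D.symm_zero]
    exact ((hh.contDiffAt (hM.mem_nhds hpM)).differentiableAt (by simp)).hasFDerivAt
  intro h2
  set l := D.σ ⟨i, hi⟩
  -- As h vanishes on the hyperplane y_l = 0, its derivatives at 0 along the other axes are zero. If
  -- the one along the l-axis were zero too, then Dh would vanish at p.
  have h3 : ∀ k ≠ l, fderiv ℝ (h ∘ D.x.symm) 0 (EuclideanSpace.single k 1) = 0 := by
    intro k hk
    have h4 : HasDerivAt (fun t : ℝ => t • (EuclideanSpace.single k (1 : ℝ) : Euc n))
        (EuclideanSpace.single k (1 : ℝ) : Euc n) 0 := by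
      simpa using (hasDerivAt_id (0 : ℝ)).smul_const (EuclideanSpace.single k (1 : ℝ) : Euc n)
    have h5 := HasFDerivAt.comp_hasDerivAt (f := fun t : ℝ =>
      t • (EuclideanSpace.single k (1 : ℝ) : Euc n)) 0 (by rw [zero_smul]; exact h1) h4
    have h6 := h5.unique ((hasDerivAt_const (0 : ℝ) (0 : F)).congr_of_eventuallyEq ?_)
    · rw [h1.fderiv]; exact h6
    · have h7 : ∀ᶠ t : ℝ in 𝓝 0, t • (EuclideanSpace.single k (1 : ℝ) : Euc n) ∈
          Metric.ball (0 : Euc n) D.ρ := by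
        have hc : Continuous fun t : ℝ => t • (EuclideanSpace.single k (1 : ℝ) : Euc n) := by
          fun_prop
        refine hc.continuousAt.eventually (Metric.isOpen_ball.mem_nhds ?_)
        simpa using h0
      filter_upwards [h7] with t ht
      refine hz _ (D.subset (D.symm_mem ht)) ((D.symm_mem_iff ht i).2 ⟨hi, ?_⟩)
      change (t • (EuclideanSpace.single k (1 : ℝ) : Euc n)) l = 0
      simp [Ne.symm hk]
  have h4 : fderiv ℝ (h ∘ D.x.symm) 0 = 0 := by
    apply ContinuousLinearMap.coe_injective
    refine (EuclideanSpace.basisFun (Fin n) ℝ).toBasis.ext fun k => ?_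
    simp only [OrthonormalBasis.coe_toBasis, EuclideanSpace.basisFun_apply]
    by_cases hk : k = l
    · rw [hk]; exact h2
    · exact h3 k hk
  refine hd ?_
  have h5 := D.fderiv_symm_comp h0
  rw [D.symm_zero] at h5
  rw [h1.fderiv] at h4
  rw [← ContinuousLinearMap.comp_id (fderiv ℝ h p), ← h5, ← ContinuousLinearMap.comp_assoc, h4,
    ContinuousLinearMap.zero_comp]

end Crossing

/-! ### Orthogonal sums -/

section Slot

variable {κ V : Type} [Fintype κ] [DecidableEq κ] [NormedAddCommGroup V] [InnerProductSpace ℝ V]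

/-- The inclusion of a summand in the orthogonal sum of copies of `V`. -/
def slot (κ V : Type) [Fintype κ] [DecidableEq κ] [NormedAddCommGroup V] [InnerProductSpace ℝ V]
    (o : κ) : V →L[ℝ] PiLp 2 fun _ : κ => V :=
  ((PiLp.continuousLinearEquiv 2 ℝ fun _ : κ => V).symm : (κ → V) →L[ℝ] PiLp 2 fun _ : κ => V).comp
    (ContinuousLinearMap.single ℝ (fun _ : κ => V) o)

theorem slot_apply (o o' : κ) (v : V) : slot κ V o v o' = if o' = o then v else 0 := by
  change (Pi.single o v : κ → V) o' = _
  rw [Pi.single_apply]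

theorem inner_slot_slot {o o' : κ} (h : o ≠ o') (v v' : V) :
    inner ℝ (slot κ V o v) (slot κ V o' v') = 0 := by
  rw [PiLp.inner_apply]
  refine Finset.sum_eq_zero fun k _ => ?_
  rw [slot_apply, slot_apply]
  by_cases h1 : k = o
  · rw [if_neg fun h2 => h (h1.symm.trans h2), inner_zero_right]
  · rw [if_neg h1, inner_zero_left]

theorem slot_ne_zero (o : κ) {v : V} (hv : v ≠ 0) : slot κ V o v ≠ 0 := by
  intro h
  have h1 := congrArg (fun x : PiLp 2 fun _ : κ => V => x o) h
  have h2 := slot_apply o o v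
  rw [if_pos rfl] at h2
  exact hv (h2.symm.trans h1)

end Slot

/-! ### Products of charts with the half-line -/

section Split

/-- Separates the last coordinate. -/
def splitEuc (n : ℕ) : Euc (n + 1) ≃L[ℝ] Euc n × ℝ :=
  LinearEquiv.toContinuousLinearEquiv
    { toFun := fun y => (WithLp.toLp 2 fun i => y i.castSucc, y (Fin.last n))
      invFun := fun q => WithLp.toLp 2 (Fin.snoc (α := fun _ => ℝ) q.1 q.2)
      left_inv := by
        intro y
        ext i
        refine Fin.lastCases ?_ (fun j => ?_) i <;> simp
      right_inv := by
        intro q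
        refine Prod.ext ?_ ?_
        · ext i; simp
        · simp
      map_add' := fun _ _ => rfl
      map_smul' := fun _ _ => rfl }

variable {n : ℕ}

theorem splitEuc_fst (y : Euc (n + 1)) (i : Fin n) : (splitEuc n y).1 i = y i.castSucc := rfl

theorem splitEuc_snd (y : Euc (n + 1)) : (splitEuc n y).2 = y (Fin.last n) := rfl

theorem splitEuc_symm_last (q : Euc n × ℝ) : (splitEuc n).symm q (Fin.last n) = q.2 := by
  rw [← splitEuc_snd, ContinuousLinearEquiv.apply_symm_apply]

theorem splitEuc_symm_castSucc (q : Euc n × ℝ) (i : Fin n) :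
    (splitEuc n).symm q i.castSucc = q.1 i := by
  rw [← splitEuc_fst, ContinuousLinearEquiv.apply_symm_apply]

/-- The set consisting of the index of the last coordinate if `ε₀ = 0`. -/
def lastIndex (n : ℕ) (ε₀ : ℝ) : Set (Fin (n + 1)) := {i | i = Fin.last n ∧ ε₀ = 0}

/-- A neighborhood of `ε₀ ≥ 0` which contains no nonpositive numbers if `ε₀ > 0`. -/
def lastRange (ε₀ : ℝ) : Set ℝ := {t | ε₀ = 0 ∨ 0 < t}

theorem isOpen_lastRange (ε₀ : ℝ) : IsOpen (lastRange ε₀) := by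
  by_cases h : ε₀ = 0
  · simp [lastRange, h]
  · simp only [lastRange, h, false_or]
    exact isOpen_Ioi

theorem mem_cornerSet_lastIndex {ε₀ : ℝ} {y : Euc (n + 1)} (hy : y (Fin.last n) ∈ lastRange ε₀) :
    y ∈ cornerSet (lastIndex n ε₀) ↔ 0 ≤ y (Fin.last n) := by
  constructor
  · intro h
    rcases hy with h1 | h1
    · exact h _ ⟨rfl, h1⟩
    · exact h1.le
  · rintro h i ⟨rfl, -⟩
    exact h

/-- The product of a smooth chart of an open subset of `ℝ^n` with an interval. -/
def prodParam (x : OpenPartialHomeomorph (Euc n) (Euc n)) (h1 : ContDiffOn ℝ ∞ x x.source)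
    (h2 : ContDiffOn ℝ ∞ x.symm x.target) (ε₀ : ℝ) : Param (n + 1) (Euc n × ℝ) where
  B := lastIndex n ε₀
  O := splitEuc n ⁻¹' (x.target ×ˢ lastRange ε₀)
  U := x.source ×ˢ lastRange ε₀
  w y := (x.symm (splitEuc n y).1, (splitEuc n y).2)
  ξ q := (splitEuc n).symm (x q.1, q.2)
  isOpen_O := (x.open_target.prod (isOpen_lastRange ε₀)).preimage (splitEuc n).continuous
  isOpen_U := x.open_source.prod (isOpen_lastRange ε₀)
  smooth_w := (h2.comp (contDiff_fst.comp (splitEuc n).contDiff).contDiffOn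
    fun _ hy => hy.1).prodMk (contDiff_snd.comp (splitEuc n).contDiff).contDiffOn
  smooth_ξ := (splitEuc n).symm.contDiff.comp_contDiffOn
    ((h1.comp contDiffOn_fst fun _ hq => hq.1).prodMk contDiffOn_snd)

variable {M Sig : Set (Euc n)} {hM : IsOpen M}

theorem prodParam_fits {x : OpenPartialHomeomorph (Euc n) (Euc n)}
    {h1 : ContDiffOn ℝ ∞ x x.source} {h2 : ContDiffOn ℝ ∞ x.symm x.target} {ε₀ : ℝ}
    (hx : x.source ⊆ M) :
    (prodParam x h1 h2 ε₀).Fits (productCoord (Sig := Sig) (hM := hM)) where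
  exists_eq := by
    rintro y ⟨hy, hyB⟩
    have h3 : 0 ≤ y (Fin.last n) := (mem_cornerSet_lastIndex hy.2).1 hyB
    exact ⟨(⟨(x.symm (splitEuc n y).1, (splitEuc n y).2), hx (x.map_target hy.1), h3⟩ :
      ProductCarrier M), rfl⟩
  w_mem y hy := ⟨x.map_target hy.1.1, hy.1.2⟩
  ξ_w y hy := by
    change (splitEuc n).symm (x (x.symm (splitEuc n y).1), (splitEuc n y).2) = y
    rw [x.right_inv hy.1.1]
    exact (splitEuc n).symm_apply_apply y
  ξ_mem p hp := by
    have h3 : (splitEuc n).symm (x (productCoord p).1, (productCoord p).2) (Fin.last n) =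
      (productCoord p).2 := splitEuc_symm_last _
    refine ⟨?_, (mem_cornerSet_lastIndex ?_).2 ?_⟩
    · change splitEuc n ((splitEuc n).symm (x (productCoord p).1, (productCoord p).2)) ∈
        x.target ×ˢ lastRange ε₀
      rw [ContinuousLinearEquiv.apply_symm_apply]
      exact ⟨x.map_source hp.1, hp.2⟩
    · refine h3.symm ▸ hp.2
    · refine h3.symm ▸ ?_
      exact (Subtype.property (p : ProductCarrier M)).2
  w_ξ p hp := by
    change (x.symm (splitEuc n ((splitEuc n).symm (x (productCoord p).1, (productCoord p).2))).1,
      (splitEuc n ((splitEuc n).symm (x (productCoord p).1, (productCoord p).2))).2) = _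
    rw [ContinuousLinearEquiv.apply_symm_apply, x.left_inv hp.1]

/-- The global parametrization of `M × [0, ∞)`. -/
def globalParam (hM : IsOpen M) : Param (n + 1) (Euc n × ℝ) :=
  prodParam (OpenPartialHomeomorph.ofSet M hM) contDiffOn_id contDiffOn_id 0

theorem globalParam_fits :
    (globalParam hM).Fits (productCoord (Sig := Sig) (hM := hM)) :=
  prodParam_fits subset_rfl

theorem productCoord_mem_globalParam (p : (productSpace M Sig hM).carrier) :
    productCoord p ∈ (globalParam hM).U :=
  ⟨(Subtype.property (p : ProductCarrier M)).1, Or.inl rfl⟩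

/-- The prescribed chart of M × [0, ∞) takes exponentials of the free coordinates, exactly as
`toQuadrant` does; so the given manifold structure is one defined by parametrizations. -/
theorem chartAt_productSpace (q p : (productSpace M Sig hM).carrier) :
    chartAt (EuclideanQuadrant (n + 1)) q p =
      toQuadrant (globalParam hM).B ((globalParam hM).ξ (productCoord p)) := by
  classical
  apply Subtype.ext
  have hp2 : (0 : ℝ) ≤ (productCoord p).2 := (Subtype.property (p : ProductCarrier M)).2
  change (ProductCarrier.chart M p).1 = _
  ext i
  change (Fin.snoc (fun i => Real.exp ((productCoord p).1 i)) (productCoord p).2 :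
      Fin (n + 1) → ℝ) i =
    if i ∈ lastIndex n 0 then max ((splitEuc n).symm (productCoord p) i) 0
      else Real.exp ((splitEuc n).symm (productCoord p) i)
  refine Fin.lastCases ?_ (fun j => ?_) i
  · rw [Fin.snoc_last, if_pos ⟨rfl, rfl⟩, splitEuc_symm_last, max_eq_left hp2]
  · rw [Fin.snoc_castSucc, if_neg fun h => (Fin.castSucc_lt_last j).ne h.1,
      splitEuc_symm_castSucc]

theorem hasParamCharts_productCoord :
    HasParamCharts (d := n + 1) (productCoord (M := M) (Sig := Sig) (hM := hM)) := by
  intro q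
  refine ⟨globalParam hM, globalParam_fits, productCoord_mem_globalParam q, ?_,
    fun p _ => chartAt_productSpace q p⟩
  change univ = _
  exact (eq_univ_of_forall productCoord_mem_globalParam).symm

theorem isEmbedding_productCoord :
    Topology.IsEmbedding (productCoord (M := M) (Sig := Sig) (hM := hM)) :=
  Topology.IsEmbedding.subtypeVal (p := fun p : Euc n × ℝ => p.1 ∈ M ∧ 0 ≤ p.2)

end Split

/-! ### The resolution data of the product space -/

section BaseData

variable {n c : ℕ} {M Sig : Set (Euc n)} {V : Type} [NormedAddCommGroup V] [InnerProductSpace ℝ V]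

/-- The function `(h_i)_{i ∈ J}` together with `ε v₀`. -/
def baseWeight (h : Fin c → Euc n → V) (v₀ : V) (J : Finset (Fin c)) (q : Euc n × ℝ) :
    PiLp 2 fun _ : Option (Fin c) => V :=
  slot _ V none (q.2 • v₀) + ∑ i ∈ J, slot _ V (some i) (h i q.1)

/-- The resolution data of `M × [0, ∞)`. -/
def baseData (M Sig : Set (Euc n)) (hM : IsOpen M) (H : Fin c → Set (Euc n))
    (h : Fin c → Euc n → V) (v₀ : V) :
    ResData c (PiLp 2 fun _ : Option (Fin c) => V) (productSpace M Sig hM).carrier (Euc n × ℝ) where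
  ι := productCoord
  init := (productSpace M Sig hM).init
  proj := (productSpace M Sig hM).proj
  H i := {p | (productCoord p).2 = 0 ∧ (productCoord p).1 ∈ H i}
  b J p := baseWeight h v₀ J (productCoord p)
  L := ∅

theorem baseWeight_none (h : Fin c → Euc n → V) (v₀ : V) (J : Finset (Fin c)) (q : Euc n × ℝ) :
    baseWeight h v₀ J q none = q.2 • v₀ := by
  rw [baseWeight, PiLp.add_apply, slot_apply, if_pos rfl, WithLp.ofLp_sum, Finset.sum_apply,
    Finset.sum_eq_zero, add_zero]
  intro i _
  rw [slot_apply, if_neg (by simp)]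

theorem baseWeight_some (h : Fin c → Euc n → V) (v₀ : V) {J : Finset (Fin c)} (q : Euc n × ℝ)
    {i : Fin c} (hi : i ∈ J) : baseWeight h v₀ J q (some i) = h i q.1 := by
  rw [baseWeight, PiLp.add_apply, slot_apply, if_neg (by simp), WithLp.ofLp_sum, Finset.sum_apply,
    zero_add, Finset.sum_eq_single_of_mem i hi]
  · rw [slot_apply, if_pos rfl]
  · intro j _ hj
    rw [slot_apply, if_neg (by simpa using hj.symm)]

variable {H : Fin c → Set (Euc n)} {h : Fin c → Euc n → V} {p : Euc n}

/-- In the coordinates `D`, the functions `h i` are multiples of coordinates by the nonvanishing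
functions `a i`. -/
structure IsFactorization (h : Fin c → Euc n → V) (D : CrossingChart M H p)
    (a : Fin c → Euc n → V) : Prop where
  smooth : ∀ i, ContDiffOn ℝ ∞ (a i) (Metric.ball 0 D.ρ)
  eq : ∀ i (hi : p ∈ H i), ∀ y ∈ Metric.ball 0 D.ρ,
    h i (D.x.symm y) = y (D.σ ⟨i, hi⟩) • a i y
  ne_zero : ∀ i, p ∈ H i → ∀ y ∈ Metric.ball 0 D.ρ, a i y ≠ 0

/-- Hadamard's lemma: h_i vanishes at y - y_l e_l, so h_i is y_l times the difference quotient with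
step y_l in the direction e_l. The quotient is nonzero at the center of the chart, hence on a
smaller ball. -/
theorem CrossingChart.exists_factorization [CompleteSpace V] (hM : IsOpen M)
    (hh : ∀ i, ContDiffOn ℝ ∞ (h i) M) (hz : ∀ i, ∀ q ∈ M, q ∈ H i → h i q = 0)
    (hd : ∀ i, ∀ q ∈ M, q ∈ H i → fderiv ℝ (h i) q ≠ 0) (D : CrossingChart M H p) :
    ∃ (D' : CrossingChart M H p) (a : Fin c → Euc n → V), IsFactorization h D' a := by
  classical
  let τ : Fin c → Euc n := fun i => if hi : p ∈ H i then EuclideanSpace.single (D.σ ⟨i, hi⟩) 1 else 0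
  let l : Fin c → Euc n →L[ℝ] ℝ := fun i =>
    if hi : p ∈ H i then (EuclideanSpace.proj (D.σ ⟨i, hi⟩) : Euc n →L[ℝ] ℝ) else 0
  let a : Fin c → Euc n → V := fun i y => diffQuot (h i ∘ D.x.symm) (y, l i y, τ i)
  have hτ : ∀ i, ‖τ i‖ ≤ 1 := by
    intro i
    by_cases hi : p ∈ H i <;> simp [τ, hi]
  have hl : ∀ i y, |l i y| ≤ ‖y‖ := by
    intro i y
    by_cases hi : p ∈ H i
    · simp only [l, hi, dif_pos]
      exact PiLp.norm_apply_le y _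
    · simp [l, hi]
  have hη : ∀ i, ContDiffOn ℝ ∞ (h i ∘ D.x.symm) (Metric.ball 0 D.ρ) := fun i =>
    (hh i).comp D.smooth_symm fun y hy => D.subset (D.symm_mem hy)
  -- The radius ρ/3 is dictated by ‖y‖ + 2 |y_l| ≤ 3 ‖y‖.
  have hdom : ∀ i, ∀ y ∈ Metric.ball (0 : Euc n) (D.ρ / 3),
      (y, l i y, τ i) ∈ diffQuotDomain (Euc n) D.ρ := by
    intro i y hy
    rw [mem_ball_zero_iff] at hy
    change ‖y‖ + 2 * (|l i y| * ‖τ i‖) < D.ρ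
    have h1 : |l i y| * ‖τ i‖ ≤ ‖y‖ * 1 := mul_le_mul (hl i y) (hτ i) (norm_nonneg _) (norm_nonneg _)
    linarith
  have ha : ∀ i, ContDiffOn ℝ ∞ (a i) (Metric.ball 0 (D.ρ / 3)) := fun i =>
    (contDiffOn_diffQuot (hη i)).comp (by fun_prop) (hdom i)
  have h3 : 0 < D.ρ / 3 := by linarith [D.pos]
  have hpM := D.subset D.mem
  have hnear : ∀ᶠ y in 𝓝 (0 : Euc n), ∀ i, p ∈ H i → a i y ≠ 0 := by
    rw [Filter.eventually_all]
    intro i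
    by_cases hi : p ∈ H i
    · have h4 : a i 0 ≠ 0 := by
        have := D.diffQuot_ne_zero hM (hh i) hi (hz i) (hd i p hpM hi)
        simpa [a, l, τ, hi] using this
      have h5 := ((ha i).continuousOn.continuousAt
        (Metric.ball_mem_nhds (0 : Euc n) h3)).eventually_ne h4
      filter_upwards [h5] with y hy _ using hy
    · exact Filter.Eventually.of_forall fun y hy => (hi hy).elim
  obtain ⟨r, hr, hball⟩ := Metric.eventually_nhds_iff_ball.1 hnear
  obtain ⟨D', h4, h5, h6⟩ := D.exists_shrink (ρ := min r (D.ρ / 3)) (lt_min hr h3)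
    ((min_le_right _ _).trans (by linarith [D.pos]))
  have hsub : Metric.ball (0 : Euc n) D'.ρ ⊆ Metric.ball 0 (D.ρ / 3) :=
    h4 ▸ Metric.ball_subset_ball (min_le_right _ _)
  refine ⟨D', a, fun i => (ha i).mono hsub, fun i hi y hy => ?_, fun i hi y hy => ?_⟩
  · have h7 := smul_diffQuot (hη i) (hdom i y (hsub hy))
    have hball : y - l i y • τ i ∈ Metric.ball (0 : Euc n) D.ρ := by
      simpa using sub_smul_mem_ball (hdom i y (hsub hy)) (t := 1) (by norm_num)
    have h8 : h i (D.x.symm (y - l i y • τ i)) = 0 := by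
      refine hz i _ (D.subset (D.symm_mem hball)) ((D.symm_mem_iff hball i).2 ⟨hi, ?_⟩)
      simp [l, τ, hi]
    rw [Function.comp_apply, Function.comp_apply, h8, sub_zero] at h7
    rw [h5, h6, ← h7]
    simp [a, l, hi]
  · refine hball y ?_ i hi
    rw [h4] at hy
    exact Metric.ball_subset_ball (min_le_left _ _) hy

end BaseData

/-! ### Adapted charts of the product space -/

section BaseChart

variable {n c : ℕ} {M Sig : Set (Euc n)} {hM : IsOpen M} {V : Type} [NormedAddCommGroup V]
  [InnerProductSpace ℝ V] {H : Fin c → Set (Euc n)} {h : Fin c → Euc n → V} {v₀ : V}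

open Classical in
/-- The coordinates of `M × [0, ∞)` corresponding to the components. -/
def CrossingChart.index {p : Euc n} (D : CrossingChart M H p) (i : Fin c) : Fin (n + 1) :=
  if hi : p ∈ H i then (D.σ ⟨i, hi⟩).castSucc else Fin.last n

theorem CrossingChart.index_of_mem {p : Euc n} (D : CrossingChart M H p) {i : Fin c}
    (hi : p ∈ H i) : D.index i = (D.σ ⟨i, hi⟩).castSucc := dif_pos hi

open Classical in
/-- The coefficients of `baseWeight h v₀ J`. -/
def baseCoeff {p : Euc n} (D : CrossingChart M H p) (a : Fin c → Euc n → V) (v₀ : V)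
    (J : Finset (Fin c)) (k : Fin (n + 1)) (y : Euc (n + 1)) : PiLp 2 fun _ : Option (Fin c) => V :=
  if k = Fin.last n then slot _ V none v₀
    -- If all components in J pass through p, at most one term survives. The filtered sum makes
    -- sense, and is orthogonal for distinct k, without this assumption.
    else ∑ i ∈ J with D.index i = k, slot _ V (some i) (a i (splitEuc n y).1)

/-- Distinct values of k involve disjoint sets of orthogonal slots. -/
theorem inner_baseCoeff {p : Euc n} (D : CrossingChart M H p) (a : Fin c → Euc n → V) (v₀ : V)
    (J : Finset (Fin c)) {k l : Fin (n + 1)} (hkl : k ≠ l) (y : Euc (n + 1)) :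
    inner ℝ (baseCoeff D a v₀ J k y) (baseCoeff D a v₀ J l y) = 0 := by
  by_cases hk : k = Fin.last n
  · have hl : l ≠ Fin.last n := fun h => hkl (hk.trans h.symm)
    rw [baseCoeff, if_pos hk, baseCoeff, if_neg hl, inner_sum]
    exact Finset.sum_eq_zero fun i _ => inner_slot_slot (by simp) _ _
  · by_cases hl : l = Fin.last n
    · rw [baseCoeff, if_neg hk, baseCoeff, if_pos hl, sum_inner]
      exact Finset.sum_eq_zero fun i _ => inner_slot_slot (by simp) _ _
    · rw [baseCoeff, if_neg hk, baseCoeff, if_neg hl, sum_inner]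
      refine Finset.sum_eq_zero fun i hi => ?_
      rw [inner_sum]
      refine Finset.sum_eq_zero fun j hj => inner_slot_slot ?_ _ _
      intro hij
      have hij' : i = j := Option.some_injective _ hij
      have h1 := (Finset.mem_filter.1 hi).2
      have h2 := (Finset.mem_filter.1 hj).2
      exact hkl (h1.symm.trans (hij' ▸ h2))

theorem baseCoeff_ne_zero {p : Euc n} {D : CrossingChart M H p} {a : Fin c → Euc n → V}
    (ha : IsFactorization h D a) (hv : v₀ ≠ 0) {J : Finset (Fin c)} (hJ : ∀ i ∈ J, p ∈ H i)
    {k : Fin (n + 1)} (hk : k ∈ coordSet (Fin.last n) D.index J) {y : Euc (n + 1)}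
    (hy : (splitEuc n y).1 ∈ Metric.ball 0 D.ρ) : baseCoeff D a v₀ J k y ≠ 0 := by
  by_cases hl : k = Fin.last n
  · rw [baseCoeff, if_pos hl]
    exact slot_ne_zero _ hv
  · rw [baseCoeff, if_neg hl]
    obtain ⟨i, hi, rfl⟩ := Finset.mem_image.1 ((Finset.mem_insert.1 hk).resolve_left hl)
    intro h0
    refine ha.ne_zero i (hJ i hi) _ hy ?_
    have h1 := congrArg (fun x : PiLp 2 fun _ : Option (Fin c) => V => x (some i)) h0
    refine Eq.trans (Eq.symm ?_) h1
    rw [WithLp.ofLp_sum, Finset.sum_apply,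
      Finset.sum_eq_single_of_mem i 
        ((Finset.mem_filter (p := fun j => D.index j = D.index i)).2 ⟨hi, rfl⟩)]
    · rw [slot_apply, if_pos rfl]
    · intro j _ hj
      rw [slot_apply, if_neg (by simpa using hj.symm)]

theorem contDiffOn_baseCoeff {p : Euc n} {D : CrossingChart M H p} {a : Fin c → Euc n → V}
    (ha : IsFactorization h D a) (J : Finset (Fin c)) (k : Fin (n + 1)) :
    ContDiffOn ℝ ∞ (baseCoeff D a v₀ J k) {y | (splitEuc n y).1 ∈ Metric.ball 0 D.ρ} := by
  by_cases hl : k = Fin.last n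
  · have : baseCoeff D a v₀ J k = fun _ => slot _ V none v₀ := by
      ext1 y
      rw [baseCoeff, if_pos hl]
    rw [this]
    exact contDiffOn_const
  · have : baseCoeff D a v₀ J k = fun y => ∑ i ∈ J with D.index i = k,
        slot _ V (some i) (a i (splitEuc n y).1) := by
      ext1 y
      rw [baseCoeff, if_neg hl]
    rw [this]
    refine ContDiffOn.sum fun i _ => ?_
    refine (slot _ V (some i)).contDiff.comp_contDiffOn ((ha.smooth i).comp ?_ fun y hy => hy)
    exact (contDiff_fst.comp (splitEuc n).contDiff).contDiffOn

theorem baseWeight_eq_sum {p : Euc n} {D : CrossingChart M H p} {a : Fin c → Euc n → V}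
    (ha : IsFactorization h D a) {J : Finset (Fin c)} (hJ : ∀ i ∈ J, p ∈ H i)
    {y : Euc (n + 1)} (hy : (splitEuc n y).1 ∈ Metric.ball 0 D.ρ) :
    baseWeight h v₀ J (D.x.symm (splitEuc n y).1, (splitEuc n y).2) =
      ∑ k ∈ coordSet (Fin.last n) D.index J, y k • baseCoeff D a v₀ J k y := by
  classical
  have hne : ∀ i ∈ J, D.index i ≠ Fin.last n := by
    intro i hi
    rw [D.index_of_mem (hJ i hi)]
    exact (Fin.castSucc_lt_last _).ne
  have hinj : ∀ i ∈ J, ∀ j ∈ J, D.index i = D.index j → i = j := by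
    intro i hi j hj hij
    rw [D.index_of_mem (hJ i hi), D.index_of_mem (hJ j hj)] at hij
    exact congrArg Subtype.val (D.σ.injective (Fin.castSucc_injective _ hij))
  have hnot : Fin.last n ∉ J.image D.index := by
    rw [Finset.mem_image]
    rintro ⟨i, hi, h1⟩
    exact hne i hi h1
  rw [coordSet, Finset.sum_insert hnot, Finset.sum_image hinj, baseWeight]
  congr 1
  · rw [baseCoeff, if_pos rfl, map_smul, splitEuc_snd]
  · refine Finset.sum_congr rfl fun i hi => ?_
    have hfilter : (J.filter fun j => D.index j = D.index i) = {i} := by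
      ext j
      rw [Finset.mem_filter, Finset.mem_singleton]
      exact ⟨fun h1 => hinj j h1.1 i hi h1.2, fun h1 => ⟨h1 ▸ hi, h1 ▸ rfl⟩⟩
    have h2 : baseCoeff D a v₀ J (D.index i) y = slot _ V (some i) (a i (splitEuc n y).1) := by
      rw [baseCoeff, if_neg (hne i hi)]
      refine Eq.trans (Finset.sum_congr ?_ fun _ _ => rfl) (Finset.sum_singleton _ i)
      rw [← hfilter]
    rw [h2, ha.eq i (hJ i hi) _ hy, map_smul, D.index_of_mem (hJ i hi), splitEuc_fst]

/-- The adapted chart of `M × [0, ∞)` given by normal crossings coordinates. -/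
def baseChart (hh : ∀ i, ContDiffOn ℝ ∞ (h i) M) (hz : ∀ i, ∀ q ∈ M, h i q = 0 ↔ q ∈ H i)
    (hv : v₀ ≠ 0) {q : (productSpace M Sig hM).carrier}
    (D : CrossingChart M H (productCoord q).1) (a : Fin c → Euc n → V)
    (ha : IsFactorization h D a) :
    AdaptedChart (n + 1) (baseData M Sig hM H h v₀) q where
  toParam := prodParam D.x D.smooth (D.target_eq ▸ D.smooth_symm) (productCoord q).2
  e := Fin.last n
  σ := D.index
  β J y := baseWeight h v₀ J (D.x.symm (splitEuc n y).1, (splitEuc n y).2)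
  A := baseCoeff D a v₀
  ϖ y := y (Fin.last n)
  fits := prodParam_fits D.subset
  mem := by
    refine ⟨D.mem, ?_⟩
    have h1 : 0 ≤ (productCoord q).2 := (Subtype.property (q : ProductCarrier M)).2
    exact h1.eq_or_lt.imp Eq.symm id
  smooth_ϖ := by fun_prop
  proj_eq p _ := (splitEuc_symm_last (D.x (productCoord p).1, (productCoord p).2)).symm
  proj_eq_zero p hp := by
    change (productCoord p).2 = 0 ↔ ∃ i ∈ lastIndex n _, (splitEuc n).symm _ i = 0
    constructor
    · intro h0
      refine ⟨Fin.last n, ⟨rfl, ?_⟩, (splitEuc_symm_last _).trans h0⟩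
      exact hp.2.resolve_right fun h1 => (h0 ▸ h1 : (0 : ℝ) < 0).false
    · rintro ⟨i, ⟨rfl, -⟩, h0⟩
      exact (splitEuc_symm_last (D.x (productCoord p).1, (productCoord p).2)).symm.trans h0
  e_mem hq := ⟨rfl, hq⟩
  init_iff p hp := by
    change (productCoord p).2 = 0 ↔ (productCoord q).2 = 0 ∧ (splitEuc n).symm _ (Fin.last n) = 0
    rw [splitEuc_symm_last]
    exact ⟨fun h0 => ⟨hp.2.resolve_right fun h1 => (h0 ▸ h1 : (0 : ℝ) < 0).false, h0⟩, And.right⟩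
  σ_not_mem i hi := by
    rw [D.index_of_mem hi.2]
    exact fun h1 => (Fin.castSucc_lt_last _).ne h1.1
  σ_inj i j hi hj hij := by
    rw [D.index_of_mem hi.2, D.index_of_mem hj.2] at hij
    exact congrArg Subtype.val (D.σ.injective (Fin.castSucc_injective _ hij))
  H_iff p hp i := by
    change (productCoord p).2 = 0 ∧ (productCoord p).1 ∈ H i ↔
      ((productCoord q).2 = 0 ∧ (productCoord q).1 ∈ H i) ∧
        (splitEuc n).symm (D.x (productCoord p).1, (productCoord p).2) (Fin.last n) = 0 ∧
        (splitEuc n).symm (D.x (productCoord p).1, (productCoord p).2) (D.index i) = 0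
    rw [splitEuc_symm_last, D.mem_iff (productCoord p).1 hp.1]
    constructor
    · rintro ⟨h0, hi, h1⟩
      refine ⟨⟨hp.2.resolve_right fun h1 => (h0 ▸ h1 : (0 : ℝ) < 0).false, hi⟩, h0, ?_⟩
      rw [D.index_of_mem hi, splitEuc_symm_castSucc]
      exact h1
    · rintro ⟨⟨-, hi⟩, h0, h1⟩
      rw [D.index_of_mem hi, splitEuc_symm_castSucc] at h1
      exact ⟨h0, hi, h1⟩
  smooth_β J := by
    have h1 : ContDiffOn ℝ ∞ (fun y : Euc (n + 1) => D.x.symm (splitEuc n y).1)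
        (splitEuc n ⁻¹' (D.x.target ×ˢ lastRange (productCoord q).2)) :=
      D.smooth_symm.comp (contDiff_fst.comp (splitEuc n).contDiff).contDiffOn
        fun y hy => D.target_eq ▸ hy.1
    have h2 : ContDiff ℝ ∞ fun y : Euc (n + 1) => (splitEuc n y).2 :=
      contDiff_snd.comp (splitEuc n).contDiff
    refine ((slot (Option (Fin c)) V none).contDiff.comp
      (h2.smul contDiff_const)).contDiffOn.add
      (ContDiffOn.sum fun i _ => ?_)
    refine (slot _ V (some i)).contDiff.comp_contDiffOn ((hh i).comp h1 fun y hy => ?_)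
    exact D.subset (D.x.map_target hy.1)
  smooth_A J k := (contDiffOn_baseCoeff ha J k).mono fun y hy => D.target_eq ▸ hy.1
  b_eq J _ p hp := congrArg (baseWeight h v₀ J) ((prodParam_fits D.subset).w_ξ p hp).symm
  β_eq J _ _ hJ y hy := baseWeight_eq_sum ha (fun i hi => (hJ i hi).2) (D.target_eq ▸ hy.1)
  A_orth J _ _ _ y _ k _ l _ hkl := inner_baseCoeff D a v₀ J hkl y
  A_ne J _ _ hJ y hy k hk :=
    baseCoeff_ne_zero ha hv (fun i hi => (hJ i hi).2) hk (D.target_eq ▸ hy.1)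
  β_ne J _ _ hJ y hy h0 := by
    push Not at hJ
    obtain ⟨i, hi, hqi⟩ := hJ
    -- If ε₀ = 0, the component i misses the point, hence the chart, and its slot is nonzero. If ε₀
    -- > 0, then ε > 0 on the chart and the slot `none` is nonzero.
    by_cases hε : (productCoord q).2 = 0
    · have h1 := congrArg (fun x : PiLp 2 fun _ : Option (Fin c) => V => x (some i)) h0
      have h2 := (baseWeight_some h v₀ _ hi).symm.trans h1
      have hy' : (splitEuc n y).1 ∈ Metric.ball 0 D.ρ := D.target_eq ▸ hy.1
      have h3 := (hz i _ (D.subset (D.symm_mem hy'))).1 h2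
      exact hqi ⟨hε, ((D.symm_mem_iff hy' i).1 h3).choose⟩
    · have h1 := congrArg (fun x : PiLp 2 fun _ : Option (Fin c) => V => x none) h0
      have h2 := (baseWeight_none h v₀ J _).symm.trans h1
      exact (smul_ne_zero (hy.2.resolve_left hε).ne' hv) h2

end BaseChart

/-! ### The product space is regularized -/

section BaseGood

variable {n c : ℕ} {M Sig : Set (Euc n)} {hM : IsOpen M} {V : Type} [NormedAddCommGroup V]
  [InnerProductSpace ℝ V] [CompleteSpace V] {H : Fin c → Set (Euc n)} {h : Fin c → Euc n → V}
  {v₀ : V}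

theorem baseData_good (hH : ∀ i, IsOpen (M \ H i))
    (hD : ∀ p ∈ M, Nonempty (CrossingChart M H p)) (hh : ∀ i, ContDiffOn ℝ ∞ (h i) M)
    (hz : ∀ i, ∀ q ∈ M, h i q = 0 ↔ q ∈ H i)
    (hd : ∀ i, ∀ q ∈ M, q ∈ H i → fderiv ℝ (h i) q ≠ 0) (hv : v₀ ≠ 0) :
    (baseData M Sig hM H h v₀).Good (n + 1) where
  emb := isEmbedding_productCoord
  isClosed_init := isClosed_eq (continuous_snd.comp isEmbedding_productCoord.continuous)
    continuous_const
  isClosed_H i := by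
    have h1 : IsClosed {p : (productSpace M Sig hM).carrier | (productCoord p).2 = 0} :=
      isClosed_eq (continuous_snd.comp isEmbedding_productCoord.continuous) continuous_const
    have h2 : IsOpen {p : (productSpace M Sig hM).carrier | (productCoord p).1 ∈ M \ H i} :=
      (hH i).preimage (continuous_fst.comp isEmbedding_productCoord.continuous)
    convert! h1.inter h2.isClosed_compl using 1
    ext p
    have hp : (productCoord p).1 ∈ M := (Subtype.property (p : ProductCarrier M)).1
    change (productCoord p).2 = 0 ∧ (productCoord p).1 ∈ H i ↔
      (productCoord p).2 = 0 ∧ ¬((productCoord p).1 ∈ M ∧ (productCoord p).1 ∉ H i)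
    tauto
  H_subset i p hp := hp.1
  proj_nonneg p := (Subtype.property (p : ProductCarrier M)).2
  upward J hJ := hJ.elim
  exists_chart q := by
    obtain ⟨D⟩ := hD (productCoord q).1 (Subtype.property (q : ProductCarrier M)).1
    obtain ⟨D', a, ha⟩ := D.exists_factorization hM hh (fun i q hq => (hz i q hq).2) hd
    exact ⟨baseChart hh hz hv D' a ha⟩
  comp_not_mem q J _ _ := fun hJ => hJ

theorem mem_boundary_productSpace_iff (p : (productSpace M Sig hM).carrier) :
    (productCoord p).2 = 0 ↔
      p ∈ (cornerModel (n + 1)).boundary (productSpace M Sig hM).carrier := by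
  rw [globalParam_fits.mem_boundary_iff (productCoord_mem_globalParam p)
    (chartAt_productSpace p p)]
  constructor
  · intro h0
    exact ⟨Fin.last n, ⟨rfl, rfl⟩, (splitEuc_symm_last _).trans h0⟩
  · rintro ⟨i, ⟨rfl, -⟩, h0⟩
    exact (splitEuc_symm_last (productCoord p)).symm.trans h0

theorem exists_mfderiv_productCoord_eq (p : (productSpace M Sig hM).carrier) (v : Euc n × ℝ) :
    ∃ u : TangentSpace (cornerModel (n + 1)) p,
      (mfderiv (cornerModel (n + 1)) 𝓘(ℝ, Euc n × ℝ) productCoord p u : Euc n × ℝ) = v := by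
  obtain ⟨u, hu⟩ := hasParamCharts_productCoord.exists_mfderiv_eq isEmbedding_productCoord
    globalParam_fits (productCoord_mem_globalParam p) ((splitEuc n).symm v)
  refine ⟨u, hu.trans ?_⟩
  have h1 : (globalParam hM).w = splitEuc n := rfl
  rw [h1]
  exact (congrArg (fun L : Euc (n + 1) →L[ℝ] Euc n × ℝ => L ((splitEuc n).symm v))
    (splitEuc n).fderiv).trans ((splitEuc n).apply_symm_apply v)

theorem mfderiv_proj_productSpace (p : (productSpace M Sig hM).carrier)
    (u : TangentSpace (cornerModel (n + 1)) p) :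
    (mfderiv (cornerModel (n + 1)) 𝓘(ℝ, ℝ) (productSpace M Sig hM).proj p u : ℝ) =
      (mfderiv (cornerModel (n + 1)) 𝓘(ℝ, Euc n × ℝ) productCoord p u : Euc n × ℝ).2 := by
  have h1 := ((hasParamCharts_productCoord (Sig := Sig) (hM := hM)).contMDiff
    isEmbedding_productCoord).mdifferentiable (by simp) p
  have h2 : HasMFDerivAt 𝓘(ℝ, Euc n × ℝ) 𝓘(ℝ, ℝ) (Prod.snd : Euc n × ℝ → ℝ) (productCoord p)
      (ContinuousLinearMap.snd ℝ (Euc n) ℝ) :=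
    (ContinuousLinearMap.snd ℝ (Euc n) ℝ).hasFDerivAt.hasMFDerivAt
  have h3 := (HasMFDerivAt.comp p h2 h1.hasMFDerivAt).mfderiv
  exact congrArg (fun L : Euc (n + 1) →L[ℝ] ℝ => L u) h3

theorem productSpace_realizes (hSig : Sig = ⋃ i, H i) (hH : ∀ i, IsOpen (M \ H i))
    (hD : ∀ p ∈ M, Nonempty (CrossingChart M H p)) (hh : ∀ i, ContDiffOn ℝ ∞ (h i) M)
    (hz : ∀ i, ∀ q ∈ M, h i q = 0 ↔ q ∈ H i)
    (hd : ∀ i, ∀ q ∈ M, q ∈ H i → fderiv ℝ (h i) q ≠ 0) (hv : v₀ ≠ 0) :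
    (productSpace M Sig hM).Realizes (baseData M Sig hM H h v₀) := by
  have hdisc : (productSpace M Sig hM).disc = (baseData M Sig hM H h v₀).disc := by
    ext p
    rw [ResData.mem_disc]
    change (productCoord p).2 = 0 ∧ (productCoord p).1 ∈ Sig ↔
      ∃ i, (productCoord p).2 = 0 ∧ (productCoord p).1 ∈ H i
    rw [hSig, mem_iUnion, exists_and_left]
  have hgood : (baseData M Sig hM H h v₀).Good (n + 1) := baseData_good hH hD hh hz hd hv
  refine ⟨hgood, hasParamCharts_productCoord, rfl, rfl, hdisc,
    hgood.isRegularized hasParamCharts_productCoord rfl rfl hdisc mem_boundary_productSpace_iff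
      fun p _ r => ?_⟩
  obtain ⟨u, hu⟩ := exists_mfderiv_productCoord_eq p ((0, r) : Euc n × ℝ)
  exact ⟨u, (mfderiv_proj_productSpace p u).trans (congrArg Prod.snd hu)⟩

end BaseGood

/-! ### Sign patterns -/

section SignCell

variable {κ : Type} [Finite κ] {n : ℕ}

/-- The points at which given coordinates have prescribed signs. -/
def signCell (σ : κ → Fin n) (s : κ → SignType) : Set (Euc n) :=
  {y | ∀ k, SignType.sign (y (σ k)) = s k}

theorem setOf_sign_eq (a : SignType) :
    {t : ℝ | SignType.sign t = a} = match a with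
      | .zero => {0}
      | .neg => Iio 0
      | .pos => Ioi 0 := by
  ext t
  cases a
  · exact sign_eq_zero_iff
  · exact sign_eq_neg_one_iff
  · exact sign_eq_one_iff

theorem signCell_eq_iInter (σ : κ → Fin n) (s : κ → SignType) :
    signCell σ s = ⋂ k, (EuclideanSpace.proj (σ k) : Euc n →L[ℝ] ℝ) ⁻¹'
      {t | SignType.sign t = s k} := by
  ext y
  simp [signCell]

theorem convex_signCell (σ : κ → Fin n) (s : κ → SignType) : Convex ℝ (signCell σ s) := by
  rw [signCell_eq_iInter]
  refine convex_iInter fun k => ?_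
  refine Convex.linear_preimage (f := ((EuclideanSpace.proj (σ k) : Euc n →L[ℝ] ℝ) : Euc n →ₗ[ℝ] ℝ)) ?_
  rw [setOf_sign_eq]
  cases s k
  · exact convex_singleton 0
  · exact convex_Iio 0
  · exact convex_Ioi 0

theorem measurableSet_signCell (σ : κ → Fin n) (s : κ → SignType) :
    MeasurableSet (signCell σ s) := by
  rw [signCell_eq_iInter]
  refine MeasurableSet.iInter fun k =>
    (EuclideanSpace.proj (σ k) : Euc n →L[ℝ] ℝ).continuous.measurable ?_
  rw [setOf_sign_eq]
  cases s k
  · exact measurableSet_singleton 0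
  · exact measurableSet_Iio
  · exact measurableSet_Ioi

theorem volume_coord_eq_zero (l : Fin n) : volume {y : Euc n | y l = 0} = 0 := by
  have h1 := Measure.addHaar_submodule (volume : Measure (Euc n))
    (LinearMap.ker ((EuclideanSpace.proj l : Euc n →L[ℝ] ℝ) : Euc n →ₗ[ℝ] ℝ)) ?_
  · exact h1
  · intro h
    have h2 : (EuclideanSpace.single l (1 : ℝ) : Euc n) ∈
        LinearMap.ker ((EuclideanSpace.proj l : Euc n →L[ℝ] ℝ) : Euc n →ₗ[ℝ] ℝ) :=
      h ▸ Submodule.mem_top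
    have h3 : (EuclideanSpace.single l (1 : ℝ) : Euc n) l = 0 := h2
    simp at h3

end SignCell

/-! ### Piecewise smooth vector fields in normal crossings coordinates -/

section Sectors

variable {n c : ℕ} {M Sig : Set (Euc n)} {H : Fin c → Set (Euc n)} {X : Euc n → Euc n} {p : Euc n}

/-- On the ball of radius `r`, the vector field `X` is given in the coordinates `D` by smooth functions
`Y s` on the sectors with signs `s`. -/
structure IsSectorial (D : CrossingChart M H p) (X : Euc n → Euc n) (r : ℝ)
    (Y : ({i // p ∈ H i} → SignType) → Euc n → Euc n) : Prop where
  pos : 0 < r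
  le : r ≤ D.ρ
  smooth : ∀ s, ContDiffOn ℝ ∞ (Y s) (Metric.ball 0 r)
  eq : ∀ y ∈ Metric.ball 0 r, (∀ i, y (D.σ i) ≠ 0) →
    X (D.x.symm y) = Y (fun i => SignType.sign (y (D.σ i))) y

theorem CrossingChart.symm_mem_iUnion_iff (D : CrossingChart M H p) {y : Euc n}
    (hy : y ∈ Metric.ball 0 D.ρ) : D.x.symm y ∈ ⋃ i, H i ↔ ∃ i, y (D.σ i) = 0 := by
  rw [mem_iUnion]
  constructor
  · rintro ⟨i, hi⟩
    obtain ⟨h1, h2⟩ := (D.symm_mem_iff hy i).1 hi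
    exact ⟨⟨i, h1⟩, h2⟩
  · rintro ⟨⟨i, h1⟩, h2⟩
    exact ⟨i, (D.symm_mem_iff hy i).2 ⟨h1, h2⟩⟩

/-- A sign cell intersected with a ball is convex. Its image is connected and avoids Σ, so it lies
in a single connected component of V \ Σ, from which X extends smoothly. -/
theorem CrossingChart.exists_sectorial (D : CrossingChart M H p) (hSig : Sig = ⋃ i, H i)
    (hX : IsPiecewiseSmoothOn M Sig X) : ∃ r Y, IsSectorial D X r Y := by
  obtain ⟨V, hV, hpV, hVM, hY⟩ := hX.2 p (D.subset D.mem)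
  have hcont := D.smooth_symm.continuousOn
  have h0 : (0 : Euc n) ∈ Metric.ball (0 : Euc n) D.ρ ∩ D.x.symm ⁻¹' V :=
    ⟨Metric.mem_ball_self D.pos, by rw [mem_preimage, D.symm_zero]; exact hpV⟩
  obtain ⟨r, hr, hball⟩ := Metric.isOpen_iff.1
    (hcont.isOpen_inter_preimage Metric.isOpen_ball hV) 0 h0
  have hle : Metric.ball (0 : Euc n) (min r D.ρ) ⊆ Metric.ball 0 D.ρ ∩ D.x.symm ⁻¹' V :=
    (Metric.ball_subset_ball (min_le_left _ _)).trans hball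
  have key : ∀ s : {i // p ∈ H i} → SignType, ∃ Y : Euc n → Euc n,
      ContDiffOn ℝ ∞ Y (Metric.ball 0 (min r D.ρ)) ∧ ∀ y ∈ Metric.ball 0 (min r D.ρ),
        (∀ i, y (D.σ i) ≠ 0) → y ∈ signCell D.σ s → X (D.x.symm y) = Y y := by
    intro s
    by_cases hs : ∃ y ∈ Metric.ball (0 : Euc n) (min r D.ρ),
      (∀ i, y (D.σ i) ≠ 0) ∧ y ∈ signCell D.σ s
    · obtain ⟨z, hz, hz0, hzs⟩ := hs
      have hsub : D.x.symm '' (Metric.ball 0 (min r D.ρ) ∩ signCell D.σ s) ⊆ V \ Sig := by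
        rintro _ ⟨y, ⟨hy, hys⟩, rfl⟩
        refine ⟨(hle hy).2, ?_⟩
        rw [hSig, D.symm_mem_iUnion_iff (hle hy).1]
        rintro ⟨i, hi⟩
        have h1 := (hys i).trans (hzs i).symm
        rw [hi, sign_zero, eq_comm, sign_eq_zero_iff] at h1
        exact hz0 i h1
      obtain ⟨Y, hYs, hYe⟩ := hY (D.x.symm z) (hsub ⟨z, ⟨hz, hzs⟩, rfl⟩)
      refine ⟨Y ∘ D.x.symm, hYs.comp (D.smooth_symm.mono fun y hy => (hle hy).1)
        fun y hy => (hle hy).2, fun y hy _ hys => hYe ?_⟩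
      have hpre : IsPreconnected (D.x.symm '' (Metric.ball 0 (min r D.ρ) ∩ signCell D.σ s)) :=
        ((convex_ball _ _).inter (convex_signCell _ _)).isPreconnected.image _
          (hcont.mono fun y hy => (hle hy.1).1)
      exact hpre.subset_connectedComponentIn ⟨z, ⟨hz, hzs⟩, rfl⟩ hsub ⟨y, ⟨hy, hys⟩, rfl⟩
    -- Cells with a zero among the signs contain no point to be considered, and any function will
    -- do.
    · exact ⟨fun _ => 0, contDiffOn_const, fun y hy hy0 hys => (hs ⟨y, hy, hy0, hys⟩).elim⟩
  choose Y hY1 hY2 using key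
  exact ⟨min r D.ρ, Y, lt_min hr D.pos, min_le_right _ _, hY1,
    fun y hy hy0 => hY2 _ y hy hy0 fun _ => rfl⟩

theorem isOpen_sdiff_iUnion (hH : ∀ i, IsOpen (M \ H i)) (hM : IsOpen M) :
    IsOpen (M \ ⋃ i, H i) := by
  have : M \ ⋃ i, H i = M ∩ ⋂ i, M \ H i := by
    ext q
    simp only [mem_sdiff, mem_iUnion, mem_inter_iff, mem_iInter, not_exists]
    exact ⟨fun h => ⟨h.1, fun i => ⟨h.1, h.2 i⟩⟩, fun h => ⟨h.1, fun i => (h.2 i).2⟩⟩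
  rw [this]
  exact hM.inter (isOpen_iInter_of_finite hH)

/-- A piecewise smooth vector field is locally integrable. -/
theorem IsPiecewiseSmoothOn.locallyIntegrableOn (hM : IsOpen M) (hSig : Sig = ⋃ i, H i)
    (hH : ∀ i, IsOpen (M \ H i)) (hD : ∀ p ∈ M, Nonempty (CrossingChart M H p))
    (hX : IsPiecewiseSmoothOn M Sig X) : LocallyIntegrableOn X M := by
  classical
  intro p hp
  obtain ⟨D⟩ := hD p hp
  obtain ⟨r, Y, hY⟩ := D.exists_sectorial hSig hX
  have hr2 : r / 2 < r := by linarith [hY.pos]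
  have hsub : Metric.closedBall (0 : Euc n) (r / 2) ⊆ Metric.ball 0 r :=
    Metric.closedBall_subset_ball hr2
  have hsub' : Metric.closedBall (0 : Euc n) (r / 2) ⊆ Metric.ball 0 D.ρ :=
    hsub.trans (Metric.ball_subset_ball hY.le)
  have hbd : ∀ s, ∃ C, ∀ y ∈ Metric.closedBall (0 : Euc n) (r / 2), ‖Y s y‖ ≤ C := fun s =>
    (isCompact_closedBall _ _).exists_bound_of_continuousOn ((hY.smooth s).continuousOn.mono hsub)
  choose C hC using hbd
  -- The ball of radius 1 is there to give A finite measure.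
  let A : Set (Euc n) := D.x.source ∩ D.x ⁻¹' Metric.ball 0 (r / 2) ∩ Metric.ball p 1
  have hA : IsOpen A := (D.smooth.continuousOn.isOpen_inter_preimage D.x.open_source
    Metric.isOpen_ball).inter Metric.isOpen_ball
  have hpA : p ∈ A := by
    refine ⟨⟨D.mem, ?_⟩, Metric.mem_ball_self one_pos⟩
    rw [mem_preimage, D.map_eq]
    exact Metric.mem_ball_self (half_pos hY.pos)
  -- In the chart Σ is a finite union of smooth images of pieces of hyperplanes, hence null, and the
  -- arbitrary values of X on it do not matter.
  have hnull : volume (A ∩ Sig) = 0 := by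
    refine measure_mono_null (t := ⋃ i, D.x.symm '' (Metric.ball 0 D.ρ ∩ {y | y (D.σ i) = 0})) ?_ ?_
    · rintro q ⟨⟨⟨hq, -⟩, -⟩, hqS⟩
      rw [hSig, ← D.x.left_inv hq, D.symm_mem_iUnion_iff (D.map_mem hq)] at hqS
      obtain ⟨i, hi⟩ := hqS
      exact mem_iUnion.2 ⟨i, D.x q, ⟨D.map_mem hq, hi⟩, D.x.left_inv hq⟩
    · rw [measure_iUnion_null_iff]
      intro i
      refine addHaar_image_eq_zero_of_differentiableOn_of_addHaar_eq_zero _ ?_ ?_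
      · exact fun y hy => (D.hasFDerivAt_symm hy.1).differentiableAt.differentiableWithinAt
      · exact measure_mono_null inter_subset_right (volume_coord_eq_zero _)
  refine ⟨A, nhdsWithin_le_nhds (hA.mem_nhds hpA), ?_⟩
  have hAM : A ⊆ M := fun q hq => D.subset hq.1.1
  have hAS : IsOpen (A \ Sig) := by
    have : A \ Sig = A ∩ (M \ ⋃ i, H i) := by
      ext q
      rw [hSig]
      exact ⟨fun h => ⟨h.1, hAM h.1, h.2⟩, fun h => ⟨h.1, h.2.2⟩⟩
    rw [this]
    exact hA.inter (isOpen_sdiff_iUnion hH hM)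
  have hint : IntegrableOn X (A \ Sig) := by
    refine IntegrableOn.of_bound ?_ ?_ (∑ s, |C s|) ?_
    · exact (measure_mono fun q hq => hq.1.2).trans_lt Metric.isBounded_ball.measure_lt_top
    · exact (hX.1.continuousOn.mono fun q hq => ⟨hAM hq.1, hq.2⟩).aestronglyMeasurable
        hAS.measurableSet
    · refine (ae_restrict_iff' hAS.measurableSet).2 (Filter.Eventually.of_forall fun q hq => ?_)
      have hy := D.map_mem hq.1.1.1
      have hy2 : D.x q ∈ Metric.ball (0 : Euc n) (r / 2) := hq.1.1.2
      have hne : ∀ i, D.x q (D.σ i) ≠ 0 := by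
        intro i hi
        refine hq.2 ?_
        rw [hSig, ← D.x.left_inv hq.1.1.1]
        exact (D.symm_mem_iUnion_iff hy).2 ⟨i, hi⟩
      have h1 := hY.eq (D.x q) (hsub (Metric.ball_subset_closedBall hy2)) hne
      rw [D.x.left_inv hq.1.1.1] at h1
      rw [h1]
      refine (hC _ _ (Metric.ball_subset_closedBall hy2)).trans ((le_abs_self _).trans ?_)
      exact Finset.single_le_sum (f := fun s => |C s|) (fun _ _ => abs_nonneg _)
        (Finset.mem_univ _)
  have h2 : A =ᵐ[volume] (A \ Sig : Set (Euc n)) := by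
    rw [ae_eq_set]
    refine ⟨?_, by rw [sdiff_eq_empty.2 sdiff_subset, measure_empty]⟩
    rwa [sdiff_sdiff_right_self]
  exact hint.congr_set_ae h2

end Sectors

/-! ### Regularization away from the boundary -/

section Regularization

variable {n : ℕ} {m : Euc n → ℝ} {M : Set (Euc n)} {X : Euc n → Euc n}

theorem IsMollifier.exists_radius (hm : IsMollifier m) : ∃ R, 0 < R ∧ ∀ t, m t ≠ 0 → ‖t‖ ≤ R := by
  obtain ⟨R, hR, h⟩ := hm.hasCompactSupport.isBounded.exists_pos_norm_le
  exact ⟨R, hR, fun t ht => h t (subset_tsupport _ ht)⟩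

/-- The regularization is smooth at the points where the convolution integral only involves values of
`X` in `M`. -/
theorem contDiffAt_regularization (hM : IsOpen M) (hX : LocallyIntegrableOn X M)
    (hm : IsMollifier m) {p : Euc n} {ε₀ : ℝ} (hε : 0 < ε₀)
    (hp : ∀ t ∈ tsupport m, p - ε₀ • t ∈ M) :
    ContDiffAt ℝ ∞ (fun q : Euc n × ℝ => regularization m X q.1 q.2) (p, ε₀) := by
  obtain ⟨R, hR, hmR⟩ := hm.exists_radius
  have hK : IsCompact ((fun t => p - ε₀ • t) '' tsupport m) :=
    hm.hasCompactSupport.isCompact.image (by fun_prop)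
  obtain ⟨K, hKc, hK1, hK2⟩ := exists_compact_between hK hM (by
    rintro _ ⟨t, ht, rfl⟩
    exact hp t ht)
  -- Near (p, ε₀) the convolution only involves values of X on K; cut off outside K, the field is
  -- locally integrable on all of ℝ^n.
  let f : Euc n → Euc n := K.indicator X
  have hf : LocallyIntegrable f volume :=
    ((integrable_indicator_iff hKc.measurableSet).2
      (hX.integrableOn_compact_subset hK2 hKc)).locallyIntegrable
  let s : Set (Euc n × ℝ) := univ ×ˢ Ioo 0 (ε₀ + 1)
  have hs : IsOpen s := isOpen_univ.prod isOpen_Ioo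
  let g : Euc n × ℝ → Euc n → ℝ := fun q y => rescaled m q.2 y
  have hgs : ∀ q, ∀ y, q ∈ s → y ∉ Metric.closedBall (0 : Euc n) ((ε₀ + 1) * R) → g q y = 0 := by
    intro q y hq hy
    have hq0 : 0 < q.2 := hq.2.1
    have hq1 : q.2 < ε₀ + 1 := hq.2.2
    by_contra h0
    have h1 : m (q.2⁻¹ • y) ≠ 0 := fun h => h0 (by simp [g, rescaled, h])
    have h2 := hmR _ h1
    rw [norm_smul, norm_inv, Real.norm_eq_abs, abs_of_pos hq0, inv_mul_le_iff₀ hq0] at h2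
    refine hy (mem_closedBall_zero_iff.2 (h2.trans ?_))
    gcongr
  have hg : ContDiffOn ℝ ∞ ↿g (s ×ˢ univ) := by
    have h1 : ContDiffOn ℝ ∞ (fun z : (Euc n × ℝ) × Euc n => z.1.2) (s ×ˢ univ) := by fun_prop
    have h2 : ∀ z ∈ s ×ˢ (univ : Set (Euc n)), z.1.2 ≠ 0 := fun z hz => hz.1.2.1.ne'
    have h3 : ContDiffOn ℝ ∞ (fun z : (Euc n × ℝ) × Euc n => z.1.2⁻¹ • z.2) (s ×ˢ univ) :=
      (h1.inv h2).smul contDiffOn_snd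
    exact ((h1.pow n).inv fun z hz => pow_ne_zero _ (h2 z hz)).mul (hm.smooth.comp_contDiffOn h3)
  have h := contDiffOn_convolution_right_with_param_comp (n := ⊤) (μ := volume)
    ((ContinuousLinearMap.lsmul ℝ ℝ : ℝ →L[ℝ] Euc n →L[ℝ] Euc n).flip)
    (v := fun q : Euc n × ℝ => q.1) contDiffOn_fst hs (isCompact_closedBall _ _) hgs hf hg
  have hpos : ∀ᶠ q : Euc n × ℝ in 𝓝 (p, ε₀), q.2 ∈ Ioo 0 (ε₀ + 1) :=
    (continuous_snd.tendsto (p, ε₀)).eventually (isOpen_Ioo.mem_nhds ⟨hε, by linarith⟩)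
  have hin : ∀ᶠ q : Euc n × ℝ in 𝓝 (p, ε₀), ∀ t ∈ tsupport m, q.1 - q.2 • t ∈ interior K := by
    refine hm.hasCompactSupport.isCompact.eventually_forall_of_forall_eventually fun t ht => ?_
    have hc : Continuous fun z : (Euc n × ℝ) × Euc n => z.1.1 - z.1.2 • z.2 := by fun_prop
    exact hc.continuousAt.eventually (isOpen_interior.mem_nhds (hK1 ⟨t, ht, rfl⟩))
  refine (h.contDiffAt (hs.mem_nhds ⟨mem_univ _, hε, by linarith⟩)).congr_of_eventuallyEq ?_
  filter_upwards [hpos, hin] with q hq1 hq2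
  rw [regularization, if_neg hq1.1.ne', convolution_def]
  rw [← integral_sub_left_eq_self (fun y => rescaled m q.2 y • X (q.1 - y)) volume q.1]
  congr 1
  ext1 y
  change rescaled m q.2 (q.1 - y) • X (q.1 - (q.1 - y)) = rescaled m q.2 (q.1 - y) • f y
  rw [sub_sub_cancel]
  by_cases h0 : m (q.2⁻¹ • (q.1 - y)) = 0
  · rw [rescaled, h0, mul_zero, zero_smul, zero_smul]
  · have h1 := hq2 _ (subset_tsupport _ h0)
    rw [smul_inv_smul₀ hq1.1.ne', sub_sub_cancel] at h1
    simp only [f, indicator_of_mem (interior_subset h1)]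

end Regularization

/-! ### Convolutions over sectors -/

section SectorKernel

variable {n : ℕ}

/-- The Leibniz formula exhibits the determinant as a polynomial in the matrix entries. -/
theorem contDiff_det : ContDiff ℝ ∞ fun A : Euc n →L[ℝ] Euc n => A.det := by
  let b := (EuclideanSpace.basisFun (Fin n) ℝ).toBasis
  have h1 : ∀ A : Euc n →L[ℝ] Euc n, A.det =
      ∑ π : Equiv.Perm (Fin n), ((Equiv.Perm.sign π : ℤ) : ℝ) *
        ∏ i, A (EuclideanSpace.single i 1) (π i) := by
    intro A
    change LinearMap.det (A : Euc n →ₗ[ℝ] Euc n) = _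
    rw [← LinearMap.det_toMatrix b, Matrix.det_apply']
    refine Finset.sum_congr rfl fun π _ => congrArg _ (Finset.prod_congr rfl fun i _ => ?_)
    rw [LinearMap.toMatrix_apply]
    simp [b]
  simp only [h1]
  refine ContDiff.sum fun π _ => contDiff_const.mul (contDiff_prod fun i _ => ?_)
  exact ((EuclideanSpace.proj (π i) : Euc n →L[ℝ] ℝ).comp
    (ContinuousLinearMap.apply ℝ (Euc n) (EuclideanSpace.single i (1 : ℝ)))).contDiff

/-- The part of the convolution integral in the coordinates `η` which comes from one sector. -/
def sectorKernel (m : Euc n → ℝ) (η : Euc n → Euc n) (χ : Euc n → ℝ) (Y : Euc n → Euc n)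
    (a : (Euc n × ℝ) × Euc n) : Euc n :=
  -- Using the difference quotient in place of (η(y) - η(y - ετ))/ε makes the kernel smooth across ε
  -- = 0.
  χ a.2 • ((m (diffQuot η (a.1.1, a.1.2, a.2)) * |(fderiv ℝ η (a.1.1 - a.1.2 • a.2)).det|) •
    Y (a.1.1 - a.1.2 • a.2))

/-- The points `(y, ε)` for which `y - ε τ` stays in a ball for all `τ` of norm at most `R`. -/
def sectorDomain (n : ℕ) (r R : ℝ) : Set (Euc n × ℝ) := {q | ‖q.1‖ + 2 * (|q.2| * R) < r}

theorem isOpen_sectorDomain (r R : ℝ) : IsOpen (sectorDomain n r R) :=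
  isOpen_lt (by fun_prop) continuous_const

theorem mem_diffQuotDomain_of_sectorDomain {r R : ℝ} {q : Euc n × ℝ} (hq : q ∈ sectorDomain n r R)
    {τ : Euc n} (hτ : ‖τ‖ ≤ R) : (q.1, q.2, τ) ∈ diffQuotDomain (Euc n) r := by
  have h1 : |q.2| * ‖τ‖ ≤ |q.2| * R := by gcongr
  have h2 : ‖q.1‖ + 2 * (|q.2| * R) < r := hq
  change ‖q.1‖ + 2 * (|q.2| * ‖τ‖) < r
  linarith

theorem sub_smul_mem_of_sectorDomain {r R : ℝ} {q : Euc n × ℝ} (hq : q ∈ sectorDomain n r R)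
    {τ : Euc n} (hτ : ‖τ‖ ≤ R) : q.1 - q.2 • τ ∈ Metric.ball (0 : Euc n) r := by
  simpa using sub_smul_mem_ball (mem_diffQuotDomain_of_sectorDomain hq hτ) (t := 1) (by norm_num)

theorem contDiffOn_sectorKernel {m : Euc n → ℝ} {η : Euc n → Euc n} {χ : Euc n → ℝ}
    {Y : Euc n → Euc n} {r R : ℝ} (hm : ContDiff ℝ ∞ m)
    (hη : ContDiffOn ℝ ∞ η (Metric.ball 0 r))
    (hdet : ∀ y ∈ Metric.ball (0 : Euc n) r, (fderiv ℝ η y).det ≠ 0) (hχ : ContDiff ℝ ∞ χ)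
    (hχR : tsupport χ ⊆ Metric.ball 0 R) (hY : ContDiffOn ℝ ∞ Y (Metric.ball 0 r)) :
    ContDiffOn ℝ ∞ (sectorKernel m η χ Y) (sectorDomain n r R ×ˢ univ) := by
  refine contDiffOn_cutoff_smul (isOpen_sectorDomain r R) Metric.isOpen_ball hχ hχR
    (k := fun a => (m (diffQuot η (a.1.1, a.1.2, a.2)) *
      |(fderiv ℝ η (a.1.1 - a.1.2 • a.2)).det|) • Y (a.1.1 - a.1.2 • a.2)) ?_
  have hmap : MapsTo (fun a : (Euc n × ℝ) × Euc n => a.1.1 - a.1.2 • a.2)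
      (sectorDomain n r R ×ˢ Metric.ball 0 R) (Metric.ball 0 r) := fun a ha =>
    sub_smul_mem_of_sectorDomain ha.1 (mem_ball_zero_iff.1 ha.2).le
  have hsub : ContDiff ℝ ∞ fun a : (Euc n × ℝ) × Euc n => a.1.1 - a.1.2 • a.2 := by fun_prop
  have h1 : ContDiffOn ℝ ∞ (fun a : (Euc n × ℝ) × Euc n =>
      m (diffQuot η (a.1.1, a.1.2, a.2))) (sectorDomain n r R ×ˢ Metric.ball 0 R) := by
    refine hm.comp_contDiffOn ((contDiffOn_diffQuot hη).comp (by fun_prop) fun a ha => ?_)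
    exact mem_diffQuotDomain_of_sectorDomain ha.1 (mem_ball_zero_iff.1 ha.2).le
  have h2 : ContDiffOn ℝ ∞ (fun a : (Euc n × ℝ) × Euc n =>
      |(fderiv ℝ η (a.1.1 - a.1.2 • a.2)).det|) (sectorDomain n r R ×ˢ Metric.ball 0 R) := by
    have h3 := contDiff_det.comp_contDiffOn
      (hη.fderiv_of_isOpen Metric.isOpen_ball (m := ∞) (by simp))
    have h4 := h3.comp hsub.contDiffOn hmap
    exact fun a ha => (h4 a ha).abs (hdet _ (hmap ha))
  exact (h1.mul h2).smul (hY.comp hsub.contDiffOn hmap)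

variable {κ : Type} [Fintype κ]

open Classical in
/-- The sum of the convolutions of functions `K s` with the indicator functions of the sectors. -/
def sectorSum (σ : κ → Fin n) (K : (κ → SignType) → Euc n → Euc n) (v : Euc n) : Euc n :=
  ∑ s, ∫ τ, (signCell σ s).indicator (fun _ => (1 : ℝ)) (v - τ) • K s τ

/-- Each summand is a convolution in v of an indicator function with a smooth kernel of uniformly
bounded support; it is smooth in v and in the parameters although the indicator function jumps. -/
theorem contDiffOn_sectorSum {P : Type} [NormedAddCommGroup P] [NormedSpace ℝ P] {S : Set P}
    (hS : IsOpen S) (σ : κ → Fin n) {K : (κ → SignType) → P → Euc n → Euc n} {R : ℝ}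
    (hK : ∀ s, ContDiffOn ℝ ∞ ↿(K s) (S ×ˢ univ)) (hR : ∀ s q τ, R < ‖τ‖ → K s q τ = 0)
    {v : P → Euc n} (hv : ContDiffOn ℝ ∞ v S) :
    ContDiffOn ℝ ∞ (fun q => sectorSum σ (fun s => K s q) (v q)) S := by
  refine ContDiffOn.sum fun s _ => ?_
  have hf : LocallyIntegrable ((signCell σ s).indicator fun _ => (1 : ℝ)) volume :=
    (locallyIntegrable_const 1).indicator (measurableSet_signCell σ s)
  have h := contDiffOn_convolution_right_with_param_comp (n := ⊤) (μ := volume)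
    (ContinuousLinearMap.lsmul ℝ ℝ : ℝ →L[ℝ] Euc n →L[ℝ] Euc n) hv hS
    (isCompact_closedBall (0 : Euc n) R)
    (fun q τ _ hτ => hR s q τ (by simpa using hτ)) hf (hK s)
  exact h.congr fun q _ => by rw [convolution_eq_swap]; rfl

/-- The convolution does not change if the signs do not change for the relevant `τ`. -/
theorem sectorSum_congr (σ : κ → Fin n) {K : (κ → SignType) → Euc n → Euc n} {R : ℝ}
    (hR : ∀ s τ, R < ‖τ‖ → K s τ = 0) {v v' : Euc n}
    (h : ∀ τ : Euc n, ‖τ‖ ≤ R → ∀ k,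
      SignType.sign (v (σ k) - τ (σ k)) = SignType.sign (v' (σ k) - τ (σ k))) :
    sectorSum σ K v = sectorSum σ K v' := by
  refine Finset.sum_congr rfl fun s _ => integral_congr_ae (Filter.Eventually.of_forall fun τ => ?_)
  by_cases hτ : ‖τ‖ ≤ R
  · have h1 : v - τ ∈ signCell σ s ↔ v' - τ ∈ signCell σ s :=
      forall_congr' fun k => by
        rw [PiLp.sub_apply, PiLp.sub_apply, h τ hτ k]
    by_cases hv : v - τ ∈ signCell σ s
    · simp only [indicator_of_mem hv, indicator_of_mem (h1.1 hv)]
    · simp only [indicator_of_notMem hv, indicator_of_notMem fun h' => hv (h1.2 h')]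
  · simp only [hR s τ (not_le.1 hτ), smul_zero]

/-- For each τ the point v - τ lies in exactly one cell, so only one kernel contributes. -/
theorem sectorSum_eq_integral (σ : κ → Fin n) {K : (κ → SignType) → Euc n → Euc n}
    (hK : ∀ s, Integrable (K s)) (v : Euc n) :
    sectorSum σ K v = ∫ τ, K (fun k => SignType.sign (v (σ k) - τ (σ k))) τ := by
  classical
  rw [sectorSum, ← integral_finsetSum]
  · refine integral_congr_ae (Filter.Eventually.of_forall fun τ => ?_)
    refine (Finset.sum_eq_single_of_mem (fun k => SignType.sign (v (σ k) - τ (σ k)))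
      (Finset.mem_univ _) fun s _ hs => ?_).trans ?_
    · have h1 : v - τ ∉ signCell σ s := fun h => hs (funext fun k => (h k).symm)
      rw [indicator_of_notMem h1, zero_smul]
    · have h1 : v - τ ∈ signCell σ fun k => SignType.sign (v (σ k) - τ (σ k)) := fun k => rfl
      rw [indicator_of_mem h1, one_smul]
  · intro s _
    have h1 : (fun τ => (signCell σ s).indicator (fun _ => (1 : ℝ)) (v - τ) • K s τ) =
        ((fun τ => v - τ) ⁻¹' signCell σ s).indicator (K s) := by
      ext1 τ
      by_cases h : v - τ ∈ signCell σ s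
      · rw [indicator_of_mem h, one_smul, indicator_of_mem (show τ ∈ (fun τ => v - τ) ⁻¹' signCell σ s from h)]
      · rw [indicator_of_notMem h, zero_smul, indicator_of_notMem (show τ ∉ (fun τ => v - τ) ⁻¹' signCell σ s from h)]
    rw [h1]
    exact (hK s).indicator ((measurableSet_signCell σ s).preimage (by fun_prop))

theorem integrable_sectorKernel {m : Euc n → ℝ} {η : Euc n → Euc n} {χ : Euc n → ℝ}
    {Y : Euc n → Euc n} {r R : ℝ}
    (h : ContDiffOn ℝ ∞ (sectorKernel m η χ Y) (sectorDomain n r R ×ˢ univ))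
    (hχ : HasCompactSupport χ) {q : Euc n × ℝ} (hq : q ∈ sectorDomain n r R) :
    Integrable fun τ => sectorKernel m η χ Y (q, τ) := by
  refine Continuous.integrable_of_hasCompactSupport ?_ ?_
  · rw [← continuousOn_univ]
    exact h.continuousOn.comp (by fun_prop) fun τ _ => ⟨hq, mem_univ _⟩
  · exact hχ.smul_right

end SectorKernel

/-! ### The convolution integral in coordinates -/

section Coordinates

variable {n c : ℕ} {M : Set (Euc n)} {H : Fin c → Set (Euc n)} {X : Euc n → Euc n} {p : Euc n}
  {m : Euc n → ℝ}

theorem regularization_eq_integral {ε : ℝ} (hε : 0 < ε) (x : Euc n) :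
    regularization m X x ε = ∫ x', rescaled m ε (x - x') • X x' := by
  rw [regularization, if_neg hε.ne',
    ← integral_sub_left_eq_self (fun y => rescaled m ε y • X (x - y)) volume x]
  simp only [sub_sub_cancel]

theorem CrossingChart.det_fderiv_symm_ne_zero (D : CrossingChart M H p) {y : Euc n}
    (hy : y ∈ Metric.ball 0 D.ρ) : (fderiv ℝ D.x.symm y).det ≠ 0 := by
  have h1 := congrArg (fun L : Euc n →L[ℝ] Euc n => L.det) (D.fderiv_comp_symm hy)
  have h2 : (fderiv ℝ D.x (D.x.symm y)).det * (fderiv ℝ D.x.symm y).det = 1 := by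
    refine Eq.trans ?_ (h1.trans LinearMap.det_id)
    exact (LinearMap.det_comp _ _).symm
  exact right_ne_zero_of_mul_eq_one h2

theorem IsMollifier.integral_comp_linear (hm : IsMollifier m) (A : Euc n →L[ℝ] Euc n)
    (hA : A.det ≠ 0) : ∫ τ, m (A τ) * |A.det| = 1 := by
  have hinj : Function.Bijective A := by
    have := (LinearMap.equivOfDetNeZero (A : Euc n →ₗ[ℝ] Euc n) hA).bijective
    exact this
  have h1 := integral_image_eq_integral_abs_det_fderiv_smul (volume : Measure (Euc n))
    (s := univ) (f := A) (f' := fun _ => A) MeasurableSet.univ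
    (fun x _ => A.hasFDerivAt.hasFDerivWithinAt) hinj.injective.injOn m
  rw [image_univ, hinj.surjective.range_eq, setIntegral_univ, setIntegral_univ,
    hm.integral_eq_one] at h1
  rw [h1]
  simp only [smul_eq_mul, mul_comm]

/-- The change of variables `x' = η (y - ε τ)` in the convolution integral. -/
theorem CrossingChart.integral_eq (D : CrossingChart M H p) {r : ℝ}
    {Y : ({i // p ∈ H i} → SignType) → Euc n → Euc n} (hY : IsSectorial D X r Y) {f : Euc n → ℝ}
    (hf : ∀ x', f x' ≠ 0 → x' ∈ D.x.symm '' Metric.ball 0 r) (y : Euc n) {ε : ℝ} (hε : 0 < ε) :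
    ∫ x', f x' • X x' = ∫ τ, ε ^ n • (Metric.ball (0 : Euc n) r).indicator
      (fun y' => (f (D.x.symm y') * |(fderiv ℝ D.x.symm y').det|) •
        Y (fun i => SignType.sign (y' (D.σ i))) y') (y - ε • τ) := by
  classical
  have hsub : Metric.ball (0 : Euc n) r ⊆ Metric.ball 0 D.ρ := Metric.ball_subset_ball hY.le
  have h1 : ∫ x', f x' • X x' = ∫ x' in D.x.symm '' Metric.ball 0 r, f x' • X x' := by
    refine (setIntegral_eq_integral_of_forall_compl_eq_zero fun x' hx' => ?_).symm
    rw [not_imp_comm.1 (hf x') hx', zero_smul]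
  have h2 := integral_image_eq_integral_abs_det_fderiv_smul (volume : Measure (Euc n))
    (s := Metric.ball 0 r) (f := D.x.symm) (f' := fderiv ℝ D.x.symm) Metric.isOpen_ball.measurableSet
    (fun y' hy' => (D.hasFDerivAt_symm (hsub hy')).hasFDerivWithinAt)
    (fun a ha b hb hab => by rw [← D.right_inv (hsub ha), hab, D.right_inv (hsub hb)])
    (fun x' => f x' • X x')
  -- The coordinate hyperplanes are null sets, so the sectorial description of X holds almost
  -- everywhere.
  have hae : ∀ᵐ y' : Euc n, ∀ i, y' (D.σ i) ≠ 0 := by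
    rw [ae_all_iff]
    intro i
    exact measure_mono_null (fun y' hy' => not_not.1 hy') (volume_coord_eq_zero (D.σ i))
  set F : Euc n → Euc n := (Metric.ball (0 : Euc n) r).indicator
      (fun y' => (f (D.x.symm y') * |(fderiv ℝ D.x.symm y').det|) •
        Y (fun i => SignType.sign (y' (D.σ i))) y')
  have h3 : ∫ y' in Metric.ball 0 r, |(fderiv ℝ D.x.symm y').det| • f (D.x.symm y') •
      X (D.x.symm y') = ∫ y', F y' := by
    rw [← integral_indicator Metric.isOpen_ball.measurableSet]
    refine integral_congr_ae ?_
    filter_upwards [hae] with y' hy'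
    by_cases hb : y' ∈ Metric.ball (0 : Euc n) r
    · simp only [F, indicator_of_mem hb]
      rw [hY.eq y' hb hy', smul_smul, mul_comm]
    · simp only [F, indicator_of_notMem hb]
  -- The substitution y' = y - ετ produces the factor ε^n, which is going to cancel ε^{-n} in the
  -- rescaled mollifier.
  have h4 : ∫ y', F y' = ∫ τ, ε ^ n • F (y - ε • τ) := by
    have h5 := Measure.integral_comp_smul (volume : Measure (Euc n)) (fun w => F (y - w)) ε
    rw [integral_sub_left_eq_self F volume y, finrank_euclideanSpace_fin,
      abs_of_pos (inv_pos.2 (pow_pos hε n))] at h5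
    rw [integral_smul, h5, smul_inv_smul₀ (pow_ne_zero n hε.ne')]
  rw [h1, h2, h3, h4]

end Coordinates

/-! ### The regularization as a function of the coordinates and their quotients by ε -/

section SectorFormula

variable {n c : ℕ} {M : Set (Euc n)} {H : Fin c → Set (Euc n)} {X : Euc n → Euc n} {p : Euc n}
  {m : Euc n → ℝ}

theorem abs_coord_le {τ : Euc n} {R : ℝ} (h : ‖τ‖ ≤ R) (l : Fin n) : |τ l| ≤ R :=
  (PiLp.norm_apply_le τ l).trans h

theorem sign_sub_eq {R a t : ℝ} (ha : R < |a|) (ht : |t| ≤ R) :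
    SignType.sign (a - t) = SignType.sign a := by
  have h1 := abs_le.1 ht
  rcases lt_or_ge a 0 with h | h
  · rw [abs_of_neg h] at ha
    rw [sign_neg h, sign_neg (by linarith [h1.1])]
  · rw [abs_of_nonneg h] at ha
    rw [sign_pos (show 0 < a by linarith [abs_nonneg t]), sign_pos (by linarith [h1.2])]

/-- Constants controlling the convolution integral near `p`. -/
structure SectorBounds (D : CrossingChart M H p) (m : Euc n → ℝ) (r δ Rm R' R : ℝ)
    (χ : Euc n → ℝ) : Prop where
  pos : 0 < δ
  le : r ≤ D.ρ
  support_le : ∀ t, m t ≠ 0 → ‖t‖ ≤ Rm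
  ball_subset : Metric.ball p δ ⊆ D.x.symm '' Metric.ball 0 r
  lipschitz : ∃ K : NNReal, LipschitzOnWith K D.x (Metric.ball p δ) ∧ K * Rm ≤ R'
  le_R : R' ≤ R
  cutoff_eq_one : ∀ τ, ‖τ‖ ≤ R' → χ τ = 1
  cutoff_eq_zero : ∀ τ, R < ‖τ‖ → χ τ = 0

namespace SectorBounds

variable {D : CrossingChart M H p} {r δ Rm R' R : ℝ} {χ : Euc n → ℝ}

/-- Where the mollifier does not vanish, the two points of M have distance at most ε Rm; the
Lipschitz bound for the coordinates then confines τ = (y - y')/ε to a ball independent of ε. -/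
theorem norm_sub_le (hB : SectorBounds D m r δ Rm R' R χ) {y y' : Euc n}
    (hy : y ∈ Metric.ball (0 : Euc n) r) (hy' : y' ∈ Metric.ball (0 : Euc n) r)
    (hp : D.x.symm y ∈ Metric.ball p (δ / 2)) {ε : ℝ} (hε : 0 < ε) (hεδ : ε * Rm < δ / 2)
    (h0 : m (ε⁻¹ • (D.x.symm y - D.x.symm y')) ≠ 0) : ‖y - y'‖ ≤ ε * R' := by
  have hsub : Metric.ball (0 : Euc n) r ⊆ Metric.ball 0 D.ρ := Metric.ball_subset_ball hB.le
  obtain ⟨K, hK, hKR⟩ := hB.lipschitz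
  have h1 := hB.support_le _ h0
  rw [norm_smul, norm_inv, Real.norm_eq_abs, abs_of_pos hε, inv_mul_le_iff₀ hε] at h1
  have h2 : D.x.symm y ∈ Metric.ball p δ := Metric.ball_subset_ball (by linarith [hB.pos]) hp
  have h3 : D.x.symm y' ∈ Metric.ball p δ := by
    rw [Metric.mem_ball] at hp ⊢
    rw [← dist_eq_norm] at h1
    calc dist (D.x.symm y') p ≤ dist (D.x.symm y') (D.x.symm y) + dist (D.x.symm y) p :=
          dist_triangle _ _ _
      _ < δ := by rw [dist_comm (D.x.symm y')]; linarith
  have h4 := hK.dist_le_mul _ h2 _ h3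
  rw [D.right_inv (hsub hy), D.right_inv (hsub hy'), dist_eq_norm, dist_eq_norm] at h4
  calc ‖y - y'‖ ≤ K * ‖D.x.symm y - D.x.symm y'‖ := h4
    _ ≤ K * (ε * Rm) := by gcongr
    _ = ε * (K * Rm) := by ring
    _ ≤ ε * R' := by gcongr

/-- For ‖τ‖ ≤ R' the cutoff is 1 and the integrands agree. For larger τ both vanish: the kernel
because m vanishes at the difference quotient if ‖τ‖ ≤ R, and because of the cutoff beyond R. -/
theorem regularization_eq (hB : SectorBounds D m r δ Rm R' R χ)
    {Y : ({i // p ∈ H i} → SignType) → Euc n → Euc n} (hY : IsSectorial D X r Y) {y : Euc n}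
    {ε : ℝ} (hyε : (y, ε) ∈ sectorDomain n r R) (hy : y ∈ Metric.ball (0 : Euc n) r)
    (hp : D.x.symm y ∈ Metric.ball p (δ / 2)) (hε : 0 < ε) (hεδ : ε * Rm < δ / 2) :
    regularization m X (D.x.symm y) ε = ∫ τ, sectorKernel m D.x.symm χ
      (Y fun i => SignType.sign (y (D.σ i) - ε * τ (D.σ i))) ((y, ε), τ) := by
  rw [regularization_eq_integral hε, D.integral_eq hY (f := fun x' => rescaled m ε (D.x.symm y - x'))
    ?_ y hε]
  · refine integral_congr_ae (Filter.Eventually.of_forall fun τ => ?_)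
    have key : y - ε • τ ∈ Metric.ball (0 : Euc n) r →
        m (ε⁻¹ • (D.x.symm y - D.x.symm (y - ε • τ))) ≠ 0 → ‖τ‖ ≤ R' := by
      intro h1 h2
      have h3 := hB.norm_sub_le hy h1 hp hε hεδ h2
      rw [sub_sub_cancel, norm_smul, Real.norm_eq_abs, abs_of_pos hε] at h3
      exact le_of_mul_le_mul_left h3 hε
    have hsmooth : ContDiffOn ℝ ∞ D.x.symm (Metric.ball 0 r) :=
      D.smooth_symm.mono (Metric.ball_subset_ball hB.le)
    have hquot : ‖τ‖ ≤ R → diffQuot D.x.symm (y, ε, τ) =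
        ε⁻¹ • (D.x.symm y - D.x.symm (y - ε • τ)) := by
      intro hτ
      rw [← smul_diffQuot hsmooth (mem_diffQuotDomain_of_sectorDomain hyε hτ),
        inv_smul_smul₀ hε.ne']
    change ε ^ n • (Metric.ball (0 : Euc n) r).indicator _ (y - ε • τ) = sectorKernel m D.x.symm χ
      (Y fun i => SignType.sign (y (D.σ i) - ε * τ (D.σ i))) ((y, ε), τ)
    by_cases hτ : ‖τ‖ ≤ R'
    · have hτR := hτ.trans hB.le_R
      rw [indicator_of_mem (sub_smul_mem_of_sectorDomain hyε hτR), sectorKernel,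
        hB.cutoff_eq_one τ hτ, one_smul, hquot hτR, smul_smul, rescaled, ← mul_assoc, ← mul_assoc,
        mul_inv_cancel₀ (pow_ne_zero n hε.ne'), one_mul]
      rfl
    · have h1 : sectorKernel m D.x.symm χ
          (Y fun i => SignType.sign (y (D.σ i) - ε * τ (D.σ i))) ((y, ε), τ) = 0 := by
        by_cases hτR : ‖τ‖ ≤ R
        · have h2 : m (diffQuot D.x.symm (y, ε, τ)) = 0 := by
            rw [hquot hτR]
            by_contra h3
            exact hτ (key (sub_smul_mem_of_sectorDomain hyε hτR) h3)
          rw [sectorKernel, h2, zero_mul, zero_smul, smul_zero]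
        · rw [sectorKernel, hB.cutoff_eq_zero τ (not_le.1 hτR), zero_smul]
      rw [h1]
      by_cases hb : y - ε • τ ∈ Metric.ball (0 : Euc n) r
      · have h2 : m (ε⁻¹ • (D.x.symm y - D.x.symm (y - ε • τ))) = 0 := by
          by_contra h3
          exact hτ (key hb h3)
        rw [indicator_of_mem hb, rescaled, h2, mul_zero, zero_mul, zero_smul, smul_zero]
      · rw [indicator_of_notMem hb, smul_zero]
  · intro x' hx'
    have h1 : m (ε⁻¹ • (D.x.symm y - x')) ≠ 0 := fun h => hx' (by rw [rescaled, h, mul_zero])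
    have h2 := hB.support_le _ h1
    rw [norm_smul, norm_inv, Real.norm_eq_abs, abs_of_pos hε, inv_mul_le_iff₀ hε] at h2
    refine hB.ball_subset ?_
    rw [Metric.mem_ball] at hp ⊢
    rw [← dist_eq_norm] at h2
    calc dist x' p ≤ dist x' (D.x.symm y) + dist (D.x.symm y) p := dist_triangle _ _ _
      _ < δ := by rw [dist_comm x']; linarith

/-- At ε = 0 the difference quotient is Dη(y)τ, and m(Dη(y)τ) |det Dη(y)| has integral 1 in τ, so
the integral returns the value of X. -/
theorem apply_eq_integral (hB : SectorBounds D m r δ Rm R' R χ) (hm : IsMollifier m)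
    {Y : ({i // p ∈ H i} → SignType) → Euc n → Euc n} (hY : IsSectorial D X r Y) {y : Euc n}
    (hy : y ∈ Metric.ball (0 : Euc n) r)
    (hp : D.x.symm y ∈ Metric.ball p (δ / 2)) (h0 : ∀ i, y (D.σ i) ≠ 0) :
    X (D.x.symm y) = ∫ τ, sectorKernel m D.x.symm χ
      (Y fun i => SignType.sign (y (D.σ i))) ((y, 0), τ) := by
  have hyρ : y ∈ Metric.ball (0 : Euc n) D.ρ := Metric.ball_subset_ball hB.le hy
  obtain ⟨K, hK, hKR⟩ := hB.lipschitz
  have hball : Metric.ball p δ ∈ 𝓝 (D.x.symm y) :=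
    Metric.isOpen_ball.mem_nhds (Metric.ball_subset_ball (by linarith [hB.pos]) hp)
  have hnorm := norm_fderiv_le_of_lipschitzOn ℝ hball hK
  have h1 : ∀ τ : Euc n, m (fderiv ℝ D.x.symm y τ) ≠ 0 → χ τ = 1 := by
    intro τ hτ
    refine hB.cutoff_eq_one τ ?_
    have h2 := congrArg (fun L : Euc n →L[ℝ] Euc n => L τ) (D.fderiv_comp_symm hyρ)
    have h3 : fderiv ℝ D.x (D.x.symm y) (fderiv ℝ D.x.symm y τ) = τ := h2
    calc ‖τ‖ = ‖fderiv ℝ D.x (D.x.symm y) (fderiv ℝ D.x.symm y τ)‖ := by rw [h3]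
      _ ≤ ‖fderiv ℝ D.x (D.x.symm y)‖ * ‖fderiv ℝ D.x.symm y τ‖ :=
        ContinuousLinearMap.le_opNorm _ _
      _ ≤ K * Rm := by
        gcongr
        exact hB.support_le _ hτ
      _ ≤ R' := hKR
  have h2 : ∀ τ : Euc n, sectorKernel m D.x.symm χ
      (Y fun i => SignType.sign (y (D.σ i))) ((y, 0), τ) =
      (m (fderiv ℝ D.x.symm y τ) * |(fderiv ℝ D.x.symm y).det|) •
        Y (fun i => SignType.sign (y (D.σ i))) y := by
    intro τ
    simp only [sectorKernel, diffQuot_zero, zero_smul, sub_zero]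
    by_cases hτ : m (fderiv ℝ D.x.symm y τ) = 0
    · rw [hτ, zero_mul, zero_smul, smul_zero]
    · rw [h1 τ hτ, one_smul]
  simp only [h2]
  rw [integral_smul_const, hm.integral_comp_linear _ (D.det_fderiv_symm_ne_zero hyρ), one_smul]
  exact hY.eq y hy h0

end SectorBounds

theorem CrossingChart.exists_sectorBounds (D : CrossingChart M H p) {r : ℝ} (hr : 0 < r)
    (hle : r ≤ D.ρ) (hm : IsMollifier m) :
    ∃ (δ Rm R' R : ℝ) (χ : ContDiffBump (0 : Euc n)), 0 < R ∧
      tsupport χ ⊆ Metric.ball 0 R ∧ SectorBounds D m r δ Rm R' R χ := by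
  obtain ⟨Rm, hRm, hsupp⟩ := hm.exists_radius
  have hx : ContDiffAt ℝ 1 D.x p :=
    (D.smooth.contDiffAt (D.x.open_source.mem_nhds D.mem)).of_le (by simp)
  obtain ⟨K, t, ht, hK⟩ := hx.exists_lipschitzOnWith
  have hopen : IsOpen (D.x.source ∩ D.x ⁻¹' Metric.ball 0 r) :=
    D.smooth.continuousOn.isOpen_inter_preimage D.x.open_source Metric.isOpen_ball
  have hp : p ∈ D.x.source ∩ D.x ⁻¹' Metric.ball 0 r :=
    ⟨D.mem, by rw [mem_preimage, D.map_eq]; exact Metric.mem_ball_self hr⟩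
  obtain ⟨δ, hδ, hball⟩ := Metric.mem_nhds_iff.1 (Filter.inter_mem ht (hopen.mem_nhds hp))
  have hR' : 0 < K * Rm + 1 := by positivity
  -- The inner radius K Rm + 1 is R', made positive by the summand 1; the support has radius K Rm +
  -- 2, smaller than R = K Rm + 3.
  let χ : ContDiffBump (0 : Euc n) := ⟨K * Rm + 1, K * Rm + 2, hR', by linarith⟩
  refine ⟨δ, Rm, K * Rm + 1, K * Rm + 3, χ, by linarith, ?_, hδ, hle, hsupp, ?_,
    ⟨K, hK.mono fun q hq => (hball hq).1, by linarith⟩, by linarith, ?_, ?_⟩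
  · rw [χ.tsupport_eq]
    exact Metric.closedBall_subset_ball (show (K * Rm + 2 : ℝ) < K * Rm + 3 by linarith)
  · intro q hq
    exact ⟨D.x q, (hball hq).2.2, D.x.left_inv (hball hq).2.1⟩
  · intro τ hτ
    exact χ.one_of_mem_closedBall (mem_closedBall_zero_iff.2 hτ)
  · intro τ hτ
    refine χ.zero_of_le_dist ?_
    rw [dist_zero_right]
    have : χ.rOut = K * Rm + 2 := rfl
    linarith

/-- In normal crossings coordinates, the regularization is a smooth function of the coordinates and of
their quotients by `ε`, which is locally constant in the quotients if they are large. -/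
theorem CrossingChart.exists_sectorFormula {Sig : Set (Euc n)} (D : CrossingChart M H p)
    (hSig : Sig = ⋃ i, H i) (hX : IsPiecewiseSmoothOn M Sig X) (hm : IsMollifier m) :
    ∃ (R : ℝ) (Ω : Set (Euc n × ℝ)) (Φ : (Fin c → ℝ) → Euc n × ℝ → Euc n), 0 < R ∧ IsOpen Ω ∧
      (0, 0) ∈ Ω ∧ (∀ q ∈ Ω, q.1 ∈ Metric.ball 0 D.ρ) ∧
      ContDiffOn ℝ ∞ (fun z : (Fin c → ℝ) × (Euc n × ℝ) => Φ z.1 z.2) (univ ×ˢ Ω) ∧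
      (∀ u u' : Fin c → ℝ, ∀ q,
        (∀ i, p ∈ H i → u i = u' i ∨ (R < u i ∧ R < u' i) ∨ (u i < -R ∧ u' i < -R)) →
        Φ u q = Φ u' q) ∧
      (∀ u : Fin c → ℝ, ∀ q ∈ Ω, 0 < q.2 → (∀ i (hi : p ∈ H i), u i = q.1 (D.σ ⟨i, hi⟩) / q.2) →
        regularization m X (D.x.symm q.1) q.2 = Φ u q) ∧
      (∀ u : Fin c → ℝ, ∀ q ∈ Ω, q.2 = 0 → (∀ i, q.1 (D.σ i) ≠ 0) →
        (∀ i (hi : p ∈ H i), u i = SignType.sign (q.1 (D.σ ⟨i, hi⟩)) * (R + 1)) →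
        regularization m X (D.x.symm q.1) q.2 = Φ u q) := by
  classical
  obtain ⟨r, Y, hY⟩ := D.exists_sectorial hSig hX
  obtain ⟨δ, Rm, R', R, χ, hR, hχ, hB⟩ := D.exists_sectorBounds hY.pos hY.le hm
  have hsub : Metric.ball (0 : Euc n) r ⊆ Metric.ball 0 D.ρ := Metric.ball_subset_ball hY.le
  have hη : ContDiffOn ℝ ∞ D.x.symm (Metric.ball 0 r) := D.smooth_symm.mono hsub
  let Ω : Set (Euc n × ℝ) := sectorDomain n r R ∩
    ((Metric.ball 0 r ∩ D.x.symm ⁻¹' Metric.ball p (δ / 2)) ×ˢ {ε | ε * Rm < δ / 2})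
  have hΩ : IsOpen Ω := (isOpen_sectorDomain r R).inter
    ((hη.continuousOn.isOpen_inter_preimage Metric.isOpen_ball Metric.isOpen_ball).prod
      (isOpen_lt (by fun_prop) continuous_const))
  -- The quotients become the entries of a vector at the positions σ i; the remaining entries do not
  -- affect the signs that are tested.
  let v : (Fin c → ℝ) → Euc n := fun u =>
    ∑ i : {i // p ∈ H i}, u i • (EuclideanSpace.single (D.σ i) (1 : ℝ) : Euc n)
  have hv : ∀ u i, v u (D.σ i) = u i := by
    intro u i
    simp only [v, WithLp.ofLp_sum, Finset.sum_apply, PiLp.smul_apply]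
    rw [Finset.sum_eq_single_of_mem i (Finset.mem_univ i)]
    · simp
    · intro j _ hj
      have : D.σ i ≠ D.σ j := fun h => hj (D.σ.injective h).symm
      simp [this]
  have hvs : ContDiff ℝ ∞ v := ContDiff.sum fun i _ =>
    (contDiff_apply ℝ ℝ (i : Fin c)).smul contDiff_const
  let κ : ({i // p ∈ H i} → SignType) → Euc n × ℝ → Euc n → Euc n := fun s q τ =>
    sectorKernel m D.x.symm χ (Y s) (q, τ)
  have hκs : ∀ s, ContDiffOn ℝ ∞ (sectorKernel m D.x.symm χ (Y s))
      (sectorDomain n r R ×ˢ univ) := fun s =>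
    contDiffOn_sectorKernel hm.smooth hη (fun y hy => D.det_fderiv_symm_ne_zero (hsub hy))
      χ.contDiff hχ (hY.smooth s)
  have hκ0 : ∀ s q τ, R < ‖τ‖ → κ s q τ = 0 := fun s q τ hτ => by
    simp only [κ, sectorKernel, hB.cutoff_eq_zero τ hτ, zero_smul]
  have hint : ∀ q ∈ Ω, ∀ s, Integrable (κ s q) := fun q hq s =>
    integrable_sectorKernel (hκs s) χ.hasCompactSupport hq.1
  refine ⟨R, Ω, fun u q => sectorSum D.σ (fun s => κ s q) (v u), hR, hΩ, ?_,
    fun q hq => hsub hq.2.1.1, ?_, ?_, ?_, ?_⟩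
  · refine ⟨?_, ⟨Metric.mem_ball_self hY.pos, ?_⟩, ?_⟩
    · simpa [sectorDomain] using hY.pos
    · rw [mem_preimage, D.symm_zero]
      exact Metric.mem_ball_self (half_pos hB.pos)
    · simpa using hB.pos
  · refine contDiffOn_sectorSum (isOpen_univ.prod hΩ) (D.σ : {i // p ∈ H i} → Fin n)
      (K := fun s (z : (Fin c → ℝ) × (Euc n × ℝ)) => κ s z.2) (R := R) (fun s => ?_)
      (fun s z τ hτ => hκ0 s _ τ hτ) (hvs.comp contDiff_fst).contDiffOn
    exact (hκs s).comp (f := fun z : ((Fin c → ℝ) × (Euc n × ℝ)) × Euc n => (z.1.2, z.2))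
      (by fun_prop) fun z hz => ⟨hz.1.2.1, mem_univ _⟩
  · intro u u' q h
    refine sectorSum_congr _ (fun s τ hτ => hκ0 s q τ hτ) fun τ hτ i => ?_
    rw [hv, hv]
    have ht := abs_coord_le hτ (D.σ i)
    rcases h i i.2 with h1 | ⟨h1, h2⟩ | ⟨h1, h2⟩
    · rw [h1]
    · rw [sign_sub_eq (h1.trans_le (le_abs_self _)) ht, sign_sub_eq (h2.trans_le (le_abs_self _)) ht,
        sign_pos (hR.trans h1), sign_pos (hR.trans h2)]
    · have e1 : u i < 0 := by linarith
      have e2 : u' i < 0 := by linarith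
      rw [sign_sub_eq (by rw [abs_of_neg e1]; linarith) ht,
        sign_sub_eq (by rw [abs_of_neg e2]; linarith) ht, sign_neg e1, sign_neg e2]
  · intro u q hq hε hu
    change _ = sectorSum D.σ (fun s => κ s q) (v u)
    rw [sectorSum_eq_integral _ (hint q hq), hB.regularization_eq hY hq.1 hq.2.1.1 hq.2.1.2 hε hq.2.2]
    refine integral_congr_ae (Filter.Eventually.of_forall fun τ => ?_)
    -- For ε > 0 the sign of y_i - ετ_i is that of y_i/ε - τ_i. This is where the quotients enter.
    have h1 : (fun i => SignType.sign (q.1 (D.σ i) - q.2 * τ (D.σ i))) =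
        fun i => SignType.sign (v u (D.σ i) - τ (D.σ i)) := by
      ext1 i
      rw [hv, hu i i.2]
      have h2 : q.1 (D.σ i) - q.2 * τ (D.σ i) = q.2 * (q.1 (D.σ i) / q.2 - τ (D.σ i)) := by
        field_simp
      rw [h2, sign_mul, sign_pos hε, one_mul]
    simp only [κ, h1]
  · intro u q hq h0 hne hu
    change _ = sectorSum D.σ (fun s => κ s q) (v u)
    rw [sectorSum_eq_integral _ (hint q hq), h0, regularization, if_pos rfl,
      hB.apply_eq_integral hm hY hq.2.1.1 hq.2.1.2 hne]
    refine integral_congr_ae (Filter.Eventually.of_forall fun τ => ?_)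
    have hq' : q = (q.1, 0) := Prod.ext rfl h0
    -- As u_i = ±(R + 1) dominates τ_i, the sign of u_i - τ_i is that of y_i; beyond R all kernels
    -- vanish.
    by_cases hτ : ‖τ‖ ≤ R
    · have h1 : (fun i => SignType.sign (q.1 (D.σ i))) =
          fun i => SignType.sign (v u (D.σ i) - τ (D.σ i)) := by
        ext1 i
        have ht := abs_coord_le hτ (D.σ i)
        rw [hv, hu i i.2]
        rcases lt_or_gt_of_ne (hne i) with h2 | h2
        · rw [sign_neg h2, SignType.coe_neg_one, sign_sub_eq _ ht, sign_neg (by linarith)]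
          rw [neg_one_mul, abs_neg, abs_of_pos (by linarith)]
          linarith
        · rw [sign_pos h2, SignType.coe_one, one_mul, sign_sub_eq _ ht, sign_pos (by linarith)]
          rw [abs_of_pos (by linarith)]
          linarith
      simp only [κ, h1]
      rw [← hq']
    · have h2 := hκ0 (fun i => SignType.sign (q.1 (D.σ i))) q τ (not_le.1 hτ)
      rw [hq'] at h2
      exact h2.trans (hκ0 _ q τ (not_le.1 hτ)).symm

end SectorFormula

/-! ### The profile of the regularized vector field -/

section BaseProfile

variable {n c : ℕ} {M Sig : Set (Euc n)} {hM : IsOpen M} {V : Type} [NormedAddCommGroup V]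
  [InnerProductSpace ℝ V] {H : Fin c → Set (Euc n)} {h : Fin c → Euc n → V} {v₀ : V}
  {X : Euc n → Euc n} {m : Euc n → ℝ}

/-- The points `(x, ε)` such that `x - ε t ∈ M` for all `t` in the support of `m`. -/
def regSet (M : Set (Euc n)) (m : Euc n → ℝ) : Set (Euc n × ℝ) :=
  {q | ∀ t ∈ tsupport m, q.1 - q.2 • t ∈ M}

theorem isOpen_regSet (hM : IsOpen M) (hm : IsMollifier m) : IsOpen (regSet M m) := by
  rw [isOpen_iff_mem_nhds]
  intro q hq
  refine hm.hasCompactSupport.isCompact.eventually_forall_of_forall_eventually fun t ht => ?_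
  have hc : Continuous fun z : (Euc n × ℝ) × Euc n => z.1.1 - z.1.2 • z.2 := by fun_prop
  exact hc.continuousAt.eventually (hM.mem_nhds (hq t ht))

theorem CrossingChart.fderiv_prodParam {p : Euc n} (D : CrossingChart M H p) (ε₀ : ℝ)
    (h2 : ContDiffOn ℝ ∞ D.x.symm D.x.target) {y : Euc (n + 1)}
    (hy : (splitEuc n y).1 ∈ Metric.ball 0 D.ρ) (b : Euc n) :
    fderiv ℝ (prodParam D.x D.smooth h2 ε₀).w y ((splitEuc n).symm (b, 0)) =
      (fderiv ℝ D.x.symm (splitEuc n y).1 b, 0) := by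
  let S : Euc (n + 1) →L[ℝ] Euc n × ℝ := splitEuc n
  have h3 : HasFDerivAt S S y := S.hasFDerivAt
  have h4 : HasFDerivAt (fun z => D.x.symm (S z).1)
      ((fderiv ℝ D.x.symm (S y).1).comp ((ContinuousLinearMap.fst ℝ (Euc n) ℝ).comp S)) y :=
    HasFDerivAt.comp y (D.hasFDerivAt_symm hy) h3.fst
  have h5 : HasFDerivAt (prodParam D.x D.smooth h2 ε₀).w
      (((fderiv ℝ D.x.symm (S y).1).comp ((ContinuousLinearMap.fst ℝ (Euc n) ℝ).comp S)).prod
        ((ContinuousLinearMap.snd ℝ (Euc n) ℝ).comp S)) y := h4.prodMk h3.snd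
  have h6 : S ((splitEuc n).symm (b, 0)) = (b, 0) := (splitEuc n).apply_symm_apply _
  rw [h5.fderiv, ContinuousLinearMap.prod_apply, ContinuousLinearMap.comp_apply,
    ContinuousLinearMap.comp_apply, ContinuousLinearMap.comp_apply, h6]
  rfl

/-- A profile for the horizontal components of a vector field in normal crossings coordinates gives
a profile of the vector field. -/
theorem hasProfile_of_isProfile (hh : ∀ i, ContDiffOn ℝ ∞ (h i) M)
    (hz : ∀ i, ∀ q ∈ M, h i q = 0 ↔ q ∈ H i) (hv : v₀ ≠ 0) {q : (productSpace M Sig hM).carrier}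
    (D : CrossingChart M H (productCoord q).1) (a : Fin c → Euc n → V)
    (ha : IsFactorization h D a) {Y : (productSpace M Sig hM).VField} {F : Euc n × ℝ → Euc n}
    (hY : ∀ p, (mfderiv (cornerModel (n + 1)) 𝓘(ℝ, Euc n × ℝ) productCoord p (Y p) : Euc n × ℝ) =
      (F (productCoord p), 0))
    {Ω : Set (Euc (n + 1))} {r : ℝ} {Φ : (Fin c → ℝ) → Euc (n + 1) → Euc n}
    (hΦ : IsProfile {i | (productCoord q).2 = 0 ∧ (productCoord q).1 ∈ H i} r Ω Φ)
    (hΩ : ∀ y ∈ Ω, (splitEuc n y).1 ∈ Metric.ball 0 D.ρ)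
    (hq : (splitEuc n).symm (0, (productCoord q).2) ∈ Ω)
    (heq : ∀ y ∈ Ω, 0 ≤ (splitEuc n y).2 →
      ((splitEuc n y).2 = 0 → D.x.symm (splitEuc n y).1 ∉ ⋃ i, H i) →
      F (D.x.symm (splitEuc n y).1, (splitEuc n y).2) = Φ (ratioVec r (Fin.last n) D.index y) y) :
    (productSpace M Sig hM).HasProfile (baseData M Sig hM H h v₀) Y q := by
  -- A horizontal vector Φ has components Dx(Φ) in the coordinates x, and component 0 in the
  -- direction of ε.
  refine ⟨baseChart hh hz hv D a ha, Ω, r, fun u y =>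
    (splitEuc n).symm (fderiv ℝ D.x (D.x.symm (splitEuc n y).1) (Φ u y), 0),
    ⟨hΦ.pos, hΦ.isOpen, ?_, fun u u' y hy huu => ?_⟩, ?_, fun p hp hpΩ hpd => ?_⟩
  · have h1 := D.smooth.fderiv_of_isOpen D.x.open_source (m := ∞) (by simp)
    have h2 : ContDiffOn ℝ ∞ (fun z : (Fin c → ℝ) × Euc (n + 1) => D.x.symm (splitEuc n z.2).1)
        (univ ×ˢ Ω) :=
      D.smooth_symm.comp (contDiff_fst.comp ((splitEuc n).contDiff.comp contDiff_snd)).contDiffOn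
        fun z hz => hΩ _ hz.2
    have h3 := h1.comp h2 fun z hz => D.symm_mem (hΩ _ hz.2)
    exact (splitEuc n).symm.contDiff.comp_contDiffOn
      ((h3.clm_apply hΦ.smooth).prodMk contDiffOn_const)
  · rw [hΦ.eq u u' y hy huu]
  · change (splitEuc n).symm (D.x (productCoord q).1, (productCoord q).2) ∈ Ω
    rw [D.map_eq]
    exact hq
  · let y : Euc (n + 1) := (splitEuc n).symm (D.x (productCoord p).1, (productCoord p).2)
    have hyΩ : y ∈ Ω := hpΩ
    have hy : splitEuc n y = (D.x (productCoord p).1, (productCoord p).2) :=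
      (splitEuc n).apply_symm_apply _
    have hsymm : D.x.symm (splitEuc n y).1 = (productCoord p).1 := by
      rw [hy]
      exact D.x.left_inv hp.1
    have hpt : (D.x.symm (splitEuc n y).1, (splitEuc n y).2) = productCoord p :=
      Prod.ext hsymm (by change (splitEuc n y).2 = _; rw [hy])
    have h1 := heq y hyΩ (by rw [hy]; exact (Subtype.property (p : ProductCarrier M)).2) (by
      intro h0 hmem
      rw [hsymm] at hmem
      rw [hy] at h0
      obtain ⟨i, hi⟩ := mem_iUnion.1 hmem
      exact hpd (ResData.mem_disc.2 ⟨i, h0, hi⟩))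
    rw [hpt] at h1
    refine (hY p).trans ?_
    refine Eq.trans ?_ (D.fderiv_prodParam (productCoord q).2 (D.target_eq ▸ D.smooth_symm)
      (hΩ y hyΩ) _).symm
    refine Prod.ext ?_ rfl
    have h2 := congrArg (fun L : Euc n →L[ℝ] Euc n => L (Φ (ratioVec r (Fin.last n) D.index y) y))
      (D.fderiv_symm_comp (hΩ y hyΩ))
    exact h1.trans h2.symm

/-- At ε₀ = 0 the profile is the one of `exists_sectorFormula`. At ε₀ > 0 the regularization is a
smooth function of (x, ε), and its profile ignores the quotients. -/
theorem hasProfile_regularization [CompleteSpace V] (hSig : Sig = ⋃ i, H i)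
    (hH : ∀ i, IsOpen (M \ H i)) (hD : ∀ p ∈ M, Nonempty (CrossingChart M H p))
    (hh : ∀ i, ContDiffOn ℝ ∞ (h i) M) (hz : ∀ i, ∀ q ∈ M, h i q = 0 ↔ q ∈ H i)
    (hd : ∀ i, ∀ q ∈ M, q ∈ H i → fderiv ℝ (h i) q ≠ 0) (hv : v₀ ≠ 0)
    (hX : IsPiecewiseSmoothOn M Sig X) (hm : IsMollifier m)
    {Y : (productSpace M Sig hM).VField}
    (hY : ∀ p, (mfderiv (cornerModel (n + 1)) 𝓘(ℝ, Euc n × ℝ) productCoord p (Y p) : Euc n × ℝ) =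
      (regularization m X (productCoord p).1 (productCoord p).2, 0))
    {q : (productSpace M Sig hM).carrier} (hq : q ∈ regDomain M Sig hM m) :
    (productSpace M Sig hM).HasProfile (baseData M Sig hM H h v₀) Y q := by
  obtain ⟨D₀⟩ := hD (productCoord q).1 (Subtype.property (q : ProductCarrier M)).1
  obtain ⟨D, a, ha⟩ := D₀.exists_factorization hM hh (fun i q hq => (hz i q hq).2) hd
  have hq2 : 0 ≤ (productCoord q).2 := (Subtype.property (q : ProductCarrier M)).2
  rcases hq2.eq_or_lt with h0 | h0
  · obtain ⟨R, Ω, Φ, hR, hΩ, h0Ω, hΩD, hΦs, hΦe, hpos, hzero⟩ := D.exists_sectorFormula hSig hX hm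
    refine hasProfile_of_isProfile hh hz hv D a ha
      (F := fun z => regularization m X z.1 z.2) hY (Ω := splitEuc n ⁻¹' Ω) (r := R)
      (Φ := fun u y => Φ u (splitEuc n y)) ⟨hR, hΩ.preimage (splitEuc n).continuous, ?_, ?_⟩
      (fun y hy => hΩD _ hy) ?_ fun y hy hy0 hyd => ?_
    · exact hΦs.comp (f := fun z : (Fin c → ℝ) × Euc (n + 1) => (z.1, splitEuc n z.2))
        (contDiff_fst.prodMk ((splitEuc n).contDiff.comp contDiff_snd)).contDiffOn
        fun z hz => ⟨mem_univ _, hz.2⟩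
    · exact fun u u' y _ huu => hΦe u u' _ fun i hi => huu i ⟨h0.symm, hi⟩
    · rw [mem_preimage, ContinuousLinearEquiv.apply_symm_apply, ← h0]
      exact h0Ω
    · rcases hy0.eq_or_lt with h1 | h1
      · refine hzero _ _ hy h1.symm (fun i hi => ?_) fun i hi => ?_
        · exact hyd h1.symm ((D.symm_mem_iUnion_iff (hΩD _ hy)).2 ⟨i, hi⟩)
        · have h2 : y (Fin.last n) = 0 := h1.symm
          rw [ratioVec, if_pos h2, D.index_of_mem hi]
          rfl
      · refine hpos _ _ hy h1 fun i hi => ?_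
        have h2 : y (Fin.last n) ≠ 0 := h1.ne'
        rw [ratioVec, if_neg h2, D.index_of_mem hi]
        rfl
  · have hloc := hX.locallyIntegrableOn hM hSig hH hD
    let Ω : Set (Euc (n + 1)) := (splitEuc n ⁻¹' (Metric.ball 0 D.ρ ×ˢ Ioi 0)) ∩
      (fun y => (D.x.symm (splitEuc n y).1, (splitEuc n y).2)) ⁻¹' regSet M m
    have hs : ContDiffOn ℝ ∞ (fun y => (D.x.symm (splitEuc n y).1, (splitEuc n y).2))
        (splitEuc n ⁻¹' (Metric.ball 0 D.ρ ×ˢ Ioi (0 : ℝ))) :=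
      (D.smooth_symm.comp (contDiff_fst.comp (splitEuc n).contDiff).contDiffOn
        fun y hy => hy.1).prodMk (contDiff_snd.comp (splitEuc n).contDiff).contDiffOn
    have hΩ : IsOpen Ω := hs.continuousOn.isOpen_inter_preimage
      ((Metric.isOpen_ball.prod isOpen_Ioi).preimage (splitEuc n).continuous) (isOpen_regSet hM hm)
    refine hasProfile_of_isProfile hh hz hv D a ha
      (F := fun z => regularization m X z.1 z.2) hY (Ω := Ω) (r := 1)
      (Φ := fun u y => regularization m X (D.x.symm (splitEuc n y).1) (splitEuc n y).2)
      ⟨one_pos, hΩ, ?_, fun _ _ _ _ _ => rfl⟩ (fun y hy => hy.1.1) ?_ fun _ _ _ _ => rfl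
    · have h1 : ContDiffOn ℝ ∞ (fun y => regularization m X (D.x.symm (splitEuc n y).1)
          (splitEuc n y).2) Ω := by
        intro y hy
        have h2 := contDiffAt_regularization hM hloc hm hy.1.2 hy.2
        exact ContDiffAt.comp_contDiffWithinAt
          (f := fun y => (D.x.symm (splitEuc n y).1, (splitEuc n y).2)) y h2
          ((hs y hy.1).mono inter_subset_left)
      exact h1.comp contDiffOn_snd fun z hz => hz.2
    · refine ⟨?_, ?_⟩
      · rw [mem_preimage, ContinuousLinearEquiv.apply_symm_apply]
        exact ⟨Metric.mem_ball_self D.pos, h0⟩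
      · rw [mem_preimage, ContinuousLinearEquiv.apply_symm_apply, D.symm_zero]
        exact hq

end BaseProfile

end

/-! ### The resolution theorem -/

theorem mainTheorem2 (n : ℕ) (M Sig : Set (Euc n)) (hM : IsOpen M)
    (hSig : IsNormalCrossings M Sig) :
    (productSpace M Sig hM).IsRegularized ∧
    ∃ (T : FiberedSpace n) (b : FiberedSpace.BlowupSequence (productSpace M Sig hM) T),
      T.disc = ∅ ∧
      ∀ (X : Euc n → Euc n) (m : Euc n → ℝ), IsPiecewiseSmoothOn M Sig X → IsMollifier m →
        ∃ (F₀ : (productSpace M Sig hM).Foliation (regDomain M Sig hM m))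
          (F : T.Foliation (b.preimage (regDomain M Sig hM m))),
          (∃ Y : (productSpace M Sig hM).VField,
            IsRegularizedVField m X Y ∧ (regDomain M Sig hM m, Y) ∈ F₀.gens) ∧
          FiberedSpace.LiftsTo F₀ b F ∧
          ∀ G ∈ F.gens, T.SmoothOn G.2 G.1 ∧
            ∀ p ∈ G.1, mfderiv (cornerModel (n + 1)) 𝓘(ℝ, ℝ) T.proj p (G.2 p) = 0 := by
  obtain ⟨c, H, hSigH, hH, hcharts⟩ := hSig
  have hD : ∀ p ∈ M, Nonempty (CrossingChart M H p) := fun p hp =>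
    exists_crossingChart (hcharts p hp)
  obtain ⟨h, hh⟩ := exists_definingFunctions hM (fun i => (hH i).2) hD
  -- The additional index `none` guarantees a nonzero vector even if M is empty.
  have hv : (lp.single 2 none 1 : SquareSummable M) ≠ 0 := by
    intro h0
    have h1 := congrArg (fun f : SquareSummable M => f none) h0
    simp at h1
  have hR := productSpace_realizes (hM := hM) hSigH (fun i => (hH i).2) hD (fun i => (hh i).1)
    (fun i => (hh i).2.1) (fun i => (hh i).2.2) hv
  refine ⟨hR.isRegularized, ?_⟩
  -- The blowings-up are fixed here, before any vector field or mollifier is introduced.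
  obtain ⟨T, b, hT, hlift⟩ := hR.exists_resolution
  refine ⟨T, b, hT, fun X m hX hm => ?_⟩
  -- The field is prescribed at every point by its components in the ambient space; its values on Σ
  -- are harmless.
  choose Y hY using fun p : (productSpace M Sig hM).carrier =>
    exists_mfderiv_productCoord_eq p
      ((regularization m X (productCoord p).1 (productCoord p).2, 0) : Euc n × ℝ)
  obtain ⟨F₀, F, hF₀, hF, hG⟩ := hlift (regDomain M Sig hM m) Y
    ((isOpen_regSet hM hm).preimage isEmbedding_productCoord.continuous)
    (fun q hq => hasProfile_regularization hSigH (fun i => (hH i).2) hD (fun i => (hh i).1)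
      (fun i => (hh i).2.1) (fun i => (hh i).2.2) hv hX hm hY hq)
    fun p _ => (mfderiv_proj_productSpace p (Y p)).trans (congrArg Prod.snd (hY p))
  exact ⟨F₀, F, ⟨Y, fun p _ => hY p, hF₀⟩, hF, hG⟩
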